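/- Let $k$ be a field and $S$ a separable $k$-algebra (not necessarily commutative). All bimodules are $S$-$S$-bimodules on which $k$ acts centrally, $\otimes=\otimes_S$, gradings are $\mathbb Z$-gradings, differentials have degree $-1$, and $V[m]_n=V_{n+m}$. For a bimodule $V$ let $T^+(V)=\bigoplus_{n\ge1}V^{\otimes n}$ be the non-unital tensor algebra. A dg algebra is a (non-unital) differential graded $S$-algebra. An $A_\infty$-coalgebra over $S$ is a graded bimodule $C$ with bimodule maps $\Delta_n\colon C\to C^{\otimes n}$ ($n\ge1$) of degree $n-2$, only finitely many of which are non-zero on any given element, such that the map $d$ on $T^+(C[1])$ determined by the components $-[1]^{\otimes n}\circ\Delta_n\circ[-1]$ on $C[1]$ and the graded Leibniz rule satisfies $d^2=0$; the dg algebra $\Omega_\infty C=(T^+(C[1]),d)$ is its cobar construction. A morphism $f=(f_i\colon C'\to C^{\otimes i})$ of $A_\infty$-coalgebras amounts to a morphism of dg algebras $\Omega_\infty f\colon\Omega_\infty C'\to\Omega_\infty C$. It is a quasi-isomorphism if $f_1\colon (C',\Delta_1)\to (C,\Delta_1)$ is one, and a weak equivalence if $\Omega_\infty f$ is a quasi-isomorphism.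 $C$ is cocomplete if there is a sequence $0=C(0)\subseteq C(1)\subseteq\cdots$ of graded sub-bimodules with $\bigcup_i C(i)=C$ such that $\Delta_n(C(i))\subseteq\sum_{i_1+\cdots+i_n=i}C(i_1)\otimes\cdots\otimes C(i_n)$ for all $n\ge 1$ and all $i$. Two $A_\infty$-coalgebras are called weakly equivalent (resp. quasi-isomorphic) if they are connected by a zigzag of weak equivalences (resp. quasi-isomorphisms) between cocomplete $A_\infty$-coalgebras. For a dg algebra $A$ let $BA=T^+(A[-1])$ be its bar construction, a dg coalgebra with the reduced deconcatenation coproduct, regarded as an $A_\infty$-coalgebra. Let $A^+=S\oplus A$ be the associated augmented unital dg algebra, and write $\operatorname{Tor}^{A}(S,S)$ for the reduced Tor $\operatorname{Tor}^{A^+}(S,S)/S$, the quotient by the image of the coaugmentation $S\to\operatorname{Tor}^{A^+}(S,S)$; it is computed from any semi-projective resolution $P\to S$ over $A^+\otimes_k S^{\mathrm{op}}$ as the homology of $S\otimes_{A^+}P$ modulo the image of $H(P)=S$, and carries the coproduct induced by $S\otimes^{L}_{A^+}S= S\otimes^{L}_{A^+}A^+\otimes^{L}_{A^+}S\to S\otimes^{L}_{A^+}S\otimes^{L}_{A^+}S=(S\otimes^{L}_{A^+}S)\otimes_S(S\otimes^{L}_{A^+}S)$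 and the Künneth isomorphism. Proposition. Let $C$ be a cocomplete $A_\infty$-coalgebra and let $\Omega_\infty C\to A$ be a quasi-isomorphism of dg algebras. Then $C$ is weakly equivalent to $BA$, and also quasi-isomorphic to $BA$. Moreover $\Delta_2$ induces (uniquely, through the Künneth isomorphism $H(C\otimes C)\cong H(C)\otimes H(C)$) a graded coalgebra structure on the homology $H(C)$ of $(C,\Delta_1)$; resolutions as above exist and each of them induces a unique graded coalgebra structure on $\operatorname{Tor}^{A}(S,S)$; and there is an isomorphism $$H(C)\cong\operatorname{Tor}^{A}(S,S)$$ of graded coalgebras over $S$. -/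

import Mathlib

universe u

noncomputable section

namespace AInf

section Bimodules

variable (k S : Type u) [Field k] [Ring S] [Algebra k S]

/-- An `S`-`S`-bimodule over the field `k`: a `k`-vector space with commuting left and right
actions of the `k`-algebra `S`, i.e. a module over `S ⊗ₖ Sᵒᵖ`. `l s` is `x ↦ s x` and
`r (op s)` is `x ↦ x s`. -/
structure SBimod where
  carrier : Type u
  [grp : AddCommGroup carrier]
  [mod : Module k carrier]
  l : S →ₐ[k] Module.End k carrier
  r : Sᵐᵒᵖ →ₐ[k] Module.End k carrier
  comm : ∀ s t x, l s (r t x) = r t (l s x)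

instance : CoeSort (SBimod k S) (Type u) := ⟨SBimod.carrier⟩

attribute [instance] SBimod.grp SBimod.mod

end Bimodules

variable {k S : Type u} [Field k] [Ring S] [Algebra k S]

namespace SBimod

/-- Morphisms of bimodules. -/
structure Hom (V W : SBimod k S) where
  lin : V →ₗ[k] W
  map_l : ∀ s x, lin (V.l s x) = W.l s (lin x)
  map_r : ∀ t x, lin (V.r t x) = W.r t (lin x)

instance (V W : SBimod k S) : CoeFun (Hom V W) (fun _ => V → W) := ⟨fun f => f.lin⟩

namespace Hom

variable {V W X : SBimod k S}

theorem ext' {f g : Hom V W} (h : ∀ x, f x = g x) : f = g := by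
  cases f; cases g; congr; exact LinearMap.ext h

/-- The identity. -/
def id (V : SBimod k S) : Hom V V := ⟨LinearMap.id, fun _ _ => rfl, fun _ _ => rfl⟩

/-- Composition. -/
def comp (g : Hom W X) (f : Hom V W) : Hom V X :=
  ⟨g.lin ∘ₗ f.lin, fun s x => by simp [f.map_l, g.map_l], fun s x => by simp [f.map_r, g.map_r]⟩

instance : Zero (Hom V W) := ⟨⟨0, fun s x => by simp, fun s x => by simp⟩⟩

instance : Add (Hom V W) :=
  ⟨fun f g => ⟨f.lin + g.lin, fun s x => by simp [f.map_l, g.map_l],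
    fun s x => by simp [f.map_r, g.map_r]⟩⟩

instance : Neg (Hom V W) :=
  ⟨fun f => ⟨-f.lin, fun s x => by simp [f.map_l], fun s x => by simp [f.map_r]⟩⟩

@[simp] theorem id_apply (x : V) : Hom.id V x = x := rfl
@[simp] theorem comp_apply (g : Hom W X) (f : Hom V W) (x : V) : g.comp f x = g (f x) := rfl
@[simp] theorem zero_apply (x : V) : (0 : Hom V W) x = 0 := rfl
@[simp] theorem add_apply (f g : Hom V W) (x : V) : (f + g) x = f x + g x := rfl
@[simp] theorem neg_apply (f : Hom V W) (x : V) : (-f) x = -f x := rfl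

end Hom

/-! ### The tensor product over `S` -/

/-- The relations `v s ⊗ w = v ⊗ s w`. -/
def balanced (V W : SBimod k S) : Submodule k (TensorProduct k V W) :=
  Submodule.span k {z | ∃ (v : V) (s : S) (w : W),
    z = (V.r (MulOpposite.op s) v) ⊗ₜ[k] w - v ⊗ₜ[k] (W.l s w)}

/-- The vector space `V ⊗_S W`, as a quotient of `V ⊗ₖ W`. -/
def BalTensor (V W : SBimod k S) : Type u := TensorProduct k V W ⧸ balanced V W

instance (V W : SBimod k S) : AddCommGroup (BalTensor V W) :=
  inferInstanceAs (AddCommGroup (TensorProduct k V W ⧸ balanced V W))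

instance (V W : SBimod k S) : Module k (BalTensor V W) :=
  inferInstanceAs (Module k (TensorProduct k V W ⧸ balanced V W))

variable {U V W X Y : SBimod k S}

/-- The class of `v ⊗ w`, bilinear in `v` and `w`. -/
def mkBal (V W : SBimod k S) : V →ₗ[k] W →ₗ[k] BalTensor V W :=
  (TensorProduct.mk k V W).compr₂ (Submodule.mkQ (balanced V W))

theorem bal_induction {p : BalTensor V W → Prop} (h0 : p 0) (ha : ∀ x y, p x → p y → p (x + y))
    (ht : ∀ v w, p (mkBal V W v w)) (x : BalTensor V W) : p x := by
  obtain ⟨x, rfl⟩ := Submodule.Quotient.mk_surjective _ x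
  induction x with
  | zero => exact h0
  | add x y hx hy => exact ha _ _ hx hy
  | tmul v w => exact ht v w

theorem mkBal_balanced (v : V) (s : S) (w : W) :
    mkBal V W (V.r (MulOpposite.op s) v) w = mkBal V W v (W.l s w) :=
  (Submodule.Quotient.eq _).2 (Submodule.subset_span ⟨v, s, w, rfl⟩)

/-- `k`-linear maps out of `V ⊗_S W` are balanced bilinear maps. -/
def liftLin {M : Type*} [AddCommGroup M] [Module k M] (f : V →ₗ[k] W →ₗ[k] M)
    (hb : ∀ v s w, f (V.r (MulOpposite.op s) v) w = f v (W.l s w)) : BalTensor V W →ₗ[k] M :=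
  (balanced V W).liftQ (TensorProduct.lift f) (by
    refine Submodule.span_le.2 ?_
    rintro _ ⟨v, s, w, rfl⟩
    simp [hb])

@[simp] theorem liftLin_mkBal {M : Type*} [AddCommGroup M] [Module k M] (f : V →ₗ[k] W →ₗ[k] M)
    (hb : ∀ v s w, f (V.r (MulOpposite.op s) v) w = f v (W.l s w)) (v : V) (w : W) :
    liftLin f hb (mkBal V W v w) = f v w := rfl

theorem bal_ext {M : Type*} [AddCommGroup M] [Module k M] {f g : BalTensor V W →ₗ[k] M}
    (h : ∀ v w, f (mkBal V W v w) = g (mkBal V W v w)) : f = g := by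
  refine LinearMap.ext fun x => ?_
  induction x using bal_induction with
  | h0 => simp
  | ha x y hx hy => simp only [map_add, hx, hy]
  | ht v w => exact h v w

/-- The tensor product `V ⊗_S W`, with `s (v ⊗ w) = s v ⊗ w` and `(v ⊗ w) s = v ⊗ w s`. -/
def tensor (V W : SBimod k S) : SBimod k S where
  carrier := BalTensor V W
  l := AlgHom.ofLinearMap
    { toFun := fun s => liftLin (mkBal V W ∘ₗ V.l s) (fun v t w => by
        simp [V.comm, mkBal_balanced])
      map_add' := fun a b => bal_ext fun v w => by simp
      map_smul' := fun a b => bal_ext fun v w => by simp }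
    (bal_ext fun v w => by simp) (fun a b => bal_ext fun v w => by simp)
  r := AlgHom.ofLinearMap
    { toFun := fun s => liftLin ((mkBal V W).compl₂ (W.r s)) (fun v t w => by
        simp [← W.comm, mkBal_balanced])
      map_add' := fun a b => bal_ext fun v w => by simp
      map_smul' := fun a b => bal_ext fun v w => by simp }
    (bal_ext fun v w => by simp) (fun a b => bal_ext fun v w => by simp)
  comm := fun s t x => by
    induction x using bal_induction with
    | h0 => simp
    | ha x y hx hy => simp only [map_add, hx, hy]
    | ht v w => simp

/-- The class of `v ⊗ w` in `V ⊗_S W`, bilinear in `v` and `w`. -/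
def tmul (V W : SBimod k S) : V →ₗ[k] W →ₗ[k] V.tensor W := mkBal V W

theorem tensor_induction {p : V.tensor W → Prop} (h0 : p 0) (ha : ∀ x y, p x → p y → p (x + y))
    (ht : ∀ v w, p (tmul V W v w)) (x : V.tensor W) : p x := bal_induction h0 ha ht x

@[simp] theorem l_tmul (s : S) (v : V) (w : W) :
    (V.tensor W).l s (tmul V W v w) = tmul V W (V.l s v) w := rfl

@[simp] theorem r_tmul (s : Sᵐᵒᵖ) (v : V) (w : W) :
    (V.tensor W).r s (tmul V W v w) = tmul V W v (W.r s w) := rfl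

theorem tmul_balanced (v : V) (s : S) (w : W) :
    tmul V W (V.r (MulOpposite.op s) v) w = tmul V W v (W.l s w) := mkBal_balanced v s w

/-- `k`-linear maps out of `V ⊗_S W` are balanced bilinear maps. -/
def liftT {M : Type*} [AddCommGroup M] [Module k M] (f : V →ₗ[k] W →ₗ[k] M)
    (hb : ∀ v s w, f (V.r (MulOpposite.op s) v) w = f v (W.l s w)) : V.tensor W →ₗ[k] M :=
  liftLin f hb

@[simp] theorem liftT_tmul {M : Type*} [AddCommGroup M] [Module k M] (f : V →ₗ[k] W →ₗ[k] M)
    (hb : ∀ v s w, f (V.r (MulOpposite.op s) v) w = f v (W.l s w)) (v : V) (w : W) :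
    liftT f hb (tmul V W v w) = f v w := rfl

/-- Bimodule maps out of `V ⊗_S W`. -/
def lift (f : V →ₗ[k] W →ₗ[k] X)
    (hb : ∀ v s w, f (V.r (MulOpposite.op s) v) w = f v (W.l s w))
    (hl : ∀ s v w, f (V.l s v) w = X.l s (f v w))
    (hr : ∀ s v w, f v (W.r s w) = X.r s (f v w)) : Hom (V.tensor W) X where
  lin := liftT f hb
  map_l := fun s x => by
    induction x using tensor_induction with
    | h0 => simp
    | ha x y hx hy => simp only [map_add, hx, hy]
    | ht v w => simp [hl]
  map_r := fun s x => by
    induction x using tensor_induction with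
    | h0 => simp
    | ha x y hx hy => simp only [map_add, hx, hy]
    | ht v w => simp [hr]

@[simp] theorem lift_tmul (f : V →ₗ[k] W →ₗ[k] X) (hb hl hr) (v : V) (w : W) :
    lift f hb hl hr (tmul V W v w) = f v w := liftT_tmul f hb v w

theorem hom_tensor_ext {f g : Hom (V.tensor W) X}
    (h : ∀ v w, f (tmul V W v w) = g (tmul V W v w)) (x) : f x = g x := by
  induction x using tensor_induction with
  | h0 => simp
  | ha x y hx hy => simp only [map_add, hx, hy]
  | ht v w => exact h v w

/-- `f ⊗ g`. No sign is involved: signs are always written explicitly, through the operators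
`Grading.sgn` below. -/
def tmap (f : Hom U V) (g : Hom W X) : Hom (U.tensor W) (V.tensor X) :=
  lift ((tmul V X).compl₁₂ f.lin g.lin)
    (fun v s w => by simp [f.map_r, g.map_l, tmul_balanced])
    (fun s v w => by simp [f.map_l]) (fun s v w => by simp [g.map_r])

@[simp] theorem tmap_tmul (f : Hom U V) (g : Hom W X) (u : U) (w : W) :
    tmap f g (tmul U W u w) = tmul V X (f u) (g w) := rfl

/-- `(U ⊗ V) ⊗ W → U ⊗ (V ⊗ W)`. -/
def assoc (U V W : SBimod k S) : Hom ((U.tensor V).tensor W) (U.tensor (V.tensor W)) :=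
  lift (liftT
    (LinearMap.mk₂ k (fun u v => (tmul U (V.tensor W) u) ∘ₗ (tmul V W v))
      (fun _ _ _ => by ext; simp) (fun _ _ _ => by ext; simp) (fun _ _ _ => by ext; simp)
      (fun _ _ _ => by ext; simp))
    (fun u s v => by ext w; simp [tmul_balanced]))
    (fun x s w => by
      induction x using tensor_induction with
      | h0 => simp
      | ha x y hx hy => simp only [map_add, LinearMap.add_apply, hx, hy]
      | ht u v => simp [tmul_balanced])
    (fun s x w => by
      induction x using tensor_induction with
      | h0 => simp
      | ha x y hx hy => simp only [map_add, LinearMap.add_apply, hx, hy]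
      | ht u v => simp)
    (fun s x w => by
      induction x using tensor_induction with
      | h0 => simp
      | ha x y hx hy => simp only [map_add, LinearMap.add_apply, hx, hy]
      | ht u v => simp)

@[simp] theorem assoc_tmul (u : U) (v : V) (w : W) :
    assoc U V W (tmul _ _ (tmul _ _ u v) w) = tmul _ _ u (tmul _ _ v w) := by simp [assoc]

/-- `U ⊗ (V ⊗ W) → (U ⊗ V) ⊗ W`. -/
def assocInv (U V W : SBimod k S) : Hom (U.tensor (V.tensor W)) ((U.tensor V).tensor W) :=
  lift ((liftT
    (LinearMap.mk₂ k (fun v w => (tmul (U.tensor V) W).flip w ∘ₗ (tmul U V).flip v)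
      (fun _ _ _ => by ext; simp) (fun _ _ _ => by ext; simp) (fun _ _ _ => by ext; simp)
      (fun _ _ _ => by ext; simp))
    (fun u s v => by ext w; simp [← tmul_balanced])).flip)
    (fun u s x => by
      induction x using tensor_induction with
      | h0 => simp
      | ha x y hx hy => simp only [map_add, hx, hy]
      | ht v w => simp [tmul_balanced])
    (fun s u x => by
      induction x using tensor_induction with
      | h0 => simp
      | ha x y hx hy => simp only [map_add, hx, hy]
      | ht v w => simp)
    (fun s u x => by
      induction x using tensor_induction with
      | h0 => simp
      | ha x y hx hy => simp only [map_add, hx, hy]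
      | ht v w => simp)

@[simp] theorem assocInv_tmul (u : U) (v : V) (w : W) :
    assocInv U V W (tmul _ _ u (tmul _ _ v w)) = tmul _ _ (tmul _ _ u v) w := by simp [assocInv]

/-! ### Direct sums, and the non-unital tensor algebra -/

/-- The direct sum of a sequence of bimodules. -/
def dsum (F : ℕ → SBimod k S) : SBimod k S where
  carrier := DirectSum ℕ (fun n => F n)
  l := AlgHom.ofLinearMap
    { toFun := fun s => DirectSum.lmap (fun n => (F n).l s)
      map_add' := fun a b => by ext n x : 2; simp
      map_smul' := fun a b => by ext n x : 2; simp }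
    (by ext n x : 2; simp) (fun a b => by ext n x : 2; simp)
  r := AlgHom.ofLinearMap
    { toFun := fun s => DirectSum.lmap (fun n => (F n).r s)
      map_add' := fun a b => by ext n x : 2; simp
      map_smul' := fun a b => by ext n x : 2; simp }
    (by ext n x : 2; simp) (fun a b => by ext n x : 2; simp)
  comm := fun s t x => by
    ext n
    simp [(F n).comm]

/-- The `n`-th summand. -/
def ι (F : ℕ → SBimod k S) (n : ℕ) : Hom (F n) (dsum F) where
  lin := DirectSum.lof k ℕ (fun n => F n) n
  map_l := fun s x => (DirectSum.lmap_lof (fun n => (F n).l s) n x).symm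
  map_r := fun s x => (DirectSum.lmap_lof (fun n => (F n).r s) n x).symm

/-- The projection to the `n`-th summand. -/
def π (F : ℕ → SBimod k S) (n : ℕ) : Hom (dsum F) (F n) where
  lin := DirectSum.component k ℕ (fun n => F n) n
  map_l := fun s x => DirectSum.lmap_apply (fun n => (F n).l s) x n
  map_r := fun s x => DirectSum.lmap_apply (fun n => (F n).r s) x n

theorem π_ι_self {F : ℕ → SBimod k S} {n : ℕ} (x : F n) : π F n (ι F n x) = x :=
  DirectSum.component.lof_self (M := fun n => F n) k n x

theorem π_ι_ne {F : ℕ → SBimod k S} {m n : ℕ} (x : F m) (h : m ≠ n) : π F n (ι F m x) = 0 :=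
  DirectSum.of_eq_of_ne (β := fun n => F n) m n x h.symm

theorem dsum_induction {F : ℕ → SBimod k S} {p : dsum F → Prop} (h0 : p 0)
    (ha : ∀ x y, p x → p y → p (x + y)) (hi : ∀ n x, p (ι F n x)) (x : dsum F) : p x :=
  DirectSum.induction_on (β := fun n => F n) x h0 (fun n x => hi n x) ha

/-- Linear maps out of a direct sum. -/
def dliftLin {M : Type*} [AddCommGroup M] [Module k M] {F : ℕ → SBimod k S}
    (f : ∀ n, F n →ₗ[k] M) : dsum F →ₗ[k] M :=
  DirectSum.toModule k ℕ M f

@[simp] theorem dliftLin_ι {M : Type*} [AddCommGroup M] [Module k M] {F : ℕ → SBimod k S}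
    (f : ∀ n, F n →ₗ[k] M) (n : ℕ) (x : F n) : dliftLin f (ι F n x) = f n x :=
  DirectSum.toModule_lof (M := fun n => F n) k n x

/-- Bimodule maps out of a direct sum. -/
def dlift {F : ℕ → SBimod k S} (f : ∀ n, Hom (F n) X) : Hom (dsum F) X where
  lin := dliftLin (fun n => (f n).lin)
  map_l := fun s x => by
    induction x using dsum_induction with
    | h0 => simp
    | ha x y hx hy => simp only [map_add, hx, hy]
    | hi n x => simp [← Hom.map_l]
  map_r := fun s x => by
    induction x using dsum_induction with
    | h0 => simp
    | ha x y hx hy => simp only [map_add, hx, hy]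
    | hi n x => simp [← Hom.map_r]

@[simp] theorem dlift_ι {F : ℕ → SBimod k S} (f : ∀ n, Hom (F n) X) (n : ℕ) (x : F n) :
    dlift f (ι F n x) = f n x := dliftLin_ι _ n x

/-- `V ⊗ (⨁ Fₙ) → X` from maps `V ⊗ Fₙ → X`. -/
def dliftRight {F : ℕ → SBimod k S} (f : ∀ n, Hom (V.tensor (F n)) X) :
    Hom (V.tensor (dsum F)) X :=
  lift (dliftLin (fun n => ((tmul V (F n)).compr₂ (f n).lin).flip)).flip
    (fun v s x => by
      induction x using dsum_induction with
      | h0 => simp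
      | ha x y hx hy => simp only [map_add, hx, hy]
      | hi n x => simp [← Hom.map_l, tmul_balanced])
    (fun s v x => by
      induction x using dsum_induction with
      | h0 => simp
      | ha x y hx hy => simp only [map_add, hx, hy]
      | hi n x => simp [← Hom.map_l])
    (fun s v x => by
      induction x using dsum_induction with
      | h0 => simp
      | ha x y hx hy => simp only [map_add, hx, hy]
      | hi n x => simp [← Hom.map_r])

@[simp] theorem dliftRight_ι {F : ℕ → SBimod k S} (f : ∀ n, Hom (V.tensor (F n)) X)
    (v : V) (n : ℕ) (x : F n) : dliftRight f (tmul _ _ v (ι F n x)) = f n (tmul _ _ v x) := by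
  simp [dliftRight]

/-- `(⨁ Fₙ) ⊗ W → X` from maps `Fₙ ⊗ W → X`. -/
def dliftLeft {F : ℕ → SBimod k S} (f : ∀ n, Hom ((F n).tensor W) X) :
    Hom ((dsum F).tensor W) X :=
  lift (dliftLin (fun n => (tmul (F n) W).compr₂ (f n).lin))
    (fun x s w => by
      induction x using dsum_induction with
      | h0 => simp
      | ha x y hx hy => simp only [map_add, LinearMap.add_apply, hx, hy]
      | hi n x => simp [← Hom.map_r, tmul_balanced])
    (fun s x w => by
      induction x using dsum_induction with
      | h0 => simp
      | ha x y hx hy => simp only [map_add, LinearMap.add_apply, hx, hy]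
      | hi n x => simp [← Hom.map_l])
    (fun s x w => by
      induction x using dsum_induction with
      | h0 => simp
      | ha x y hx hy => simp only [map_add, LinearMap.add_apply, hx, hy]
      | hi n x => simp [← Hom.map_r])

@[simp] theorem dliftLeft_ι {F : ℕ → SBimod k S} (f : ∀ n, Hom ((F n).tensor W) X)
    (n : ℕ) (x : F n) (w : W) : dliftLeft f (tmul _ _ (ι F n x) w) = f n (tmul _ _ x w) := by
  simp [dliftLeft]

/-- `V.pow n` is the tensor power `V^{⊗ (n + 1)}` over `S` (note the shift of the index). -/
def pow (V : SBimod k S) : ℕ → SBimod k S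
  | 0 => V
  | n + 1 => V.tensor (V.pow n)

/-- The non-unital tensor algebra `T⁺ V = ⨁_{n ≥ 1} V^{⊗ n}`. -/
def T (V : SBimod k S) : SBimod k S := dsum V.pow

/-- The inclusion of `V^{⊗ (n + 1)}` in `T⁺ V`. -/
def inc (V : SBimod k S) (n : ℕ) : Hom (V.pow n) V.T := ι V.pow n

/-- The inclusion of `V` in `T⁺ V` (words with one letter). -/
def letter (V : SBimod k S) : Hom V V.T := V.inc 0

/-- The projection of `T⁺ V` to `V^{⊗ (n + 1)}`. -/
def prj (V : SBimod k S) (n : ℕ) : Hom V.T (V.pow n) := π V.pow n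

/-- The projection of `T⁺ V` to `V`. -/
def fst (V : SBimod k S) : Hom V.T V := V.prj 0

/-- The projection of `T⁺ V` to `V ⊗ V`. -/
def snd (V : SBimod k S) : Hom V.T (V.tensor V) := V.prj 1

/-- `v ⊗ w ↦ v w`, for a letter `v` and a word `w`. -/
def cons (V : SBimod k S) : Hom (V.tensor V.T) V.T := dliftRight (fun n => V.inc (n + 1))

theorem cons_inc (v : V) (n : ℕ) (w : V.pow n) :
    V.cons (tmul _ _ v (V.inc n w)) = V.inc (n + 1) (tmul V (V.pow n) v w) :=
  dliftRight_ι (fun n => V.inc (n + 1)) v n w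

theorem T_inc_induction {p : V.T → Prop} (h0 : p 0) (ha : ∀ x y, p x → p y → p (x + y))
    (hi : ∀ n w, p (V.inc n w)) (x : V.T) : p x := dsum_induction (F := V.pow) (p := p) h0 ha hi x

theorem T_induction {p : V.T → Prop} (h0 : p 0) (ha : ∀ x y, p x → p y → p (x + y))
    (h1 : ∀ v, p (V.letter v)) (hc : ∀ v x, p x → p (V.cons (tmul _ _ v x))) (x : V.T) : p x := by
  refine dsum_induction (F := V.pow) (p := p) h0 ha (fun n => ?_) x
  change ∀ x, p (V.inc n x)
  induction n with
  | zero => exact h1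
  | succ n ih =>
    refine fun x => tensor_induction (V := V) (W := V.pow n)
      (p := fun y => p (V.inc (n + 1) y)) ?_ ?_ ?_ x
    · rw [show V.inc (n + 1) (0 : V.tensor (V.pow n)) = 0 from (V.inc (n + 1)).lin.map_zero]
      exact h0
    · intro x y hx hy
      rw [show V.inc (n + 1) (x + y) = V.inc (n + 1) x + V.inc (n + 1) y from
        (V.inc (n + 1)).lin.map_add x y]
      exact ha _ _ hx hy
    · intro v w
      rw [← cons_inc]
      exact hc _ _ (ih w)

/-- Auxiliary to `recT`. -/
def recPow (f : Hom V X) (g : Hom (V.tensor V.T) X) (h : Hom (V.tensor X) X) :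
    ∀ n, Hom (V.pow n) X
  | 0 => f
  | n + 1 => g.comp (tmap (Hom.id V) (V.inc n)) + h.comp (tmap (Hom.id V) (recPow f g h n))

/-- Recursive definition of maps out of the tensor algebra: `F = recT f g h` is determined by
`F v = f v` and `F (v w) = g (v ⊗ w) + h (v ⊗ F w)`, for a letter `v` and a word `w`. -/
def recT (f : Hom V X) (g : Hom (V.tensor V.T) X) (h : Hom (V.tensor X) X) : Hom V.T X :=
  dlift (recPow f g h)

theorem recT_letter (f : Hom V X) (g : Hom (V.tensor V.T) X) (h : Hom (V.tensor X) X) (v : V) :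
    recT f g h (V.letter v) = f v := dlift_ι (recPow f g h) 0 v

theorem recT_cons (f : Hom V X) (g : Hom (V.tensor V.T) X) (h : Hom (V.tensor X) X)
    (v : V) (x : V.T) : recT f g h (V.cons (tmul _ _ v x)) =
      g (tmul _ _ v x) + h (tmul _ _ v (recT f g h x)) := by
  induction x using T_inc_induction with
  | h0 => simp
  | ha x y hx hy =>
    simp only [map_add, hx, hy]
    abel
  | hi n w =>
    rw [cons_inc,
      show recT f g h (V.inc n w) = recPow f g h n w from dlift_ι (recPow f g h) n w]
    exact (dlift_ι (recPow f g h) (n + 1) (tmul V (V.pow n) v w)).trans rfl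

/-- Concatenation of a word of length `n + 1` with a word. -/
def cat (V : SBimod k S) : ∀ n, Hom ((V.pow n).tensor V.T) V.T
  | 0 => V.cons
  | n + 1 => V.cons.comp ((tmap (Hom.id V) (V.cat n)).comp (assoc V (V.pow n) V.T))

/-- The product (concatenation) of the tensor algebra. -/
def mulT (V : SBimod k S) : Hom (V.T.tensor V.T) V.T := dliftLeft V.cat

theorem mulT_letter (v : V) (x : V.T) :
    V.mulT (tmul _ _ (V.letter v) x) = V.cons (tmul _ _ v x) := dliftLeft_ι V.cat 0 v x

theorem mulT_cons (v : V) (x y : V.T) :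
    V.mulT (tmul _ _ (V.cons (tmul _ _ v x)) y) = V.cons (tmul _ _ v (V.mulT (tmul _ _ x y))) := by
  induction x using T_inc_induction with
  | h0 => simp
  | ha x y hx hy => simp only [map_add, LinearMap.add_apply, hx, hy]
  | hi n w =>
    rw [cons_inc,
      show V.mulT (tmul _ _ (V.inc n w) y) = V.cat n (tmul _ _ w y) from dliftLeft_ι V.cat n w y]
    exact (dliftLeft_ι V.cat (n + 1) (tmul V (V.pow n) v w) y).trans rfl

theorem mulT_assoc (x y z : V.T) :
    V.mulT (tmul _ _ (V.mulT (tmul _ _ x y)) z) = V.mulT (tmul _ _ x (V.mulT (tmul _ _ y z))) := by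
  induction x using T_induction with
  | h0 => simp only [map_zero, LinearMap.zero_apply]
  | ha x x' hx hx' => simp only [map_add, LinearMap.add_apply, hx, hx']
  | h1 v => rw [mulT_letter, mulT_cons, mulT_letter]
  | hc v x hx => rw [mulT_cons, mulT_cons, mulT_cons, hx]

/-- Sub-bimodules. -/
structure SubBimod (V : SBimod k S) where
  carrier : Submodule k V
  l_mem : ∀ s x, x ∈ carrier → V.l s x ∈ carrier
  r_mem : ∀ t x, x ∈ carrier → V.r t x ∈ carrier

instance (V : SBimod k S) : Membership V (SubBimod V) := ⟨fun N x => x ∈ N.carrier⟩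

/-- A sub-bimodule as a bimodule. -/
def SubBimod.toBimod {V : SBimod k S} (N : SubBimod V) : SBimod k S where
  carrier := N.carrier
  l := AlgHom.ofLinearMap
    { toFun := fun s => (V.l s).restrict (N.l_mem s)
      map_add' := fun a b => by ext x; simp
      map_smul' := fun a b => by ext x; simp }
    (by ext x; simp) (fun a b => by ext x; simp)
  r := AlgHom.ofLinearMap
    { toFun := fun s => (V.r s).restrict (N.r_mem s)
      map_add' := fun a b => by ext x; simp
      map_smul' := fun a b => by ext x; simp }
    (by ext x; simp) (fun a b => by ext x; simp)
  comm := fun s t x => Subtype.ext (V.comm s t x)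

/-- The inclusion of a sub-bimodule. -/
def SubBimod.incl {V : SBimod k S} (N : SubBimod V) : Hom N.toBimod V :=
  ⟨N.carrier.subtype, fun _ _ => rfl, fun _ _ => rfl⟩

/-- The quotient by a sub-bimodule. -/
def SubBimod.quot {V : SBimod k S} (N : SubBimod V) : SBimod k S where
  carrier := V ⧸ N.carrier
  l := AlgHom.ofLinearMap
    { toFun := fun s => N.carrier.mapQ N.carrier (V.l s) (N.l_mem s)
      map_add' := fun a b => by ext x; simp
      map_smul' := fun a b => by ext x; simp }
    (by ext x; simp) (fun a b => by ext x; simp)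
  r := AlgHom.ofLinearMap
    { toFun := fun s => N.carrier.mapQ N.carrier (V.r s) (N.r_mem s)
      map_add' := fun a b => by ext x; simp
      map_smul' := fun a b => by ext x; simp }
    (by ext x; simp) (fun a b => by ext x; simp)
  comm := fun s t x => by
    obtain ⟨x, rfl⟩ := Submodule.Quotient.mk_surjective _ x
    simp [V.comm]

/-- The quotient map. -/
def SubBimod.proj {V : SBimod k S} (N : SubBimod V) : Hom V N.quot :=
  ⟨N.carrier.mkQ, fun _ _ => rfl, fun _ _ => rfl⟩

/-- Maps out of a quotient. -/
def SubBimod.desc {V W : SBimod k S} (N : SubBimod V) (f : Hom V W) (hf : ∀ x ∈ N, f x = 0) :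
    Hom N.quot W where
  lin := N.carrier.liftQ f.lin hf
  map_l := fun s x => by
    obtain ⟨x, rfl⟩ := Submodule.Quotient.mk_surjective _ x
    exact f.map_l s x
  map_r := fun s x => by
    obtain ⟨x, rfl⟩ := Submodule.Quotient.mk_surjective _ x
    exact f.map_r s x

/-- The kernel of a morphism. -/
def Hom.ker {V W : SBimod k S} (f : Hom V W) : SubBimod V where
  carrier := LinearMap.ker f.lin
  l_mem := fun s x hx => by
    rw [LinearMap.mem_ker] at hx ⊢
    rw [f.map_l, hx, map_zero]
  r_mem := fun s x hx => by
    rw [LinearMap.mem_ker] at hx ⊢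
    rw [f.map_r, hx, map_zero]

/-- The image of a morphism. -/
def Hom.range {V W : SBimod k S} (f : Hom V W) : SubBimod W where
  carrier := LinearMap.range f.lin
  l_mem := by
    rintro s _ ⟨x, rfl⟩
    exact ⟨V.l s x, f.map_l s x⟩
  r_mem := by
    rintro s _ ⟨x, rfl⟩
    exact ⟨V.r s x, f.map_r s x⟩

/-! ### Gradings -/

/-- A `ℤ`-grading of a bimodule by sub-bimodules. -/
structure Grading (V : SBimod k S) where
  gr : ℤ → Submodule k V
  l_mem : ∀ n s x, x ∈ gr n → V.l s x ∈ gr n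
  r_mem : ∀ n t x, x ∈ gr n → V.r t x ∈ gr n
  internal : DirectSum.IsInternal gr

/-- A criterion for a direct sum decomposition, in terms of the map `ρ` sending an element to the
family of its components. -/
theorem isInternal_of_components {M : Type*} [AddCommGroup M] [Module k M] (gr : ℤ → Submodule k M)
    (ρ : M →ₗ[k] (ℤ →₀ M)) (h1 : ∀ x, (ρ x).sum (fun _ y => y) = x)
    (h2 : ∀ n x, x ∈ gr n → ρ x = Finsupp.single n x) (h3 : ∀ x n, ρ x n ∈ gr n) :
    DirectSum.IsInternal gr := by
  constructor
  · have hi : ∀ x n, ρ (DirectSum.coeLinearMap gr x) n = x n := by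
      intro x n
      induction x using DirectSum.induction_on with
      | zero => simp
      | of m x =>
        have : DirectSum.coeLinearMap gr (DirectSum.of (fun n => gr n) m x) = (x : M) :=
          DirectSum.coeLinearMap_lof gr m x
        rw [this, h2 m x x.2]
        by_cases hmn : m = n
        · subst hmn; simp
        · rw [Finsupp.single_eq_of_ne (Ne.symm hmn), DirectSum.of_eq_of_ne _ _ _ (Ne.symm hmn)]
          rfl
      | add x y hx hy => rw [map_add, map_add, Finsupp.add_apply, hx, hy]; rfl
    intro x y hxy
    have hxy' : DirectSum.coeLinearMap gr x = DirectSum.coeLinearMap gr y := hxy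
    refine DFinsupp.ext fun n => Subtype.ext ?_
    rw [← hi, ← hi, hxy']
  · intro x
    refine ⟨(ρ x).sum (fun n _ => DirectSum.of (fun n => gr n) n ⟨ρ x n, h3 x n⟩), ?_⟩
    rw [Finsupp.sum, map_sum]
    simpa [Finsupp.sum] using h1 x

namespace Grading

variable {g : Grading V} {h : Grading W}

/-- The components of an element. -/
def comps (g : Grading V) : V →ₗ[k] (ℤ →₀ V) :=
  (DirectSum.toModule k ℤ (ℤ →₀ V) (fun n => Finsupp.lsingle n ∘ₗ (g.gr n).subtype)) ∘ₗ
    (LinearEquiv.ofBijective (DirectSum.coeLinearMap g.gr) g.internal).symm.toLinearMap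

theorem comps_of_mem {n : ℤ} {x : V} (hx : x ∈ g.gr n) : g.comps x = Finsupp.single n x := by
  have : (LinearEquiv.ofBijective (DirectSum.coeLinearMap g.gr) g.internal).symm x =
      DirectSum.lof k ℤ (fun n => g.gr n) n ⟨x, hx⟩ := by
    rw [LinearEquiv.symm_apply_eq]
    exact (DirectSum.coeLinearMap_lof g.gr n ⟨x, hx⟩).symm
  simp only [comps, LinearMap.comp_apply, LinearEquiv.coe_coe]
  rw [this, DirectSum.toModule_lof]
  rfl

theorem gr_induction (g : Grading V) {p : V → Prop} (h0 : p 0)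
    (ha : ∀ x y, p x → p y → p (x + y)) (hm : ∀ n x, x ∈ g.gr n → p x) (x : V) : p x := by
  obtain ⟨y, rfl⟩ := g.internal.2 x
  induction y using DirectSum.induction_on with
  | zero => simpa using h0
  | of n y => simpa using hm n y y.2
  | add a b ha' hb' => simpa using ha _ _ ha' hb'

theorem comps_sum (g : Grading V) (x : V) : (g.comps x).sum (fun _ y => y) = x := by
  induction x using g.gr_induction with
  | h0 => simp
  | ha x y hx hy =>
    rw [map_add, Finsupp.sum_add_index' (fun _ => rfl) (fun _ _ _ => rfl), hx, hy]
  | hm n x hx => rw [comps_of_mem hx]; simp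

theorem comps_mem (g : Grading V) (x : V) (n : ℤ) : g.comps x n ∈ g.gr n := by
  induction x using g.gr_induction with
  | h0 => simp
  | ha x y hx hy => simpa using add_mem hx hy
  | hm m x hx =>
    rw [comps_of_mem hx]
    by_cases hmn : m = n
    · subst hmn; simpa using hx
    · rw [Finsupp.single_eq_of_ne (Ne.symm hmn)]; exact zero_mem _

theorem mem_of_comps {x : V} {n : ℤ} (hx : g.comps x = Finsupp.single n x) : x ∈ g.gr n := by
  have := g.comps_mem x n
  rwa [hx, Finsupp.single_eq_same] at this

/-- The sign operator `x ↦ (-1)^{m n} x` for `x` of degree `n`. -/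
def sgn (g : Grading V) (m : ℤ) : Hom V V where
  lin := (Finsupp.lsum k (fun n : ℤ => ((((m * n).negOnePow : ℤ) : k) • LinearMap.id : V →ₗ[k] V))) ∘ₗ
    g.comps
  map_l := fun s x => by
    induction x using g.gr_induction with
    | h0 => simp
    | ha x y hx hy => simp only [map_add, hx, hy]
    | hm n x hx => simp [comps_of_mem hx, comps_of_mem (g.l_mem n s x hx)]
  map_r := fun s x => by
    induction x using g.gr_induction with
    | h0 => simp
    | ha x y hx hy => simp only [map_add, hx, hy]
    | hm n x hx => simp [comps_of_mem hx, comps_of_mem (g.r_mem n s x hx)]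

theorem sgn_of_mem {m n : ℤ} {x : V} (hx : x ∈ g.gr n) :
    g.sgn m x = (((m * n).negOnePow : ℤ) : k) • x := by
  simp [sgn, comps_of_mem hx]

/-- A morphism is homogeneous of degree `e`. -/
def IsHomog (g : Grading V) (h : Grading W) (e : ℤ) (f : Hom V W) : Prop :=
  ∀ n x, x ∈ g.gr n → f x ∈ h.gr (n + e)

/-- The shift `[m]`, with `V[m]ₙ = Vₙ₊ₘ`. -/
def shift (g : Grading V) (m : ℤ) : Grading V where
  gr := fun n => g.gr (n + m)
  l_mem := fun n => g.l_mem (n + m)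
  r_mem := fun n => g.r_mem (n + m)
  internal := isInternal_of_components _
    ((Finsupp.domLCongr (Equiv.addRight (-m))).toLinearMap ∘ₗ g.comps)
    (fun x => by
      simp only [LinearMap.comp_apply, LinearEquiv.coe_coe, Finsupp.domLCongr_apply,
        Finsupp.domCongr_apply]
      rw [Finsupp.sum_equivMapDomain]
      exact g.comps_sum x)
    (fun n x hx => by simp [comps_of_mem hx])
    (fun x n => by simpa using g.comps_mem x _)

theorem tensor_gr_induction (g : Grading V) (h : Grading W) {p : V.tensor W → Prop} (h0 : p 0)
    (ha : ∀ x y, p x → p y → p (x + y))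
    (ht : ∀ i j v w, v ∈ g.gr i → w ∈ h.gr j → p (tmul V W v w)) (x : V.tensor W) : p x := by
  induction x using tensor_induction with
  | h0 => exact h0
  | ha x y hx hy => exact ha x y hx hy
  | ht v w =>
    induction v using g.gr_induction with
    | h0 => simpa using h0
    | ha x y hx hy => simpa using ha _ _ hx hy
    | hm i v hv =>
      induction w using h.gr_induction with
      | h0 => simpa using h0
      | ha x y hx hy => simpa using ha _ _ hx hy
      | hm j w hw => exact ht i j v w hv hw

/-- The grading of a tensor product: `|v ⊗ w| = |v| + |w|`. -/
def tensor (g : Grading V) (h : Grading W) : Grading (V.tensor W) where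
  gr := fun n => Submodule.span k {z | ∃ i j v w, v ∈ g.gr i ∧ w ∈ h.gr j ∧ i + j = n ∧
    z = tmul V W v w}
  l_mem := fun n s x hx => by
    induction hx using Submodule.span_induction with
    | mem x hx =>
      obtain ⟨i, j, v, w, hv, hw, hn, rfl⟩ := hx
      exact Submodule.subset_span ⟨i, j, _, w, g.l_mem i s v hv, hw, hn, rfl⟩
    | zero => simp
    | add x y _ _ hx hy => simpa using add_mem hx hy
    | smul a x _ hx => simpa using Submodule.smul_mem _ a hx
  r_mem := fun n s x hx => by
    induction hx using Submodule.span_induction with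
    | mem x hx =>
      obtain ⟨i, j, v, w, hv, hw, hn, rfl⟩ := hx
      exact Submodule.subset_span ⟨i, j, v, _, hv, h.r_mem j s w hw, hn, rfl⟩
    | zero => simp
    | add x y _ _ hx hy => simpa using add_mem hx hy
    | smul a x _ hx => simpa using Submodule.smul_mem _ a hx
  internal := by
    let b : (ℤ →₀ V) →ₗ[k] (ℤ →₀ W) →ₗ[k] (ℤ →₀ V.tensor W) :=
      Finsupp.lsum k (fun i => LinearMap.flip (Finsupp.lsum k (fun j =>
        ((tmul V W).compr₂ (Finsupp.lsingle (i + j))).flip)))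
    have hb : ∀ i j v w, b (Finsupp.single i v) (Finsupp.single j w) =
        Finsupp.single (i + j) (tmul V W v w) := fun i j v w => by simp [b]
    have key : ∀ i j v w, v ∈ g.gr i → w ∈ h.gr j → b (g.comps v) (h.comps w) =
        Finsupp.single (i + j) (tmul V W v w) := fun i j v w hv hw => by
      rw [comps_of_mem hv, comps_of_mem hw, hb]
    let ρ : V.tensor W →ₗ[k] (ℤ →₀ V.tensor W) := liftT (b.compl₁₂ g.comps h.comps) (by
      intro v s w
      simp only [LinearMap.compl₁₂_apply]
      induction v using g.gr_induction with
      | h0 => simp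
      | ha x y hx hy => simp only [map_add, LinearMap.add_apply, hx, hy]
      | hm i v hv =>
        induction w using h.gr_induction with
        | h0 => simp
        | ha x y hx hy => simp only [map_add, hx, hy]
        | hm j w hw =>
          rw [key i j _ _ (g.r_mem i _ v hv) hw, key i j _ _ hv (h.l_mem j _ w hw), tmul_balanced])
    have hρ : ∀ i j v w, v ∈ g.gr i → w ∈ h.gr j →
        ρ (tmul V W v w) = Finsupp.single (i + j) (tmul V W v w) := key
    refine isInternal_of_components _ ρ ?_ ?_ ?_
    · intro x
      induction x using tensor_gr_induction g h with
      | h0 => simp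
      | ha x y hx hy =>
        rw [map_add, Finsupp.sum_add_index' (fun _ => rfl) (fun _ _ _ => rfl), hx, hy]
      | ht i j v w hv hw => rw [hρ i j v w hv hw]; simp
    · intro n x hx
      induction hx using Submodule.span_induction with
      | mem x hx =>
        obtain ⟨i, j, v, w, hv, hw, rfl, rfl⟩ := hx
        exact hρ i j v w hv hw
      | zero => simp
      | add x y _ _ hx hy => rw [map_add, hx, hy, Finsupp.single_add]
      | smul a x _ hx => rw [map_smul, hx, Finsupp.smul_single]
    · intro x n
      induction x using tensor_gr_induction g h with
      | h0 => simp
      | ha x y hx hy => simpa using add_mem hx hy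
      | ht i j v w hv hw =>
        rw [hρ i j v w hv hw]
        by_cases hn : i + j = n
        · rw [hn, Finsupp.single_eq_same]
          exact Submodule.subset_span ⟨i, j, v, w, hv, hw, hn, rfl⟩
        · rw [Finsupp.single_eq_of_ne (Ne.symm hn)]; exact zero_mem _

theorem tmul_mem {i j : ℤ} {v : V} {w : W} (hv : v ∈ g.gr i) (hw : w ∈ h.gr j) :
    tmul V W v w ∈ (g.tensor h).gr (i + j) :=
  Submodule.subset_span ⟨i, j, v, w, hv, hw, rfl, rfl⟩

/-- The grading of a direct sum. -/
def dsum {F : ℕ → SBimod k S} (g : ∀ n, Grading (F n)) : Grading (dsum F) where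
  gr := fun n => ⨅ i, ((g i).gr n).comap (π F i).lin
  l_mem := fun n s x hx => by
    simp only [Submodule.mem_iInf, Submodule.mem_comap] at hx ⊢
    intro i
    rw [Hom.map_l]
    exact (g i).l_mem n s _ (hx i)
  r_mem := fun n s x hx => by
    simp only [Submodule.mem_iInf, Submodule.mem_comap] at hx ⊢
    intro i
    rw [Hom.map_r]
    exact (g i).r_mem n s _ (hx i)
  internal := by
    let ρ : SBimod.dsum F →ₗ[k] (ℤ →₀ SBimod.dsum F) :=
      dliftLin (fun i => Finsupp.mapRange.linearMap (ι F i).lin ∘ₗ (g i).comps)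
    have hρ : ∀ i (x : F i) n, ρ (ι F i x) n = ι F i ((g i).comps x n) := fun i x n => by
      simp [ρ]
    have hπ : ∀ x n i, π F i (ρ x n) = (g i).comps (π F i x) n := by
      intro x n i
      induction x using dsum_induction with
      | h0 => simp
      | ha x y hx hy => simp only [map_add, Finsupp.add_apply, hx, hy]
      | hi j x =>
        rw [hρ]
        by_cases hij : j = i
        · subst hij; rw [π_ι_self, π_ι_self]
        · rw [π_ι_ne _ hij, π_ι_ne _ hij]; simp
    have hext : ∀ x y : SBimod.dsum F, (∀ i, π F i x = π F i y) → x = y := fun x y hxy =>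
      DFinsupp.ext hxy
    refine isInternal_of_components _ ρ ?_ ?_ ?_
    · intro x
      induction x using dsum_induction with
      | h0 => simp
      | ha x y hx hy =>
        rw [map_add, Finsupp.sum_add_index' (fun _ => rfl) (fun _ _ _ => rfl), hx, hy]
      | hi j x =>
        have : ρ (ι F j x) = Finsupp.mapRange.linearMap (ι F j).lin ((g j).comps x) := by simp [ρ]
        rw [this, Finsupp.mapRange.linearMap_apply, Finsupp.sum_mapRange_index (fun _ => rfl)]
        conv_rhs => rw [← (g j).comps_sum x]
        rw [Finsupp.sum, Finsupp.sum, map_sum]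
    · intro n x hx
      simp only [Submodule.mem_iInf, Submodule.mem_comap] at hx
      ext1 m
      refine hext _ _ fun i => ?_
      rw [hπ, comps_of_mem (hx i)]
      by_cases hmn : m = n
      · subst hmn; simp
      · rw [Finsupp.single_eq_of_ne hmn, Finsupp.single_eq_of_ne hmn, map_zero]
    · intro x n
      simp only [Submodule.mem_iInf, Submodule.mem_comap]
      intro i
      rw [hπ]
      exact (g i).comps_mem _ _

/-- The grading of `V^{⊗ (n + 1)}`. -/
def pow (g : Grading V) : ∀ n, Grading (V.pow n)
  | 0 => g
  | n + 1 => g.tensor (g.pow n)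

/-- The grading of the tensor algebra. -/
def T (g : Grading V) : Grading V.T := dsum g.pow

/-- A sub-bimodule is graded if it contains the components of its elements. -/
def IsGraded (g : Grading V) (N : SubBimod V) : Prop := ∀ x ∈ N, ∀ n, g.comps x n ∈ N

/-- The grading of a graded sub-bimodule. -/
def sub (g : Grading V) (N : SubBimod V) (hN : g.IsGraded N) : Grading N.toBimod where
  gr := fun n => (g.gr n).comap N.incl.lin
  l_mem := fun n s x hx => g.l_mem n s _ hx
  r_mem := fun n s x hx => g.r_mem n s _ hx
  internal := by
    let ρ : N.toBimod →ₗ[k] (ℤ →₀ N.toBimod) :=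
      { toFun := fun x => Finsupp.onFinset (g.comps (N.incl x)).support
          (fun n => (⟨g.comps (N.incl x) n, hN _ x.2 n⟩ : N.carrier))
          (fun n hn => Finsupp.mem_support_iff.2 (fun h0 => hn (Subtype.ext h0)))
        map_add' := fun x y => by
          ext1 n; refine Subtype.ext ?_
          exact congrArg (fun f => f n) (g.comps.map_add (N.incl x) (N.incl y))
        map_smul' := fun a x => by
          ext1 n; refine Subtype.ext ?_
          exact congrArg (fun f => f n) (g.comps.map_smul a (N.incl x)) }
    have hρ : ∀ x n, N.incl (ρ x n) = g.comps (N.incl x) n := fun x n => rfl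
    have hinj : ∀ x y : N.toBimod, N.incl x = N.incl y → x = y := fun x y h => Subtype.ext h
    refine isInternal_of_components _ ρ ?_ ?_ ?_
    · intro x
      refine hinj _ _ ?_
      rw [Finsupp.sum, map_sum]
      conv_rhs => rw [← g.comps_sum (N.incl x)]
      rw [Finsupp.sum]
      refine Finset.sum_congr ?_ (fun n _ => hρ x n)
      ext n
      rw [Finsupp.mem_support_iff, Finsupp.mem_support_iff, ← hρ]
      exact ⟨fun h h' => h (hinj _ _ (by simpa using h')), fun h h' => h (by rw [h', map_zero])⟩
    · intro n x hx
      ext1 m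
      refine hinj _ _ ?_
      rw [hρ, comps_of_mem hx]
      by_cases hmn : m = n
      · subst hmn; simp
      · rw [Finsupp.single_eq_of_ne hmn, Finsupp.single_eq_of_ne hmn, map_zero]
    · exact fun x n => g.comps_mem _ n

/-- The grading of the quotient by a graded sub-bimodule. -/
def quot (g : Grading V) (N : SubBimod V) (hN : g.IsGraded N) : Grading N.quot where
  gr := fun n => (g.gr n).map N.proj.lin
  l_mem := by
    rintro n s _ ⟨x, hx, rfl⟩
    exact ⟨V.l s x, g.l_mem n s x hx, rfl⟩
  r_mem := by
    rintro n s _ ⟨x, hx, rfl⟩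
    exact ⟨V.r s x, g.r_mem n s x hx, rfl⟩
  internal := by
    let ρ : N.quot →ₗ[k] (ℤ →₀ N.quot) :=
      N.carrier.liftQ (Finsupp.mapRange.linearMap N.proj.lin ∘ₗ g.comps) (fun x hx => by
        rw [LinearMap.mem_ker]
        ext1 n
        exact (Submodule.Quotient.mk_eq_zero _).2 (hN x hx n))
    have hρ : ∀ x n, ρ (N.proj x) n = N.proj (g.comps x n) := fun x n => rfl
    have hs : ∀ y, ∃ x, N.proj x = y := Submodule.Quotient.mk_surjective _
    refine isInternal_of_components _ ρ ?_ ?_ ?_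
    · intro x
      obtain ⟨x, rfl⟩ := hs x
      have : ρ (N.proj x) = Finsupp.mapRange.linearMap N.proj.lin (g.comps x) := rfl
      rw [this, Finsupp.mapRange.linearMap_apply, Finsupp.sum_mapRange_index (fun _ => rfl)]
      conv_rhs => rw [← g.comps_sum x]
      rw [Finsupp.sum, Finsupp.sum, map_sum]
    · rintro n _ ⟨x, hx, rfl⟩
      ext1 m
      rw [hρ, comps_of_mem hx]
      by_cases hmn : m = n
      · subst hmn; simp
      · rw [Finsupp.single_eq_of_ne hmn, Finsupp.single_eq_of_ne hmn, map_zero]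
    · intro x n
      obtain ⟨x, rfl⟩ := hs x
      exact ⟨_, g.comps_mem x n, rfl⟩

/-! ### Degrees and signs -/

theorem dsum_mem {F : ℕ → SBimod k S} {g : ∀ n, Grading (F n)} {n : ℤ} {x : SBimod.dsum F} :
    x ∈ (dsum g).gr n ↔ ∀ i, π F i x ∈ (g i).gr n := by
  simp only [dsum, Submodule.mem_iInf, Submodule.mem_comap]

theorem mem_T {g : Grading V} {n : ℤ} {x : V.T} :
    x ∈ g.T.gr n ↔ ∀ i, V.prj i x ∈ (g.pow i).gr n := dsum_mem

theorem inc_mem {g : Grading V} {i : ℕ} {n : ℤ} {w : V.pow i} (hw : w ∈ (g.pow i).gr n) :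
    V.inc i w ∈ g.T.gr n := by
  refine mem_T.2 fun j => ?_
  by_cases h : i = j
  · subst h
    rwa [show V.prj i (V.inc i w) = w from π_ι_self w]
  · rw [show V.prj j (V.inc i w) = 0 from π_ι_ne w h]
    exact zero_mem _

theorem eq_sum_inc (x : V.T) : ∃ s : Finset ℕ, x = ∑ i ∈ s, V.inc i (V.prj i x) := by
  classical
  exact ⟨DFinsupp.support x, (DirectSum.sum_support_of (β := fun n => V.pow n) x).symm⟩

theorem T_gr_induction {g : Grading V} {n : ℤ} {N : Type*} [AddCommGroup N] [Module k N]
    (P : Submodule k N) (f : V.T →ₗ[k] N)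
    (h : ∀ i w, w ∈ (g.pow i).gr n → f (V.inc i w) ∈ P) {x : V.T} (hx : x ∈ g.T.gr n) :
    f x ∈ P := by
  obtain ⟨s, hs⟩ := eq_sum_inc x
  rw [hs, map_sum]
  exact sum_mem fun i _ => h i _ (mem_T.1 hx i)

theorem tensor_gr_le {n : ℤ} {N : Type*} [AddCommGroup N] [Module k N]
    (P : Submodule k N) (f : V.tensor W →ₗ[k] N)
    (hf : ∀ i j v w, v ∈ g.gr i → w ∈ h.gr j → i + j = n → f (tmul V W v w) ∈ P)
    {x : V.tensor W} (hx : x ∈ (g.tensor h).gr n) : f x ∈ P := by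
  induction hx using Submodule.span_induction with
  | mem x hx =>
    obtain ⟨i, j, v, w, hv, hw, hn, rfl⟩ := hx
    exact hf i j v w hv hw hn
  | zero => simp
  | add x y _ _ hx hy => simpa using add_mem hx hy
  | smul a x _ hx => simpa using Submodule.smul_mem _ a hx

theorem isHomog_T {g : Grading V} {h : Grading X} {e : ℤ} {f : Hom V.T X}
    (hf : ∀ i, IsHomog (g.pow i) h e (f.comp (V.inc i))) : IsHomog g.T h e f :=
  fun n _ hx => T_gr_induction (h.gr (n + e)) f.lin (fun i w hw => hf i n w hw) hx

theorem isHomog_tensor {g : Grading V} {h : Grading W} {l : Grading X} {e : ℤ}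
    {f : Hom (V.tensor W) X}
    (hf : ∀ i j v w, v ∈ g.gr i → w ∈ h.gr j → f (tmul V W v w) ∈ l.gr (i + j + e)) :
    IsHomog (g.tensor h) l e f :=
  fun n _ hx => tensor_gr_le (l.gr (n + e)) f.lin
    (fun i j v w hv hw hn => by subst hn; exact hf i j v w hv hw) hx

theorem inc_homog {g : Grading V} {i : ℕ} : IsHomog (g.pow i) g.T 0 (V.inc i) :=
  fun n x hx => by simpa using inc_mem hx

theorem letter_homog {g : Grading V} : IsHomog g g.T 0 V.letter := inc_homog (i := 0)

theorem id_homog {g : Grading V} : IsHomog g g 0 (Hom.id V) := fun n x hx => by simpa using hx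

theorem IsHomog.comp {g : Grading V} {h : Grading W} {l : Grading X} {f : Hom V W} {f' : Hom W X}
    {e e' e'' : ℤ} (hf' : IsHomog h l e' f') (hf : IsHomog g h e f) (he : e + e' = e'') :
    IsHomog g l e'' (f'.comp f) := fun n x hx => by
  have := hf' _ _ (hf n x hx)
  rwa [add_assoc, he] at this

theorem IsHomog.add {g : Grading V} {h : Grading W} {f f' : Hom V W} {e : ℤ}
    (hf : IsHomog g h e f) (hf' : IsHomog g h e f') : IsHomog g h e (f + f') :=
  fun n x hx => add_mem (hf n x hx) (hf' n x hx)

theorem IsHomog.neg {g : Grading V} {h : Grading W} {f : Hom V W} {e : ℤ}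
    (hf : IsHomog g h e f) : IsHomog g h e (-f) :=
  fun n x hx => neg_mem (hf n x hx)

theorem zero_homog {g : Grading V} {h : Grading W} {e : ℤ} : IsHomog g h e (0 : Hom V W) :=
  fun _ _ _ => zero_mem _

theorem IsHomog.tmap {g : Grading U} {h : Grading V} {l : Grading W} {m : Grading X}
    {f : Hom U V} {f' : Hom W X} {e e' e'' : ℤ} (hf : IsHomog g h e f) (hf' : IsHomog l m e' f')
    (he : e + e' = e'') : IsHomog (g.tensor l) (h.tensor m) e'' (tmap f f') :=
  isHomog_tensor fun i j v w hv hw => by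
    rw [tmap_tmul]
    have := tmul_mem (hf i v hv) (hf' j w hw)
    rwa [show i + e + (j + e') = i + j + e'' by omega] at this

theorem cons_homog {g : Grading V} : IsHomog (g.tensor g.T) g.T 0 V.cons :=
  isHomog_tensor fun i j v x hv hx => by
    refine T_gr_induction (g.T.gr (i + j + 0)) (V.cons.lin ∘ₗ tmul V V.T v) (fun n w hw => ?_) hx
    rw [LinearMap.comp_apply, cons_inc, add_zero]
    exact inc_mem (tmul_mem hv hw)

theorem T_mem_induction {g : Grading V} (Q : ℤ → Submodule k V.T)
    (h1 : ∀ n v, v ∈ g.gr n → V.letter v ∈ Q n)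
    (hc : ∀ i j v x, v ∈ g.gr i → x ∈ g.T.gr j → x ∈ Q j → V.cons (tmul _ _ v x) ∈ Q (i + j))
    {n : ℤ} {x : V.T} (hx : x ∈ g.T.gr n) : x ∈ Q n := by
  refine T_gr_induction (Q n) LinearMap.id (fun i => ?_) hx
  clear hx
  induction i generalizing n with
  | zero => exact h1 n
  | succ i ih =>
    refine fun w₀ hw₀ => tensor_gr_le (g := g) (h := g.pow i) (Q n) (V.inc (i + 1)).lin
      (fun a b v w hv hw hab => ?_) hw₀
    subst hab
    have := hc a b v (V.inc i w) hv (inc_mem hw) (ih w hw)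
    rwa [cons_inc] at this

theorem recT_homog {g : Grading V} {l : Grading X} {e : ℤ} {f : Hom V X}
    {f' : Hom (V.tensor V.T) X} {f'' : Hom (V.tensor X) X} (hf : IsHomog g l e f)
    (hf' : IsHomog (g.tensor g.T) l e f') (hf'' : IsHomog (g.tensor l) l 0 f'') :
    IsHomog g.T l e (recT f f' f'') := by
  intro n x hx
  refine T_mem_induction (fun n => (l.gr (n + e)).comap (recT f f' f'').lin) (fun m v hv => ?_)
    (fun i j v x hv hx ih => ?_) hx
  · rw [Submodule.mem_comap, recT_letter]
    exact hf m v hv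
  · rw [Submodule.mem_comap, recT_cons]
    refine add_mem (hf' _ _ (tmul_mem hv hx)) ?_
    have := hf'' _ _ (tmul_mem hv ih)
    rwa [show i + (j + e) + 0 = i + j + e by omega] at this

theorem mulT_homog {g : Grading V} : IsHomog (g.T.tensor g.T) g.T 0 V.mulT := by
  refine isHomog_tensor fun i j x y hx hy => ?_
  rw [add_zero]
  refine T_mem_induction
    (fun i => (g.T.gr (i + j)).comap (V.mulT.lin ∘ₗ (tmul V.T V.T).flip y)) (fun m v hv => ?_)
    (fun a b v x hv hx ih => ?_) hx
  · rw [Submodule.mem_comap, LinearMap.comp_apply, LinearMap.flip_apply, mulT_letter]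
    simpa using cons_homog _ _ (tmul_mem hv hy)
  · rw [Submodule.mem_comap, LinearMap.comp_apply, LinearMap.flip_apply] at ih ⊢
    rw [mulT_cons]
    have := cons_homog _ _ (tmul_mem hv ih)
    rwa [show a + (b + j) + 0 = a + b + j by omega] at this

theorem sgn_homog {m : ℤ} : IsHomog g g 0 (g.sgn m) := fun n x hx => by
  rw [sgn_of_mem hx, add_zero]
  exact Submodule.smul_mem _ _ hx

theorem sgn_sgn (x : V) : g.sgn 1 (g.sgn 1 x) = x := by
  induction x using g.gr_induction with
  | h0 => simp
  | ha x y hx hy => simp only [map_add, hx, hy]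
  | hm n x hx =>
    rw [sgn_of_mem hx, map_smul, sgn_of_mem hx, smul_smul]
    rcases Int.even_or_odd n with hn | hn
    · simp [Int.negOnePow_even n hn]
    · simp [Int.negOnePow_odd n hn]

theorem sgn_comm {f : Hom V W} (hf : IsHomog g h 0 f) (x : V) :
    h.sgn 1 (f x) = f (g.sgn 1 x) := by
  induction x using g.gr_induction with
  | h0 => simp
  | ha x y hx hy => simp only [map_add, hx, hy]
  | hm n x hx => rw [sgn_of_mem hx, sgn_of_mem (hf n x hx), map_smul, add_zero]

theorem sgn_anticomm {f : Hom V W} (hf : IsHomog g h (-1) f) (x : V) :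
    h.sgn 1 (f x) = - f (g.sgn 1 x) := by
  induction x using g.gr_induction with
  | h0 => simp
  | ha x y hx hy => simp only [map_add, hx, hy, neg_add]
  | hm n x hx =>
    rw [sgn_of_mem hx, sgn_of_mem (hf n x hx), map_smul, one_mul, one_mul,
      show n + -1 = n - 1 by omega, Int.negOnePow_sub, Int.negOnePow_one]
    simp

theorem sgn_tmul (v : V) (w : W) :
    (g.tensor h).sgn 1 (tmul V W v w) = tmul V W (g.sgn 1 v) (h.sgn 1 w) := by
  induction v using g.gr_induction with
  | h0 => simp
  | ha x y hx hy => simp only [map_add, LinearMap.add_apply, hx, hy]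
  | hm i v hv =>
    induction w using h.gr_induction with
    | h0 => simp
    | ha x y hx hy => simp only [map_add, hx, hy]
    | hm j w hw =>
      rw [sgn_of_mem hv, sgn_of_mem hw, sgn_of_mem (tmul_mem hv hw), one_mul, one_mul, one_mul,
        Int.negOnePow_add]
      simp only [map_smul, LinearMap.smul_apply, smul_smul, Units.val_mul, Int.cast_mul]
      rw [mul_comm]

theorem sgn_shift_odd {m : ℤ} (hm : Odd m) (x : V) : (g.shift m).sgn 1 x = - g.sgn 1 x := by
  induction x using g.gr_induction with
  | h0 => simp
  | ha x y hx hy => simp only [map_add, hx, hy, neg_add]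
  | hm n x hx =>
    have hx' : x ∈ (g.shift m).gr (n - m) := by simpa [shift] using hx
    rw [sgn_of_mem hx, sgn_of_mem hx', one_mul, one_mul, Int.negOnePow_sub, Int.negOnePow_odd m hm]
    simp

theorem sgn_letter {g : Grading V} (v : V) : g.T.sgn 1 (V.letter v) = V.letter (g.sgn 1 v) :=
  sgn_comm letter_homog v

theorem sgn_cons {g : Grading V} (v : V) (x : V.T) :
    g.T.sgn 1 (V.cons (tmul _ _ v x)) = V.cons (tmul _ _ (g.sgn 1 v) (g.T.sgn 1 x)) := by
  rw [sgn_comm cons_homog, sgn_tmul]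

theorem shift_pow_mem {g : Grading V} {i : ℕ} {n m p : ℤ} {w : V.pow i} (hw : w ∈ (g.pow i).gr n)
    (h : p + (i + 1) * m = n) : w ∈ ((g.shift m).pow i).gr p := by
  induction i generalizing n p with
  | zero =>
    have : p + m = n := by simpa using h
    subst this
    exact hw
  | succ i ih =>
    refine tensor_gr_le (g := g) (h := g.pow i) (((g.shift m).pow (i + 1)).gr p)
      (LinearMap.id : V.pow (i + 1) →ₗ[k] V.pow (i + 1)) (fun a b v w hv hw hab => ?_) hw
    have hv' : v ∈ (g.shift m).gr (a - m) := by simpa [shift] using hv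
    have hw' := ih (p := b - (i + 1) * m) hw (by ring)
    have := tmul_mem hv' hw'
    rwa [show a - m + (b - (i + 1) * m) = p by push_cast at h; linarith] at this

end Grading

end SBimod

open SBimod

/-- A morphism `f` of complexes `(V, d)`, `(W, d')` is a quasi-isomorphism: it is injective and
surjective on homology. -/
def IsQuasiIso {V W : SBimod k S} (d : Hom V V) (d' : Hom W W) (f : Hom V W) : Prop :=
  (∀ x, d x = 0 → (∃ y, d' y = f x) → ∃ x', d x' = x) ∧
    ∀ y, d' y = 0 → ∃ x y', d x = 0 ∧ f x + d' y' = y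

/-! ### Differential graded algebras -/

/-- A (non-unital) differential graded `S`-algebra, with homological grading (the differential has
degree `-1`) and the left Leibniz rule `d (a b) = (d a) b + (-1)^{|a|} a (d b)`. -/
structure DGAlg (k S : Type u) [Field k] [Ring S] [Algebra k S] where
  V : SBimod k S
  g : Grading V
  mul : Hom (V.tensor V) V
  d : Hom V V
  mul_assoc : ∀ a b c, mul (tmul _ _ (mul (tmul _ _ a b)) c) =
    mul (tmul _ _ a (mul (tmul _ _ b c)))
  mul_homog : Grading.IsHomog (g.tensor g) g 0 mul
  d_homog : Grading.IsHomog g g (-1) d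
  d_d : ∀ a, d (d a) = 0
  leibniz : ∀ a b, d (mul (tmul _ _ a b)) =
    mul (tmul _ _ (d a) b) + mul (tmul _ _ (g.sgn 1 a) (d b))

/-- Morphisms of dg algebras. -/
structure DGAlg.Hom (A B : DGAlg k S) where
  f : SBimod.Hom A.V B.V
  homog : Grading.IsHomog A.g B.g 0 f
  map_mul : ∀ a b, f (A.mul (tmul _ _ a b)) = B.mul (tmul _ _ (f a) (f b))
  map_d : ∀ a, f (A.d a) = B.d (f a)

/-- Quasi-isomorphisms of dg algebras. -/
def DGAlg.Hom.QuasiIso {A B : DGAlg k S} (F : DGAlg.Hom A B) : Prop := IsQuasiIso A.d B.d F.f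

/-! ### A∞-coalgebras and the cobar construction -/

section Cobar

variable {V : SBimod k S}

/-- The map `[1]^{⊗ n} : V^{⊗ n} → V[1]^{⊗ n}` (here with `n + 1` in place of `n`), with the sign
`(-1)^{∑ (n - i) mᵢ}` on elements of degrees `m₁, …, mₙ` given by the Koszul rule. -/
def twistPow (g : Grading V) : ∀ n, Hom (V.pow n) (V.pow n)
  | 0 => Hom.id V
  | n + 1 => tmap (g.sgn (n + 1)) (twistPow g n)

/-- The direct sum of the maps `[1]^{⊗ n}`. -/
def twist (g : Grading V) : Hom V.T V.T := dlift (fun n => (V.inc n).comp (twistPow g n))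

/-- The restriction to `V[1]` of the differential of the cobar construction: its components are
`- [1]^{⊗ n} ∘ Δₙ ∘ [-1]`. -/
def cobarGen (g : Grading V) (Δ : Hom V V.T) : Hom V V.T := -((twist g).comp Δ)

/-- The extension of `cobarGen` to `T⁺ (V[1])` by the Leibniz rule
`d (v w) = (d v) w + (-1)^{|v|} v (d w)`, where `|v|` is the degree in `V[1]`. -/
def cobarD (g : Grading V) (Δ : Hom V V.T) : Hom V.T V.T :=
  recT (cobarGen g Δ) (V.mulT.comp (tmap (cobarGen g Δ) (Hom.id _)))
    (V.cons.comp (tmap ((g.shift 1).sgn 1) (Hom.id _)))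

theorem cobarD_letter (g : Grading V) (Δ : Hom V V.T) (v : V) :
    cobarD g Δ (V.letter v) = cobarGen g Δ v := recT_letter _ _ _ v

theorem cobarD_cons (g : Grading V) (Δ : Hom V V.T) (v : V) (x : V.T) :
    cobarD g Δ (V.cons (tmul _ _ v x)) = V.mulT (tmul _ _ (cobarGen g Δ v) x) +
      V.cons (tmul _ _ ((g.shift 1).sgn 1 v) (cobarD g Δ x)) := by
  rw [cobarD, recT_cons]
  simp

theorem prj_twist (g : Grading V) (n : ℕ) (x : V.T) :
    V.prj n (twist g x) = twistPow g n (V.prj n x) := by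
  induction x using T_inc_induction with
  | h0 => simp
  | ha x y hx hy => simp only [map_add, hx, hy]
  | hi m w =>
    rw [show twist g (V.inc m w) = V.inc m (twistPow g m w) from dlift_ι _ m w]
    by_cases h : m = n
    · subst h
      exact (π_ι_self (F := V.pow) _).trans (congrArg _ (π_ι_self (F := V.pow) w).symm)
    · rw [show V.prj n (V.inc m (twistPow g m w)) = 0 from π_ι_ne (F := V.pow) _ h,
        show V.prj n (V.inc m w) = 0 from π_ι_ne (F := V.pow) _ h, map_zero]

theorem twistPow_homog (g : Grading V) (n : ℕ) :
    Grading.IsHomog (g.pow n) (g.pow n) 0 (twistPow g n) := by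
  induction n with
  | zero => exact Grading.id_homog
  | succ n ih => exact Grading.sgn_homog.tmap ih rfl

theorem cobarGen_homog {g : Grading V} {Δ : Hom V V.T}
    (hΔ : ∀ n : ℕ, Grading.IsHomog g (g.pow n) (n - 1) ((V.prj n).comp Δ)) :
    Grading.IsHomog (g.shift 1) (g.shift 1).T (-1) (cobarGen g Δ) := by
  refine Grading.IsHomog.neg fun n x hx => Grading.mem_T.2 fun i => ?_
  rw [Hom.comp_apply, prj_twist]
  refine Grading.shift_pow_mem (twistPow_homog g i _ _ (hΔ i _ x hx)) ?_
  ring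

theorem cobarD_homog {g : Grading V} {Δ : Hom V V.T}
    (hΔ : ∀ n : ℕ, Grading.IsHomog g (g.pow n) (n - 1) ((V.prj n).comp Δ)) :
    Grading.IsHomog (g.shift 1).T (g.shift 1).T (-1) (cobarD g Δ) :=
  Grading.recT_homog (cobarGen_homog hΔ)
    (Grading.mulT_homog.comp ((cobarGen_homog hΔ).tmap Grading.id_homog rfl) rfl)
    (Grading.cons_homog.comp (Grading.sgn_homog.tmap Grading.id_homog rfl) rfl)

theorem cobarD_leibniz (g : Grading V) (Δ : Hom V V.T) (x y : V.T) :
    cobarD g Δ (V.mulT (tmul _ _ x y)) = V.mulT (tmul _ _ (cobarD g Δ x) y) +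
      V.mulT (tmul _ _ ((g.shift 1).T.sgn 1 x) (cobarD g Δ y)) := by
  induction x using T_induction with
  | h0 => simp
  | ha x x' hx hx' =>
    simp only [map_add, LinearMap.add_apply, hx, hx']
    abel
  | h1 v => rw [mulT_letter, cobarD_cons, cobarD_letter, Grading.sgn_letter, mulT_letter]
  | hc v x hx =>
    rw [mulT_cons, cobarD_cons, hx, cobarD_cons, Grading.sgn_cons, mulT_cons]
    simp only [map_add, LinearMap.add_apply]
    rw [mulT_cons, mulT_assoc]
    abel

/-- It suffices to check `d² = 0` on letters. -/
theorem cobarD_sq {g : Grading V} {Δ : Hom V V.T}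
    (hΔ : ∀ n : ℕ, Grading.IsHomog g (g.pow n) (n - 1) ((V.prj n).comp Δ))
    (h : ∀ v, cobarD g Δ (cobarGen g Δ v) = 0) (x : V.T) : cobarD g Δ (cobarD g Δ x) = 0 := by
  induction x using T_induction with
  | h0 => simp
  | ha x y hx hy => simp only [map_add, hx, hy, add_zero]
  | h1 v => rw [cobarD_letter, h]
  | hc v x hx =>
    rw [cobarD_cons, map_add, cobarD_leibniz, cobarD_cons, hx, h,
      Grading.sgn_anticomm (cobarGen_homog hΔ)]
    simp

end Cobar

/-- An A∞-coalgebra over `S`: a graded bimodule `V` with coproducts `Δₙ : V → V^{⊗ n}`, `n ≥ 1`,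
sending `Vₘ` to degree `m + n - 2`, such that only finitely many `Δₙ x` are nonzero for each
`x` (so that the coproducts are the components of a map `Δ : V → ⨁_{n ≥ 1} V^{⊗ n}`), and subject
to the A∞-relations, in the form `d² = 0` for the differential `d` of the cobar construction.
The component of `Δ` with index `n` is `Δₙ₊₁`. -/
structure AInfCoalg (k S : Type u) [Field k] [Ring S] [Algebra k S] where
  V : SBimod k S
  g : Grading V
  Δ : Hom V V.T
  Δ_homog : ∀ n : ℕ, Grading.IsHomog g (g.pow n) (n - 1) ((V.prj n).comp Δ)
  rel : ∀ x, cobarD g Δ (cobarD g Δ x) = 0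

namespace AInfCoalg

/-- The cobar construction `Ω_∞ C = T⁺ (C[1])`. -/
def cobar (C : AInfCoalg k S) : DGAlg k S where
  V := C.V.T
  g := (C.g.shift 1).T
  mul := C.V.mulT
  d := cobarD C.g C.Δ
  mul_assoc := mulT_assoc
  mul_homog := Grading.mulT_homog
  d_homog := cobarD_homog C.Δ_homog
  d_d := C.rel
  leibniz := cobarD_leibniz C.g C.Δ

/-- The differential `Δ₁` of the complex underlying an A∞-coalgebra. -/
def Δ₁ (C : AInfCoalg k S) : SBimod.Hom C.V C.V := C.V.fst.comp C.Δ

/-- The binary coproduct `Δ₂`. -/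
def Δ₂ (C : AInfCoalg k S) : SBimod.Hom C.V (C.V.tensor C.V) := C.V.snd.comp C.Δ

/-- A morphism `f = (fᵢ : C → C'^{⊗ i})` of A∞-coalgebras. It is given by the corresponding
morphism of dg algebras `Ω_∞ f : Ω_∞ C → Ω_∞ C'`, which is determined by its restriction
`C[1] → T⁺ (C'[1])`, whose components are the `fᵢ`, up to shifts. -/
structure Hom (C C' : AInfCoalg k S) where
  Ωmap : DGAlg.Hom C.cobar C'.cobar

/-- The linear part `f₁ : C → C'` of a morphism. -/
def Hom.lin {C C' : AInfCoalg k S} (f : Hom C C') : SBimod.Hom C.V C'.V :=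
  C'.V.fst.comp (f.Ωmap.f.comp C.V.letter)

/-- `f` is a quasi-isomorphism if `f₁` is one. -/
def Hom.QuasiIso {C C' : AInfCoalg k S} (f : Hom C C') : Prop := IsQuasiIso C.Δ₁ C'.Δ₁ f.lin

/-- `f` is a weak equivalence if `Ω_∞ f` is a quasi-isomorphism. -/
def Hom.WeakEquiv {C C' : AInfCoalg k S} (f : Hom C C') : Prop := f.Ωmap.QuasiIso

/-- The filtration of `V^{⊗ (n + 1)}` induced by a filtration of `V`: its `i`-th term is the sum of
the images of `F i₀ ⊗ ⋯ ⊗ F iₙ` with `i₀ + ⋯ + iₙ = i`. -/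
def filtPow {V : SBimod k S} (F : ℕ → Submodule k V) : ∀ n, ℕ → Submodule k (V.pow n)
  | 0, i => F i
  | n + 1, i => Submodule.span k {z : V.tensor (V.pow n) | ∃ a b v w, v ∈ F a ∧
      w ∈ filtPow F n b ∧ a + b = i ∧ z = tmul V (V.pow n) v w}

/-- An admissible filtration of an A∞-coalgebra: an increasing sequence
`0 = F 0 ⊆ F 1 ⊆ ⋯` of graded sub-bimodules with union `C`, such that all coproducts are compatible
with the induced filtrations. -/
structure IsAdmissible (C : AInfCoalg k S) (F : ℕ → SubBimod C.V) : Prop where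
  graded : ∀ i, C.g.IsGraded (F i)
  mono : ∀ i, (F i).carrier ≤ (F (i + 1)).carrier
  zero : (F 0).carrier = ⊥
  exhaust : ∀ x, ∃ i, x ∈ F i
  compat : ∀ n i x, x ∈ F i → C.V.prj n (C.Δ x) ∈ filtPow (fun j => (F j).carrier) n i

/-- `C` is cocomplete if it supports an admissible filtration. -/
def Cocomplete (C : AInfCoalg k S) : Prop := ∃ F, C.IsAdmissible F

/-- Two A∞-coalgebras are weakly equivalent if they are connected by a zigzag of weak equivalences
between cocomplete A∞-coalgebras. -/
def WeaklyEquivalent : AInfCoalg k S → AInfCoalg k S → Prop :=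
  Relation.EqvGen (fun C C' => C.Cocomplete ∧ C'.Cocomplete ∧ ∃ f : Hom C C', f.WeakEquiv)

/-- Two A∞-coalgebras are quasi-isomorphic if they are connected by a zigzag of
quasi-isomorphisms between cocomplete A∞-coalgebras. -/
def QuasiIsomorphic : AInfCoalg k S → AInfCoalg k S → Prop :=
  Relation.EqvGen (fun C C' => C.Cocomplete ∧ C'.Cocomplete ∧ ∃ f : Hom C C', f.QuasiIso)

end AInfCoalg

/-! ### The bar construction -/

section Bar

/-- `x ⊗ y ↦ x y`, from `V ⊗ V` to words of length two. -/
def pair (V : SBimod k S) : Hom (V.tensor V) V.T := V.cons.comp (tmap (Hom.id V) V.letter)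

/-- The reduced deconcatenation coproduct `T⁺ V → T⁺ V ⊗ T⁺ V`,
`v₁ ⋯ vₙ ↦ ∑_{0 < i < n} v₁ ⋯ vᵢ ⊗ vᵢ₊₁ ⋯ vₙ`, defined recursively by
`v w ↦ v ⊗ w + (v ·) (deconc w)`. -/
def deconc (V : SBimod k S) : Hom V.T (V.T.tensor V.T) :=
  recT 0 (tmap V.letter (Hom.id _)) ((tmap V.cons (Hom.id _)).comp (assocInv _ _ _))

/-- Multiplication of the first letter of a word by an element of an algebra:
`a ⊗ a₁ a₂ ⋯ aₙ ↦ (a a₁) a₂ ⋯ aₙ`. -/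
def firstPow {V : SBimod k S} (m : Hom (V.tensor V) V) : ∀ n, Hom (V.tensor (V.pow n)) (V.pow n)
  | 0 => m
  | n + 1 => (tmap m (Hom.id (V.pow n))).comp (assocInv V V (V.pow n))

/-- Multiplication of the first letter of a word, on the tensor algebra. -/
def first {V : SBimod k S} (m : Hom (V.tensor V) V) : Hom (V.tensor V.T) V.T :=
  dliftRight (fun n => (V.inc n).comp (firstPow m n))

/-- The differential of the bar construction `T⁺ (A[-1])`, given on words by
`[a₁|⋯|aₙ] ↦ ∑ᵢ (-1)^{eᵢ₋₁} (-[a₁|⋯|d aᵢ|⋯|aₙ] + (-1)^{|aᵢ|} [a₁|⋯|aᵢ aᵢ₊₁|⋯|aₙ])`,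
where `eᵢ = ∑_{j ≤ i} (|aⱼ| + 1)`; recursively
`b [a|w] = -[d a|w] + (-1)^{|a|} [a w₁|w₂|⋯] - (-1)^{|a|} [a|b w]`. -/
def barD (A : DGAlg k S) : Hom A.V.T A.V.T :=
  recT (-(A.V.letter.comp A.d))
    (-(A.V.cons.comp (tmap A.d (Hom.id _))) + (first A.mul).comp (tmap (A.g.sgn 1) (Hom.id _)))
    (-(A.V.cons.comp (tmap (A.g.sgn 1) (Hom.id _))))

/-- All the coproducts of the bar construction: `Δ₁` is the differential, `Δ₂` the deconcatenation
coproduct, and the others vanish. -/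
def barΔ (A : DGAlg k S) : Hom A.V.T A.V.T.T :=
  A.V.T.letter.comp (barD A) + (pair A.V.T).comp (deconc A.V)

variable {V : SBimod k S}

theorem deconc_letter (v : V) : deconc V (V.letter v) = 0 := recT_letter _ _ _ v

theorem deconc_cons (v : V) (x : V.T) : deconc V (V.cons (tmul _ _ v x)) =
    tmul _ _ (V.letter v) x + tmap V.cons (Hom.id _) (assocInv _ _ _ (tmul _ _ v (deconc V x))) := by
  rw [deconc, recT_cons]
  simp

theorem first_letter (m : Hom (V.tensor V) V) (a b : V) :
    first m (tmul _ _ a (V.letter b)) = V.letter (m (tmul _ _ a b)) :=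
  dliftRight_ι (fun n => (V.inc n).comp (firstPow m n)) a 0 b

theorem first_cons (m : Hom (V.tensor V) V) (a b : V) (x : V.T) :
    first m (tmul _ _ a (V.cons (tmul _ _ b x))) = V.cons (tmul _ _ (m (tmul _ _ a b)) x) := by
  induction x using T_inc_induction with
  | h0 => simp
  | ha x y hx hy => simp only [map_add, hx, hy]
  | hi n w =>
    rw [cons_inc, cons_inc]
    refine (dliftRight_ι (fun n => (V.inc n).comp (firstPow m n)) a (n + 1)
      (tmul V (V.pow n) b w)).trans ?_
    have : tmap m (Hom.id (V.pow n)) (assocInv V V (V.pow n) (tmul _ _ a (tmul _ _ b w))) =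
        tmul V (V.pow n) (m (tmul _ _ a b)) w := by
      rw [assocInv_tmul, tmap_tmul]
      rfl
    exact congrArg (V.inc (n + 1)) this

theorem first_homog {g : Grading V} {m : Hom (V.tensor V) V}
    (hm : Grading.IsHomog (g.tensor g) g 0 m) : Grading.IsHomog (g.tensor g.T) g.T 0 (first m) := by
  refine Grading.isHomog_tensor fun i j v x hv hx => ?_
  rw [add_zero]
  refine Grading.T_mem_induction
    (fun j => (g.T.gr (i + j)).comap ((first m).lin ∘ₗ tmul V V.T v)) (fun n w hw => ?_)
    (fun a b w x hw hx _ => ?_) hx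
  · rw [Submodule.mem_comap, LinearMap.comp_apply, first_letter]
    have := Grading.letter_homog _ _ (hm _ _ (Grading.tmul_mem hv hw))
    simpa using this
  · rw [Submodule.mem_comap, LinearMap.comp_apply, first_cons]
    have := Grading.cons_homog _ _ (Grading.tmul_mem (hm _ _ (Grading.tmul_mem hv hw)) hx)
    simpa [add_assoc] using this

theorem assocInv_homog {U V W : SBimod k S} {g : Grading U} {h : Grading V} {l : Grading W} :
    Grading.IsHomog (g.tensor (h.tensor l)) ((g.tensor h).tensor l) 0 (assocInv U V W) := by
  refine Grading.isHomog_tensor fun i j u x hu hx => ?_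
  refine Grading.tensor_gr_le (((g.tensor h).tensor l).gr (i + j + 0))
    ((assocInv U V W).lin ∘ₗ tmul U (V.tensor W) u) (fun a b v w hv hw hab => ?_) hx
  rw [LinearMap.comp_apply, assocInv_tmul, ← hab, add_zero, ← add_assoc]
  exact Grading.tmul_mem (Grading.tmul_mem hu hv) hw

theorem deconc_homog {g : Grading V} : Grading.IsHomog g.T (g.T.tensor g.T) 0 (deconc V) :=
  Grading.recT_homog Grading.zero_homog (Grading.letter_homog.tmap Grading.id_homog rfl)
    ((Grading.cons_homog.tmap Grading.id_homog rfl).comp assocInv_homog rfl)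

theorem deconc_coassoc (x : V.T) : assoc _ _ _ (tmap (deconc V) (Hom.id _) (deconc V x)) =
    tmap (Hom.id _) (deconc V) (deconc V x) := by
  induction x using T_induction with
  | h0 => simp
  | ha x y hx hy => simp only [map_add, hx, hy]
  | h1 v => simp [deconc_letter]
  | hc v x hx =>
    have key : ∀ t : V.T.tensor V.T, assoc _ _ _ (tmap (deconc V) (Hom.id _)
        (tmap V.cons (Hom.id _) (assocInv _ _ _ (tmul _ _ v t)))) =
        tmul _ _ (V.letter v) t + tmap V.cons (Hom.id _) (assocInv _ _ _ (tmul _ _ v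
          (assoc _ _ _ (tmap (deconc V) (Hom.id _) t)))) := by
      intro t
      induction t using tensor_induction with
      | h0 => simp
      | ha x y hx hy =>
        simp only [map_add, hx, hy]
        abel
      | ht y z =>
        simp only [assocInv_tmul, tmap_tmul, Hom.id_apply, deconc_cons, map_add,
          LinearMap.add_apply, assoc_tmul]
        congr 1
        induction deconc V y using tensor_induction with
        | h0 => simp
        | ha x y hx hy => simp only [map_add, LinearMap.add_apply, hx, hy]
        | ht y y' => simp
    have key2 : ∀ t : V.T.tensor V.T, tmap (Hom.id _) (deconc V)
        (tmap V.cons (Hom.id _) (assocInv _ _ _ (tmul _ _ v t))) =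
        tmap V.cons (Hom.id _) (assocInv _ _ _ (tmul _ _ v (tmap (Hom.id _) (deconc V) t))) := by
      intro t
      induction t using tensor_induction with
      | h0 => simp
      | ha x y hx hy => simp only [map_add, hx, hy]
      | ht y z => simp
    rw [deconc_cons, map_add, map_add, map_add, key, key2, hx]
    simp [deconc_letter]

variable (A : DGAlg k S)

theorem barD_letter (a : A.V) : barD A (A.V.letter a) = -A.V.letter (A.d a) := recT_letter _ _ _ a

/-- The sign operator on `A[-1]`. -/
def barSgn : Hom A.V A.V := (A.g.shift (-1)).sgn 1

theorem barSgn_apply (a : A.V) : barSgn A a = -A.g.sgn 1 a :=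
  Grading.sgn_shift_odd (by decide) a

theorem barD_cons (a : A.V) (x : A.V.T) : barD A (A.V.cons (tmul _ _ a x)) =
    -A.V.cons (tmul _ _ (A.d a) x) - first A.mul (tmul _ _ (barSgn A a) x) +
      A.V.cons (tmul _ _ (barSgn A a) (barD A x)) := by
  rw [barD, recT_cons, barSgn_apply]
  simp

theorem shift_homog {V W : SBimod k S} {g : Grading V} {h : Grading W} {e m : ℤ} {f : Hom V W}
    (hf : Grading.IsHomog g h e f) : Grading.IsHomog (g.shift m) (h.shift m) e f := by
  intro n x hx
  have := hf _ x hx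
  rwa [show n + m + e = n + e + m by omega] at this

theorem shift_mul_homog :
    Grading.IsHomog ((A.g.shift (-1)).tensor (A.g.shift (-1))) (A.g.shift (-1)) (-1) A.mul := by
  refine Grading.isHomog_tensor fun i j a b ha hb => ?_
  have := A.mul_homog _ _ (Grading.tmul_mem ha hb)
  rwa [show i + -1 + (j + -1) + 0 = i + j + -1 + -1 by omega] at this

theorem first_homog' : Grading.IsHomog ((A.g.shift (-1)).tensor (A.g.shift (-1)).T)
    (A.g.shift (-1)).T (-1) (first A.mul) := by
  refine Grading.isHomog_tensor fun i j v x hv hx => ?_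
  refine Grading.T_mem_induction
    (fun j => ((A.g.shift (-1)).T.gr (i + j + -1)).comap ((first A.mul).lin ∘ₗ tmul A.V A.V.T v))
    (fun n w hw => ?_) (fun a b w x hw hx _ => ?_) hx
  · rw [Submodule.mem_comap, LinearMap.comp_apply, first_letter]
    have := Grading.letter_homog _ _ (shift_mul_homog A _ _ (Grading.tmul_mem hv hw))
    rwa [add_zero] at this
  · rw [Submodule.mem_comap, LinearMap.comp_apply, first_cons]
    have := Grading.cons_homog _ _
      (Grading.tmul_mem (shift_mul_homog A _ _ (Grading.tmul_mem hv hw)) hx)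
    rwa [show i + a + -1 + b + 0 = i + (a + b) + -1 by omega] at this

theorem sgn_homog_shift {m : ℤ} {V : SBimod k S} {g : Grading V} {n : ℤ} :
    Grading.IsHomog (g.shift m) (g.shift m) 0 (g.sgn n) := shift_homog Grading.sgn_homog

theorem barD_homog : Grading.IsHomog (A.g.shift (-1)).T (A.g.shift (-1)).T (-1) (barD A) :=
  Grading.recT_homog
    (Grading.letter_homog.comp (shift_homog A.d_homog) rfl).neg
    ((Grading.cons_homog.comp ((shift_homog A.d_homog).tmap Grading.id_homog rfl) rfl).neg.add
      ((first_homog' A).comp (sgn_homog_shift.tmap Grading.id_homog rfl) rfl))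
    (Grading.cons_homog.comp (sgn_homog_shift.tmap Grading.id_homog rfl) rfl).neg

theorem barSgn_barSgn (a : A.V) : barSgn A (barSgn A a) = a := Grading.sgn_sgn a

theorem barSgn_d (a : A.V) : barSgn A (A.d a) = -A.d (barSgn A a) :=
  Grading.sgn_anticomm (shift_homog A.d_homog) a

theorem barSgn_mul (a b : A.V) : barSgn A (A.mul (tmul _ _ a b)) =
    -A.mul (tmul _ _ (barSgn A a) (barSgn A b)) := by
  have := Grading.sgn_anticomm (shift_mul_homog A) (tmul _ _ a b)
  rwa [Grading.sgn_tmul] at this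

theorem first_first (a b : A.V) (x : A.V.T) :
    first A.mul (tmul _ _ a (first A.mul (tmul _ _ b x))) =
      first A.mul (tmul _ _ (A.mul (tmul _ _ a b)) x) := by
  induction x using T_induction with
  | h0 => simp
  | ha x y hx hy => simp only [map_add, hx, hy]
  | h1 v => rw [first_letter, first_letter, first_letter, A.mul_assoc]
  | hc v x hx => rw [first_cons, first_cons, first_cons, A.mul_assoc]

theorem leibniz' (a b : A.V) : A.d (A.mul (tmul _ _ a b)) =
    A.mul (tmul _ _ (A.d a) b) - A.mul (tmul _ _ (barSgn A a) (A.d b)) := by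
  rw [A.leibniz, barSgn_apply]
  simp

theorem barD_first (a : A.V) (x : A.V.T) : barD A (first A.mul (tmul _ _ a x)) =
    -first A.mul (tmul _ _ (A.d a) x) - first A.mul (tmul _ _ (barSgn A a) (barD A x)) := by
  induction x using T_induction with
  | h0 => simp
  | ha x y hx hy =>
    simp only [map_add, hx, hy]
    abel
  | h1 v =>
    rw [first_letter, barD_letter, barD_letter, leibniz']
    simp only [map_neg, map_sub, first_letter]
    abel
  | hc v x hx =>
    rw [first_cons, barD_cons, barD_cons, leibniz', barSgn_mul]
    simp only [map_neg, map_sub, map_add, first_cons, LinearMap.sub_apply, LinearMap.neg_apply,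
      first_first]
    abel

theorem barD_barD (x : A.V.T) : barD A (barD A x) = 0 := by
  induction x using T_induction with
  | h0 => simp
  | ha x y hx hy => simp only [map_add, hx, hy, add_zero]
  | h1 v => rw [barD_letter, map_neg, barD_letter, A.d_d]; simp
  | hc v x hx =>
    rw [barD_cons, map_add, map_sub, map_neg, barD_cons, barD_first, barD_cons, hx, A.d_d,
      barSgn_d, barSgn_barSgn]
    simp only [map_neg, map_zero, LinearMap.neg_apply, LinearMap.zero_apply]
    abel

theorem deconc_first (a : A.V) (x : A.V.T) : deconc A.V (first A.mul (tmul _ _ a x)) =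
    tmap (first A.mul) (Hom.id _) (assocInv _ _ _ (tmul _ _ a (deconc A.V x))) := by
  induction x using T_induction with
  | h0 => simp
  | ha x y hx hy => simp only [map_add, hx, hy]
  | h1 v => rw [first_letter, deconc_letter, deconc_letter]; simp
  | hc v x hx =>
    rw [first_cons, deconc_cons, deconc_cons]
    simp only [map_add, assocInv_tmul, tmap_tmul, first_letter, Hom.id_apply]
    congr 1
    induction deconc A.V x using tensor_induction with
    | h0 => simp
    | ha x y hx hy => simp only [map_add, hx, hy]
    | ht y z => simp [first_cons]

/-- The sign operator on `T⁺ (A[-1])`. -/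
def barSgnT : Hom A.V.T A.V.T := (A.g.shift (-1)).T.sgn 1

theorem barSgnT_letter (a : A.V) : barSgnT A (A.V.letter a) = A.V.letter (barSgn A a) :=
  Grading.sgn_letter a

theorem barSgnT_cons (a : A.V) (x : A.V.T) : barSgnT A (A.V.cons (tmul _ _ a x)) =
    A.V.cons (tmul _ _ (barSgn A a) (barSgnT A x)) := Grading.sgn_cons a x

theorem barSgnT_barSgnT (x : A.V.T) : barSgnT A (barSgnT A x) = x := Grading.sgn_sgn x

theorem barSgnT_barD (x : A.V.T) : barSgnT A (barD A x) = -barD A (barSgnT A x) :=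
  Grading.sgn_anticomm (barD_homog A) x

theorem deconc_barSgnT (x : A.V.T) : deconc A.V (barSgnT A x) =
    tmap (barSgnT A) (barSgnT A) (deconc A.V x) := by
  rw [barSgnT, ← Grading.sgn_comm (deconc_homog (g := A.g.shift (-1)))]
  refine hom_tensor_ext (f := ((A.g.shift (-1)).T.tensor (A.g.shift (-1)).T).sgn 1)
    (g := tmap _ _) (fun v w => ?_) _
  rw [Grading.sgn_tmul, tmap_tmul]

theorem deconc_barD (x : A.V.T) : deconc A.V (barD A x) =
    tmap (barD A) (Hom.id _) (deconc A.V x) + tmap (barSgnT A) (barD A) (deconc A.V x) := by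
  induction x using T_induction with
  | h0 => simp
  | ha x y hx hy =>
    simp only [map_add, hx, hy]
    abel
  | h1 v => rw [barD_letter, map_neg, deconc_letter, deconc_letter]; simp
  | hc a x hx =>
    have key : ∀ t : A.V.T.tensor A.V.T,
        tmap (barD A) (Hom.id _) (tmap A.V.cons (Hom.id _) (assocInv _ _ _ (tmul _ _ a t))) +
        tmap (barSgnT A) (barD A) (tmap A.V.cons (Hom.id _) (assocInv _ _ _ (tmul _ _ a t))) =
        -tmap A.V.cons (Hom.id _) (assocInv _ _ _ (tmul _ _ (A.d a) t)) -
        tmap (first A.mul) (Hom.id _) (assocInv _ _ _ (tmul _ _ (barSgn A a) t)) +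
        tmap A.V.cons (Hom.id _) (assocInv _ _ _ (tmul _ _ (barSgn A a)
          (tmap (barD A) (Hom.id _) t + tmap (barSgnT A) (barD A) t))) := by
      intro t
      induction t using tensor_induction with
      | h0 => simp
      | ha x y hx hy =>
        simp only [map_add] at hx hy ⊢
        rw [add_add_add_comm, hx, hy]
        abel
      | ht y z =>
        simp only [assocInv_tmul, tmap_tmul, Hom.id_apply, barD_cons, barSgnT_cons, map_add,
          map_sub, map_neg, LinearMap.add_apply, LinearMap.sub_apply, LinearMap.neg_apply]
        abel
    rw [barD_cons, map_add, map_sub, map_neg, deconc_cons, deconc_first, deconc_cons, deconc_cons,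
      map_add, map_add, add_add_add_comm _ _ (tmap (barSgnT A) (barD A) _), key, hx]
    simp only [tmap_tmul, barD_letter, barSgnT_letter, Hom.id_apply, map_neg, LinearMap.neg_apply]
    abel

theorem twist_letter (g : Grading V) (v : V) : twist g (V.letter v) = V.letter v :=
  dlift_ι (fun n => (V.inc n).comp (twistPow g n)) 0 v

theorem pair_tmul (v w : V) : pair V (tmul _ _ v w) = V.inc 1 (tmul V V v w) := by
  rw [pair, Hom.comp_apply, tmap_tmul]
  exact cons_inc v 0 w

theorem twist_pair (g : Grading V) (t : V.tensor V) :
    twist g (pair V t) = pair V (tmap (g.sgn 1) (Hom.id V) t) := by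
  induction t using tensor_induction with
  | h0 => simp
  | ha x y hx hy => simp only [map_add, hx, hy]
  | ht v w =>
    rw [tmap_tmul, pair_tmul, pair_tmul]
    have : twistPow g 1 (tmul V V v w) = tmul V V (g.sgn 1 v) w := by
      change tmap (g.sgn (((0 : ℕ) : ℤ) + 1)) (Hom.id V) (tmul V V v w) = _
      rw [tmap_tmul, Nat.cast_zero, zero_add]
      rfl
    exact (dlift_ι (fun n => (V.inc n).comp (twistPow g n)) 1 (tmul V V v w)).trans
      (congrArg (V.inc 1) this)

/-- The grading of the bar construction: `|[a₁|⋯|aₙ]| = ∑ (|aᵢ| + 1)`. -/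
def barG : Grading A.V.T := (A.g.shift (-1)).T

theorem barGen_apply (x : A.V.T) : cobarGen (barG A) (barΔ A) x =
    -A.V.T.letter (barD A x) - pair A.V.T (tmap (barSgnT A) (Hom.id _) (deconc A.V x)) := by
  simp only [cobarGen, barΔ, Hom.neg_apply, Hom.comp_apply, Hom.add_apply, map_add, twist_letter,
    twist_pair]
  rw [barG, ← barSgnT]
  abel

theorem barΔ_homog (n : ℕ) :
    Grading.IsHomog (barG A) ((barG A).pow n) (n - 1) ((A.V.T.prj n).comp (barΔ A)) := by
  intro m x hx
  have h1 : A.V.T.letter (barD A x) ∈ (barG A).T.gr (m - 1) := by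
    have := Grading.letter_homog _ _ (barD_homog A m x hx)
    rwa [add_zero] at this
  have h2 : pair A.V.T (deconc A.V x) ∈ (barG A).T.gr m := by
    have := (Grading.cons_homog.comp (Grading.id_homog.tmap Grading.letter_homog rfl) rfl :
      Grading.IsHomog ((barG A).tensor (barG A)) (barG A).T 0 (pair A.V.T)) _ _
      (deconc_homog m x hx)
    rwa [add_zero, add_zero] at this
  have e1 : ∀ n, n ≠ 0 → A.V.T.prj n (A.V.T.letter (barD A x)) = 0 := fun n hn =>
    π_ι_ne (F := A.V.T.pow) _ hn.symm
  have e2 : ∀ n, n ≠ 1 → A.V.T.prj n (pair A.V.T (deconc A.V x)) = 0 := fun n hn => by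
    induction deconc A.V x using tensor_induction with
    | h0 => simp
    | ha x y hx hy => simp only [map_add, hx, hy, add_zero]
    | ht v w =>
      rw [pair_tmul]
      exact π_ι_ne (F := A.V.T.pow) _ hn.symm
  rw [Hom.comp_apply, barΔ, Hom.add_apply, map_add, Hom.comp_apply, Hom.comp_apply]
  rcases n with _ | _ | n
  · rw [e2 0 (by omega), add_zero]
    have := Grading.mem_T.1 h1 0
    rwa [show m - 1 = m + (((0 : ℕ) : ℤ) - 1) by push_cast; ring] at this
  · rw [e1 (0 + 1) (by omega), zero_add (A.V.T.prj (0 + 1) _)]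
    have := Grading.mem_T.1 h2 1
    rwa [show m = m + (((1 : ℕ) : ℤ) - 1) by push_cast; ring] at this
  · rw [e1 _ (by omega), e2 _ (by omega), add_zero]
    exact zero_mem _

/-- The bar construction `B A = T⁺ (A[-1])`, as a dg coalgebra, i.e. as an A∞-coalgebra with
`Δₙ = 0` for `n ≥ 3`. -/
def bar : AInfCoalg k S where
  V := A.V.T
  g := barG A
  Δ := barΔ A
  Δ_homog := barΔ_homog A
  rel := by
    refine cobarD_sq (barΔ_homog A) fun x => ?_
    have hs : ∀ y : A.V.T, ((barG A).shift 1).sgn 1 y = -barSgnT A y := fun y =>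
      Grading.sgn_shift_odd (by decide) y
    -- the differential of a word of length two
    have hpair : ∀ t : A.V.T.tensor A.V.T, cobarD (barG A) (barΔ A) (pair _ t) =
        -pair _ (tmap (barD A) (Hom.id _) t) + pair _ (tmap (barSgnT A) (barD A) t) -
        A.V.T.cons (tmap (Hom.id _) (pair _) (assoc _ _ _
          (tmap (tmap (barSgnT A) (Hom.id _)) (Hom.id _) (tmap (deconc A.V) (Hom.id _) t)))) +
        A.V.T.cons (tmap (Hom.id _) (pair _)
          (tmap (barSgnT A) (tmap (barSgnT A) (Hom.id _)) (tmap (Hom.id _) (deconc A.V) t))) := by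
      intro t
      induction t using tensor_induction with
      | h0 => simp
      | ha x y hx hy =>
        simp only [map_add, hx, hy]
        abel
      | ht y z =>
        have h3 : ∀ u : A.V.T.tensor A.V.T, A.V.T.mulT (tmul _ _ (pair _ u) (A.V.T.letter z)) =
            A.V.T.cons (tmap (Hom.id _) (pair _) (assoc _ _ _ (tmul _ _ u z))) := by
          intro u
          induction u using tensor_induction with
          | h0 => simp
          | ha x y hx hy => simp only [map_add, LinearMap.add_apply, hx, hy]
          | ht v w => simp [pair, mulT_cons, mulT_letter]
        have h4 : pair _ (tmul _ _ y z) = A.V.T.cons (tmul _ _ y (A.V.T.letter z)) := by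
          simp [pair]
        have h5 : ∀ y z, A.V.T.cons (tmul _ _ y (A.V.T.letter z)) = pair _ (tmul _ _ y z) := by
          simp [pair]
        rw [h4, cobarD_cons, cobarD_letter, barGen_apply, barGen_apply, hs]
        simp only [map_sub, map_neg, LinearMap.sub_apply, LinearMap.neg_apply, mulT_letter, h3,
          h5, tmap_tmul, Hom.id_apply]
        abel
    rw [barGen_apply, map_sub, map_neg, cobarD_letter, barGen_apply, barD_barD, deconc_barD, hpair]
    have e1 : ∀ t : A.V.T.tensor A.V.T,
        tmap (barD A) (Hom.id _) (tmap (barSgnT A) (Hom.id _) t) =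
        -tmap (barSgnT A) (Hom.id _) (tmap (barD A) (Hom.id _) t) := by
      intro t
      induction t using tensor_induction with
      | h0 => simp
      | ha x y hx hy => simp only [map_add, hx, hy, neg_add]
      | ht v w => simp [barSgnT_barD]
    have e2 : ∀ t : A.V.T.tensor A.V.T,
        tmap (barSgnT A) (barD A) (tmap (barSgnT A) (Hom.id _) t) =
        tmap (barSgnT A) (Hom.id _) (tmap (barSgnT A) (barD A) t) := by
      intro t
      induction t using tensor_induction with
      | h0 => simp
      | ha x y hx hy => simp only [map_add, hx, hy]
      | ht v w => simp
    have e3 : ∀ t : A.V.T.tensor A.V.T, assoc _ _ _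
        (tmap (tmap (barSgnT A) (Hom.id _)) (Hom.id _) (tmap (deconc A.V) (Hom.id _)
          (tmap (barSgnT A) (Hom.id _) t))) =
        tmap (Hom.id _) (tmap (barSgnT A) (Hom.id _))
          (assoc _ _ _ (tmap (deconc A.V) (Hom.id _) t)) := by
      intro t
      induction t using tensor_induction with
      | h0 => simp
      | ha x y hx hy => simp only [map_add, hx, hy]
      | ht v w =>
        simp only [tmap_tmul, Hom.id_apply, deconc_barSgnT]
        induction deconc A.V v using tensor_induction with
        | h0 => simp
        | ha x y hx hy => simp only [map_add, LinearMap.add_apply, hx, hy]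
        | ht v v' => simp [barSgnT_barSgnT]
    have e4 : ∀ t : A.V.T.tensor A.V.T,
        tmap (barSgnT A) (tmap (barSgnT A) (Hom.id _)) (tmap (Hom.id _) (deconc A.V)
          (tmap (barSgnT A) (Hom.id _) t)) =
        tmap (Hom.id _) (tmap (barSgnT A) (Hom.id _)) (tmap (Hom.id _) (deconc A.V) t) := by
      intro t
      induction t using tensor_induction with
      | h0 => simp
      | ha x y hx hy => simp only [map_add, hx, hy]
      | ht v w => simp [barSgnT_barSgnT]
    rw [e1, e2, e3, e4, deconc_coassoc]
    simp only [map_add, map_neg, map_zero]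
    abel

end Bar

/-! ### Complexes and homology -/

namespace SBimod

/-- The preimage of a sub-bimodule. -/
def SubBimod.comap {V W : SBimod k S} (N : SubBimod W) (f : Hom V W) : SubBimod V where
  carrier := N.carrier.comap f.lin
  l_mem := fun s x hx => by
    rw [Submodule.mem_comap, f.map_l]
    exact N.l_mem s _ hx
  r_mem := fun s x hx => by
    rw [Submodule.mem_comap, f.map_r]
    exact N.r_mem s _ hx

/-- The sum of two sub-bimodules. -/
def SubBimod.sup {V : SBimod k S} (M N : SubBimod V) : SubBimod V where
  carrier := M.carrier ⊔ N.carrier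
  l_mem := fun s x hx => by
    obtain ⟨y, hy, z, hz, rfl⟩ := Submodule.mem_sup.1 hx
    rw [map_add]
    exact Submodule.add_mem_sup (M.l_mem s y hy) (N.l_mem s z hz)
  r_mem := fun s x hx => by
    obtain ⟨y, hy, z, hz, rfl⟩ := Submodule.mem_sup.1 hx
    rw [map_add]
    exact Submodule.add_mem_sup (M.r_mem s y hy) (N.r_mem s z hz)

namespace Grading

variable {V W : SBimod k S} {g : Grading V} {h : Grading W}

theorem comps_homog {f : Hom V W} {e : ℤ} (hf : IsHomog g h e f) (x : V) (n : ℤ) :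
    h.comps (f x) (n + e) = f (g.comps x n) := by
  induction x using g.gr_induction with
  | h0 => simp
  | ha x y hx hy => simp only [map_add, Finsupp.add_apply, hx, hy]
  | hm m x hx =>
    rw [comps_of_mem hx, comps_of_mem (hf m x hx)]
    by_cases hmn : n = m
    · subst hmn; simp
    · rw [Finsupp.single_eq_of_ne hmn, Finsupp.single_eq_of_ne (by omega), map_zero]

theorem isGraded_ker {f : Hom V W} {e : ℤ} (hf : IsHomog g h e f) : g.IsGraded f.ker :=
  fun x hx n => by
    have hx' : f x = 0 := hx
    change f (g.comps x n) = 0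
    rw [← comps_homog hf, hx']
    simp

theorem isGraded_range {f : Hom V W} {e : ℤ} (hf : IsHomog g h e f) : h.IsGraded f.range := by
  rintro _ ⟨x, rfl⟩ n
  refine ⟨g.comps x (n - e), ?_⟩
  rw [← comps_homog hf, sub_add_cancel]

theorem isGraded_sup {M N : SubBimod V} (hM : g.IsGraded M) (hN : g.IsGraded N) :
    g.IsGraded (M.sup N) := fun x hx n => by
  obtain ⟨y, hy, z, hz, rfl⟩ := Submodule.mem_sup.1 hx
  rw [map_add, Finsupp.add_apply]
  exact Submodule.add_mem_sup (hM y hy n) (hN z hz n)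

theorem isGraded_comap {N : SubBimod W} (hN : h.IsGraded N) {f : Hom V W}
    (hf : IsHomog g h 0 f) : g.IsGraded (N.comap f) := fun x hx n => by
  change f (g.comps x n) ∈ N
  rw [← comps_homog hf, add_zero]
  exact hN _ hx n

theorem incl_homog {N : SubBimod V} (hN : g.IsGraded N) : IsHomog (g.sub N hN) g 0 N.incl :=
  fun n x hx => by rw [add_zero]; exact hx

theorem proj_homog {N : SubBimod V} (hN : g.IsGraded N) : IsHomog g (g.quot N hN) 0 N.proj :=
  fun n x hx => by rw [add_zero]; exact ⟨x, hx, rfl⟩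

end Grading

end SBimod

/-- Complexes of bimodules, with differential of degree `-1`. -/
structure Cplx (k S : Type u) [Field k] [Ring S] [Algebra k S] where
  V : SBimod k S
  g : Grading V
  d : Hom V V
  d_homog : Grading.IsHomog g g (-1) d
  d_d : ∀ x, d (d x) = 0

namespace Cplx

variable (X : Cplx k S)

/-- The cycles. -/
def Z : SBimod k S := X.d.ker.toBimod

/-- The grading of the cycles. -/
def Zg : Grading X.Z := X.g.sub X.d.ker (Grading.isGraded_ker X.d_homog)

/-- The inclusion of the cycles. -/
def incZ : Hom X.Z X.V := X.d.ker.incl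

theorem incZ_homog : Grading.IsHomog X.Zg X.g 0 X.incZ := Grading.incl_homog _

/-- The differential of `X ⊗ Y`: `d (x ⊗ y) = d x ⊗ y + (-1)^{|x|} x ⊗ d y`. -/
def tensorD (X Y : Cplx k S) : Hom (X.V.tensor Y.V) (X.V.tensor Y.V) :=
  tmap X.d (Hom.id _) + tmap (X.g.sgn 1) Y.d

/-- For a graded sub-bimodule `N`, the bimodule of cycles modulo the cycles lying in `N`. -/
def quotZ (N : SubBimod X.V) : SBimod k S := (N.comap X.incZ).quot

/-- The class of a cycle modulo `N`. -/
def cls (N : SubBimod X.V) : Hom X.Z (X.quotZ N) := (N.comap X.incZ).proj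

/-- The grading of the cycles modulo `N`. -/
def quotZg (N : SubBimod X.V) (hN : X.g.IsGraded N) : Grading (X.quotZ N) :=
  X.Zg.quot _ (Grading.isGraded_comap hN X.incZ_homog)

/-- The boundaries. -/
def B : SubBimod X.V := X.d.range

theorem B_graded : X.g.IsGraded X.B := Grading.isGraded_range X.d_homog

/-- The homology `H(X)`: cycles modulo boundaries. -/
def H : SBimod k S := X.quotZ X.B

/-- The grading of the homology. -/
def Hg : Grading X.H := X.quotZg X.B X.B_graded

end Cplx

/-- The structure of a graded (coassociative, non-counital) coalgebra over `S` on a graded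
bimodule. -/
structure CoalgStr {V : SBimod k S} (g : Grading V) where
  comul : Hom V (V.tensor V)
  homog : Grading.IsHomog g (g.tensor g) 0 comul
  coassoc : ∀ x, assoc _ _ _ (tmap comul (Hom.id V) (comul x)) =
    tmap (Hom.id V) comul (comul x)

/-- Isomorphisms of graded coalgebras. -/
structure CoalgStr.Iso {V W : SBimod k S} {g : Grading V} {h : Grading W}
    (δ : CoalgStr g) (δ' : CoalgStr h) where
  f : Hom V W
  bijective : Function.Bijective f
  homog : Grading.IsHomog g h 0 f
  comul : ∀ x, tmap f f (δ.comul x) = δ'.comul (f x)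

/-- Let `Δ : X → X ⊗ X` be a morphism of complexes and let `N` be a graded sub-bimodule containing
the boundaries. A comultiplication `δ` on the cycles modulo `N` is induced by `Δ` if
`δ [z] = ∑ [aᵢ] ⊗ [bᵢ]` for some cycles `aᵢ`, `bᵢ` such that `Δ z` is homologous to
`∑ aᵢ ⊗ bᵢ` in `X ⊗ X`. If `N` is the bimodule of boundaries, this says that `δ` is the map
`H(X) → H(X ⊗ X) ≅ H(X) ⊗ H(X)` given by `Δ` and the Künneth isomorphism. -/
def Cplx.IsInduced (X : Cplx k S) (Δ : Hom X.V (X.V.tensor X.V)) (N : SubBimod X.V)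
    (hN : X.g.IsGraded N) (δ : CoalgStr (X.quotZg N hN)) : Prop :=
  ∀ z : X.Z, ∃ (u : X.Z.tensor X.Z) (y : X.V.tensor X.V),
    Δ (X.incZ z) = tmap X.incZ X.incZ u + X.tensorD X y ∧
    δ.comul (X.cls N z) = tmap (X.cls N) (X.cls N) u

namespace AInfCoalg

variable (C : AInfCoalg k S)

theorem fst_letter (v : C.V) : C.V.fst (C.V.letter v) = v := π_ι_self (F := C.V.pow) (n := 0) v

theorem fst_cobarD (x : C.V.T) :
    C.V.fst (cobarD C.g C.Δ x) = -C.Δ₁ (C.V.fst x) := by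
  have hc : ∀ (v : C.V) (x : C.V.T), C.V.fst (C.V.cons (tmul _ _ v x)) = 0 := by
    intro v x
    induction x using T_inc_induction with
    | h0 => simp
    | ha x y hx hy => simp only [map_add, hx, hy, add_zero]
    | hi n w =>
      rw [cons_inc]
      exact π_ι_ne (F := C.V.pow) _ (Nat.succ_ne_zero n)
  have hm : ∀ x y : C.V.T, C.V.fst (C.V.mulT (tmul _ _ x y)) = 0 := by
    intro x y
    induction x using T_induction with
    | h0 => simp
    | ha x y hx hy => simp only [map_add, LinearMap.add_apply, hx, hy, add_zero]
    | h1 v => rw [mulT_letter, hc]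
    | hc v x hx => rw [mulT_cons, hc]
  induction x using T_induction with
  | h0 => simp
  | ha x y hx hy =>
    simp only [map_add, hx, hy]
    abel
  | h1 v =>
    rw [cobarD_letter, cobarGen, Hom.neg_apply, map_neg, Hom.comp_apply, fst_letter]
    exact congrArg _ (prj_twist C.g 0 (C.Δ v))
  | hc v x hx => rw [cobarD_cons, map_add, hc, hc, hm, map_zero, neg_zero, add_zero]

/-- The underlying complex `(C, Δ₁)`. -/
def cplx : Cplx k S where
  V := C.V
  g := C.g
  d := C.Δ₁
  d_homog := C.Δ_homog 0
  d_d := fun x => by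
    have h := congrArg C.V.fst (C.rel (C.V.letter x))
    rw [fst_cobarD, fst_cobarD, fst_letter] at h
    simpa using h

/-- A coalgebra structure on `H(C)` is the induced one if it is induced by `Δ₂`. -/
def IsHomologyCoalg (δ : CoalgStr C.cplx.Hg) : Prop :=
  C.cplx.IsInduced C.Δ₂ C.cplx.B C.cplx.B_graded δ

end AInfCoalg

/-! ### Modules over dg algebras, and Tor -/

/-- A left dg module over a non-unital dg `S`-algebra `A`, in `S`-`S`-bimodules over `k`. This is
the same as a dg bimodule over `A⁺` and `S`, where `A⁺ = S ⊕ A` is the augmented unital dg algebra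
corresponding to `A`, i.e. a left dg module over `A⁺ ⊗ₖ Sᵒᵖ`. -/
structure DGMod (A : DGAlg k S) where
  V : SBimod k S
  g : Grading V
  act : Hom (A.V.tensor V) V
  d : Hom V V
  act_act : ∀ a b x, act (tmul _ _ (A.mul (tmul _ _ a b)) x) =
    act (tmul _ _ a (act (tmul _ _ b x)))
  act_homog : Grading.IsHomog (A.g.tensor g) g 0 act
  d_homog : Grading.IsHomog g g (-1) d
  d_d : ∀ x, d (d x) = 0
  leibniz : ∀ a x, d (act (tmul _ _ a x)) =
    act (tmul _ _ (A.d a) x) + act (tmul _ _ (A.g.sgn 1 a) (d x))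

/-- Morphisms of dg modules. -/
structure DGMod.Hom {A : DGAlg k S} (M N : DGMod A) where
  f : SBimod.Hom M.V N.V
  homog : Grading.IsHomog M.g N.g 0 f
  map_act : ∀ a x, f (M.act (tmul _ _ a x)) = N.act (tmul _ _ a (f x))
  map_d : ∀ x, f (M.d x) = N.d (f x)

/-- A dg module `P` is semi-projective (cofibrant) if morphisms out of `P` lift along surjective
quasi-isomorphisms. -/
def DGMod.IsSemiprojective {A : DGAlg k S} (P : DGMod A) : Prop :=
  ∀ (M N : DGMod A) (p : DGMod.Hom M N), Function.Surjective p.f → IsQuasiIso M.d N.d p.f →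
    ∀ f : DGMod.Hom P N, ∃ f' : DGMod.Hom P M, ∀ x, p.f (f'.f x) = f.f x

/-- `S` as an `S`-`S`-bimodule. -/
def SBimod.unit (k S : Type u) [Field k] [Ring S] [Algebra k S] : SBimod k S where
  carrier := S
  l := Algebra.lsmul k k S
  r := Algebra.lsmul k k S
  comm := fun s t x => by simp [mul_assoc]

/-- The grading of `S` concentrated in degree `0`. -/
def SBimod.unitG (k S : Type u) [Field k] [Ring S] [Algebra k S] : Grading (SBimod.unit k S) where
  gr := fun n => if n = 0 then ⊤ else ⊥
  l_mem := fun n s x hx => by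
    split_ifs at hx ⊢ with h
    · trivial
    · rw [Submodule.mem_bot] at hx ⊢
      rw [hx, map_zero]
  r_mem := fun n s x hx => by
    split_ifs at hx ⊢ with h
    · trivial
    · rw [Submodule.mem_bot] at hx ⊢
      rw [hx, map_zero]
  internal := isInternal_of_components _ (Finsupp.lsingle 0) (fun x => by simp)
    (fun n x hx => by
      split_ifs at hx with h
      · rw [h]; rfl
      · rw [Submodule.mem_bot] at hx
        rw [hx, map_zero, Finsupp.single_zero])
    (fun x n => by
      split_ifs with h
      · trivial
      · rw [Finsupp.lsingle_apply, Finsupp.single_eq_of_ne h]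
        exact zero_mem _)

/-- The canonical map `S ⊗ V → V`, `s ⊗ v ↦ s v`. -/
def SBimod.unitL (V : SBimod k S) : Hom ((SBimod.unit k S).tensor V) V :=
  lift V.l.toLinearMap
    (fun (s : S) (t : S) v => by
      change V.l (s * t) v = V.l s (V.l t v)
      rw [map_mul]; rfl)
    (fun (s : S) (t : S) v => by
      change V.l (s * t) v = V.l s (V.l t v)
      rw [map_mul]; rfl)
    (fun s t v => V.comm t s v)

/-- `S` as a dg module on which `A` acts trivially (by zero). -/
def DGMod.trivial (A : DGAlg k S) : DGMod A where
  V := SBimod.unit k S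
  g := SBimod.unitG k S
  act := 0
  d := 0
  act_act := fun a b x => by simp
  act_homog := Grading.zero_homog
  d_homog := Grading.zero_homog
  d_d := fun x => by simp
  leibniz := fun a x => by simp

namespace DGMod

variable {A : DGAlg k S} (P : DGMod A)

/-- The sub-bimodule `A P` of `P`. -/
def AP : SubBimod P.V := P.act.range

theorem AP_graded : P.g.IsGraded P.AP := Grading.isGraded_range P.act_homog

theorem proj_act (a : A.V) (x : P.V) : P.AP.proj (P.act (tmul _ _ a x)) = 0 :=
  (Submodule.Quotient.mk_eq_zero _).2 ⟨_, rfl⟩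

theorem proj_surjective : Function.Surjective P.AP.proj := Submodule.Quotient.mk_surjective _

/-- The complex `S ⊗_{A⁺} P = P / A P`. -/
def indec : Cplx k S where
  V := P.AP.quot
  g := P.g.quot P.AP P.AP_graded
  d := P.AP.desc (P.AP.proj.comp P.d) (by
    rintro _ ⟨x, rfl⟩
    induction x using tensor_induction with
    | h0 => simp
    | ha x y hx hy => rw [map_add, map_add, hx, hy, add_zero]
    | ht a x => rw [Hom.comp_apply, P.leibniz, map_add, proj_act, proj_act, add_zero])
  d_homog := by
    rintro n _ ⟨x, hx, rfl⟩
    exact ⟨P.d x, P.d_homog n x hx, rfl⟩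
  d_d := fun x => by
    obtain ⟨x, rfl⟩ := P.proj_surjective x
    change P.AP.proj (P.d (P.d x)) = 0
    rw [P.d_d, map_zero]

/-- The projection `P → S ⊗_{A⁺} P`. -/
def π : SBimod.Hom P.V P.indec.V := P.AP.proj

theorem π_act (a : A.V) (x : P.V) : P.π (P.act (tmul _ _ a x)) = 0 := P.proj_act a x

/-- The complex underlying a dg module. -/
def cplx : Cplx k S := ⟨P.V, P.g, P.d, P.d_homog, P.d_d⟩

end DGMod

/-- The data needed to compute `Tor^A(S, S)` with its coproduct: a semi-projective resolution
`ε : P → S` over `A⁺`, and a lift `φ : P → P ⊗_S Q` of the projection `P → Q`, where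
`Q = S ⊗_{A⁺} P`, along the quasi-isomorphism `ε ⊗ 1 : P ⊗_S Q → S ⊗_S Q = Q` of dg modules. -/
structure TorResolution (A : DGAlg k S) where
  P : DGMod A
  semiprojective : P.IsSemiprojective
  ε : DGMod.Hom P (DGMod.trivial A)
  quasiIso : IsQuasiIso P.d (DGMod.trivial A).d ε.f
  φ : Hom P.V (P.V.tensor P.indec.V)
  φ_homog : Grading.IsHomog P.g (P.g.tensor P.indec.g) 0 φ
  φ_act : ∀ a x, φ (P.act (tmul _ _ a x)) =
    tmap P.act (Hom.id _) (assocInv _ _ _ (tmul _ _ a (φ x)))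
  φ_d : ∀ x, φ (P.d x) = P.cplx.tensorD P.indec (φ x)
  φ_ε : ∀ x, unitL _ (tmap ε.f (Hom.id _) (φ x)) = P.π x

namespace TorResolution

variable {A : DGAlg k S} (R : TorResolution A)

/-- The complex `Q = S ⊗_{A⁺} P`, whose homology is `Tor^{A⁺}(S, S)`. -/
abbrev Q : Cplx k S := R.P.indec

/-- The map `S ⊗_{A⁺} P → S ⊗_{A⁺} (P ⊗_S Q) = Q ⊗_S Q` given by `φ`, inducing the coproduct
`S ⊗ᴸ S = S ⊗ᴸ A⁺ ⊗ᴸ S → S ⊗ᴸ S ⊗ᴸ S = (S ⊗ᴸ S) ⊗_S (S ⊗ᴸ S)` of `Tor^{A⁺}(S, S)`. -/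
def ΔQ : Hom R.Q.V (R.Q.V.tensor R.Q.V) :=
  R.P.AP.desc ((tmap R.P.π (Hom.id _)).comp R.φ) (by
    rintro _ ⟨x, rfl⟩
    induction x using tensor_induction with
    | h0 => simp
    | ha x y hx hy => rw [map_add, map_add, hx, hy, add_zero]
    | ht a x =>
      rw [Hom.comp_apply, R.φ_act]
      induction R.φ x using tensor_induction with
      | h0 => simp
      | ha x y hx hy => simp only [map_add, hx, hy, add_zero]
      | ht y z => simp [DGMod.π_act])

/-- The boundaries of `Q`, together with the images of the cycles of `P`. Since `H(P) = S`, the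
latter represent the image of the coaugmentation `S → Tor^{A⁺}(S, S)`. -/
def N : SubBimod R.Q.V := R.Q.B.sup (R.P.π.comp R.P.cplx.incZ).range

theorem N_graded : R.Q.g.IsGraded R.N :=
  Grading.isGraded_sup R.Q.B_graded (Grading.isGraded_range
    ((Grading.proj_homog R.P.AP_graded).comp R.P.cplx.incZ_homog rfl))

/-- `Tor^A(S, S)` for the non-unital algebra `A`, i.e. the reduced Tor
`Tor^{A⁺}(S, S) / S`. -/
def Tor : SBimod k S := R.Q.quotZ R.N

/-- The grading of Tor. -/
def Torg : Grading R.Tor := R.Q.quotZg R.N R.N_graded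

/-- A coalgebra structure on Tor is the canonical one if it is induced by `ΔQ`. -/
def IsTorCoalg (δ : CoalgStr R.Torg) : Prop := R.Q.IsInduced R.ΔQ R.N R.N_graded δ

end TorResolution

/-- `S` is a separable `k`-algebra: it has a separability idempotent, i.e. there is
`e ∈ S ⊗ₖ S` with `μ(e) = 1` and `s e = e s` for all `s ∈ S`. -/
def IsSeparableAlg (k S : Type u) [Field k] [Ring S] [Algebra k S] : Prop :=
  ∃ e : TensorProduct k S S, LinearMap.mul' k S e = 1 ∧
    ∀ s : S, TensorProduct.map (LinearMap.mulLeft k s) LinearMap.id e =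
      TensorProduct.map LinearMap.id (LinearMap.mulRight k s) e

end AInf

end

/-!
Averaging over a separability idempotent turns every `k`-linear splitting of bimodules into a
bilinear one. Hence surjective maps of graded bimodules have graded sections, and the kernel of a
surjective quasi-isomorphism of complexes of bimodules is contractible
(`exists_section_contraction`). Two consequences carry the whole argument: the Künneth theorem, in
the elementary form of `Cplx.exists_kunneth` and `Cplx.kunneth_iff`, with its corollary that tensor
products of quasi-isomorphisms are quasi-isomorphisms (`IsQuasiIso.tmap`); and the possibility of
lifting maps out of objects that are free apart from the differential, one filtration step at a
time, by choosing a lift with the section and correcting it with the contraction.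

*Weak equivalence.* The counit `Ω B A → A` is a surjective quasi-isomorphism
(`counitMap_quasiIso`). Since `Ω_∞ C` is free as a graded algebra and `C` is cocomplete, the given
map `Ω_∞ C → A` lifts along the counit (`exists_lift`); the lift is a quasi-isomorphism because the
other two maps are. So there is a single weak equivalence `C → B A` (`exists_weakEquiv_bar`).

*Quasi-isomorphism.* A weak equivalence `C → C'` of cocomplete A∞-coalgebras is a
quasi-isomorphism (`AInfCoalg.Hom.WeakEquiv.quasiIso`): the bar construction preserves
quasi-isomorphisms (`mapWord_quasiIso`, by comparing tensor powers), and the projection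
`B Ω_∞ C → C` to words with a single letter is a quasi-isomorphism
(`AInfCoalg.unitProj_quasiIso`), compatibly with the linear part of the morphism.

The quasi-isomorphism statements for the counit and for this projection are of the same kind: the
map is surjective, and there is an explicit operator `s` on its source such that `1 - d s` lowers
an exhaustive filtration of the cycles in the kernel (`isQuasiIso_of_nilpotent`).

*Homology as a coalgebra.* By the Künneth theorem, the deconcatenation coproduct induces one on
`H(B A)`. The linear part of a quasi-isomorphism `C → B A` respects the coproducts up to a
homotopy given by its quadratic part, so `H(C)` is isomorphic to `H(B A)` as a coalgebra
(`homologyCoalg_of_quasiIso`). The passage from one coproduct to the other is isolated in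
`Cplx.transfer`, which is used for Tor as well.

*Tor.* The bar resolution `P = A⁺ ⊗ (S ⊕ B A)` is semi-projective (`BarRes.semiprojective`) and
resolves `S` (`BarRes.resolution`), and `S ⊗_{A⁺} P = S ⊕ B A`. Any other resolution `Q` is compared
to it by a lift of the identity of `S`, and lifts out of semi-projective modules agree after
applying `S ⊗_{A⁺} -`, up to boundaries (`DGMod.lift_unique`). Applied to the two maps from `Q` to
`P ⊗ B A`, one through the diagonal of `Q` and one through that of `P`, this shows that the
coproducts of Tor correspond. On `P` the diagonal is
deconcatenation, so `Tor` is isomorphic to `H(B A)` as a coalgebra (`BarRes.torCoalg`), and hence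
to `H(C)`.
-/

noncomputable section

namespace AInf

open SBimod

variable {k S : Type u} [Field k] [Ring S] [Algebra k S]

namespace SBimod

variable {U V W X Y : SBimod k S}

/-! ### Averaging over a separability idempotent -/

/-- `∑ aᵢ L (bᵢ w)` for `e = ∑ aᵢ ⊗ bᵢ`. -/
def avgL (V W : SBimod k S) (L : W →ₗ[k] V) : TensorProduct k S S →ₗ[k] (W →ₗ[k] V) :=
  TensorProduct.lift (LinearMap.mk₂ k (fun a b => V.l a ∘ₗ L ∘ₗ W.l b)
    (fun _ _ _ => by ext; simp) (fun _ _ _ => by ext; simp) (fun _ _ _ => by ext; simp)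
    (fun _ _ _ => by ext; simp))

/-- `∑ L (w aᵢ) bᵢ` for `e = ∑ aᵢ ⊗ bᵢ`. -/
def avgR (V W : SBimod k S) (L : W →ₗ[k] V) : TensorProduct k S S →ₗ[k] (W →ₗ[k] V) :=
  TensorProduct.lift (LinearMap.mk₂ k
    (fun a b => V.r (MulOpposite.op b) ∘ₗ L ∘ₗ W.r (MulOpposite.op a))
    (fun _ _ _ => by ext; simp) (fun _ _ _ => by ext; simp) (fun _ _ _ => by ext; simp)
    (fun _ _ _ => by ext; simp))

@[simp] theorem avgL_tmul (L : W →ₗ[k] V) (a b : S) (w : W) :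
    avgL V W L (a ⊗ₜ b) w = V.l a (L (W.l b w)) := rfl

@[simp] theorem avgR_tmul (L : W →ₗ[k] V) (a b : S) (w : W) :
    avgR V W L (a ⊗ₜ b) w = V.r (MulOpposite.op b) (L (W.r (MulOpposite.op a) w)) := rfl

theorem l_mul (s t : S) (v : V) : V.l (s * t) v = V.l s (V.l t v) := by rw [map_mul]; rfl

theorem r_mul (s t : S) (v : V) : V.r (MulOpposite.op (s * t)) v =
    V.r (MulOpposite.op t) (V.r (MulOpposite.op s) v) := by
  rw [MulOpposite.op_mul, map_mul]; rfl

theorem l_one (v : V) : V.l 1 v = v := by rw [map_one]; rfl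

theorem r_one (v : V) : V.r 1 v = v := by rw [map_one]; rfl

theorem l_avgL (L : W →ₗ[k] V) (e : TensorProduct k S S) (s : S) (w : W) :
    V.l s (avgL V W L e w) =
      avgL V W L (TensorProduct.map (LinearMap.mulLeft k s) LinearMap.id e) w := by
  induction e with
  | zero => simp
  | add x y hx hy => simp only [map_add, LinearMap.add_apply, hx, hy]
  | tmul a b => simp

theorem avgL_l (L : W →ₗ[k] V) (e : TensorProduct k S S) (s : S) (w : W) :
    avgL V W L e (W.l s w) =
      avgL V W L (TensorProduct.map LinearMap.id (LinearMap.mulRight k s) e) w := by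
  induction e with
  | zero => simp
  | add x y hx hy => simp only [map_add, LinearMap.add_apply, hx, hy]
  | tmul a b => simp

theorem r_avgR (L : W →ₗ[k] V) (e : TensorProduct k S S) (s : S) (w : W) :
    V.r (MulOpposite.op s) (avgR V W L e w) =
      avgR V W L (TensorProduct.map LinearMap.id (LinearMap.mulRight k s) e) w := by
  induction e with
  | zero => simp
  | add x y hx hy => simp only [map_add, LinearMap.add_apply, hx, hy]
  | tmul a b => simp only [avgR_tmul, TensorProduct.map_tmul, LinearMap.id_apply,
      LinearMap.mulRight_apply, r_mul]

theorem avgR_r (L : W →ₗ[k] V) (e : TensorProduct k S S) (s : S) (w : W) :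
    avgR V W L e (W.r (MulOpposite.op s) w) =
      avgR V W L (TensorProduct.map (LinearMap.mulLeft k s) LinearMap.id e) w := by
  induction e with
  | zero => simp
  | add x y hx hy => simp only [map_add, LinearMap.add_apply, hx, hy]
  | tmul a b => simp only [avgR_tmul, TensorProduct.map_tmul, LinearMap.id_apply,
      LinearMap.mulLeft_apply, r_mul]

theorem avgR_map_l (L : W →ₗ[k] V) (hL : ∀ s w, L (W.l s w) = V.l s (L w))
    (e : TensorProduct k S S) (s : S) (w : W) :
    avgR V W L e (W.l s w) = V.l s (avgR V W L e w) := by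
  induction e with
  | zero => simp
  | add x y hx hy => simp only [map_add, LinearMap.add_apply, hx, hy]
  | tmul a b => simp only [avgR_tmul, ← W.comm, hL, V.comm]

theorem map_avgL (L : W →ₗ[k] V) (f : Hom V W) (hL : ∀ v, f (L (f v)) = f v)
    (e : TensorProduct k S S) (v : V) :
    f (avgL V W L e (f v)) = W.l (LinearMap.mul' k S e) (f v) := by
  induction e with
  | zero => simp
  | add x y hx hy => simp only [map_add, LinearMap.add_apply, hx, hy]
  | tmul a b =>
    simp only [avgL_tmul, LinearMap.mul'_apply, l_mul]
    rw [← f.map_l, f.map_l a, hL]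

theorem map_avgR (L : W →ₗ[k] V) (f : Hom V W) (hL : ∀ v, f (L (f v)) = f v)
    (e : TensorProduct k S S) (v : V) :
    f (avgR V W L e (f v)) = W.r (MulOpposite.op (LinearMap.mul' k S e)) (f v) := by
  induction e with
  | zero => simp
  | add x y hx hy => simp only [map_add, LinearMap.add_apply, hx, hy, MulOpposite.op_add]
  | tmul a b =>
    simp only [avgR_tmul, LinearMap.mul'_apply, r_mul]
    rw [← f.map_r, f.map_r (MulOpposite.op b), hL]

/-- Over a separable algebra every morphism of bimodules has a generalized inverse. -/
theorem exists_quasiInverse (hS : IsSeparableAlg k S) (f : Hom V W) :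
    ∃ t : Hom W V, ∀ v, f (t (f v)) = f v := by
  obtain ⟨e, he, hc⟩ := hS
  obtain ⟨σ, hσ⟩ := f.lin.rangeRestrict.exists_rightInverse_of_surjective
    (LinearMap.range_rangeRestrict _)
  obtain ⟨ρ, hρ⟩ := (LinearMap.range f.lin).subtype.exists_leftInverse_of_injective
    (Submodule.ker_subtype _)
  have hL : ∀ v, f ((σ ∘ₗ ρ) (f v)) = f v := fun v => by
    have h1 : ρ (f v) = f.lin.rangeRestrict v := LinearMap.congr_fun hρ (f.lin.rangeRestrict v)
    have h2 := congrArg Subtype.val (LinearMap.congr_fun hσ (f.lin.rangeRestrict v))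
    rw [LinearMap.comp_apply, h1]
    exact h2
  let L := avgL V W (σ ∘ₗ ρ) e
  have hLl : ∀ s w, L (W.l s w) = V.l s (L w) := fun s w => by
    rw [avgL_l, l_avgL, hc]
  have hL' : ∀ v, f (L (f v)) = f v := fun v => by rw [map_avgL _ f hL, he, l_one]
  refine ⟨⟨avgR V W L e, avgR_map_l L hLl e, fun t w => ?_⟩, fun v => ?_⟩
  · obtain ⟨s, rfl⟩ := MulOpposite.op_surjective t
    rw [avgR_r, r_avgR, hc]
  · refine (map_avgR L f hL' e v).trans ?_
    rw [he, MulOpposite.op_one, r_one]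

/-- The part of degree `e` of a morphism of graded bimodules. -/
def Hom.degPart (g : Grading V) (h : Grading W) (e : ℤ) (f : Hom V W) : Hom V W where
  lin := (Finsupp.lsum k (fun n : ℤ => Finsupp.lapply (n + e) ∘ₗ h.comps ∘ₗ f.lin)) ∘ₗ g.comps
  map_l := fun s x => by
    induction x using g.gr_induction with
    | h0 => simp
    | ha x y hx hy => simp only [map_add, hx, hy]
    | hm n x hx =>
      simp only [LinearMap.comp_apply, Grading.comps_of_mem hx,
        Grading.comps_of_mem (g.l_mem n s x hx), Finsupp.lsum_single, Finsupp.lapply_apply, f.map_l]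
      generalize f x = y
      induction y using h.gr_induction with
      | h0 => simp
      | ha x y hx hy => simp only [map_add, Finsupp.add_apply, hx, hy]
      | hm m y hy =>
        rw [Grading.comps_of_mem hy, Grading.comps_of_mem (h.l_mem m s y hy),
          Finsupp.single_apply, Finsupp.single_apply]
        split_ifs <;> simp
  map_r := fun s x => by
    induction x using g.gr_induction with
    | h0 => simp
    | ha x y hx hy => simp only [map_add, hx, hy]
    | hm n x hx =>
      simp only [LinearMap.comp_apply, Grading.comps_of_mem hx,
        Grading.comps_of_mem (g.r_mem n s x hx), Finsupp.lsum_single, Finsupp.lapply_apply, f.map_r]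
      generalize f x = y
      induction y using h.gr_induction with
      | h0 => simp
      | ha x y hx hy => simp only [map_add, Finsupp.add_apply, hx, hy]
      | hm m y hy =>
        rw [Grading.comps_of_mem hy, Grading.comps_of_mem (h.r_mem m s y hy),
          Finsupp.single_apply, Finsupp.single_apply]
        split_ifs <;> simp

theorem Hom.degPart_of_mem {g : Grading V} {h : Grading W} {e : ℤ} {f : Hom V W} {n : ℤ} {x : V}
    (hx : x ∈ g.gr n) : f.degPart g h e x = h.comps (f x) (n + e) := by
  change (Finsupp.lsum k (fun n : ℤ => Finsupp.lapply (n + e) ∘ₗ h.comps ∘ₗ f.lin)) (g.comps x) = _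
  rw [Grading.comps_of_mem hx]
  simp

theorem Hom.degPart_homog {g : Grading V} {h : Grading W} {e : ℤ} {f : Hom V W} :
    Grading.IsHomog g h e (f.degPart g h e) := fun n x hx => by
  rw [degPart_of_mem hx]
  exact h.comps_mem _ _

/-- Over a separable algebra every homogeneous morphism has a homogeneous generalized inverse. -/
theorem exists_homog_quasiInverse (hS : IsSeparableAlg k S) {g : Grading V} {h : Grading W} {e : ℤ}
    {f : Hom V W} (hf : Grading.IsHomog g h e f) :
    ∃ t : Hom W V, Grading.IsHomog h g (-e) t ∧ ∀ v, f (t (f v)) = f v := by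
  obtain ⟨t, ht⟩ := exists_quasiInverse hS f
  refine ⟨t.degPart h g (-e), Hom.degPart_homog, fun v => ?_⟩
  induction v using g.gr_induction with
  | h0 => simp
  | ha x y hx hy => simp only [map_add, hx, hy]
  | hm n x hx =>
    rw [Hom.degPart_of_mem (hf n x hx), show n + e + -e = n by omega,
      ← Grading.comps_homog hf, ht, Grading.comps_of_mem (hf n x hx), Finsupp.single_eq_same]

/-- Surjections of graded bimodules split. -/
theorem exists_section (hS : IsSeparableAlg k S) {g : Grading V} {h : Grading W}
    {f : Hom V W} (hf : Grading.IsHomog g h 0 f) (hs : Function.Surjective f) :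
    ∃ t : Hom W V, Grading.IsHomog h g 0 t ∧ ∀ w, f (t w) = w := by
  obtain ⟨t, ht, h1⟩ := exists_homog_quasiInverse hS hf
  refine ⟨t, ht, fun w => ?_⟩
  obtain ⟨v, rfl⟩ := hs w
  exact h1 v

end SBimod

/-! ### Quasi-isomorphisms -/

section QuasiIso

variable {V W X : SBimod k S} {d : Hom V V} {d' : Hom W W} {d'' : Hom X X}

/-- A morphism of complexes is a quasi-isomorphism if and only if its cone is acyclic. -/
theorem isQuasiIso_iff_cone {f : Hom V W} (hf : ∀ x, f (d x) = d' (f x)) : IsQuasiIso d d' f ↔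
      ∀ x y, d x = 0 → f x = d' y → ∃ x' y', d x' = x ∧ f x' + d' y' = y := by
  constructor
  · rintro ⟨h1, h2⟩ x y hx hxy
    obtain ⟨x', rfl⟩ := h1 x hx ⟨y, hxy.symm⟩
    obtain ⟨z, y', hz, hy'⟩ := h2 (y - f x') (by rw [map_sub, ← hxy, hf, sub_self])
    refine ⟨x' + z, y', by rw [map_add, hz, add_zero], ?_⟩
    rw [map_add, add_assoc, hy']
    abel
  · intro h
    refine ⟨fun x hx ⟨y, hy⟩ => ?_, fun y hy => ?_⟩
    · obtain ⟨x', _, h', _⟩ := h x y hx hy.symm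
      exact ⟨x', h'⟩
    · obtain ⟨x', y', h1, h2⟩ := h 0 y (map_zero _) (by rw [map_zero, hy])
      exact ⟨x', y', h1, h2⟩

theorem IsQuasiIso.comp {f : Hom V W} {f' : Hom W X} (hf' : IsQuasiIso d' d'' f')
    (h : IsQuasiIso d d' f) (hf : ∀ x, f (d x) = d' (f x)) (hd' : ∀ x, f' (d' x) = d'' (f' x)) :
    IsQuasiIso d d'' (f'.comp f) := by
  refine ⟨fun x hx hy => h.1 x hx (hf'.1 _ (by rw [← hf, hx, map_zero]) hy), fun y hy => ?_⟩
  obtain ⟨x, y', hx, hxy⟩ := hf'.2 y hy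
  obtain ⟨z, x', hz, hzx⟩ := h.2 x hx
  refine ⟨z, f' x' + y', hz, ?_⟩
  rw [← hxy, ← hzx, map_add, map_add, hd', Hom.comp_apply, add_assoc]

/-- If `f' ∘ f` and `f` are quasi-isomorphisms, then so is `f'`. -/
theorem IsQuasiIso.of_comp_left {f : Hom V W} {f' : Hom W X} (h : IsQuasiIso d d'' (f'.comp f))
    (h1 : IsQuasiIso d d' f) (hf : ∀ x, f (d x) = d' (f x))
    (hd' : ∀ x, f' (d' x) = d'' (f' x)) : IsQuasiIso d' d'' f' := by
  refine ⟨fun x hx hy => ?_, fun y hy => ?_⟩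
  · obtain ⟨z, x', hz, rfl⟩ := h1.2 x hx
    obtain ⟨y, hy⟩ := hy
    obtain ⟨w, rfl⟩ := h.1 z hz ⟨y - f' x', by
      rw [map_sub, hy, map_add, hd', add_sub_cancel_right]; rfl⟩
    exact ⟨f w + x', by rw [map_add, hf]⟩
  · obtain ⟨x, y', hx, hxy⟩ := h.2 y hy
    exact ⟨f x, y', by rw [← hf, hx, map_zero], hxy⟩

/-- If `f' ∘ f` and `f'` are quasi-isomorphisms, then so is `f`. -/
theorem IsQuasiIso.of_comp_right {f : Hom V W} {f' : Hom W X} (h : IsQuasiIso d d'' (f'.comp f))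
    (h1 : IsQuasiIso d' d'' f') (hf : ∀ x, f (d x) = d' (f x))
    (hd' : ∀ x, f' (d' x) = d'' (f' x)) : IsQuasiIso d d' f := by
  refine ⟨fun x hx hy => ?_, fun y hy => ?_⟩
  · obtain ⟨y, hy⟩ := hy
    exact h.1 x hx ⟨f' y, by rw [← hd', hy]; rfl⟩
  · obtain ⟨x, y', hx, hxy⟩ := h.2 (f' y) (by rw [← hd', hy, map_zero])
    have hc : d' (y - f x) = 0 := by rw [map_sub, hy, ← hf, hx, map_zero, sub_zero]
    obtain ⟨z, hz⟩ := h1.1 (y - f x) hc ⟨y', by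
      rw [map_sub, ← hxy, Hom.comp_apply, add_sub_cancel_left]⟩
    exact ⟨x, z, hx, by rw [hz]; abel⟩

/-- A surjection with acyclic kernel is a quasi-isomorphism. -/
theorem isQuasiIso_of_acyclic_ker {f : Hom V W} (hd : ∀ x, d (d x) = 0)
    (hf : ∀ x, f (d x) = d' (f x)) (hs : Function.Surjective f)
    (hk : ∀ x, d x = 0 → f x = 0 → ∃ y, f y = 0 ∧ d y = x) : IsQuasiIso d d' f := by
  refine ⟨fun x hx ⟨y, hy⟩ => ?_, fun y hy => ?_⟩
  · obtain ⟨z, rfl⟩ := hs y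
    obtain ⟨w, _, hw⟩ := hk (x - d z) (by rw [map_sub, hx, hd, sub_zero])
      (by rw [map_sub, hf, hy, sub_self])
    exact ⟨w + z, by rw [map_add, hw, sub_add_cancel]⟩
  · obtain ⟨x, rfl⟩ := hs y
    obtain ⟨w, hw, hwx⟩ := hk (d x) (hd x) (by rw [hf, hy])
    exact ⟨x - w, 0, by rw [map_sub, hwx, sub_self], by rw [map_sub, hw, map_zero]; simp⟩

/-- The kernel of a surjective quasi-isomorphism is acyclic. -/
theorem IsQuasiIso.acyclic_ker {f : Hom V W} (h : IsQuasiIso d d' f) (hd : ∀ x, d (d x) = 0)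
    (hf : ∀ x, f (d x) = d' (f x)) (hs : Function.Surjective f) (x : V) (hx : d x = 0)
    (hfx : f x = 0) : ∃ y, f y = 0 ∧ d y = x := by
  obtain ⟨x', y', h1, h2⟩ := (isQuasiIso_iff_cone hf).1 h x 0 hx (by rw [hfx, map_zero])
  obtain ⟨w, rfl⟩ := hs y'
  exact ⟨x' + d w, by rw [map_add, hf, h2], by rw [map_add, hd, h1, add_zero]⟩

/-- A surjection is a quasi-isomorphism if `1 - d s` lowers an exhaustive filtration
of the cycles in its kernel. -/
theorem isQuasiIso_of_nilpotent {f : Hom V W} (hd : ∀ x, d (d x) = 0)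
    (hf : ∀ x, f (d x) = d' (f x)) (hs : Function.Surjective f) (s : Hom V V)
    (hfs : ∀ x, f (s x) = 0) (F : ℕ → Submodule k V) (hF0 : F 0 = ⊥) (hF : ∀ x, ∃ i, x ∈ F i)
    (hN : ∀ i, ∀ x ∈ F (i + 1), d x = 0 → f x = 0 → x - d (s x) ∈ F i) : IsQuasiIso d d' f := by
  refine isQuasiIso_of_acyclic_ker hd hf hs fun x hx hfx => ?_
  obtain ⟨i, hi⟩ := hF x
  induction i generalizing x with
  | zero =>
    rw [hF0, Submodule.mem_bot] at hi
    exact ⟨0, map_zero _, by rw [hi, map_zero]⟩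
  | succ i ih =>
    obtain ⟨y, hy, hyx⟩ := ih (x - d (s x)) (by rw [map_sub, hx, hd, sub_zero])
      (by rw [map_sub, hfx, hf, hfs, map_zero, sub_zero]) (hN i x hi hx hfx)
    exact ⟨y + s x, by rw [map_add, hy, hfs, add_zero], by rw [map_add, hyx, sub_add_cancel]⟩

/-- A filtered morphism with acyclic associated graded cone is a quasi-isomorphism. -/
theorem isQuasiIso_of_filtered {f : Hom V W} (hd : ∀ x, d (d x) = 0) (hd' : ∀ x, d' (d' x) = 0)
    (hf : ∀ x, f (d x) = d' (f x)) (F : ℕ → Submodule k V) (G : ℕ → Submodule k W)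
    (hF0 : F 0 = ⊥) (hG0 : G 0 = ⊥) (hF : ∀ x y, ∃ i, x ∈ F i ∧ y ∈ G i)
    (hN : ∀ i, ∀ x ∈ F (i + 1), ∀ y ∈ G (i + 1), d x = 0 → f x = d' y →
      ∃ x' y', x - d x' ∈ F i ∧ y - f x' - d' y' ∈ G i) : IsQuasiIso d d' f := by
  refine (isQuasiIso_iff_cone hf).2 fun x y hx hxy => ?_
  obtain ⟨i, hi, hi'⟩ := hF x y
  induction i generalizing x y with
  | zero =>
    rw [hF0, Submodule.mem_bot] at hi
    rw [hG0, Submodule.mem_bot] at hi'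
    exact ⟨0, 0, by rw [hi, map_zero], by rw [hi']; simp⟩
  | succ i ih =>
    obtain ⟨x', y', h1, h2⟩ := hN i x hi y hi' hx hxy
    obtain ⟨x'', y'', h3, h4⟩ := ih _ _ (by rw [map_sub, hd, hx, sub_zero])
      (by rw [map_sub, map_sub, map_sub, hd', hf, hxy, sub_zero]) h1 h2
    refine ⟨x'' + x', y'' + y', by rw [map_add, h3, sub_add_cancel], ?_⟩
    rw [map_add, map_add, ← sub_eq_zero]
    rw [← sub_eq_zero] at h4
    rw [← h4]
    abel

/-- A surjective quasi-isomorphism of complexes of bimodules over a separable algebra has a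
section of graded bimodules, and its kernel is contractible. -/
theorem exists_section_contraction (hS : IsSeparableAlg k S) {g : Grading V} {h : Grading W}
    {f : Hom V W} (hq : IsQuasiIso d d' f) (hdg : Grading.IsHomog g g (-1) d)
    (hfg : Grading.IsHomog g h 0 f) (hd : ∀ x, d (d x) = 0)
    (hf : ∀ x, f (d x) = d' (f x)) (hs : Function.Surjective f) :
    ∃ (σ : Hom W V) (s : Hom V V), Grading.IsHomog h g 0 σ ∧ Grading.IsHomog g g 1 s ∧
      (∀ x, f (σ x) = x) ∧ (∀ x, f (s x) = 0) ∧ ∀ x, f x = 0 → d (s x) + s (d x) = x := by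
  obtain ⟨σ, hσ, hfσ⟩ := exists_section hS hfg hs
  -- the projection to the kernel of `f`
  let e : Hom V V := Hom.id V + -(σ.comp f)
  have he : Grading.IsHomog g g 0 e := Grading.id_homog.add (hσ.comp hfg rfl).neg
  have he1 : ∀ x, f x = 0 → e x = x := fun x hx => by simp [e, hx]
  have he2 : ∀ x, f (e x) = 0 := fun x => by simp [e, hfσ]
  obtain ⟨t, ht, hdt⟩ :=
    exists_homog_quasiInverse hS (hdg.comp he rfl : Grading.IsHomog g g _ (d.comp e))
  rw [show -(0 + -1 : ℤ) = 1 by norm_num] at ht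
  have hz : ∀ x, d x = 0 → f x = 0 → d (e (t x)) = x := fun x hx hfx => by
    obtain ⟨y, hy, rfl⟩ := hq.acyclic_ker hd hf hs x hx hfx
    have := hdt y
    simpa only [Hom.comp_apply, he1 y hy] using this
  refine ⟨σ, e.comp (t.comp (e + -((e.comp t).comp (d.comp e)))), hσ, ?_, hfσ, fun x => he2 _,
    fun x hx => ?_⟩
  · refine he.comp (ht.comp (he.add (Grading.IsHomog.neg ?_)) (zero_add _)) (add_zero _)
    exact (he.comp ht (add_zero _)).comp (hdg.comp he rfl) (by norm_num)
  · have hdx : f (d x) = 0 := by rw [hf, hx, map_zero]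
    have hc : d (x - e (t (d x))) = 0 := by
      rw [map_sub, hz _ (hd x) hdx, sub_self]
    have hc' := hz _ hc (by rw [map_sub, hx, he2, sub_zero])
    simp only [Hom.comp_apply, Hom.add_apply, Hom.neg_apply, he1 x hx, he1 _ hdx, hd, map_zero,
      neg_zero, add_zero, ← sub_eq_add_neg]
    rw [hc', sub_add_cancel]

end QuasiIso

/-! ### Homology and the Künneth theorem -/

namespace SBimod

variable {U V W X Y Z : SBimod k S}

/-- A morphism with values in a sub-bimodule. -/
def Hom.toSub (f : Hom V W) (N : SubBimod W) (hf : ∀ x, f x ∈ N) : Hom V N.toBimod where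
  lin := f.lin.codRestrict N.carrier hf
  map_l := fun s x => Subtype.ext (f.map_l s x)
  map_r := fun s x => Subtype.ext (f.map_r s x)

theorem tmap_tmap (f : Hom V W) (f' : Hom W X) (g : Hom U Y) (g' : Hom Y Z) (x : V.tensor U) :
    tmap f' g' (tmap f g x) = tmap (f'.comp f) (g'.comp g) x :=
  hom_tensor_ext (f := (tmap f' g').comp (tmap f g)) (g := tmap (f'.comp f) (g'.comp g))
    (fun v w => by simp) x

theorem tmap_id_id (x : V.tensor W) : tmap (Hom.id V) (Hom.id W) x = x :=
  hom_tensor_ext (f := tmap (Hom.id V) (Hom.id W)) (g := Hom.id _) (fun v w => by simp) x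

theorem tmap_congr {f f' : Hom V W} {g g' : Hom U Y} (hf : ∀ x, f x = f' x) (hg : ∀ x, g x = g' x)
    (x : V.tensor U) : tmap f g x = tmap f' g' x := by
  rw [Hom.ext' hf, Hom.ext' hg]

theorem assoc_tmap {U' V' W' : SBimod k S} (f : Hom U U') (g : Hom V V') (h : Hom W W')
    (x : (U.tensor V).tensor W) :
    assoc _ _ _ (tmap (tmap f g) h x) = tmap f (tmap g h) (assoc _ _ _ x) := by
  refine hom_tensor_ext (f := (assoc _ _ _).comp (tmap (tmap f g) h))
    (g := (tmap f (tmap g h)).comp (assoc _ _ _)) (fun v w => ?_) x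
  induction v using tensor_induction with
  | h0 => simp
  | ha x y hx hy => simp only [map_add, LinearMap.add_apply, hx, hy]
  | ht v v' => simp

/-- A bijective morphism has an inverse. -/
theorem Hom.exists_inverse {f : Hom V W} (hf : Function.Bijective f) :
    ∃ f' : Hom W V, (∀ x, f' (f x) = x) ∧ ∀ y, f (f' y) = y := by
  let e := LinearEquiv.ofBijective f.lin hf
  have he : ∀ y, f (e.symm y) = y := fun y => e.apply_symm_apply y
  exact ⟨⟨e.symm.toLinearMap, fun s x => hf.1 (by
    rw [f.map_l]; exact (he _).trans (congrArg _ (he x).symm)), fun s x => hf.1 (by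
    rw [f.map_r]; exact (he _).trans (congrArg _ (he x).symm))⟩, e.symm_apply_apply, he⟩

theorem Grading.mem_of_map_mem {g : Grading V} {h : Grading W} {f : Hom V W}
    (hf : Function.Injective f) (hfg : Grading.IsHomog g h 0 f) {n : ℤ} {x : V}
    (hx : f x ∈ h.gr n) : x ∈ g.gr n := by
  refine mem_of_comps (Finsupp.ext fun m => hf ?_)
  rw [← comps_homog hfg, comps_of_mem hx, add_zero]
  by_cases hm : m = n
  · rw [hm, Finsupp.single_eq_same, Finsupp.single_eq_same]
  · rw [Finsupp.single_eq_of_ne hm, Finsupp.single_eq_of_ne hm, map_zero]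

end SBimod

namespace Cplx

variable (X Y : Cplx k S)

theorem d_incZ (z : X.Z) : X.d (X.incZ z) = 0 := z.2

/-- An element `x` with `d x = 0`, as an element of the bimodule of cycles. -/
def mkZ (x : X.V) (hx : X.d x = 0) : X.Z := ⟨x, hx⟩

theorem incZ_injective : Function.Injective X.incZ := Subtype.val_injective

theorem cls_surjective (N : SubBimod X.V) : Function.Surjective (X.cls N) :=
  Submodule.Quotient.mk_surjective _

theorem cls_eq_zero {N : SubBimod X.V} {z : X.Z} : X.cls N z = 0 ↔ X.incZ z ∈ N :=
  Submodule.Quotient.mk_eq_zero _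

theorem cls_homog {N : SubBimod X.V} (hN : X.g.IsGraded N) :
    Grading.IsHomog X.Zg (X.quotZg N hN) 0 (X.cls N) := Grading.proj_homog _

/-- The tensor product of two complexes. -/
def tensor : Cplx k S where
  V := X.V.tensor Y.V
  g := X.g.tensor Y.g
  d := X.tensorD Y
  d_homog := (X.d_homog.tmap Grading.id_homog rfl).add (Grading.sgn_homog.tmap Y.d_homog rfl)
  d_d := fun x => by
    induction x using tensor_induction with
    | h0 => simp
    | ha x y hx hy => simp only [map_add, hx, hy, add_zero]
    | ht v w =>
      simp [tensorD, X.d_d, Y.d_d, Grading.sgn_anticomm X.d_homog]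

variable {X Y}

theorem tensorD_tmul (x : X.V) (y : Y.V) : X.tensorD Y (tmul _ _ x y) =
    tmul _ _ (X.d x) y + tmul _ _ (X.g.sgn 1 x) (Y.d y) := rfl

theorem tensorD_tensorD (x : X.V.tensor Y.V) : X.tensorD Y (X.tensorD Y x) = 0 :=
  (X.tensor Y).d_d x

theorem tensorD_incZ (u : X.Z.tensor Y.Z) : X.tensorD Y (tmap X.incZ Y.incZ u) = 0 := by
  induction u using tensor_induction with
  | h0 => simp
  | ha x y hx hy => simp only [map_add, hx, hy, add_zero]
  | ht v w => simp [tensorD_tmul, d_incZ]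

theorem tmap_tensorD {X' Y' : Cplx k S} {f : SBimod.Hom X.V X'.V} {g : SBimod.Hom Y.V Y'.V}
    (hf : Grading.IsHomog X.g X'.g 0 f) (hfd : ∀ x, f (X.d x) = X'.d (f x))
    (hgd : ∀ x, g (Y.d x) = Y'.d (g x)) (x : X.V.tensor Y.V) :
    tmap f g (X.tensorD Y x) = X'.tensorD Y' (tmap f g x) := by
  induction x using tensor_induction with
  | h0 => simp
  | ha x y hx hy => simp only [map_add, hx, hy]
  | ht v w => simp [tensorD_tmul, hfd, hgd, Grading.sgn_comm hf]

variable (X Y)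

/-- A splitting of a complex of bimodules: its homology is a deformation retract. -/
structure Splitting where
  π : SBimod.Hom X.V (X.quotZ X.B)
  σ : SBimod.Hom (X.quotZ X.B) X.Z
  s : SBimod.Hom X.V X.V
  π_homog : Grading.IsHomog X.g (X.quotZg X.B X.B_graded) 0 π
  s_homog : Grading.IsHomog X.g X.g 1 s
  π_incZ : ∀ z, π (X.incZ z) = X.cls X.B z
  π_d : ∀ x, π (X.d x) = 0
  π_σ : ∀ y, π (X.incZ (σ y)) = y
  σ_homog : Grading.IsHomog (X.quotZg X.B X.B_graded) X.Zg 0 σ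
  homotopy : ∀ x, x = X.incZ (σ (π x)) + (X.d (s x) + s (X.d x))

/-- Over a separable algebra, every complex of bimodules splits. -/
theorem exists_splitting (hS : IsSeparableAlg k S) : Nonempty X.Splitting := by
  obtain ⟨h, hh, hd⟩ := exists_homog_quasiInverse hS X.d_homog
  -- a projection to the cycles
  let q : SBimod.Hom X.V X.V := SBimod.Hom.id _ + -(h.comp X.d)
  have hq : ∀ x, q x = x - h (X.d x) := fun x => by simp [q, sub_eq_add_neg]
  have hqh : Grading.IsHomog X.g X.g 0 q :=
    Grading.id_homog.add (hh.comp X.d_homog (by norm_num)).neg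
  have hqd : ∀ x, X.d (q x) = 0 := fun x => by rw [hq, map_sub, hd, sub_self]
  let q' : SBimod.Hom X.V X.Z := q.toSub _ hqd
  have hq' : ∀ x, X.incZ (q' x) = q x := fun x => rfl
  have hqz : ∀ z, q' (X.incZ z) = z := fun z => X.incZ_injective (by
    rw [hq', hq, d_incZ, map_zero, sub_zero])
  have hqh' : Grading.IsHomog X.g X.Zg 0 q' := hqh
  obtain ⟨σ, hσ, hσ'⟩ := exists_section hS (X.cls_homog X.B_graded) (X.cls_surjective X.B)
  let p : SBimod.Hom X.V (X.quotZ X.B) := (X.cls X.B).comp q'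
  have hp : ∀ z, p (X.incZ z) = X.cls X.B z := fun z => by simp [p, hqz]
  have hpd : ∀ x, p (X.d x) = 0 := fun x => X.cls_eq_zero.2 ⟨x, by
    rw [hq', hq, X.d_d, map_zero, sub_zero]⟩
  let r : SBimod.Hom X.V X.V := X.incZ.comp (σ.comp p)
  have hr : Grading.IsHomog X.g X.g 0 r :=
    X.incZ_homog.comp (hσ.comp ((X.cls_homog X.B_graded).comp hqh' rfl) rfl) rfl
  have hb : ∀ x, X.d (h (q x - r x)) = q x - r x := fun x => by
    have : X.cls X.B (q' x - σ (p x)) = 0 := by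
      rw [map_sub, hσ']
      exact sub_self _
    obtain ⟨y, hy⟩ := X.cls_eq_zero.1 this
    have hy' : X.d y = q x - r x := hy
    rw [← hy', hd]
  refine ⟨⟨p, σ, h.comp (q + -r), (X.cls_homog X.B_graded).comp hqh' rfl,
    SBimod.Grading.IsHomog.comp hh (hqh.add hr.neg) (by norm_num), hp, hpd,
    fun y => by rw [hp, hσ'], hσ,
    fun x => ?_⟩⟩
  have h1 : q (X.d x) = X.d x := by rw [hq, X.d_d, map_zero, sub_zero]
  have h2 : r (X.d x) = 0 := by simp only [r, SBimod.Hom.comp_apply, hpd, map_zero]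
  change x = r x + (X.d (h (q x + -(r x))) + h (q (X.d x) + -(r (X.d x))))
  rw [← sub_eq_add_neg, hb, h1, h2, neg_zero, add_zero, hq]
  abel

variable {X Y}

theorem Splitting.π_π_tensorD (a : X.Splitting) (b : Y.Splitting) (x : X.V.tensor Y.V) :
    tmap a.π b.π (X.tensorD Y x) = 0 := by
  induction x using tensor_induction with
  | h0 => simp
  | ha x y hx hy => simp only [map_add, hx, hy, add_zero]
  | ht v w => simp [tensorD_tmul, a.π_d, b.π_d]

theorem Splitting.π_π_incZ (a : X.Splitting) (b : Y.Splitting) (u : X.Z.tensor Y.Z) :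
    tmap a.π b.π (tmap X.incZ Y.incZ u) = tmap (X.cls X.B) (Y.cls Y.B) u := by
  rw [tmap_tmap]
  exact tmap_congr a.π_incZ b.π_incZ u

theorem Splitting.homotopy_tensor (a : X.Splitting) (b : Y.Splitting) :
    ∃ S : SBimod.Hom (X.V.tensor Y.V) (X.V.tensor Y.V), ∀ x,
      x = tmap X.incZ Y.incZ (tmap a.σ b.σ (tmap a.π b.π x)) +
        (X.tensorD Y (S x) + S (X.tensorD Y x)) := by
  let r : SBimod.Hom X.V X.V := X.incZ.comp (a.σ.comp a.π)
  have hr : Grading.IsHomog X.g X.g 0 r := X.incZ_homog.comp (a.σ_homog.comp a.π_homog rfl) rfl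
  have hrd : ∀ x, r (X.d x) = 0 := fun x => by simp [r, a.π_d]
  have hdr : ∀ x, X.d (r x) = 0 := fun x => X.d_incZ _
  have hs : ∀ x, X.g.sgn 1 (a.s x) = -a.s (X.g.sgn 1 x) := fun x => by
    induction x using X.g.gr_induction with
    | h0 => simp
    | ha x y hx hy => simp only [map_add, hx, hy, neg_add]
    | hm n x hx =>
      rw [Grading.sgn_of_mem hx, Grading.sgn_of_mem (a.s_homog n x hx), map_smul, one_mul, one_mul,
        Int.negOnePow_succ]
      simp
  refine ⟨tmap a.s (SBimod.Hom.id _) + tmap (r.comp (X.g.sgn 1)) b.s, fun x => ?_⟩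
  induction x using tensor_induction with
  | h0 => simp
  | ha x y hx hy =>
    simp only [map_add] at hx hy ⊢
    nth_rw 1 [hx, hy]
    abel
  | ht v w =>
    have e1 : v = r v + (X.d (a.s v) + a.s (X.d v)) := a.homotopy v
    have e2 : w = Y.incZ (b.σ (b.π w)) + (Y.d (b.s w) + b.s (Y.d w)) := b.homotopy w
    simp only [tmap_tmul, SBimod.Hom.add_apply, SBimod.Hom.comp_apply, SBimod.Hom.id_apply,
      tensorD_tmul, map_add, Grading.sgn_comm hr, Grading.sgn_sgn, hs, hrd, hdr, map_neg,
      Grading.sgn_anticomm X.d_homog, map_zero, LinearMap.zero_apply, LinearMap.neg_apply]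
    have e3 : tmul _ _ v w = tmul _ _ (r v) w +
        (tmul _ _ (X.d (a.s v)) w + tmul _ _ (a.s (X.d v)) w) := by
      conv_lhs => rw [e1]
      simp only [map_add, LinearMap.add_apply]
    have e4 : tmul X.V Y.V (r v) w = tmul _ _ (r v) (Y.incZ (b.σ (b.π w))) +
        (tmul _ _ (r v) (Y.d (b.s w)) + tmul _ _ (r v) (b.s (Y.d w))) := by
      conv_lhs => rw [e2]
      simp only [map_add]
    rw [e3, e4]
    simp only [r, SBimod.Hom.comp_apply]
    abel

/-- Every cycle of `X ⊗ Y` is homologous to a sum of tensor products of cycles. -/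
theorem exists_kunneth (hS : IsSeparableAlg k S) {w : X.V.tensor Y.V}
    (hw : X.tensorD Y w = 0) : ∃ (u : X.Z.tensor Y.Z) (y : X.V.tensor Y.V),
      w = tmap X.incZ Y.incZ u + X.tensorD Y y := by
  obtain ⟨a⟩ := X.exists_splitting hS
  obtain ⟨b⟩ := Y.exists_splitting hS
  obtain ⟨s, hs⟩ := a.homotopy_tensor b
  exact ⟨_, _, by have := hs w; rwa [hw, map_zero, add_zero] at this⟩

/-- A sum of tensor products of cycles is a boundary in `X ⊗ Y` if and only if the corresponding
element of `H(X) ⊗ H(Y)` vanishes. -/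
theorem kunneth_iff (hS : IsSeparableAlg k S) {u : X.Z.tensor Y.Z} :
    (∃ y, X.tensorD Y y = tmap X.incZ Y.incZ u) ↔ tmap (X.cls X.B) (Y.cls Y.B) u = 0 := by
  obtain ⟨a⟩ := X.exists_splitting hS
  obtain ⟨b⟩ := Y.exists_splitting hS
  constructor
  · rintro ⟨y, hy⟩
    rw [← a.π_π_incZ b, ← hy, a.π_π_tensorD]
  · intro hu
    obtain ⟨s, hs⟩ := a.homotopy_tensor b
    have := hs (tmap X.incZ Y.incZ u)
    rw [a.π_π_incZ b, hu, tensorD_incZ, map_zero, map_zero, map_zero, add_zero, zero_add] at this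
    exact ⟨_, this.symm⟩

/-- The map on cycles induced by a morphism of complexes. -/
def mapZ (f : SBimod.Hom X.V Y.V) (hf : ∀ x, f (X.d x) = Y.d (f x)) : SBimod.Hom X.Z Y.Z :=
  (f.comp X.incZ).toSub _ (fun z => show Y.d (f (X.incZ z)) = 0 by rw [← hf, d_incZ, map_zero])

theorem incZ_mapZ (f : SBimod.Hom X.V Y.V) (hf : ∀ x, f (X.d x) = Y.d (f x)) (z : X.Z) :
    Y.incZ (mapZ f hf z) = f (X.incZ z) := rfl

theorem incZ_incZ_mapZ {X' Y' : Cplx k S} (f : SBimod.Hom X.V X'.V) (g : SBimod.Hom Y.V Y'.V)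
    (hf : ∀ x, f (X.d x) = X'.d (f x)) (hg : ∀ x, g (Y.d x) = Y'.d (g x)) (u : X.Z.tensor Y.Z) :
    tmap X'.incZ Y'.incZ (tmap (mapZ f hf) (mapZ g hg) u) =
      tmap f g (tmap X.incZ Y.incZ u) := by
  rw [tmap_tmap, tmap_tmap]
  exact tmap_congr (incZ_mapZ f hf) (incZ_mapZ g hg) u

/-- The map `[z] ↦ [f z]` induced by a morphism `f` of complexes on cycles modulo sub-bimodules. -/
def mapQuotZ (f : SBimod.Hom X.V Y.V) (hf : ∀ x, f (X.d x) = Y.d (f x)) (N : SubBimod X.V)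
    (M : SubBimod Y.V) (h : ∀ z, X.incZ z ∈ N → f (X.incZ z) ∈ M) :
    SBimod.Hom (X.quotZ N) (Y.quotZ M) :=
  (N.comap X.incZ).desc ((Y.cls M).comp (mapZ f hf)) (fun z hz => Y.cls_eq_zero.2 (h z hz))

theorem mapQuotZ_cls (f : SBimod.Hom X.V Y.V) (hf : ∀ x, f (X.d x) = Y.d (f x)) (N : SubBimod X.V)
    (M : SubBimod Y.V) (h : ∀ z, X.incZ z ∈ N → f (X.incZ z) ∈ M) (z : X.Z) :
    mapQuotZ f hf N M h (X.cls N z) = Y.cls M (mapZ f hf z) := rfl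

theorem mapQuotZ_homog {f : SBimod.Hom X.V Y.V} (hf : ∀ x, f (X.d x) = Y.d (f x))
    {N : SubBimod X.V} {M : SubBimod Y.V} (h : ∀ z, X.incZ z ∈ N → f (X.incZ z) ∈ M)
    (hfg : Grading.IsHomog X.g Y.g 0 f) (hN : X.g.IsGraded N) (hM : Y.g.IsGraded M) :
    Grading.IsHomog (X.quotZg N hN) (Y.quotZg M hM) 0 (mapQuotZ f hf N M h) := by
  rintro n _ ⟨z, hz, rfl⟩
  exact ⟨mapZ f hf z, hfg n _ hz, rfl⟩

/-- `[z] ↦ [f z]` is bijective if and only if `f` satisfies the condition for a quasi-isomorphism,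
with boundaries replaced by the given sub-bimodules. -/
theorem mapQuotZ_bijective {f : SBimod.Hom X.V Y.V} (hf : ∀ x, f (X.d x) = Y.d (f x))
    {N : SubBimod X.V} {M : SubBimod Y.V} (h : ∀ z, X.incZ z ∈ N → f (X.incZ z) ∈ M)
    (h1 : ∀ x, X.d x = 0 → f x ∈ M → x ∈ N)
    (h2 : ∀ y, Y.d y = 0 → ∃ x, X.d x = 0 ∧ y - f x ∈ M) :
    Function.Bijective (mapQuotZ f hf N M h) := by
  constructor
  · refine (injective_iff_map_eq_zero (mapQuotZ f hf N M h).lin).2 fun x hx => ?_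
    obtain ⟨z, rfl⟩ := X.cls_surjective N x
    exact X.cls_eq_zero.2 (h1 _ (X.d_incZ z) (Y.cls_eq_zero.1 hx))
  · intro y
    obtain ⟨z, rfl⟩ := Y.cls_surjective M y
    obtain ⟨x, hx, hxy⟩ := h2 _ (Y.d_incZ z)
    refine ⟨X.cls N (X.mkZ x hx), ?_⟩
    rw [mapQuotZ_cls, ← sub_eq_zero, ← map_sub, Y.cls_eq_zero, ← neg_sub, map_neg]
    exact neg_mem (S := Submodule k Y.V) hxy

theorem mapQuotZ_bijective_of_isQuasiIso {f : SBimod.Hom X.V Y.V}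
    (hf : ∀ x, f (X.d x) = Y.d (f x)) (hq : IsQuasiIso X.d Y.d f)
    (h : ∀ z, X.incZ z ∈ X.B → f (X.incZ z) ∈ Y.B) :
    Function.Bijective (mapQuotZ f hf X.B Y.B h) :=
  mapQuotZ_bijective hf h (fun x hx hy => hq.1 x hx hy) (fun y hy => by
    obtain ⟨x, y', hx, hxy⟩ := hq.2 y hy
    exact ⟨x, hx, y', by rw [← hxy, add_sub_cancel_left]⟩)

theorem map_mem_B {f : SBimod.Hom X.V Y.V} (hf : ∀ x, f (X.d x) = Y.d (f x)) (z : X.Z)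
    (hz : X.incZ z ∈ X.B) : f (X.incZ z) ∈ Y.B := by
  obtain ⟨x, hx⟩ := hz
  exact ⟨f x, by rw [← hx, ← hf]⟩

/-- Over a separable algebra, the tensor product of two quasi-isomorphisms is one. -/
theorem _root_.AInf.IsQuasiIso.tmap (hS : IsSeparableAlg k S) {X' Y' : Cplx k S}
    {f : SBimod.Hom X.V X'.V} {g : SBimod.Hom Y.V Y'.V} (hfg : Grading.IsHomog X.g X'.g 0 f)
    (hf : ∀ x, f (X.d x) = X'.d (f x)) (hg : ∀ x, g (Y.d x) = Y'.d (g x))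
    (hfq : IsQuasiIso X.d X'.d f) (hgq : IsQuasiIso Y.d Y'.d g) :
    IsQuasiIso (X.tensorD Y) (X'.tensorD Y') (SBimod.tmap f g) := by
  obtain ⟨f', hf'1, hf'2⟩ := Hom.exists_inverse
    (mapQuotZ_bijective_of_isQuasiIso hf hfq (map_mem_B hf))
  obtain ⟨g', hg'1, hg'2⟩ := Hom.exists_inverse
    (mapQuotZ_bijective_of_isQuasiIso hg hgq (map_mem_B hg))
  have key : ∀ u : X.Z.tensor Y.Z,
      SBimod.tmap (X'.cls X'.B) (Y'.cls Y'.B) (SBimod.tmap (mapZ f hf) (mapZ g hg) u) =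
      SBimod.tmap (mapQuotZ f hf _ _ (map_mem_B hf)) (mapQuotZ g hg _ _ (map_mem_B hg))
        (SBimod.tmap (X.cls X.B) (Y.cls Y.B) u) := fun u => by
    rw [tmap_tmap, tmap_tmap]
    exact tmap_congr (fun _ => rfl) (fun _ => rfl) u
  refine ⟨fun x hx ⟨y, hy⟩ => ?_, fun y hy => ?_⟩
  · obtain ⟨u, t, rfl⟩ := exists_kunneth hS hx
    have h1 : ∃ y, X'.tensorD Y' y =
        SBimod.tmap X'.incZ Y'.incZ (SBimod.tmap (mapZ f hf) (mapZ g hg) u) := by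
      refine ⟨y - SBimod.tmap f g t, ?_⟩
      rw [map_sub, hy, map_add, tmap_tensorD hfg hf hg, incZ_incZ_mapZ, add_sub_cancel_right]
    rw [kunneth_iff hS, key] at h1
    have h2 := congrArg (SBimod.tmap f' g') h1
    rw [tmap_tmap, map_zero, tmap_congr hf'1 hg'1 (f' := SBimod.Hom.id _) (g' := SBimod.Hom.id _),
      tmap_id_id] at h2
    obtain ⟨y', hy'⟩ := (kunneth_iff hS).2 h2
    exact ⟨y' + t, by rw [map_add, hy']⟩
  · obtain ⟨u, t, rfl⟩ := exists_kunneth hS hy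
    obtain ⟨a⟩ := X.exists_splitting hS
    obtain ⟨b⟩ := Y.exists_splitting hS
    let v : X.Z.tensor Y.Z := SBimod.tmap a.σ b.σ (SBimod.tmap f' g'
      (SBimod.tmap (X'.cls X'.B) (Y'.cls Y'.B) u))
    have hv : SBimod.tmap (X.cls X.B) (Y.cls Y.B) v = SBimod.tmap f' g'
      (SBimod.tmap (X'.cls X'.B) (Y'.cls Y'.B) u) := by
      rw [← a.π_π_incZ b, tmap_tmap, tmap_tmap]
      exact (tmap_congr a.π_σ b.π_σ _).trans (tmap_id_id _)
    have hc : SBimod.tmap (X'.cls X'.B) (Y'.cls Y'.B)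
        (u - SBimod.tmap (mapZ f hf) (mapZ g hg) v) = 0 := by
      rw [map_sub, key, hv, tmap_tmap, tmap_congr hf'2 hg'2 (f' := SBimod.Hom.id _)
        (g' := SBimod.Hom.id _), tmap_id_id, sub_self]
    obtain ⟨y', hy'⟩ := (kunneth_iff hS).2 hc
    refine ⟨SBimod.tmap X.incZ Y.incZ v, y' + t, tensorD_incZ v, ?_⟩
    rw [map_add, hy', map_sub, incZ_incZ_mapZ]
    abel

end Cplx

/-! ### Coproducts on homology -/

theorem CoalgStr.ext' {V : SBimod k S} {g : Grading V} {δ δ' : CoalgStr g}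
    (h : ∀ x, δ.comul x = δ'.comul x) : δ = δ' := by
  cases δ; cases δ'; congr; exact SBimod.Hom.ext' h

/-- Two coalgebras isomorphic to a third one are isomorphic. -/
theorem CoalgStr.Iso.of_common {V W X : SBimod k S} {g : Grading V} {h : Grading W} {l : Grading X}
    {δ : CoalgStr g} {δ' : CoalgStr h} {ε : CoalgStr l} (i : δ.Iso ε) (j : δ'.Iso ε) :
    Nonempty (δ.Iso δ') := by
  obtain ⟨j', h1, h2⟩ := Hom.exists_inverse j.bijective
  have hj' : Grading.IsHomog l h 0 j' := fun n x hx =>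
    Grading.mem_of_map_mem j.bijective.1 j.homog (by rw [h2, add_zero]; exact hx)
  refine ⟨⟨j'.comp i.f, ⟨?_, ?_⟩, hj'.comp i.homog rfl, fun x => ?_⟩⟩
  · exact (Function.LeftInverse.injective h2).comp i.bijective.1
  · exact (Function.LeftInverse.surjective h1).comp i.bijective.2
  · rw [← tmap_tmap, i.comul]
    have : tmap j' j' (tmap j.f j.f (δ'.comul (j' (i.f x)))) = δ'.comul (j' (i.f x)) := by
      rw [tmap_tmap]
      exact (tmap_congr h1 h1 _).trans (tmap_id_id _)
    rw [j.comul, h2] at this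
    exact this

namespace Cplx

/-- A strictly coassociative coproduct on a complex induces a coproduct on the homology. -/
theorem exists_isInduced (hS : IsSeparableAlg k S) (X : Cplx k S)
    (Δ : SBimod.Hom X.V (X.V.tensor X.V)) (hg : Grading.IsHomog X.g (X.g.tensor X.g) 0 Δ)
    (hd : ∀ x, Δ (X.d x) = X.tensorD X (Δ x))
    (hc : ∀ x, assoc _ _ _ (tmap Δ (SBimod.Hom.id _) (Δ x)) = tmap (SBimod.Hom.id _) Δ (Δ x)) :
    ∃ δ, X.IsInduced Δ X.B X.B_graded δ := by
  obtain ⟨a⟩ := X.exists_splitting hS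
  let p : SBimod.Hom X.V ((X.quotZ X.B).tensor (X.quotZ X.B)) := (tmap a.π a.π).comp Δ
  have hp : ∀ x, p (X.d x) = 0 := fun x => by
    simp only [p, SBimod.Hom.comp_apply, hd, a.π_π_tensorD]
  let δ : SBimod.Hom (X.quotZ X.B) ((X.quotZ X.B).tensor (X.quotZ X.B)) :=
    (X.B.comap X.incZ).desc (p.comp X.incZ) (by
    rintro z ⟨x, hx⟩
    rw [SBimod.Hom.comp_apply, ← hx]
    exact hp x)
  have hδ : ∀ z, δ (X.cls X.B z) = tmap a.π a.π (Δ (X.incZ z)) := fun z => rfl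
  have hδ' : ∀ z, ∃ (u : X.Z.tensor X.Z) (y : X.V.tensor X.V),
      Δ (X.incZ z) = tmap X.incZ X.incZ u + X.tensorD X y ∧
      δ (X.cls X.B z) = tmap (X.cls X.B) (X.cls X.B) u := fun z => by
    obtain ⟨u, y, huy⟩ := exists_kunneth (X := X) (Y := X) hS (w := Δ (X.incZ z))
      (by rw [← hd, d_incZ, map_zero])
    exact ⟨u, y, huy, by rw [hδ, huy, map_add, a.π_π_tensorD, add_zero, a.π_π_incZ]⟩
  refine ⟨⟨δ, ?_, fun x => ?_⟩, hδ'⟩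
  · rintro n _ ⟨z, hz, rfl⟩
    have := (a.π_homog.tmap a.π_homog rfl : Grading.IsHomog _ _ 0 _) _ _ (hg n _ hz)
    rwa [add_assoc, add_zero] at this
  · obtain ⟨z, rfl⟩ := X.cls_surjective X.B x
    obtain ⟨u, y, huy, hu⟩ := hδ' z
    -- both sides are computed by iterated coproducts on the complex
    have h1 : ∀ u : X.Z.tensor X.Z, tmap δ (SBimod.Hom.id _) (tmap (X.cls X.B) (X.cls X.B) u) =
        tmap (tmap a.π a.π) a.π (tmap Δ (SBimod.Hom.id _) (tmap X.incZ X.incZ u)) := fun u => by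
      rw [tmap_tmap, tmap_tmap, tmap_tmap]
      exact tmap_congr (fun z => rfl) (fun z => (a.π_incZ z).symm) u
    have h2 : ∀ u : X.Z.tensor X.Z, tmap (SBimod.Hom.id _) δ (tmap (X.cls X.B) (X.cls X.B) u) =
        tmap a.π (tmap a.π a.π) (tmap (SBimod.Hom.id _) Δ (tmap X.incZ X.incZ u)) := fun u => by
      rw [tmap_tmap, tmap_tmap, tmap_tmap]
      exact tmap_congr (fun z => (a.π_incZ z).symm) (fun z => rfl) u
    have h3 : ∀ y : X.V.tensor X.V,
        tmap (tmap a.π a.π) a.π (tmap Δ (SBimod.Hom.id _) (X.tensorD X y)) = 0 := fun y => by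
      induction y using tensor_induction with
      | h0 => simp
      | ha x y hx hy => simp only [map_add, hx, hy, add_zero]
      | ht v w => simp [tensorD_tmul, hd, a.π_π_tensorD, a.π_d]
    have h4 : ∀ y : X.V.tensor X.V,
        tmap a.π (tmap a.π a.π) (tmap (SBimod.Hom.id _) Δ (X.tensorD X y)) = 0 := fun y => by
      induction y using tensor_induction with
      | h0 => simp
      | ha x y hx hy => simp only [map_add, hx, hy, add_zero]
      | ht v w => simp [tensorD_tmul, hd, a.π_π_tensorD, a.π_d]
    rw [hu, h1, h2, ← sub_eq_iff_eq_add.2 huy]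
    simp only [map_sub, h3, h4, sub_zero]
    rw [assoc_tmap, hc]

variable {X Y : Cplx k S}

/-- Transfer of induced coproducts. Let `θ : X → Y` be a morphism of complexes which respects the
coproducts up to homology, and which induces a bijection from the cycles of `X` modulo `N` to the
homology of `Y`. Then an induced coproduct on `H(Y)` gives one on the cycles of `X` modulo `N`;
it is unique, and isomorphic to that of `H(Y)`. -/
theorem transfer (hS : IsSeparableAlg k S) {ΔX : SBimod.Hom X.V (X.V.tensor X.V)}
    {ΔY : SBimod.Hom Y.V (Y.V.tensor Y.V)} {N : SubBimod X.V} (hN : X.g.IsGraded N)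
    {δY : CoalgStr (Y.quotZg Y.B Y.B_graded)} (hδY : Y.IsInduced ΔY Y.B Y.B_graded δY)
    (θ : SBimod.Hom X.V Y.V) (hθg : Grading.IsHomog X.g Y.g 0 θ)
    (hθ : ∀ x, θ (X.d x) = Y.d (θ x))
    (hNB : ∀ x, X.d x = 0 → x ∈ N → θ x ∈ Y.B) (hi : ∀ x, X.d x = 0 → θ x ∈ Y.B → x ∈ N)
    (hs : ∀ y, Y.d y = 0 → ∃ x, X.d x = 0 ∧ y - θ x ∈ Y.B)
    (hΔ : ∀ x, X.d x = 0 → X.tensorD X (ΔX x) = 0)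
    (hc : ∀ x, X.d x = 0 → ∃ t, tmap θ θ (ΔX x) = ΔY (θ x) + Y.tensorD Y t) :
    (∃! δ, X.IsInduced ΔX N hN δ) ∧ ∀ δ, X.IsInduced ΔX N hN δ → Nonempty (δ.Iso δY) := by
  have hNB' : ∀ z, X.incZ z ∈ N → θ (X.incZ z) ∈ Y.B := fun z => hNB _ (X.d_incZ z)
  let Θ := mapQuotZ θ hθ N Y.B hNB'
  have hΘ : ∀ z, Θ (X.cls N z) = Y.cls Y.B (mapZ θ hθ z) := fun z => rfl
  have hb : Function.Bijective Θ := mapQuotZ_bijective hθ hNB' hi hs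
  have hΘg : Grading.IsHomog (X.quotZg N hN) (Y.quotZg Y.B Y.B_graded) 0 Θ :=
    mapQuotZ_homog hθ hNB' hθg hN Y.B_graded
  obtain ⟨Θ', h1, h2⟩ := Hom.exists_inverse hb
  have hΘ' : Grading.IsHomog (Y.quotZg Y.B Y.B_graded) (X.quotZg N hN) 0 Θ' := fun n x hx =>
    Grading.mem_of_map_mem hb.1 hΘg (by rw [h2, add_zero]; exact hx)
  have hΘΘ : ∀ u : X.Z.tensor X.Z, tmap Θ Θ (tmap (X.cls N) (X.cls N) u) =
      tmap (Y.cls Y.B) (Y.cls Y.B) (tmap (mapZ θ hθ) (mapZ θ hθ) u) := fun u => by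
    rw [tmap_tmap, tmap_tmap]
    exact tmap_congr (fun _ => rfl) (fun _ => rfl) u
  -- the coproduct of `H(Y)` computed from that of `X`
  have key : ∀ (z : X.Z) (u : X.Z.tensor X.Z) (y : X.V.tensor X.V),
      ΔX (X.incZ z) = tmap X.incZ X.incZ u + X.tensorD X y →
      tmap Θ Θ (tmap (X.cls N) (X.cls N) u) = δY.comul (Θ (X.cls N z)) := fun z u y huy => by
    obtain ⟨v, y', hv, hv'⟩ := hδY (mapZ θ hθ z)
    obtain ⟨t, ht⟩ := hc (X.incZ z) (X.d_incZ z)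
    rw [hΘΘ, hΘ, hv', ← sub_eq_zero, ← map_sub, ← kunneth_iff hS]
    refine ⟨y' + t - tmap θ θ y, ?_⟩
    rw [map_sub (tmap Y.incZ Y.incZ).lin, incZ_incZ_mapZ, ← sub_eq_iff_eq_add.2 huy,
      map_sub (tmap θ θ).lin, ht,
      tmap_tensorD hθg hθ hθ, ← sub_eq_iff_eq_add.2 hv, incZ_mapZ]
    simp only [map_add, map_sub]
    abel
  have hcomul : ∀ δ, X.IsInduced ΔX N hN δ → ∀ x, tmap Θ Θ (δ.comul x) = δY.comul (Θ x) := by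
    intro δ hδ x
    obtain ⟨z, rfl⟩ := X.cls_surjective N x
    obtain ⟨u, y, huy, hu⟩ := hδ z
    rw [hu, key z u y huy]
  have hinv : ∀ x, tmap Θ' Θ' (tmap Θ Θ x) = x := fun x => by
    rw [tmap_tmap]
    exact (tmap_congr h1 h1 x).trans (tmap_id_id x)
  let δ : SBimod.Hom (X.quotZ N) ((X.quotZ N).tensor (X.quotZ N)) :=
    (tmap Θ' Θ').comp (δY.comul.comp Θ)
  have hδ : ∀ x, δ (Θ' x) = tmap Θ' Θ' (δY.comul x) := fun x => by
    simp only [δ, SBimod.Hom.comp_apply, h2]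
  refine ⟨existsUnique_of_exists_of_unique ⟨⟨δ, ?_, fun x => ?_⟩, fun z => ?_⟩
    fun δ δ' hδ hδ' => ?_, fun δ hδ => ⟨⟨Θ, hb, hΘg, hcomul δ hδ⟩⟩⟩
  · exact (hΘ'.tmap hΘ' rfl : Grading.IsHomog _ _ 0 _).comp (δY.homog.comp hΘg rfl) rfl
  · have e1 : ∀ t, tmap δ (SBimod.Hom.id _) (tmap Θ' Θ' t) =
        tmap (tmap Θ' Θ') Θ' (tmap δY.comul (SBimod.Hom.id _) t) := fun t => by
      rw [tmap_tmap, tmap_tmap]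
      exact tmap_congr hδ (fun _ => rfl) t
    have e2 : ∀ t, tmap (SBimod.Hom.id _) δ (tmap Θ' Θ' t) =
        tmap Θ' (tmap Θ' Θ') (tmap (SBimod.Hom.id _) δY.comul t) := fun t => by
      rw [tmap_tmap, tmap_tmap]
      exact tmap_congr (fun _ => rfl) hδ t
    change assoc _ _ _ (tmap δ (SBimod.Hom.id _) (tmap Θ' Θ' (δY.comul (Θ x)))) =
      tmap (SBimod.Hom.id _) δ (tmap Θ' Θ' (δY.comul (Θ x)))
    rw [e1, e2, assoc_tmap, δY.coassoc]
  · obtain ⟨u, y, huy⟩ := exists_kunneth hS (hΔ _ (X.d_incZ z))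
    refine ⟨u, y, huy, ?_⟩
    change tmap Θ' Θ' (δY.comul (Θ (X.cls N z))) = _
    rw [← key z u y huy, hinv]
  · exact CoalgStr.ext' fun x => by rw [← hinv (δ.comul x), hcomul δ hδ, ← hcomul δ' hδ', hinv]

end Cplx

/-! ### Filtrations of tensor algebras -/

namespace SBimod

variable {V W X : SBimod k S}

theorem prj_inc_self (n : ℕ) (w : V.pow n) : V.prj n (V.inc n w) = w := π_ι_self (F := V.pow) w

theorem prj_inc_ne {m n : ℕ} (w : V.pow m) (h : m ≠ n) : V.prj n (V.inc m w) = 0 :=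
  π_ι_ne (F := V.pow) w h

theorem fst_letter' (v : V) : V.fst (V.letter v) = v := prj_inc_self 0 v

theorem snd_letter (v : V) : V.snd (V.letter v) = 0 :=
  prj_inc_ne (m := 0) (n := 1) v zero_ne_one

theorem fst_cons (v : V) (x : V.T) : V.fst (V.cons (tmul _ _ v x)) = 0 := by
  induction x using T_inc_induction with
  | h0 => simp
  | ha x y hx hy => simp only [map_add, hx, hy, add_zero]
  | hi n w =>
    rw [cons_inc]
    exact prj_inc_ne (n := 0) _ (Nat.succ_ne_zero n)

theorem snd_cons (v : V) (x : V.T) : V.snd (V.cons (tmul _ _ v x)) = tmul _ _ v (V.fst x) := by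
  induction x using T_inc_induction with
  | h0 => simp
  | ha x y hx hy => simp only [map_add, hx, hy]
  | hi n w =>
    rw [cons_inc]
    rcases n with _ | n
    · have h1 : V.fst (V.inc 0 w) = w := prj_inc_self 0 w
      rw [h1]
      exact prj_inc_self 1 (tmul V (V.pow 0) v w)
    · have h1 : V.fst (V.inc (n + 1) w) = 0 := prj_inc_ne (n := 0) _ (Nat.succ_ne_zero n)
      rw [h1, map_zero]
      exact prj_inc_ne (n := 1) _ (by omega)

theorem fst_mulT (x y : V.T) : V.fst (V.mulT (tmul _ _ x y)) = 0 := by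
  induction x using T_induction with
  | h0 => simp
  | ha x y hx hy => simp only [map_add, LinearMap.add_apply, hx, hy, add_zero]
  | h1 v => rw [mulT_letter, fst_cons]
  | hc v x hx => rw [mulT_cons, fst_cons]

theorem snd_mulT (x y : V.T) :
    V.snd (V.mulT (tmul _ _ x y)) = tmul _ _ (V.fst x) (V.fst y) := by
  induction x using T_induction with
  | h0 => simp
  | ha x y hx hy => simp only [map_add, LinearMap.add_apply, hx, hy]
  | h1 v => rw [mulT_letter, snd_cons, fst_letter']
  | hc v x hx => rw [mulT_cons, snd_cons, fst_cons, fst_mulT, map_zero, map_zero,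
      LinearMap.zero_apply]

theorem fst_pair (t : V.tensor V) : V.fst (pair V t) = 0 :=
  hom_tensor_ext (f := V.fst.comp (pair V)) (g := 0) (fun v w => by
    simp [pair, fst_cons]) t

theorem snd_pair (t : V.tensor V) : V.snd (pair V t) = t :=
  hom_tensor_ext (f := V.snd.comp (pair V)) (g := Hom.id _) (fun v w => by
    simp [pair, snd_cons, fst_letter']) t

open AInfCoalg (filtPow)

/-- The filtration of `T⁺ V` induced by a filtration `F` of `V`: words `v₁ ⋯ vₙ` with `vⱼ ∈ F iⱼ`
lie in the term of index `i₁ + ⋯ + iₙ`. -/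
def wordFilt (F : ℕ → Submodule k V) (i : ℕ) : Submodule k V.T :=
  ⨆ n, (filtPow F n i).map (V.inc n).lin

variable {F : ℕ → Submodule k V}

theorem inc_mem_wordFilt {n i : ℕ} {w : V.pow n} (hw : w ∈ filtPow F n i) :
    V.inc n w ∈ wordFilt F i := Submodule.mem_iSup_of_mem n ⟨w, hw, rfl⟩

theorem letter_mem_wordFilt {i : ℕ} {v : V} (hv : v ∈ F i) : V.letter v ∈ wordFilt F i :=
  inc_mem_wordFilt (n := 0) hv

theorem wordFilt_induction (Q : ℕ → Submodule k V.T) (h1 : ∀ i v, v ∈ F i → V.letter v ∈ Q i)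
    (hc : ∀ a b v x, v ∈ F a → x ∈ wordFilt F b → x ∈ Q b → V.cons (tmul _ _ v x) ∈ Q (a + b))
    {i : ℕ} {x : V.T} (hx : x ∈ wordFilt F i) : x ∈ Q i := by
  refine (iSup_le fun n => ?_ : wordFilt F i ≤ Q i) hx
  rw [Submodule.map_le_iff_le_comap]
  clear hx
  induction n generalizing i with
  | zero => exact h1 i
  | succ n ih =>
    refine Submodule.span_le.2 ?_
    rintro _ ⟨a, b, v, w, hv, hw, rfl, rfl⟩
    have := hc a b v (V.inc n w) hv (inc_mem_wordFilt hw) (ih hw)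
    rwa [cons_inc] at this

theorem cons_mem_wordFilt {a b : ℕ} {v : V} {x : V.T} (hv : v ∈ F a) (hx : x ∈ wordFilt F b) :
    V.cons (tmul _ _ v x) ∈ wordFilt F (a + b) := by
  refine (iSup_le fun n => ?_ :
    wordFilt F b ≤ (wordFilt F (a + b)).comap (V.cons.lin ∘ₗ tmul V V.T v)) hx
  rintro _ ⟨w, hw, rfl⟩
  rw [Submodule.mem_comap, LinearMap.comp_apply, cons_inc]
  exact inc_mem_wordFilt (n := n + 1) (Submodule.subset_span ⟨a, b, v, w, hv, hw, rfl, rfl⟩)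

theorem wordFilt_mono (hF : Monotone F) : Monotone (wordFilt F) := by
  intro i j hij x hx
  obtain ⟨l, rfl⟩ := Nat.exists_eq_add_of_le hij
  refine wordFilt_induction (fun i => wordFilt F (i + l)) (fun i v hv => ?_)
    (fun a b v x hv _ ih => ?_) hx
  · exact letter_mem_wordFilt (hF (Nat.le_add_right i l) hv)
  · rw [add_assoc]
    exact cons_mem_wordFilt hv ih

theorem wordFilt_zero (h0 : F 0 = ⊥) : wordFilt F 0 = ⊥ := by
  refine (Submodule.eq_bot_iff _).2 fun x hx => ?_
  have := wordFilt_induction (F := F) (fun i => if i = 0 then ⊥ else ⊤) (fun i v hv => ?_)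
    (fun a b v x hv _ ih => ?_) hx
  · simpa using this
  · split_ifs with h
    · subst h
      rw [h0, Submodule.mem_bot] at hv
      rw [hv, map_zero]
      exact zero_mem _
    · trivial
  · split_ifs with h
    · obtain ⟨rfl, rfl⟩ := Nat.add_eq_zero_iff.1 h
      rw [h0, Submodule.mem_bot] at hv
      rw [hv, map_zero, LinearMap.zero_apply, map_zero]
      exact zero_mem _
    · trivial

theorem wordFilt_exhaust (hF : Monotone F) (h : ∀ v, ∃ i, v ∈ F i) (x : V.T) :
    ∃ i, x ∈ wordFilt F i := by
  induction x using T_induction with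
  | h0 => exact ⟨0, zero_mem _⟩
  | ha x y hx hy =>
    obtain ⟨i, hi⟩ := hx
    obtain ⟨j, hj⟩ := hy
    exact ⟨max i j, add_mem (wordFilt_mono hF (le_max_left _ _) hi)
      (wordFilt_mono hF (le_max_right _ _) hj)⟩
  | h1 v =>
    obtain ⟨i, hi⟩ := h v
    exact ⟨i, letter_mem_wordFilt hi⟩
  | hc v x hx =>
    obtain ⟨i, hi⟩ := h v
    obtain ⟨j, hj⟩ := hx
    exact ⟨i + j, cons_mem_wordFilt hi hj⟩

/-- If `F 0 = 0`, both factors of a decomposable word in the term of index `i + 1` of the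
filtration lie in the term of index `i`. -/
theorem wordFilt_succ_induction (hF : Monotone F) (h0 : F 0 = ⊥) {i : ℕ} (Q : Submodule k V.T)
    (h1 : ∀ v ∈ F (i + 1), V.letter v ∈ Q)
    (hc : ∀ v ∈ F i, ∀ x ∈ wordFilt F i, V.cons (tmul _ _ v x) ∈ Q)
    {x : V.T} (hx : x ∈ wordFilt F (i + 1)) : x ∈ Q := by
  have := wordFilt_induction (F := F) (fun j => if j = i + 1 then Q else ⊤) (fun j v hv => ?_)
    (fun a b v x hv hx _ => ?_) hx
  · simpa using this
  · split_ifs with h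
    · exact h1 v (h ▸ hv)
    · trivial
  · split_ifs with h
    · rcases Nat.eq_zero_or_pos a with rfl | ha
      · rw [h0, Submodule.mem_bot] at hv
        rw [hv, map_zero, LinearMap.zero_apply, map_zero]
        exact zero_mem _
      rcases Nat.eq_zero_or_pos b with rfl | hb
      · rw [wordFilt_zero h0, Submodule.mem_bot] at hx
        rw [hx, map_zero, map_zero]
        exact zero_mem _
      exact hc v (hF (by omega) hv) x (wordFilt_mono hF (by omega) hx)
    · trivial

theorem prj_mem_filtPow {i : ℕ} {x : V.T} (hx : x ∈ wordFilt F i) (n : ℕ) :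
    V.prj n x ∈ filtPow F n i := by
  refine (iSup_le fun m => ?_ : wordFilt F i ≤ (filtPow F n i).comap (V.prj n).lin) hx
  rintro _ ⟨w, hw, rfl⟩
  rw [Submodule.mem_comap]
  by_cases h : m = n
  · subst h
    rw [prj_inc_self]
    exact hw
  · rw [prj_inc_ne w h]
    exact zero_mem _

theorem mem_wordFilt_of_prj {i : ℕ} {x : V.T} (hx : ∀ n, V.prj n x ∈ filtPow F n i) :
    x ∈ wordFilt F i := by
  obtain ⟨s, hs⟩ := Grading.eq_sum_inc x
  rw [hs]
  exact sum_mem fun n _ => inc_mem_wordFilt (hx n)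

/-- The filtration of `T⁺ V` induced by a filtration by sub-bimodules consists of
sub-bimodules. -/
def wordFiltSub (F : ℕ → SubBimod V) (i : ℕ) : SubBimod V.T where
  carrier := wordFilt (fun j => (F j).carrier) i
  l_mem := fun s x hx => by
    refine wordFilt_induction
      (fun i => (wordFilt (fun j => (F j).carrier) i).comap (V.T.l s)) (fun i v hv => ?_)
      (fun a b v x hv hx _ => ?_) hx
    · rw [Submodule.mem_comap, ← Hom.map_l]
      exact letter_mem_wordFilt ((F i).l_mem s v hv)
    · rw [Submodule.mem_comap, ← Hom.map_l, l_tmul]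
      exact cons_mem_wordFilt ((F a).l_mem s v hv) hx
  r_mem := fun s x hx => by
    refine wordFilt_induction
      (fun i => (wordFilt (fun j => (F j).carrier) i).comap (V.T.r s)) (fun i v hv => ?_)
      (fun a b v x hv hx ih => ?_) hx
    · rw [Submodule.mem_comap, ← Hom.map_r]
      exact letter_mem_wordFilt ((F i).r_mem s v hv)
    · rw [Submodule.mem_comap, ← Hom.map_r, r_tmul]
      exact cons_mem_wordFilt hv ih

theorem comps_mem_of_gr_le {g : Grading V} {N : Submodule k V} {n m : ℤ} {x : V}
    (hx : x ∈ g.gr n) (hN : x ∈ N) : g.comps x m ∈ N := by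
  rw [Grading.comps_of_mem hx, Finsupp.single_apply]
  split_ifs
  · exact hN
  · exact zero_mem _

theorem wordFiltSub_graded {g : Grading V} {F : ℕ → SubBimod V} (hF : ∀ i, g.IsGraded (F i))
    (i : ℕ) : g.T.IsGraded (wordFiltSub F i) := by
  intro x hx
  let G := wordFilt fun j => (F j).carrier
  suffices x ∈ ⨅ n, (G i).comap (Finsupp.lapply n ∘ₗ g.T.comps) from
    fun n => (Submodule.mem_iInf _).1 this n
  refine wordFilt_induction (F := fun j => (F j).carrier)
    (fun i => ⨅ n, (G i).comap (Finsupp.lapply n ∘ₗ g.T.comps)) (fun i v hv => ?_)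
    (fun a b v x hv _ ih => ?_) hx
  · refine (Submodule.mem_iInf _).2 fun n => ?_
    rw [Submodule.mem_comap, LinearMap.comp_apply, Finsupp.lapply_apply]
    have := Grading.comps_homog (Grading.letter_homog (g := g)) v n
    rw [add_zero] at this
    rw [this]
    exact letter_mem_wordFilt (hF i v hv n)
  · have ih' : ∀ n, g.T.comps x n ∈ G b := fun n => (Submodule.mem_iInf _).1 ih n
    refine (Submodule.mem_iInf _).2 fun n => ?_
    rw [Submodule.mem_comap, LinearMap.comp_apply, Finsupp.lapply_apply]
    have e : V.cons (tmul _ _ v x) = ∑ p ∈ (g.comps v).support, ∑ q ∈ (g.T.comps x).support,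
        V.cons (tmul _ _ (g.comps v p) (g.T.comps x q)) := by
      conv_lhs => rw [← g.comps_sum v, ← g.T.comps_sum x]
      simp only [Finsupp.sum, map_sum, LinearMap.sum_apply]
      rw [Finset.sum_comm]
    rw [e, map_sum, Finsupp.finsetSum_apply]
    refine sum_mem fun p _ => ?_
    rw [map_sum, Finsupp.finsetSum_apply]
    refine sum_mem fun q _ => comps_mem_of_gr_le
      (Grading.cons_homog _ _ (Grading.tmul_mem (g.comps_mem v p) (g.T.comps_mem x q))) ?_
    exact cons_mem_wordFilt (F := fun j => (F j).carrier) (hF a v hv p) (ih' q)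

theorem Grading.sgn_mem {g : Grading V} {N : SubBimod V} (hN : g.IsGraded N) (m : ℤ) {x : V}
    (hx : x ∈ N) : g.sgn m x ∈ N.carrier := by
  change (Finsupp.lsum k (fun n : ℤ => ((((m * n).negOnePow : ℤ) : k) • LinearMap.id :
    V →ₗ[k] V))) (g.comps x) ∈ N.carrier
  rw [Finsupp.lsum_apply]
  exact sum_mem fun n _ => Submodule.smul_mem _ _ (hN x hx n)

theorem twistPow_mem_filtPow {g : Grading V} {F : ℕ → SubBimod V} (hF : ∀ i, g.IsGraded (F i))
    (n : ℕ) {i : ℕ} {w : V.pow n} (hw : w ∈ filtPow (fun j => (F j).carrier) n i) :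
    twistPow g n w ∈ filtPow (fun j => (F j).carrier) n i := by
  induction n generalizing i with
  | zero => exact hw
  | succ n ih =>
    refine (Submodule.span_le.2 ?_ : _ ≤ (filtPow (fun j => (F j).carrier) (n + 1) i).comap
      (twistPow g (n + 1)).lin) hw
    rintro _ ⟨a, b, v, w, hv, hwb, rfl, rfl⟩
    have hw' : twistPow g n w ∈ filtPow (fun j => (F j).carrier) n b := ih hwb
    exact Submodule.subset_span ⟨a, b, _, _, Grading.sgn_mem (hF a) _ hv, hw', rfl, rfl⟩

/-- The filtration which is everything from index `1` on. It induces the filtration of the tensor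
algebra by the length of words. -/
def topFilt (V : SBimod k S) (i : ℕ) : SubBimod V where
  carrier := if i = 0 then ⊥ else ⊤
  l_mem := fun s x hx => by
    split_ifs at hx ⊢
    · rw [Submodule.mem_bot] at hx ⊢
      rw [hx, map_zero]
    · trivial
  r_mem := fun s x hx => by
    split_ifs at hx ⊢
    · rw [Submodule.mem_bot] at hx ⊢
      rw [hx, map_zero]
    · trivial

theorem topFilt_zero : (topFilt V 0).carrier = ⊥ := rfl

theorem mem_topFilt {i : ℕ} (hi : i ≠ 0) (v : V) : v ∈ (topFilt V i).carrier := by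
  change v ∈ (if i = 0 then ⊥ else ⊤ : Submodule k V)
  rw [if_neg hi]
  trivial

theorem map_mem_topFilt {i : ℕ} {v : V} (hv : v ∈ (topFilt V i).carrier) (f : V →ₗ[k] W) :
    f v ∈ (topFilt W i).carrier := by
  rcases Nat.eq_zero_or_pos i with rfl | h
  · rw [topFilt_zero, Submodule.mem_bot] at hv ⊢
    rw [hv, map_zero]
  · exact mem_topFilt h.ne' _

theorem topFilt_mono : Monotone fun i => (topFilt V i).carrier := by
  intro i j hij v hv
  rcases Nat.eq_zero_or_pos i with rfl | h
  · change v ∈ (⊥ : Submodule k V) at hv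
    rw [(Submodule.mem_bot k).1 hv]
    exact zero_mem _
  · exact mem_topFilt (by omega) v

theorem topFilt_graded (g : Grading V) (i : ℕ) : g.IsGraded (topFilt V i) := by
  intro v hv n
  exact map_mem_topFilt hv (Finsupp.lapply n ∘ₗ g.comps)

/-- The filtration of the tensor algebra by the length of words. -/
def lenFilt (V : SBimod k S) (i : ℕ) : SubBimod V.T := wordFiltSub (topFilt V) i

theorem lenFilt_zero : (lenFilt V 0).carrier = ⊥ := wordFilt_zero topFilt_zero

theorem lenFilt_mono : Monotone fun i => (lenFilt V i).carrier := wordFilt_mono topFilt_mono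

theorem lenFilt_exhaust (x : V.T) : ∃ i, x ∈ (lenFilt V i).carrier :=
  wordFilt_exhaust topFilt_mono (fun v => ⟨1, mem_topFilt one_ne_zero v⟩) x

theorem lenFilt_induction (Q : ℕ → Submodule k V.T)
    (h1 : ∀ i v, v ∈ (topFilt V i).carrier → V.letter v ∈ Q i)
    (hc : ∀ a b v x, v ∈ (topFilt V a).carrier → x ∈ (lenFilt V b).carrier → x ∈ Q b →
      V.cons (tmul _ _ v x) ∈ Q (a + b))
    {i : ℕ} {x : V.T} (hx : x ∈ (lenFilt V i).carrier) : x ∈ Q i :=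
  wordFilt_induction Q h1 hc hx

theorem cons_mem_lenFilt {a b : ℕ} {v : V} {x : V.T} (hv : v ∈ (topFilt V a).carrier)
    (hx : x ∈ (lenFilt V b).carrier) : V.cons (tmul _ _ v x) ∈ (lenFilt V (a + b)).carrier :=
  cons_mem_wordFilt (F := fun j => (topFilt V j).carrier) hv hx

theorem letter_mem_lenFilt {i : ℕ} {v : V} (hv : v ∈ (topFilt V i).carrier) :
    V.letter v ∈ (lenFilt V i).carrier :=
  letter_mem_wordFilt (F := fun j => (topFilt V j).carrier) hv

end SBimod

/-! ### The bar construction is cocomplete, and its homology is a coalgebra -/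

section Bar

variable (A : DGAlg k S)

theorem first_mem_lenFilt {i : ℕ} (a : A.V) {x : A.V.T} (hx : x ∈ (lenFilt A.V i).carrier) :
    first A.mul (tmul _ _ a x) ∈ (lenFilt A.V i).carrier := by
  refine lenFilt_induction
    (fun i => (lenFilt A.V i).carrier.comap ((first A.mul).lin ∘ₗ tmul A.V A.V.T a))
    (fun i v hv => ?_) (fun i j v x hv hx _ => ?_) hx
  · rw [Submodule.mem_comap, LinearMap.comp_apply, first_letter]
    exact letter_mem_lenFilt (map_mem_topFilt hv (A.mul.lin ∘ₗ tmul A.V A.V a))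
  · rw [Submodule.mem_comap, LinearMap.comp_apply, first_cons]
    exact cons_mem_lenFilt (map_mem_topFilt hv (A.mul.lin ∘ₗ tmul A.V A.V a)) hx

theorem barD_mem_lenFilt {i : ℕ} {x : A.V.T} (hx : x ∈ (lenFilt A.V i).carrier) :
    barD A x ∈ (lenFilt A.V i).carrier := by
  refine lenFilt_induction
    (fun i => (lenFilt A.V i).carrier.comap (barD A).lin)
    (fun i v hv => ?_) (fun i j v x hv hx ih => ?_) hx
  · rw [Submodule.mem_comap, barD_letter]
    exact neg_mem (letter_mem_lenFilt (map_mem_topFilt hv A.d.lin))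
  · rw [Submodule.mem_comap, barD_cons]
    refine add_mem (sub_mem (neg_mem (cons_mem_lenFilt (map_mem_topFilt hv A.d.lin) hx)) ?_)
      (cons_mem_lenFilt (map_mem_topFilt hv (barSgn A).lin) ih)
    exact lenFilt_mono (Nat.le_add_left _ _) (first_mem_lenFilt A _ hx)

theorem pair_deconc_mem {V : SBimod k S} {i : ℕ} {x : V.T} (hx : x ∈ (lenFilt V i).carrier) :
    pair V.T (deconc V x) ∈ wordFilt (fun j => (lenFilt V j).carrier) i := by
  let D : ℕ → Submodule k (V.T.tensor V.T) := fun i => Submodule.span k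
    {z | ∃ a b y w, y ∈ (lenFilt V a).carrier ∧ w ∈ (lenFilt V b).carrier ∧ a + b = i ∧
      z = tmul _ _ y w}
  have hD : ∀ i, D i ≤ (wordFilt (fun j => (lenFilt V j).carrier) i).comap (pair V.T).lin := by
    intro i
    refine Submodule.span_le.2 ?_
    rintro _ ⟨a, b, y, w, hy, hw, rfl, rfl⟩
    exact cons_mem_wordFilt (F := fun j => (lenFilt V j).carrier) hy
      (letter_mem_wordFilt (F := fun j => (lenFilt V j).carrier) hw)
  refine hD i (lenFilt_induction (fun i => (D i).comap (deconc V).lin)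
    (fun i v hv => ?_) (fun i j v x hv hx ih => ?_) hx)
  · rw [Submodule.mem_comap, deconc_letter]
    exact zero_mem _
  · rw [Submodule.mem_comap, deconc_cons]
    refine add_mem (Submodule.subset_span
      ⟨i, j, _, _, letter_mem_lenFilt hv, hx, rfl, rfl⟩) ?_
    rw [Submodule.mem_comap] at ih
    refine (Submodule.span_le.2 ?_ : D j ≤ (D (i + j)).comap ((tmap V.cons (Hom.id _)).lin ∘ₗ
      (assocInv _ _ _).lin ∘ₗ tmul V (V.T.tensor V.T) v)) ih
    rintro _ ⟨a, b, y, z, hy, hz, rfl, rfl⟩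
    refine Submodule.subset_span ⟨i + a, b, _, z, cons_mem_lenFilt hv hy, hz, add_assoc _ _ _, ?_⟩
    simp only [LinearMap.comp_apply]
    exact congrArg _ (assocInv_tmul v y z)

theorem bar_cocomplete : (bar A).Cocomplete := by
  refine ⟨lenFilt A.V, ⟨fun i => wordFiltSub_graded (topFilt_graded (A.g.shift (-1))) i,
    fun i => lenFilt_mono (Nat.le_succ i), lenFilt_zero, lenFilt_exhaust, fun n i x hx => ?_⟩⟩
  refine prj_mem_filtPow (F := fun j => (lenFilt A.V j).carrier) (x := barΔ A x) ?_ n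
  exact add_mem (letter_mem_wordFilt (F := fun j => (lenFilt A.V j).carrier)
    (barD_mem_lenFilt A hx)) (pair_deconc_mem hx)

theorem barΔ_apply (x : A.V.T) :
    barΔ A x = A.V.T.letter (barD A x) + pair A.V.T (deconc A.V x) := rfl

theorem bar_Δ₁ (x : A.V.T) : (bar A).Δ₁ x = barD A x := by
  change A.V.T.fst (barΔ A x) = _
  rw [barΔ_apply, map_add, fst_letter', fst_pair, add_zero]

theorem bar_Δ₂ (x : A.V.T) : (bar A).Δ₂ x = deconc A.V x := by
  change A.V.T.snd (barΔ A x) = _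
  rw [barΔ_apply, map_add, snd_letter, snd_pair, zero_add]

/-- The complex underlying the bar construction. -/
def barCplx : Cplx k S := ⟨A.V.T, barG A, barD A, barD_homog A, barD_barD A⟩

/-- The deconcatenation coproduct induces a coalgebra structure on the homology of the bar
construction. -/
theorem exists_isInduced_bar (hS : IsSeparableAlg k S) :
    ∃ δ, (barCplx A).IsInduced (deconc A.V) (barCplx A).B (barCplx A).B_graded δ :=
  (barCplx A).exists_isInduced hS (deconc A.V) deconc_homog
    (fun x => by
      refine (deconc_barD A x).trans ?_
      rfl)
    deconc_coassoc

end Bar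

/-! ### The first two components of a morphism of A∞-coalgebras -/

theorem SBimod.Grading.tmap_sgn_sgn {V W : SBimod k S} {g : Grading V} (t : V.tensor W) :
    tmap (g.sgn 1) (Hom.id W) (tmap (g.sgn 1) (Hom.id W) t) = t := by
  induction t using tensor_induction with
  | h0 => simp
  | ha x y hx hy => simp only [map_add, hx, hy]
  | ht v w => simp [Grading.sgn_sgn]

theorem SBimod.Grading.IsHomog.of_shift {V W : SBimod k S} {g : Grading V} {h : Grading W}
    {f : SBimod.Hom V W} {m e : ℤ} (hf : Grading.IsHomog (g.shift m) (h.shift m) e f) :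
    Grading.IsHomog g h e f := fun n x hx => by
  have := hf (n - m) x (show x ∈ g.gr (n - m + m) by rwa [sub_add_cancel])
  change f x ∈ h.gr (n - m + e + m) at this
  rwa [show n - m + e + m = n + e by ring] at this

theorem SBimod.Grading.fst_homog {V : SBimod k S} {g : Grading V} :
    Grading.IsHomog g.T g 0 V.fst := fun n x hx => by
  rw [add_zero]
  exact Grading.mem_T.1 hx 0

namespace AInfCoalg

variable (C : AInfCoalg k S)

theorem fst_cobarGen (v : C.V) : C.V.fst (cobarGen C.g C.Δ v) = -C.Δ₁ v := by
  rw [← cobarD_letter, fst_cobarD, fst_letter]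

theorem snd_cobarGen (v : C.V) :
    C.V.snd (cobarGen C.g C.Δ v) = -tmap (C.g.sgn 1) (SBimod.Hom.id _) (C.Δ₂ v) := by
  rw [cobarGen, Hom.neg_apply, map_neg, Hom.comp_apply]
  refine congrArg _ ((prj_twist C.g 1 (C.Δ v)).trans ?_)
  change tmap (C.g.sgn (((0 : ℕ) : ℤ) + 1)) (SBimod.Hom.id C.V) _ = _
  rw [Nat.cast_zero, zero_add]
  rfl

/-- The differential of the complex `C ⊗ C`. -/
def tensorSqD : SBimod.Hom (C.V.tensor C.V) (C.V.tensor C.V) :=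
  tmap C.Δ₁ (SBimod.Hom.id _) + tmap (C.g.sgn 1) C.Δ₁

theorem tensorSqD_tmul (v w : C.V) : C.tensorSqD (tmul _ _ v w) =
    tmul _ _ (C.Δ₁ v) w + tmul _ _ (C.g.sgn 1 v) (C.Δ₁ w) := rfl

/-- The component of the differential of the cobar construction on words with two letters. -/
theorem snd_cobarD (y : C.V.T) :
    C.V.snd (cobarD C.g C.Δ y) = tmap (C.g.sgn 1) (SBimod.Hom.id _)
      (C.tensorSqD (tmap (C.g.sgn 1) (SBimod.Hom.id _) (C.V.snd y)) - C.Δ₂ (C.V.fst y)) := by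
  induction y using T_induction with
  | h0 => simp
  | ha x y hx hy =>
    simp only [map_add, hx, hy, map_sub]
    abel
  | h1 v =>
    rw [cobarD_letter, snd_cobarGen, snd_letter, fst_letter]
    simp
  | hc v x _ =>
    have h : ∀ v, C.g.sgn 1 (C.Δ₁ v) = -C.Δ₁ (C.g.sgn 1 v) :=
      Grading.sgn_anticomm C.cplx.d_homog
    rw [cobarD_cons, map_add, snd_mulT, snd_cons, snd_cons, fst_cobarGen, fst_cobarD, fst_cons,
      Grading.sgn_shift_odd odd_one, map_zero, sub_zero, tmap_tmul, tensorSqD_tmul]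
    simp [h, Grading.sgn_sgn]

theorem tmap_sgn_injective {x y : C.V.tensor C.V}
    (h : tmap (C.g.sgn 1) (SBimod.Hom.id _) x = tmap (C.g.sgn 1) (SBimod.Hom.id _) y) : x = y := by
  rw [← Grading.tmap_sgn_sgn (g := C.g) x, h, Grading.tmap_sgn_sgn]

theorem Δ₂_Δ₁ (v : C.V) : C.Δ₂ (C.Δ₁ v) = C.tensorSqD (C.Δ₂ v) := by
  have h := congrArg C.V.snd (C.rel (C.V.letter v))
  rw [map_zero, snd_cobarD, cobarD_letter, fst_cobarGen, snd_cobarGen, map_neg,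
    Grading.tmap_sgn_sgn] at h
  have h' := C.tmap_sgn_injective (h.trans (map_zero (tmap (C.g.sgn 1) (SBimod.Hom.id _)).lin).symm)
  rw [map_neg, map_neg, sub_neg_eq_add, neg_add_eq_zero] at h'
  exact h'.symm

variable {C} {C' : AInfCoalg k S} (f : Hom C C')

/-- The map `T⁺ C → T⁺ C'` underlying a morphism of A∞-coalgebras. -/
def Hom.mapT : SBimod.Hom C.V.T C'.V.T := f.Ωmap.f

theorem Hom.mapT_mulT (x y : C.V.T) : f.mapT (C.V.mulT (tmul _ _ x y)) =
    C'.V.mulT (tmul _ _ (f.mapT x) (f.mapT y)) := f.Ωmap.map_mul x y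

theorem Hom.mapT_cobarD (y : C.V.T) :
    f.mapT (cobarD C.g C.Δ y) = cobarD C'.g C'.Δ (f.mapT y) := f.Ωmap.map_d y

theorem Hom.lin_apply (v : C.V) : f.lin v = C'.V.fst (f.mapT (C.V.letter v)) := rfl

theorem Hom.fst_mapT (y : C.V.T) : C'.V.fst (f.mapT y) = f.lin (C.V.fst y) := by
  induction y using T_induction with
  | h0 => simp
  | ha x y hx hy => simp only [map_add, hx, hy]
  | h1 v => rw [fst_letter, Hom.lin_apply]
  | hc v x _ => rw [← mulT_letter, Hom.mapT_mulT, fst_mulT, fst_mulT, map_zero]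

theorem Hom.snd_mapT (y : C.V.T) : C'.V.snd (f.mapT y) =
    C'.V.snd (f.mapT (C.V.letter (C.V.fst y))) + tmap f.lin f.lin (C.V.snd y) := by
  induction y using T_induction with
  | h0 => simp
  | ha x y hx hy =>
    simp only [map_add, hx, hy]
    abel
  | h1 v => rw [fst_letter, snd_letter, map_zero, add_zero]
  | hc v x _ =>
    rw [← mulT_letter, Hom.mapT_mulT, snd_mulT, fst_mulT, snd_mulT, Hom.fst_mapT, Hom.fst_mapT,
      tmap_tmul]
    simp

theorem Hom.lin_Δ₁ (v : C.V) : f.lin (C.Δ₁ v) = C'.Δ₁ (f.lin v) := by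
  have h := congrArg C'.V.fst (f.mapT_cobarD (C.V.letter v))
  rw [Hom.fst_mapT, fst_cobarD, fst_cobarD, Hom.fst_mapT, fst_letter, map_neg, neg_inj] at h
  exact h

theorem Hom.lin_homog : Grading.IsHomog C.g C'.g 0 f.lin :=
  Grading.IsHomog.of_shift (m := 1) ((Grading.fst_homog.comp (f.Ωmap.homog.comp
    Grading.letter_homog (e'' := 0) rfl) rfl))

/-- The linear part of a morphism respects `Δ₂` on cycles, up to a boundary given by the quadratic
part. -/
theorem Hom.lin_Δ₂ (v : C.V) (hv : C.Δ₁ v = 0) : ∃ t,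
    tmap f.lin f.lin (C.Δ₂ v) = C'.Δ₂ (f.lin v) + C'.tensorSqD t := by
  have h := congrArg C'.V.snd (f.mapT_cobarD (C.V.letter v))
  have e : ∀ t, tmap f.lin f.lin (tmap (C.g.sgn 1) (SBimod.Hom.id _) t) =
      tmap (C'.g.sgn 1) (SBimod.Hom.id _) (tmap f.lin f.lin t) := by
    intro t
    induction t using tensor_induction with
    | h0 => simp
    | ha x y hx hy => simp only [map_add, hx, hy]
    | ht v w => simp [Grading.sgn_comm f.lin_homog v]
  rw [Hom.snd_mapT, fst_cobarD, fst_letter, hv, neg_zero, map_zero, map_zero, map_zero,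
    zero_add, snd_cobarD, e, fst_letter, snd_letter, map_zero, map_zero, zero_sub, map_neg,
    snd_cobarD, Hom.fst_mapT, fst_letter] at h
  have h2 := C'.tmap_sgn_injective h
  refine ⟨-tmap (C'.g.sgn 1) (SBimod.Hom.id _) (C'.V.snd (f.mapT (C.V.letter v))), ?_⟩
  rw [map_neg, ← sub_eq_add_neg, ← neg_sub, ← h2, neg_neg]

end AInfCoalg

/-- A quasi-isomorphism from an A∞-coalgebra to the bar construction identifies the induced
coproducts on homology. -/
theorem homologyCoalg_of_quasiIso (hS : IsSeparableAlg k S) {C : AInfCoalg k S} {A : DGAlg k S}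
    (f : AInfCoalg.Hom C (bar A)) (hf : f.QuasiIso)
    {δ₀ : CoalgStr ((barCplx A).quotZg (barCplx A).B (barCplx A).B_graded)}
    (hδ₀ : (barCplx A).IsInduced (deconc A.V) (barCplx A).B (barCplx A).B_graded δ₀) :
    (∃! δ, C.IsHomologyCoalg δ) ∧ ∀ δ : CoalgStr C.cplx.Hg, C.IsHomologyCoalg δ →
      Nonempty (δ.Iso δ₀) := by
  have hd : ∀ x, f.lin (C.Δ₁ x) = barD A (f.lin x) := fun x =>
    (f.lin_Δ₁ x).trans (bar_Δ₁ A _)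
  have hd1 : (bar A).Δ₁ = barD A := SBimod.Hom.ext' (bar_Δ₁ A)
  rw [AInfCoalg.Hom.QuasiIso, hd1] at hf
  have ht : (bar A).tensorSqD = (barCplx A).tensorD (barCplx A) := by
    rw [AInfCoalg.tensorSqD, hd1]
    rfl
  refine Cplx.transfer (X := C.cplx) (Y := barCplx A) (ΔX := C.Δ₂) hS C.cplx.B_graded hδ₀ f.lin
    f.lin_homog hd ?_ (fun x hx hy => hf.1 x hx hy) ?_ ?_ ?_
  · rintro _ _ ⟨x, rfl⟩
    exact ⟨f.lin x, (hd x).symm⟩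
  · intro y hy
    obtain ⟨x, y', hx, hxy⟩ := hf.2 y hy
    exact ⟨x, hx, y', eq_sub_of_add_eq' hxy⟩
  · intro x hx
    refine (C.Δ₂_Δ₁ x).symm.trans ?_
    exact (congrArg C.Δ₂ hx).trans (map_zero C.Δ₂.lin)
  · intro x hx
    obtain ⟨t, h⟩ := f.lin_Δ₂ x hx
    exact ⟨t, h.trans (congrArg₂ _ (bar_Δ₂ A (f.lin x))
      (congrArg (fun D : SBimod.Hom _ _ => D t) ht))⟩

/-! ### Operations on the first letter of a word -/

section FirstLetter

variable {U W : SBimod k S}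

/-- Auxiliary to `firstT`. -/
def firstTPow (m : Hom (U.tensor W) W) : ∀ n, Hom (U.tensor (W.pow n)) (W.pow n)
  | 0 => m
  | n + 1 => (tmap m (Hom.id (W.pow n))).comp (assocInv U W (W.pow n))

/-- The action `u ⊗ w₁ w₂ ⋯ wₙ ↦ m(u ⊗ w₁) w₂ ⋯ wₙ` on the first letter of a word. -/
def firstT (m : Hom (U.tensor W) W) : Hom (U.tensor W.T) W.T :=
  dliftRight (fun n => (W.inc n).comp (firstTPow m n))

variable (m : Hom (U.tensor W) W)

theorem firstT_letter (a : U) (b : W) :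
    firstT m (tmul _ _ a (W.letter b)) = W.letter (m (tmul _ _ a b)) :=
  dliftRight_ι (fun n => (W.inc n).comp (firstTPow m n)) a 0 b

theorem firstT_cons (a : U) (b : W) (x : W.T) :
    firstT m (tmul _ _ a (W.cons (tmul _ _ b x))) = W.cons (tmul _ _ (m (tmul _ _ a b)) x) := by
  induction x using T_inc_induction with
  | h0 => simp
  | ha x y hx hy => simp only [map_add, hx, hy]
  | hi n w =>
    rw [cons_inc, cons_inc]
    refine (dliftRight_ι (fun n => (W.inc n).comp (firstTPow m n)) a (n + 1)
      (tmul W (W.pow n) b w)).trans ?_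
    have : tmap m (Hom.id (W.pow n)) (assocInv U W (W.pow n) (tmul _ _ a (tmul _ _ b w))) =
        tmul W (W.pow n) (m (tmul _ _ a b)) w := by
      rw [assocInv_tmul, tmap_tmul]
      rfl
    exact congrArg (W.inc (n + 1)) this

theorem firstT_mulT (a : U) (x y : W.T) : firstT m (tmul _ _ a (W.mulT (tmul _ _ x y))) =
    W.mulT (tmul _ _ (firstT m (tmul _ _ a x)) y) := by
  induction x using T_induction with
  | h0 => simp
  | ha x x' hx hx' => simp only [map_add, LinearMap.add_apply, hx, hx']
  | h1 w => rw [mulT_letter, firstT_letter, firstT_cons, mulT_letter]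
  | hc w x _ => rw [mulT_cons, firstT_cons, firstT_cons, mulT_cons]

theorem firstT_mem_wordFilt {F : ℕ → Submodule k W} {n : ℕ} (a : U)
    (hm : ∀ i, ∀ w ∈ F i, m (tmul _ _ a w) ∈ F (n + i)) {i : ℕ} {x : W.T}
    (hx : x ∈ wordFilt F i) : firstT m (tmul _ _ a x) ∈ wordFilt F (n + i) := by
  refine wordFilt_induction
    (fun i => (wordFilt F (n + i)).comap ((firstT m).lin ∘ₗ tmul U W.T a)) (fun i w hw => ?_)
    (fun i j w x hw hx _ => ?_) hx
  · rw [Submodule.mem_comap, LinearMap.comp_apply, firstT_letter]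
    exact letter_mem_wordFilt (hm i w hw)
  · rw [Submodule.mem_comap, LinearMap.comp_apply, firstT_cons, ← add_assoc]
    exact cons_mem_wordFilt (hm i w hw) hx

end FirstLetter

/-! ### The counit `Ω B A → A` -/

section Counit

variable (A : DGAlg k S)

/-- The differential of `Ω B A`. -/
def cobarBarD : Hom A.V.T.T A.V.T.T := cobarD (barG A) (barΔ A)

/-- The map `Ω B A → A` underlying the counit: it multiplies words of one-letter words, and
vanishes on all other words. -/
def counitMap : Hom A.V.T.T A.V :=
  recT A.V.fst 0 (A.mul.comp (tmap A.V.fst (Hom.id _)))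

/-- The operation `⟨w₁⟩⟨w₂⟩⋯ ↦ ⟨a w₁⟩⟨w₂⟩⋯`. -/
def prepend : Hom (A.V.tensor A.V.T.T) A.V.T.T := firstT A.V.cons

/-- The contraction `⟨[a]⟩⟨w⟩⋯ ↦ ⟨[a|w]⟩⋯`, up to sign, of the kernel of the counit. -/
def contraction : Hom A.V.T.T A.V.T.T :=
  recT 0 ((prepend A).comp (tmap ((A.g.sgn 1).comp A.V.fst) (Hom.id _))) 0

theorem counitMap_letter (w : A.V.T) : counitMap A (A.V.T.letter w) = A.V.fst w :=
  recT_letter _ _ _ w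

theorem counitMap_cons (w : A.V.T) (x : A.V.T.T) : counitMap A (A.V.T.cons (tmul _ _ w x)) =
    A.mul (tmul _ _ (A.V.fst w) (counitMap A x)) := by
  rw [counitMap, recT_cons]
  simp

theorem contraction_letter (w : A.V.T) : contraction A (A.V.T.letter w) = 0 := recT_letter _ _ _ w

theorem contraction_cons (w : A.V.T) (x : A.V.T.T) :
    contraction A (A.V.T.cons (tmul _ _ w x)) =
      prepend A (tmul _ _ (A.g.sgn 1 (A.V.fst w)) x) := by
  rw [contraction, recT_cons]
  simp

theorem prepend_letter (a : A.V) (w : A.V.T) : prepend A (tmul _ _ a (A.V.T.letter w)) =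
    A.V.T.letter (A.V.cons (tmul _ _ a w)) := firstT_letter _ a w

theorem prepend_cons (a : A.V) (w : A.V.T) (x : A.V.T.T) :
    prepend A (tmul _ _ a (A.V.T.cons (tmul _ _ w x))) =
      A.V.T.cons (tmul _ _ (A.V.cons (tmul _ _ a w)) x) := firstT_cons _ a w x

theorem contraction_prepend (a : A.V) (x : A.V.T.T) :
    contraction A (prepend A (tmul _ _ a x)) = 0 := by
  induction x using T_induction with
  | h0 => simp
  | ha x y hx hy => simp only [map_add, hx, hy, add_zero]
  | h1 w => rw [prepend_letter, contraction_letter]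
  | hc w x _ => rw [prepend_cons, contraction_cons, fst_cons]; simp

theorem counitMap_prepend (a : A.V) (x : A.V.T.T) :
    counitMap A (prepend A (tmul _ _ a x)) = 0 := by
  induction x using T_induction with
  | h0 => simp
  | ha x y hx hy => simp only [map_add, hx, hy, add_zero]
  | h1 w => rw [prepend_letter, counitMap_letter, fst_cons]
  | hc w x _ => rw [prepend_cons, counitMap_cons, fst_cons]; simp

theorem counitMap_contraction (x : A.V.T.T) : counitMap A (contraction A x) = 0 := by
  induction x using T_induction with
  | h0 => simp
  | ha x y hx hy => simp only [map_add, hx, hy, add_zero]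
  | h1 w => rw [contraction_letter, map_zero]
  | hc w x _ => rw [contraction_cons, counitMap_prepend]

theorem counitMap_mulT (x y : A.V.T.T) : counitMap A (A.V.T.mulT (tmul _ _ x y)) =
    A.mul (tmul _ _ (counitMap A x) (counitMap A y)) := by
  induction x using T_induction with
  | h0 => simp
  | ha x x' hx hx' => simp only [map_add, LinearMap.add_apply, hx, hx']
  | h1 w => rw [mulT_letter, counitMap_cons, counitMap_letter]
  | hc w x hx => rw [mulT_cons, counitMap_cons, hx, counitMap_cons, A.mul_assoc]

theorem barG_shift_sgn (w : A.V.T) : ((barG A).shift 1).sgn 1 w = -barSgnT A w :=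
  Grading.sgn_shift_odd (by decide) w

theorem cobarBarD_letter (w : A.V.T) : cobarBarD A (A.V.T.letter w) =
    -A.V.T.letter (barD A w) - pair A.V.T (tmap (barSgnT A) (Hom.id _) (deconc A.V w)) := by
  rw [cobarBarD, cobarD_letter, barGen_apply]

theorem cobarBarD_cons (w : A.V.T) (x : A.V.T.T) : cobarBarD A (A.V.T.cons (tmul _ _ w x)) =
    A.V.T.mulT (tmul _ _ (cobarBarD A (A.V.T.letter w)) x) -
      A.V.T.cons (tmul _ _ (barSgnT A w) (cobarBarD A x)) := by
  rw [cobarBarD, cobarD_cons, cobarD_letter, barG_shift_sgn, map_neg, LinearMap.neg_apply, map_neg,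
    ← sub_eq_add_neg]

theorem first_fst (a : A.V) (w : A.V.T) :
    A.V.fst (first A.mul (tmul _ _ a w)) = A.mul (tmul _ _ a (A.V.fst w)) := by
  induction w using T_induction with
  | h0 => simp
  | ha x y hx hy => simp only [map_add, hx, hy]
  | h1 w => rw [first_letter, fst_letter', fst_letter']
  | hc w x _ => rw [first_cons, fst_cons, fst_cons, map_zero, map_zero]

theorem fst_barD_cons (a : A.V) (w : A.V.T) : A.V.fst (barD A (A.V.cons (tmul _ _ a w))) =
    -A.mul (tmul _ _ (barSgn A a) (A.V.fst w)) := by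
  rw [barD_cons, map_add, map_sub, map_neg, fst_cons, fst_cons, first_fst]
  simp

theorem tmap_barSgnT_cons (a : A.V) (t : A.V.T.tensor A.V.T) :
    pair _ (tmap (barSgnT A) (Hom.id _) (tmap A.V.cons (Hom.id _) (assocInv _ _ _ (tmul _ _ a t)))) =
      prepend A (tmul _ _ (barSgn A a) (pair _ (tmap (barSgnT A) (Hom.id _) t))) := by
  induction t using tensor_induction with
  | h0 => simp
  | ha x y hx hy => simp only [map_add, hx, hy]
  | ht v w => simp [pair, prepend_cons, barSgnT_cons]

theorem cobarBarD_letter_letter (a : A.V) :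
    cobarBarD A (A.V.T.letter (A.V.letter a)) = A.V.T.letter (A.V.letter (A.d a)) := by
  rw [cobarBarD_letter, barD_letter, deconc_letter]
  simp

theorem cobarBarD_letter_cons (a : A.V) (w : A.V.T) :
    cobarBarD A (A.V.T.letter (A.V.cons (tmul _ _ a w))) =
      -A.V.T.letter (barD A (A.V.cons (tmul _ _ a w))) -
      A.V.T.cons (tmul _ _ (A.V.letter (barSgn A a)) (A.V.T.letter w)) -
      prepend A (tmul _ _ (barSgn A a) (pair _ (tmap (barSgnT A) (Hom.id _) (deconc A.V w)))) := by
  rw [cobarBarD_letter, deconc_cons, map_add, map_add, tmap_barSgnT_cons, ← sub_sub]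
  simp [pair, barSgnT_letter]

theorem counitMap_d (x : A.V.T.T) : counitMap A (cobarBarD A x) = A.d (counitMap A x) := by
  have hl : ∀ w, counitMap A (cobarBarD A (A.V.T.letter w)) = A.d (A.V.fst w) := by
    intro w
    induction w using T_induction with
    | h0 => simp
    | ha x y hx hy => simp only [map_add, hx, hy]
    | h1 a => rw [cobarBarD_letter_letter, counitMap_letter, fst_letter', fst_letter']
    | hc a w _ =>
      rw [cobarBarD_letter_cons, map_sub, map_sub, map_neg, counitMap_letter, fst_barD_cons,
        counitMap_cons, counitMap_prepend, fst_cons, counitMap_letter, fst_letter']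
      simp
  have hs : ∀ w, A.V.fst (barSgnT A w) = barSgn A (A.V.fst w) := fun w =>
    (Grading.sgn_comm (Grading.fst_homog (g := A.g.shift (-1))) w).symm
  induction x using T_induction with
  | h0 => simp
  | ha x y hx hy => simp only [map_add, hx, hy]
  | h1 w => rw [hl, counitMap_letter]
  | hc w x hx =>
    rw [cobarBarD_cons, map_sub, counitMap_mulT, hl, counitMap_cons, counitMap_cons, hx, leibniz',
      hs]

/-- The differential of a word obtained by prepending `a` to the first letter. -/
theorem cobarBarD_prepend (a : A.V) (x : A.V.T.T) : cobarBarD A (prepend A (tmul _ _ a x)) =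
    prepend A (tmul _ _ (A.d a) x) + firstT (first A.mul) (tmul _ _ (barSgn A a) x) -
      A.V.T.cons (tmul _ _ (A.V.letter (barSgn A a)) x) +
      prepend A (tmul _ _ (barSgn A a) (cobarBarD A x)) := by
  have hl : ∀ w, cobarBarD A (A.V.T.letter (A.V.cons (tmul _ _ a w))) =
      A.V.T.letter (A.V.cons (tmul _ _ (A.d a) w)) +
      A.V.T.letter (first A.mul (tmul _ _ (barSgn A a) w)) -
      A.V.T.cons (tmul _ _ (A.V.letter (barSgn A a)) (A.V.T.letter w)) +
      prepend A (tmul _ _ (barSgn A a) (cobarBarD A (A.V.T.letter w))) := by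
    intro w
    rw [cobarBarD_letter_cons, barD_cons, cobarBarD_letter, map_sub, map_sub, map_neg, map_neg,
      prepend_letter, map_add, map_sub, map_neg]
    abel
  induction x using T_induction with
  | h0 => simp
  | ha x y hx hy =>
    simp only [map_add, hx, hy]
    abel
  | h1 w => rw [prepend_letter, hl, prepend_letter, firstT_letter]
  | hc w x _ =>
    rw [prepend_cons, cobarBarD_cons, hl, cobarBarD_cons, prepend_cons, firstT_cons, barSgnT_cons,
      map_sub, map_sub, prepend_cons, prepend, firstT_mulT]
    simp only [map_add, map_sub, LinearMap.add_apply, LinearMap.sub_apply, mulT_letter, mulT_cons]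
    abel

/-- The failure `1 - (d s + s d)` of `contraction` to be a contracting homotopy. -/
def contractionErr : Hom A.V.T.T A.V.T.T :=
  Hom.id _ + -((cobarBarD A).comp (contraction A) + (contraction A).comp (cobarBarD A))

theorem contractionErr_apply (x : A.V.T.T) : contractionErr A x =
    x - (cobarBarD A (contraction A x) + contraction A (cobarBarD A x)) :=
  (sub_eq_add_neg _ _).symm

theorem contractionErr_letter_letter (a : A.V) : contractionErr A (A.V.T.letter (A.V.letter a)) =
    A.V.T.letter (A.V.letter a) := by
  rw [contractionErr_apply, contraction_letter, cobarBarD_letter_letter, contraction_letter]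
  simp

theorem contractionErr_letter_cons (a : A.V) (w : A.V.T) :
    contractionErr A (A.V.T.letter (A.V.cons (tmul _ _ a w))) = 0 := by
  rw [contractionErr_apply, contraction_letter, cobarBarD_letter_cons, map_zero, zero_add, map_sub,
    map_sub, map_neg, contraction_letter, contraction_cons, contraction_prepend, fst_letter',
    barSgn_apply, map_neg, Grading.sgn_sgn, map_neg, LinearMap.neg_apply, map_neg, prepend_letter]
  simp

theorem contractionErr_cons_letter (a : A.V) (x : A.V.T.T) :
    contractionErr A (A.V.T.cons (tmul _ _ (A.V.letter a) x)) =
      firstT (first A.mul) (tmul _ _ a x) := by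
  have h : A.d (A.g.sgn 1 a) = -A.g.sgn 1 (A.d a) := by
    rw [Grading.sgn_anticomm A.d_homog, neg_neg]
  rw [contractionErr_apply, contraction_cons, cobarBarD_cons, cobarBarD_letter_letter, mulT_letter,
    map_sub, contraction_cons, contraction_cons, barSgnT_letter, fst_letter', fst_letter',
    fst_letter', cobarBarD_prepend, barSgn_apply, barSgn_apply, map_neg, Grading.sgn_sgn, h]
  simp only [map_neg, LinearMap.neg_apply, Grading.sgn_sgn]
  abel

theorem contractionErr_cons_cons (a : A.V) (w : A.V.T) (x : A.V.T.T) :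
    contractionErr A (A.V.T.cons (tmul _ _ (A.V.cons (tmul _ _ a w)) x)) =
      prepend A (tmul _ _ (A.g.sgn 1 (A.mul (tmul _ _ (A.g.sgn 1 a) (A.V.fst w)))) x) := by
  rw [contractionErr_apply, contraction_cons, fst_cons, cobarBarD_cons, cobarBarD_letter_cons,
    map_sub, contraction_cons, barSgnT_cons, fst_cons]
  simp only [map_sub, map_neg, LinearMap.sub_apply, LinearMap.neg_apply, mulT_letter, mulT_cons]
  rw [contraction_cons, contraction_cons, fst_barD_cons, fst_letter', prepend, ← firstT_mulT,
    ← prepend, contraction_prepend, barSgn_apply]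
  simp only [map_neg, LinearMap.neg_apply, Grading.sgn_sgn, map_zero, LinearMap.zero_apply,
    prepend_cons]
  abel

/-- The filtration of `Ω B A` by the total number of letters. -/
def totalFilt (i : ℕ) : Submodule k A.V.T.T := wordFilt (fun j => (lenFilt A.V j).carrier) i

theorem totalFilt_mono : Monotone (totalFilt A) := wordFilt_mono lenFilt_mono

theorem prepend_mem_totalFilt (a : A.V) {i : ℕ} {x : A.V.T.T} (hx : x ∈ totalFilt A i) :
    prepend A (tmul _ _ a x) ∈ totalFilt A (1 + i) :=
  firstT_mem_wordFilt _ a (fun _ _ hw => cons_mem_lenFilt (mem_topFilt one_ne_zero a) hw) hx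

theorem merge_mem_totalFilt (a : A.V) {i : ℕ} {x : A.V.T.T} (hx : x ∈ totalFilt A i) :
    firstT (first A.mul) (tmul _ _ a x) ∈ totalFilt A i := by
  have := firstT_mem_wordFilt (F := fun j => (lenFilt A.V j).carrier) (n := 0) (first A.mul) a
    (fun i w hw => by
      rw [zero_add]
      exact first_mem_lenFilt A a hw) hx
  rwa [zero_add] at this

/-- The operator `1 - (d s + s d)` lowers the total number of letters, as long as that number
exceeds one. -/
theorem contractionErr_mem {i : ℕ} {x : A.V.T.T} (hx : x ∈ totalFilt A i) :
    contractionErr A x ∈ totalFilt A (max 1 (i - 1)) := by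
  refine wordFilt_induction
    (fun i => (totalFilt A (max 1 (i - 1))).comap (contractionErr A).lin) (fun i w hw => ?_)
    (fun i j w x hw hx _ => ?_) hx
  · refine lenFilt_induction (fun i => (totalFilt A (max 1 (i - 1))).comap
      ((contractionErr A).lin ∘ₗ A.V.T.letter.lin)) (fun i a ha => ?_)
      (fun i j a w ha hw _ => ?_) hw
    · rw [Submodule.mem_comap, LinearMap.comp_apply, contractionErr_letter_letter]
      exact totalFilt_mono A (le_max_left _ _)
        (letter_mem_wordFilt (letter_mem_lenFilt (mem_topFilt one_ne_zero a)))
    · rw [Submodule.mem_comap, LinearMap.comp_apply, contractionErr_letter_cons]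
      exact zero_mem _
  · refine lenFilt_induction (fun i => (totalFilt A (max 1 (i + j - 1))).comap
      ((contractionErr A).lin ∘ₗ A.V.T.cons.lin ∘ₗ (tmul _ _).flip x)) (fun i a ha => ?_)
      (fun i l a w ha hw _ => ?_) hw
    · rw [Submodule.mem_comap, LinearMap.comp_apply, LinearMap.comp_apply, LinearMap.flip_apply,
        contractionErr_cons_letter]
      rcases Nat.eq_zero_or_pos i with rfl | hi
      · rw [topFilt_zero, Submodule.mem_bot] at ha
        rw [ha, map_zero, LinearMap.zero_apply, map_zero]
        exact zero_mem _
      · exact totalFilt_mono A (by omega) (merge_mem_totalFilt A a hx)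
    · rw [Submodule.mem_comap, LinearMap.comp_apply, LinearMap.comp_apply, LinearMap.flip_apply,
        contractionErr_cons_cons]
      rcases Nat.eq_zero_or_pos i with rfl | hi
      · rw [topFilt_zero, Submodule.mem_bot] at ha
        simp [ha]
      rcases Nat.eq_zero_or_pos l with rfl | hl
      · rw [lenFilt_zero, Submodule.mem_bot] at hw
        simp [hw]
      exact totalFilt_mono A (by omega) (prepend_mem_totalFilt A _ hx)

theorem totalFilt_one {x : A.V.T.T} (hx : x ∈ totalFilt A 1) :
    ∃ a, A.V.T.letter (A.V.letter a) = x := by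
  refine wordFilt_succ_induction (i := 0) lenFilt_mono lenFilt_zero
    (LinearMap.range (A.V.T.letter.lin ∘ₗ A.V.letter.lin)) (fun w hw => ?_)
    (fun w hw x _ => ?_) hx
  · refine wordFilt_succ_induction (i := 0) topFilt_mono topFilt_zero
      ((LinearMap.range (A.V.T.letter.lin ∘ₗ A.V.letter.lin)).comap A.V.T.letter.lin)
      (fun a _ => ⟨a, rfl⟩) (fun a ha x _ => ?_) hw
    change a ∈ (topFilt A.V 0).carrier at ha
    rw [topFilt_zero, Submodule.mem_bot] at ha
    rw [ha, map_zero, LinearMap.zero_apply, map_zero]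
    exact zero_mem _
  · change w ∈ (lenFilt A.V 0).carrier at hw
    rw [lenFilt_zero, Submodule.mem_bot] at hw
    rw [hw, map_zero, LinearMap.zero_apply, map_zero]
    exact zero_mem _

theorem cobarBarD_cobarBarD (x : A.V.T.T) : cobarBarD A (cobarBarD A x) = 0 := (bar A).rel x

theorem counitMap_surjective : Function.Surjective (counitMap A) := fun a =>
  ⟨A.V.T.letter (A.V.letter a), by rw [counitMap_letter, fst_letter']⟩

/-- A cycle in the kernel of the counit is a boundary: subtracting `d s x` from a cycle `x` lowers
its total number of letters, and on a single letter the counit is injective. -/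
theorem counitMap_quasiIso : IsQuasiIso (cobarBarD A) A.d (counitMap A) := by
  refine isQuasiIso_of_nilpotent (cobarBarD_cobarBarD A) (counitMap_d A) (counitMap_surjective A)
    (contraction A) (counitMap_contraction A) (totalFilt A) (wordFilt_zero lenFilt_zero)
    (wordFilt_exhaust lenFilt_mono lenFilt_exhaust) fun i x hx hdx hεx => ?_
  have h := contractionErr_mem A hx
  rw [contractionErr_apply, hdx, map_zero, add_zero] at h
  rcases Nat.eq_zero_or_pos i with rfl | hi
  · obtain ⟨a, rfl⟩ := totalFilt_one A hx
    rw [counitMap_letter, fst_letter'] at hεx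
    rw [hεx]
    simp
  · rwa [show max 1 (i + 1 - 1) = i by omega] at h

theorem counitMap_homog : Grading.IsHomog ((barG A).shift 1).T A.g 0 (counitMap A) := by
  have h : Grading.IsHomog ((barG A).shift 1) A.g 0 A.V.fst := fun n x hx => by
    have := Grading.fst_homog (g := A.g.shift (-1)) (n + 1) x hx
    change A.V.fst x ∈ A.g.gr (n + 1 + 0 + -1) at this
    rwa [show n + 1 + 0 + -1 = n + 0 by ring] at this
  exact Grading.recT_homog h Grading.zero_homog
    (A.mul_homog.comp (h.tmap Grading.id_homog rfl) rfl)

/-- The counit `Ω B A → A` of the bar-cobar adjunction. -/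
def counit : DGAlg.Hom (bar A).cobar A where
  f := counitMap A
  homog := counitMap_homog A
  map_mul := counitMap_mulT A
  map_d := counitMap_d A

end Counit

/-! ### Lifting morphisms out of the cobar construction -/

namespace SBimod

variable {V W : SBimod k S}

theorem wordFilt_le_induction {F : ℕ → Submodule k V} (hF : Monotone F) {n : ℕ}
    (Q : Submodule k V.T) (h1 : ∀ v ∈ F n, V.letter v ∈ Q)
    (hc : ∀ v ∈ F n, ∀ x ∈ Q, V.cons (tmul _ _ v x) ∈ Q) {x : V.T} (hx : x ∈ wordFilt F n) :
    x ∈ Q := by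
  have := wordFilt_induction (F := F) (fun j => if j ≤ n then Q else ⊤) (fun j v hv => ?_)
    (fun a b v x hv _ ih => ?_) hx
  · simpa using this
  · split_ifs with h
    · exact h1 v (hF h hv)
    · trivial
  · split_ifs with h
    · rw [if_pos (by omega)] at ih
      exact hc v (hF (by omega) hv) x ih
    · trivial

/-- The limit of a sequence of morphisms which stabilizes on each term of an exhaustive
filtration. -/
theorem exists_limit {F : ℕ → SubBimod V} (hF : Monotone fun i => (F i).carrier)
    (hx : ∀ v, ∃ i, v ∈ F i) (g : ℕ → Hom V W) (hg : ∀ n, ∀ v ∈ F n, g (n + 1) v = g n v) :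
    ∃ g' : Hom V W, ∀ n, ∀ v ∈ F n, g' v = g n v := by
  choose i hi using hx
  have h1 : ∀ n, ∀ v ∈ F n, ∀ m, g (n + m) v = g n v := by
    intro n v hv m
    induction m with
    | zero => rfl
    | succ m ih => rw [← add_assoc, hg _ v (hF (Nat.le_add_right n m) hv), ih]
  have h2 : ∀ n m, ∀ v ∈ F n, v ∈ F m → g n v = g m v := by
    intro n m v hn hm
    rcases le_total n m with h | h
    · obtain ⟨l, rfl⟩ := Nat.exists_eq_add_of_le h
      exact (h1 n v hn l).symm
    · obtain ⟨l, rfl⟩ := Nat.exists_eq_add_of_le h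
      exact h1 m v hm l
  refine ⟨⟨⟨⟨fun v => g (i v) v, fun v w => ?_⟩, fun c v => ?_⟩, fun s v => ?_, fun s v => ?_⟩,
    fun n v hv => h2 _ _ _ (hi v) hv⟩
  · have hv := hF (le_max_left (i v) (i w)) (hi v)
    have hw := hF (le_max_right (i v) (i w)) (hi w)
    rw [h2 (i v) _ v (hi v) hv, h2 (i w) _ w (hi w) hw, ← map_add]
    exact h2 _ _ _ (hi _) (add_mem hv hw)
  · exact (h2 _ (i v) _ (hi _) (Submodule.smul_mem _ c (hi v))).trans (map_smul _ _ _)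
  · exact (h2 _ (i v) _ (hi _) ((F (i v)).l_mem s v (hi v))).trans (Hom.map_l _ _ _)
  · exact (h2 _ (i v) _ (hi _) ((F (i v)).r_mem s v (hi v))).trans (Hom.map_r _ _ _)

end SBimod

section Lifting

variable {V : SBimod k S} {E : DGAlg k S}

/-- The extension of a map `V → E` to a multiplicative map `T⁺ V → E`. -/
def algExt (g : Hom V E.V) : Hom V.T E.V := recT g 0 (E.mul.comp (tmap g (Hom.id _)))

theorem algExt_letter (g : Hom V E.V) (v : V) : algExt g (V.letter v) = g v := recT_letter _ _ _ v

theorem algExt_cons (g : Hom V E.V) (v : V) (x : V.T) :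
    algExt g (V.cons (tmul _ _ v x)) = E.mul (tmul _ _ (g v) (algExt g x)) := by
  rw [algExt, recT_cons]
  simp

theorem algExt_mulT (g : Hom V E.V) (x y : V.T) :
    algExt g (V.mulT (tmul _ _ x y)) = E.mul (tmul _ _ (algExt g x) (algExt g y)) := by
  induction x using T_induction with
  | h0 => simp
  | ha x x' hx hx' => simp only [map_add, LinearMap.add_apply, hx, hx']
  | h1 v => rw [mulT_letter, algExt_cons, algExt_letter]
  | hc v x hx => rw [mulT_cons, algExt_cons, hx, algExt_cons, E.mul_assoc]

theorem algExt_homog {h : Grading V} {g : Hom V E.V} (hg : Grading.IsHomog h E.g 0 g) :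
    Grading.IsHomog h.T E.g 0 (algExt g) :=
  Grading.recT_homog hg Grading.zero_homog (E.mul_homog.comp (hg.tmap Grading.id_homog rfl) rfl)

theorem algExt_congr {F : ℕ → Submodule k V} (hF : Monotone F) {g g' : Hom V E.V} {n : ℕ}
    (h : ∀ v ∈ F n, g v = g' v) {x : V.T} (hx : x ∈ wordFilt F n) : algExt g x = algExt g' x := by
  refine wordFilt_le_induction hF (LinearMap.eqLocus (algExt g).lin (algExt g').lin)
    (fun v hv => ?_) (fun v hv x ih => ?_) hx
  · rw [LinearMap.mem_eqLocus, algExt_letter, algExt_letter, h v hv]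
  · rw [LinearMap.mem_eqLocus] at ih ⊢
    rw [algExt_cons, algExt_cons, h v hv, ih]

variable (C : AInfCoalg k S)

/-- The obstruction to `g : C[1] → E` being the restriction of a morphism of dg algebras
`Ω_∞ C → E`. -/
def twistingDefect (g : Hom C.V E.V) : Hom C.V E.V :=
  E.d.comp g + -((algExt g).comp (cobarGen C.g C.Δ))

theorem twistingDefect_apply (g : Hom C.V E.V) (v : C.V) :
    twistingDefect C g v = E.d (g v) - algExt g (cobarGen C.g C.Δ v) := (sub_eq_add_neg _ _).symm

theorem twistingDefect_homog {g : Hom C.V E.V} (hg : Grading.IsHomog (C.g.shift 1) E.g 0 g) :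
    Grading.IsHomog (C.g.shift 1) E.g (-1) (twistingDefect C g) :=
  (E.d_homog.comp hg rfl).add
    ((algExt_homog hg).comp (cobarGen_homog C.Δ_homog) rfl).neg

theorem defect_cons {g : Hom C.V E.V} (hg : Grading.IsHomog (C.g.shift 1) E.g 0 g) (v : C.V)
    (x : C.V.T) : E.d (algExt g (C.V.cons (tmul _ _ v x))) -
      algExt g (cobarD C.g C.Δ (C.V.cons (tmul _ _ v x))) =
    E.mul (tmul _ _ (twistingDefect C g v) (algExt g x)) + E.mul (tmul _ _ (E.g.sgn 1 (g v))
      (E.d (algExt g x) - algExt g (cobarD C.g C.Δ x))) := by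
  rw [algExt_cons, E.leibniz, cobarD_cons, map_add, algExt_mulT, algExt_cons, twistingDefect_apply,
    Grading.sgn_comm hg]
  simp only [map_sub, LinearMap.sub_apply]
  abel

/-- Whether `algExt g` is a chain map can be checked on generators. -/
theorem algExt_cobarD {F : ℕ → Submodule k C.V} (hF : Monotone F) {g : Hom C.V E.V} {n : ℕ}
    (hg : Grading.IsHomog (C.g.shift 1) E.g 0 g) (h : ∀ v ∈ F n, twistingDefect C g v = 0)
    {x : C.V.T} (hx : x ∈ wordFilt F n) :
    E.d (algExt g x) - algExt g (cobarD C.g C.Δ x) = 0 := by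
  refine wordFilt_le_induction hF
    (LinearMap.ker (E.d.lin ∘ₗ (algExt g).lin - (algExt g).lin ∘ₗ (cobarD C.g C.Δ).lin))
    (fun v hv => ?_) (fun v hv x ih => ?_) hx
  · change E.d (algExt g (C.V.letter v)) - algExt g (cobarD C.g C.Δ (C.V.letter v)) = 0
    rw [cobarD_letter, algExt_letter, ← twistingDefect_apply, h v hv]
  · change E.d (algExt g x) - algExt g (cobarD C.g C.Δ x) = 0 at ih
    change E.d (algExt g (C.V.cons _)) - algExt g (cobarD C.g C.Δ (C.V.cons _)) = 0
    rw [defect_cons C hg, ih, h v hv]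
    simp

variable {C} {F : ℕ → SubBimod C.V}

theorem AInfCoalg.IsAdmissible.monotone (hF : C.IsAdmissible F) :
    Monotone fun i => (F i).carrier := monotone_nat_of_le_succ hF.mono

theorem AInfCoalg.IsAdmissible.cobarGen_mem (hF : C.IsAdmissible F) {n : ℕ} {v : C.V}
    (hv : v ∈ F n) : cobarGen C.g C.Δ v ∈ wordFilt (fun i => (F i).carrier) n := by
  refine neg_mem (mem_wordFilt_of_prj fun m => ?_)
  rw [SBimod.Hom.comp_apply, prj_twist]
  exact twistPow_mem_filtPow hF.graded m (hF.compat m n v hv)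

/-- If the defect of `g` vanishes on `F n`, then on `F (n + 1)` it is a cycle in `Hom(C, E)`. -/
theorem d_twistingDefect (hF : C.IsAdmissible F) {g : Hom C.V E.V} {n : ℕ}
    (hg : Grading.IsHomog (C.g.shift 1) E.g 0 g) (h : ∀ v ∈ F n, twistingDefect C g v = 0)
    {v : C.V} (hv : v ∈ F (n + 1)) :
    E.d (twistingDefect C g v) = twistingDefect C g (C.Δ₁ v) := by
  have key : ∀ x ∈ wordFilt (fun i => (F i).carrier) (n + 1),
      E.d (algExt g x) - algExt g (cobarD C.g C.Δ x) = twistingDefect C g (C.V.fst x) := by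
    intro x hx
    refine wordFilt_succ_induction hF.monotone hF.zero (LinearMap.eqLocus
      (E.d.lin ∘ₗ (algExt g).lin - (algExt g).lin ∘ₗ (cobarD C.g C.Δ).lin)
      ((twistingDefect C g).lin ∘ₗ C.V.fst.lin)) (fun v _ => ?_) (fun v hv x hx => ?_) hx
    · change E.d (algExt g (C.V.letter v)) - algExt g (cobarD C.g C.Δ (C.V.letter v)) =
        twistingDefect C g (C.V.fst (C.V.letter v))
      rw [cobarD_letter, algExt_letter, fst_letter', twistingDefect_apply]
    · change E.d (algExt g (C.V.cons _)) - algExt g (cobarD C.g C.Δ (C.V.cons _)) =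
        twistingDefect C g (C.V.fst (C.V.cons _))
      rw [defect_cons C hg, fst_cons, h v hv,
        algExt_cobarD C hF.monotone hg h hx]
      simp
  have h2 := key _ (hF.cobarGen_mem hv)
  have h3 : cobarD C.g C.Δ (cobarGen C.g C.Δ v) = 0 := by rw [← cobarD_letter, C.rel]
  rw [h3, map_zero, sub_zero, C.fst_cobarGen, map_neg] at h2
  rw [twistingDefect_apply, map_sub, E.d_d, h2, zero_sub, neg_neg]

/-- The correction of a map `g` by a contraction `s`. -/
def correct (C : AInfCoalg k S) (s : Hom E.V E.V) (g : Hom C.V E.V) : Hom C.V E.V :=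
  g + -(s.comp (twistingDefect C g))

theorem correct_apply (s : Hom E.V E.V) (g : Hom C.V E.V) (v : C.V) :
    correct C s g v = g v - s (twistingDefect C g v) := (sub_eq_add_neg _ _).symm

theorem twistingDefect_correct (hF : C.IsAdmissible F) {g : Hom C.V E.V} {n : ℕ}
    (hg : Grading.IsHomog (C.g.shift 1) E.g 0 g) (h : ∀ v ∈ F n, twistingDefect C g v = 0)
    (s : Hom E.V E.V) (hs : ∀ v, E.d (s (twistingDefect C g v)) +
      s (E.d (twistingDefect C g v)) = twistingDefect C g v) {v : C.V} (hv : v ∈ F (n + 1)) :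
    twistingDefect C (correct C s g) v = 0 := by
  have hn : ∀ v ∈ F n, correct C s g v = g v := fun v hv => by
    rw [correct_apply, h v hv, map_zero, sub_zero]
  have key : ∀ x ∈ wordFilt (fun i => (F i).carrier) (n + 1),
      algExt (correct C s g) x = algExt g x - s (twistingDefect C g (C.V.fst x)) := by
    intro x hx
    refine wordFilt_succ_induction hF.monotone hF.zero (LinearMap.eqLocus
      (algExt (correct C s g)).lin ((algExt g).lin -
        s.lin ∘ₗ (twistingDefect C g).lin ∘ₗ C.V.fst.lin)) (fun v _ => ?_) (fun v hv x hx => ?_) hx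
    · change algExt (correct C s g) (C.V.letter v) = algExt g (C.V.letter v) -
        s (twistingDefect C g (C.V.fst (C.V.letter v)))
      rw [algExt_letter, algExt_letter, fst_letter', correct_apply]
    · change algExt (correct C s g) (C.V.cons _) = algExt g (C.V.cons _) -
        s (twistingDefect C g (C.V.fst (C.V.cons _)))
      rw [algExt_cons, algExt_cons, fst_cons, map_zero, map_zero, sub_zero, hn v hv,
        algExt_congr hF.monotone hn hx]
  have h3 := hs v
  rw [d_twistingDefect hF hg h hv] at h3
  rw [twistingDefect_apply, key _ (hF.cobarGen_mem hv), correct_apply, C.fst_cobarGen, map_neg,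
    map_neg, map_sub, sub_neg_eq_add, ← sub_sub, sub_right_comm _ _ (algExt g _),
    ← twistingDefect_apply, sub_sub, h3, sub_self]

end Lifting

/-- Morphisms out of the cobar construction of a cocomplete A∞-coalgebra lift along surjective
quasi-isomorphisms of dg algebras. -/
theorem exists_lift (hS : IsSeparableAlg k S) {C : AInfCoalg k S} (hC : C.Cocomplete)
    {E A : DGAlg k S} (p : DGAlg.Hom E A) (hp : p.QuasiIso) (hs : Function.Surjective p.f)
    (f : DGAlg.Hom C.cobar A) : ∃ f' : DGAlg.Hom C.cobar E, ∀ x, p.f (f'.f x) = f.f x := by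
  obtain ⟨F, hF⟩ := hC
  obtain ⟨σ, s, hσ, hsh, hpσ, hps, hsd⟩ :=
    exists_section_contraction hS hp E.d_homog p.homog E.d_d p.map_d hs
  let fl : Hom C.V A.V := f.f.comp C.V.letter
  have hfl : Grading.IsHomog (C.g.shift 1) A.g 0 fl := f.homog.comp Grading.letter_homog rfl
  have hext : ∀ g : Hom C.V E.V, (∀ v, p.f (g v) = fl v) → ∀ x : C.V.T,
      p.f (algExt g x) = f.f x := by
    intro g hg x
    induction x using T_induction with
    | h0 => exact (map_zero (p.f.comp (algExt g)).lin).trans (map_zero f.f.lin).symm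
    | ha x y hx hy =>
      rw [map_add, map_add, hx, hy]
      exact (map_add f.f.lin x y).symm
    | h1 v => rw [algExt_letter, hg]; rfl
    | hc v x hx =>
      rw [algExt_cons, p.map_mul, hx, hg, ← mulT_letter]
      exact (f.map_mul _ _).symm
  have hpd : ∀ g : Hom C.V E.V, (∀ v, p.f (g v) = fl v) → ∀ v,
      p.f (twistingDefect C g v) = 0 := by
    intro g hg v
    rw [twistingDefect_apply, map_sub, p.map_d, hg, hext g hg, ← cobarD_letter]
    exact sub_eq_zero.2 (f.map_d _).symm
  let g : ℕ → Hom C.V E.V := fun n => Nat.rec (σ.comp fl) (fun _ g => correct C s g) n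
  have hg1 : ∀ n, Grading.IsHomog (C.g.shift 1) E.g 0 (g n) ∧ ∀ v, p.f (g n v) = fl v := by
    intro n
    induction n with
    | zero => exact ⟨hσ.comp hfl rfl, fun v => hpσ _⟩
    | succ n ih =>
      refine ⟨ih.1.add (hsh.comp (twistingDefect_homog C ih.1) rfl).neg, fun v => ?_⟩
      change p.f (correct C s (g n) v) = _
      rw [correct_apply, map_sub, hps, sub_zero, ih.2]
  have hg2 : ∀ n, ∀ v ∈ F n, twistingDefect C (g n) v = 0 := by
    intro n
    induction n with
    | zero =>
      intro v hv
      have hv' : v ∈ (F 0).carrier := hv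
      rw [hF.zero, Submodule.mem_bot] at hv'
      rw [hv', map_zero]
    | succ n ih =>
      exact fun v hv => twistingDefect_correct hF (hg1 n).1 ih s
        (fun v => hsd _ (hpd _ (hg1 n).2 v)) hv
  obtain ⟨g', hg'⟩ := exists_limit hF.monotone hF.exhaust g (fun n v hv => by
    change correct C s (g n) v = _
    rw [correct_apply, hg2 n v hv, map_zero, sub_zero])
  have hh : Grading.IsHomog (C.g.shift 1) E.g 0 g' := fun m v hv => by
    obtain ⟨n, hn⟩ := hF.exhaust v
    rw [hg' n v hn]
    exact (hg1 n).1 m v hv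
  have hp' : ∀ v, p.f (g' v) = fl v := fun v => by
    obtain ⟨n, hn⟩ := hF.exhaust v
    rw [hg' n v hn, (hg1 n).2]
  have hd' : ∀ n, ∀ v ∈ F n, twistingDefect C g' v = 0 := fun n v hv => by
    rw [twistingDefect_apply, hg' n v hv, algExt_congr hF.monotone (hg' n) (hF.cobarGen_mem hv),
      ← twistingDefect_apply, hg2 n v hv]
  refine ⟨⟨algExt g', algExt_homog hh, algExt_mulT g', fun x => ?_⟩, hext g' hp'⟩
  obtain ⟨n, hn⟩ := wordFilt_exhaust hF.monotone hF.exhaust x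
  exact (sub_eq_zero.1 (algExt_cobarD C hF.monotone hh (hd' n) hn)).symm

/-- A quasi-isomorphism `Ω_∞ C → A` lifts along the counit `Ω B A → A` to a morphism
`Ω_∞ C → Ω B A`, which is a quasi-isomorphism because the counit is one. -/
theorem exists_weakEquiv_bar (hS : IsSeparableAlg k S) {C : AInfCoalg k S} (hC : C.Cocomplete)
    {A : DGAlg k S} (F : DGAlg.Hom C.cobar A) (hF : F.QuasiIso) :
    ∃ f : AInfCoalg.Hom C (bar A), f.WeakEquiv := by
  have hε : (counit A).QuasiIso := counitMap_quasiIso A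
  obtain ⟨f, hf⟩ := exists_lift hS hC (counit A) hε (counitMap_surjective A) F
  refine ⟨⟨f⟩, IsQuasiIso.of_comp_right ?_ hε f.map_d (counit A).map_d⟩
  have e : (counit A).f.comp f.f = F.f := SBimod.Hom.ext' hf
  rw [e]
  exact hF

/-! ### The unit `B Ω_∞ C → C` on the linear level -/

section Unit

theorem SBimod.Grading.isGraded_shift {V : SBimod k S} {g : Grading V} {N : SubBimod V}
    (hN : g.IsGraded N) (m : ℤ) : (g.shift m).IsGraded N := fun x hx n => by
  have h : Grading.IsHomog g (g.shift m) (-m) (SBimod.Hom.id V) := fun n x hx => by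
    change x ∈ g.gr (n + -m + m)
    rwa [neg_add_cancel_right]
  have h2 := Grading.comps_homog h x (n + m)
  rw [add_neg_cancel_right] at h2
  exact (congrArg (· ∈ N) h2).mpr (hN x hx (n + m))

variable (C : AInfCoalg k S)

/-- The sign operator on `C[1]`. -/
def AInfCoalg.genSgn : SBimod.Hom C.V C.V := (C.g.shift 1).sgn 1

/-- The sign operator on `(Ω_∞ C)[-1]`. -/
def AInfCoalg.wordSgn : SBimod.Hom C.V.T C.V.T := barSgn C.cobar

/-- The differential of `B Ω_∞ C`. -/
def AInfCoalg.barCobarD : SBimod.Hom C.V.T.T C.V.T.T := barD C.cobar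

/-- The differential of `Ω_∞ C`. -/
def AInfCoalg.wordD : SBimod.Hom C.V.T C.V.T := cobarD C.g C.Δ

namespace AInfCoalg

theorem genSgn_genSgn (v : C.V) : C.genSgn (C.genSgn v) = v := Grading.sgn_sgn v

theorem wordSgn_apply (x : C.V.T) : C.wordSgn x = -(C.g.shift 1).T.sgn 1 x := barSgn_apply C.cobar x

theorem wordSgn_letter (v : C.V) : C.wordSgn (C.V.letter v) = -C.V.letter (C.genSgn v) := by
  rw [wordSgn_apply, Grading.sgn_letter, genSgn]

theorem wordSgn_cons (v : C.V) (x : C.V.T) : C.wordSgn (C.V.cons (tmul _ _ v x)) =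
    C.V.cons (tmul _ _ (C.genSgn v) (C.wordSgn x)) := by
  rw [wordSgn_apply, wordSgn_apply, Grading.sgn_cons, genSgn, map_neg, map_neg]

theorem wordD_cons (v : C.V) (x : C.V.T) : C.wordD (C.V.cons (tmul _ _ v x)) =
    C.V.mulT (tmul _ _ (C.wordD (C.V.letter v)) x) +
      C.V.cons (tmul _ _ (C.genSgn v) (C.wordD x)) := by
  rw [wordD, cobarD_cons, cobarD_letter, genSgn]

theorem wordSgn_wordD (x : C.V.T) : C.wordSgn (C.wordD x) = -C.wordD (C.wordSgn x) := by
  rw [wordSgn_apply, wordSgn_apply, wordD,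
    Grading.sgn_anticomm (cobarD_homog C.Δ_homog), map_neg]

theorem barCobarD_letter (y : C.V.T) :
    C.barCobarD (C.V.T.letter y) = -C.V.T.letter (C.wordD y) := barD_letter C.cobar y

theorem barCobarD_cons (y : C.V.T) (z : C.V.T.T) :
    C.barCobarD (C.V.T.cons (tmul _ _ y z)) = -C.V.T.cons (tmul _ _ (C.wordD y) z) -
      first C.V.mulT (tmul _ _ (C.wordSgn y) z) + C.V.T.cons (tmul _ _ (C.wordSgn y)
        (C.barCobarD z)) := barD_cons C.cobar y z

/-- The map `v w ↦ ± v ⊗ w` splitting off the first letter of a word. -/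
def splitFirst : SBimod.Hom C.V.T (C.V.T.tensor C.V.T) :=
  recT 0 (tmap (C.V.letter.comp C.genSgn) (SBimod.Hom.id _)) 0

/-- The map `[v w|⋯] ↦ ± [v|w|⋯]`, for a letter `v` and a nonempty word `w`. -/
def splitting : SBimod.Hom C.V.T.T C.V.T.T :=
  recT ((pair C.V.T).comp C.splitFirst)
    (C.V.T.cons.comp ((tmap (SBimod.Hom.id _) C.V.T.cons).comp ((assoc _ _ _).comp
      (tmap C.splitFirst (SBimod.Hom.id _))))) 0

theorem splitFirst_letter (v : C.V) : C.splitFirst (C.V.letter v) = 0 := recT_letter _ _ _ v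

theorem splitFirst_cons (v : C.V) (x : C.V.T) : C.splitFirst (C.V.cons (tmul _ _ v x)) =
    tmul _ _ (C.V.letter (C.genSgn v)) x := by
  rw [splitFirst, recT_cons]
  simp

theorem splitting_letter_letter (v : C.V) : C.splitting (C.V.T.letter (C.V.letter v)) = 0 := by
  rw [splitting, recT_letter, SBimod.Hom.comp_apply, splitFirst_letter, map_zero]

theorem splitting_letter_cons (v : C.V) (x : C.V.T) :
    C.splitting (C.V.T.letter (C.V.cons (tmul _ _ v x))) =
      C.V.T.cons (tmul _ _ (C.V.letter (C.genSgn v)) (C.V.T.letter x)) := by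
  rw [splitting, recT_letter, SBimod.Hom.comp_apply, splitFirst_cons]
  simp [pair]

theorem splitting_cons_letter (v : C.V) (z : C.V.T.T) :
    C.splitting (C.V.T.cons (tmul _ _ (C.V.letter v) z)) = 0 := by
  rw [splitting, recT_cons]
  simp [splitFirst_letter]

theorem splitting_cons_cons (v : C.V) (x : C.V.T) (z : C.V.T.T) :
    C.splitting (C.V.T.cons (tmul _ _ (C.V.cons (tmul _ _ v x)) z)) =
      C.V.T.cons (tmul _ _ (C.V.letter (C.genSgn v)) (C.V.T.cons (tmul _ _ x z))) := by
  rw [splitting, recT_cons]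
  simp [splitFirst_cons]

theorem splitting_first_letter (v : C.V) (z : C.V.T.T) :
    C.splitting (first C.V.mulT (tmul _ _ (C.V.letter v) z)) =
      C.V.T.cons (tmul _ _ (C.V.letter (C.genSgn v)) z) := by
  induction z using T_induction with
  | h0 => simp
  | ha x y hx hy => simp only [map_add, hx, hy]
  | h1 x => rw [first_letter, mulT_letter, splitting_letter_cons]
  | hc x z _ => rw [first_cons, mulT_letter, splitting_cons_cons]

theorem splitting_first_cons (v : C.V) (y : C.V.T) (z : C.V.T.T) :
    C.splitting (first C.V.mulT (tmul _ _ (C.V.cons (tmul _ _ v y)) z)) =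
      C.V.T.cons (tmul _ _ (C.V.letter (C.genSgn v)) (first C.V.mulT (tmul _ _ y z))) := by
  induction z using T_induction with
  | h0 => simp
  | ha x y hx hy => simp only [map_add, hx, hy]
  | h1 x => rw [first_letter, mulT_cons, splitting_letter_cons, first_letter]
  | hc x z _ => rw [first_cons, mulT_cons, splitting_cons_cons, first_cons]

/-- The way a tail (possibly empty) is attached to a word to get an element of `B Ω_∞ C`, together
with the part `ψ` of the differential which involves the tail. -/
structure IsTail (τ ψ : C.V.T →ₗ[k] C.V.T.T) : Prop where
  barCobarD : ∀ y, C.barCobarD (τ y) = -τ (C.wordD y) + ψ y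
  splitting_letter : ∀ v, C.splitting (τ (C.V.letter v)) = 0
  splitting_cons : ∀ v x, C.splitting (τ (C.V.cons (tmul _ _ v x))) =
    C.V.T.cons (tmul _ _ (C.V.letter (C.genSgn v)) (τ x))
  first : ∀ y x, AInf.first C.V.mulT (tmul _ _ y (τ x)) = τ (C.V.mulT (tmul _ _ y x))
  splitting_ψ : ∀ v x, C.splitting (ψ (C.V.cons (tmul _ _ v x))) =
    C.V.T.cons (tmul _ _ (C.V.letter v) (ψ x))

theorem isTail_letter : C.IsTail C.V.T.letter.lin 0 where
  barCobarD := fun y => by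
    rw [barCobarD_letter, LinearMap.zero_apply, add_zero]
  splitting_letter := C.splitting_letter_letter
  splitting_cons := C.splitting_letter_cons
  first := fun y x => first_letter _ y x
  splitting_ψ := fun v x => by simp

theorem isTail_cons (z : C.V.T.T) : C.IsTail (C.V.T.cons.lin ∘ₗ (tmul _ _).flip z)
    (-((AInf.first C.V.mulT).lin ∘ₗ (tmul _ _).flip z ∘ₗ C.wordSgn.lin) +
      C.V.T.cons.lin ∘ₗ (tmul _ _).flip (C.barCobarD z) ∘ₗ C.wordSgn.lin) where
  barCobarD := fun y => by
    simp only [LinearMap.comp_apply, LinearMap.flip_apply, LinearMap.add_apply,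
      LinearMap.neg_apply, barCobarD_cons]
    abel
  splitting_letter := fun v => C.splitting_cons_letter v z
  splitting_cons := fun v x => C.splitting_cons_cons v x z
  first := fun y x => first_cons _ y x z
  splitting_ψ := fun v x => by
    simp only [LinearMap.comp_apply, LinearMap.flip_apply, LinearMap.add_apply,
      LinearMap.neg_apply, wordSgn_cons, map_add, map_neg, splitting_first_cons,
      splitting_cons_cons, genSgn_genSgn]

variable {C} {τ ψ : C.V.T →ₗ[k] C.V.T.T}

theorem IsTail.homotopy (h : C.IsTail τ ψ) (v : C.V) (x : C.V.T) :
    C.barCobarD (C.splitting (τ (C.V.cons (tmul _ _ v x)))) +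
      C.splitting (C.barCobarD (τ (C.V.cons (tmul _ _ v x)))) =
    τ (C.V.cons (tmul _ _ v x)) - (C.V.T.cons (tmul _ _ (C.wordSgn (C.wordD (C.V.letter v))) (τ x)) +
      C.splitting (τ (C.V.mulT (tmul _ _ (C.wordD (C.V.letter v)) x)))) := by
  rw [h.splitting_cons, barCobarD_cons, wordSgn_letter, genSgn_genSgn, map_neg, LinearMap.neg_apply,
    map_neg, h.first, mulT_letter, h.barCobarD, h.barCobarD, wordD_cons, wordSgn_wordD,
    wordSgn_letter]
  simp only [map_add, map_neg, LinearMap.neg_apply, h.splitting_cons, h.splitting_ψ,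
    genSgn_genSgn]
  abel

variable {F : ℕ → SBimod.SubBimod C.V}

/-- The filtration of `B Ω_∞ C` given by a filtration of the first letter. -/
def firstFilt (F : ℕ → SBimod.SubBimod C.V) (i : ℕ) : Submodule k C.V.T.T :=
  Submodule.span k {z | ∃ y ∈ wordFilt (fun j => (F j).carrier) i,
    z = C.V.T.letter y ∨ ∃ w, z = C.V.T.cons (tmul _ _ y w)}

theorem letter_mem_firstFilt {i : ℕ} {y : C.V.T} (hy : y ∈ wordFilt (fun j => (F j).carrier) i) :
    C.V.T.letter y ∈ firstFilt F i := Submodule.subset_span ⟨y, hy, Or.inl rfl⟩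

theorem cons_mem_firstFilt {i : ℕ} {y : C.V.T} (hy : y ∈ wordFilt (fun j => (F j).carrier) i)
    (w : C.V.T.T) : C.V.T.cons (tmul _ _ y w) ∈ firstFilt F i :=
  Submodule.subset_span ⟨y, hy, Or.inr ⟨w, rfl⟩⟩

theorem firstFilt_mono (hF : Monotone fun i => (F i).carrier) : Monotone (firstFilt F) := by
  intro i j hij
  refine Submodule.span_mono ?_
  rintro z ⟨y, hy, hz⟩
  exact ⟨y, wordFilt_mono hF hij hy, hz⟩

theorem firstFilt_zero (h0 : (F 0).carrier = ⊥) : firstFilt F 0 = ⊥ := by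
  refine Submodule.span_eq_bot.2 ?_
  rintro z ⟨y, hy, hz⟩
  rw [wordFilt_zero h0, Submodule.mem_bot] at hy
  rcases hz with rfl | ⟨w, rfl⟩ <;> simp [hy]

theorem firstFilt_exhaust (hF : C.IsAdmissible F) (z : C.V.T.T) : ∃ i, z ∈ firstFilt F i := by
  induction z using T_induction with
  | h0 => exact ⟨0, zero_mem _⟩
  | ha x y hx hy =>
    obtain ⟨i, hi⟩ := hx
    obtain ⟨j, hj⟩ := hy
    exact ⟨max i j, add_mem (firstFilt_mono hF.monotone (le_max_left _ _) hi)
      (firstFilt_mono hF.monotone (le_max_right _ _) hj)⟩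
  | h1 y =>
    obtain ⟨i, hi⟩ := wordFilt_exhaust hF.monotone hF.exhaust y
    exact ⟨i, letter_mem_firstFilt hi⟩
  | hc y w _ =>
    obtain ⟨i, hi⟩ := wordFilt_exhaust hF.monotone hF.exhaust y
    exact ⟨i, cons_mem_firstFilt hi w⟩

theorem wordSgn_mem (hF : C.IsAdmissible F) {i : ℕ} {y : C.V.T}
    (hy : y ∈ wordFilt (fun j => (F j).carrier) i) :
    C.wordSgn y ∈ wordFilt (fun j => (F j).carrier) i := by
  rw [wordSgn_apply]
  exact neg_mem (Grading.sgn_mem (wordFiltSub_graded (g := C.g.shift 1) (F := F)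
    (fun i => Grading.isGraded_shift (hF.graded i) 1) i) 1 hy)

theorem genSgn_mem (hF : C.IsAdmissible F) {i : ℕ} {v : C.V} (hv : v ∈ (F i).carrier) :
    C.genSgn v ∈ (F i).carrier := by
  have : C.genSgn v = -C.g.sgn 1 v := Grading.sgn_shift_odd odd_one v
  rw [this]
  exact neg_mem (Grading.sgn_mem (hF.graded i) 1 hv)

theorem IsTail.splitting_mem (hF : C.IsAdmissible F) (h : C.IsTail τ ψ) {i : ℕ} {y : C.V.T}
    (hy : y ∈ wordFilt (fun j => (F j).carrier) i) : C.splitting (τ y) ∈ firstFilt F (i - 1) := by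
  refine wordFilt_induction (fun i => (firstFilt F (i - 1)).comap (C.splitting.lin ∘ₗ τ))
    (fun i v hv => ?_) (fun i j v x hv hx _ => ?_) hy
  · rw [Submodule.mem_comap, LinearMap.comp_apply, h.splitting_letter]
    exact zero_mem _
  · rw [Submodule.mem_comap, LinearMap.comp_apply]
    rcases Nat.eq_zero_or_pos j with rfl | hj
    · rw [wordFilt_zero hF.zero, Submodule.mem_bot] at hx
      simp [hx]
    · rw [h.splitting_cons]
      exact firstFilt_mono hF.monotone (by omega)
        (cons_mem_firstFilt (letter_mem_wordFilt (genSgn_mem hF hv)) _)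

theorem IsTail.splitting_mulT_mem (hF : C.IsAdmissible F) (h : C.IsTail τ ψ) {i : ℕ} {y : C.V.T}
    (hy : y ∈ wordFilt (fun j => (F j).carrier) i) (x : C.V.T) :
    C.V.T.cons (tmul _ _ (C.wordSgn y) (τ x)) + C.splitting (τ (C.V.mulT (tmul _ _ y x))) ∈
      firstFilt F i := by
  refine add_mem (cons_mem_firstFilt (wordSgn_mem hF hy) _) ?_
  refine wordFilt_induction (fun i => (firstFilt F i).comap (C.splitting.lin ∘ₗ τ ∘ₗ
    C.V.mulT.lin ∘ₗ (tmul _ _).flip x)) (fun i v hv => ?_) (fun i j v y hv hy _ => ?_) hy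
  · simp only [Submodule.mem_comap, LinearMap.comp_apply, LinearMap.flip_apply]
    rw [mulT_letter, h.splitting_cons]
    exact cons_mem_firstFilt (letter_mem_wordFilt (genSgn_mem hF hv)) _
  · simp only [Submodule.mem_comap, LinearMap.comp_apply, LinearMap.flip_apply]
    rw [mulT_cons, h.splitting_cons]
    exact firstFilt_mono hF.monotone (Nat.le_add_right i j)
      (cons_mem_firstFilt (letter_mem_wordFilt (genSgn_mem hF hv)) _)

variable (C) in
/-- The failure of the map `splitting` to be a contraction of the kernel of the projection to
words consisting of a single letter. -/
def splittingErr : SBimod.Hom C.V.T.T C.V.T.T :=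
  SBimod.Hom.id _ + -(C.barCobarD.comp C.splitting + C.splitting.comp C.barCobarD) +
    -(C.V.T.letter.comp (C.V.letter.comp (C.V.fst.comp C.V.T.fst)))

theorem splittingErr_apply (z : C.V.T.T) : C.splittingErr z =
    z - (C.barCobarD (C.splitting z) + C.splitting (C.barCobarD z)) -
      C.V.T.letter (C.V.letter (C.V.fst (C.V.T.fst z))) := by
  rw [sub_eq_add_neg, sub_eq_add_neg]
  rfl

theorem wordD_mem (hF : C.IsAdmissible F) {i : ℕ} {v : C.V} (hv : v ∈ (F i).carrier) :
    C.wordD (C.V.letter v) ∈ wordFilt (fun j => (F j).carrier) i := by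
  rw [wordD, cobarD_letter]
  exact hF.cobarGen_mem hv

/-- On the image of `τ`, the failure of `splitting` to be a homotopy lowers the filtration degree of
the word of `C[1]` that is being split. -/
theorem IsTail.splittingErr_mem (hF : C.IsAdmissible F) (h : C.IsTail τ ψ)
    (hψ : ∀ v, τ (C.V.letter v) - C.splitting (ψ (C.V.letter v)) =
      C.V.T.letter (C.V.letter (C.V.fst (C.V.T.fst (τ (C.V.letter v))))))
    (hτ : ∀ v x, C.V.fst (C.V.T.fst (τ (C.V.cons (tmul _ _ v x)))) = 0) {i : ℕ} {y : C.V.T}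
    (hy : y ∈ wordFilt (fun j => (F j).carrier) i) : C.splittingErr (τ y) ∈ firstFilt F (i - 1) := by
  refine wordFilt_induction (fun i => (firstFilt F (i - 1)).comap (C.splittingErr.lin ∘ₗ τ))
    (fun i v hv => ?_) (fun i j v x hv hx _ => ?_) hy
  · rw [Submodule.mem_comap, LinearMap.comp_apply, splittingErr_apply, h.splitting_letter, map_zero,
      zero_add, h.barCobarD, map_add, map_neg, ← hψ]
    have := h.splitting_mem hF (wordD_mem hF hv)
    convert this using 1
    abel
  · rw [Submodule.mem_comap, LinearMap.comp_apply]
    rcases Nat.eq_zero_or_pos j with rfl | hj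
    · rw [wordFilt_zero hF.zero, Submodule.mem_bot] at hx
      simp [hx]
    · rw [splittingErr_apply, h.homotopy, sub_sub_cancel, hτ, map_zero, map_zero, sub_zero]
      exact firstFilt_mono hF.monotone (by omega)
        (h.splitting_mulT_mem hF (wordD_mem hF hv) x)

theorem splittingErr_mem (hF : C.IsAdmissible F) {i : ℕ} {z : C.V.T.T}
    (hz : z ∈ firstFilt F i) : C.splittingErr z ∈ firstFilt F (i - 1) := by
  refine (Submodule.span_le.2 ?_ :
    firstFilt F i ≤ (firstFilt F (i - 1)).comap C.splittingErr.lin) hz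
  rintro _ ⟨y, hy, rfl | ⟨w, rfl⟩⟩
  · refine C.isTail_letter.splittingErr_mem hF (fun v => ?_) (fun v x => ?_) hy
    · rw [LinearMap.zero_apply, map_zero, sub_zero, fst_letter', fst_letter']
    · rw [fst_letter', fst_cons]
  · refine (C.isTail_cons w).splittingErr_mem hF (fun v => ?_) (fun v x => ?_) hy
    · simp only [LinearMap.comp_apply, LinearMap.flip_apply, LinearMap.add_apply,
        LinearMap.neg_apply, wordSgn_letter, map_neg, map_add, splitting_first_letter,
        splitting_cons_letter, genSgn_genSgn, fst_cons, map_zero]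
      abel
    · simp only [LinearMap.comp_apply, LinearMap.flip_apply, fst_cons, map_zero]

variable (C) in
/-- The projection `B Ω_∞ C → C` to words consisting of a single letter. -/
def unitProj : SBimod.Hom C.V.T.T C.V := C.V.fst.comp C.V.T.fst

theorem unitProj_d (z : C.V.T.T) : C.unitProj (C.barCobarD z) = C.Δ₁ (C.unitProj z) := by
  change C.V.fst (C.V.T.fst (C.barCobarD z)) = C.Δ₁ (C.V.fst (C.V.T.fst z))
  induction z using T_induction with
  | h0 => simp
  | ha x y hx hy => simp only [map_add, hx, hy]
  | h1 y => rw [barCobarD_letter, map_neg, fst_letter', map_neg, wordD, fst_cobarD, neg_neg,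
      fst_letter']
  | hc y z ih =>
    clear ih
    have h : C.V.fst (C.V.T.fst (AInf.first C.V.mulT (tmul _ _ (C.wordSgn y) z))) = 0 := by
      induction z using T_induction with
      | h0 => simp
      | ha x y hx hy => simp only [map_add, hx, hy, add_zero]
      | h1 x => rw [first_letter, fst_letter', fst_mulT]
      | hc x z _ => rw [first_cons, fst_cons, map_zero]
    rw [barCobarD_cons, map_add, map_sub, map_neg, fst_cons, fst_cons, fst_cons, map_add, map_sub,
      h]
    simp

theorem unitProj_splitting (z : C.V.T.T) : C.unitProj (C.splitting z) = 0 := by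
  change C.V.fst (C.V.T.fst (C.splitting z)) = 0
  induction z using T_induction with
  | h0 => simp
  | ha x y hx hy => simp only [map_add, hx, hy, add_zero]
  | h1 y =>
    induction y using T_induction with
    | h0 => simp
    | ha x y hx hy => simp only [map_add, hx, hy, add_zero]
    | h1 v => rw [splitting_letter_letter, map_zero, map_zero]
    | hc v x _ => rw [splitting_letter_cons, fst_cons, map_zero]
  | hc y z _ =>
    induction y using T_induction with
    | h0 => simp
    | ha x y hx hy => simp only [map_add, LinearMap.add_apply, hx, hy, add_zero]
    | h1 v => rw [splitting_cons_letter, map_zero, map_zero]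
    | hc v x _ => rw [splitting_cons_cons, fst_cons, map_zero]

theorem barCobarD_barCobarD (z : C.V.T.T) : C.barCobarD (C.barCobarD z) = 0 :=
  barD_barD C.cobar z

/-- For a cocomplete A∞-coalgebra, the projection `B Ω_∞ C → C` is a quasi-isomorphism. -/
theorem unitProj_quasiIso (hC : C.Cocomplete) : IsQuasiIso C.barCobarD C.Δ₁ C.unitProj := by
  obtain ⟨F, hF⟩ := hC
  refine isQuasiIso_of_nilpotent barCobarD_barCobarD unitProj_d
    (fun v => ⟨C.V.T.letter (C.V.letter v), ?_⟩)
    C.splitting unitProj_splitting (firstFilt F) (firstFilt_zero hF.zero)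
    (firstFilt_exhaust hF) fun i z hz hdz hz0 => ?_
  · change C.V.fst (C.V.T.fst (C.V.T.letter (C.V.letter v))) = v
    rw [fst_letter', fst_letter']
  · have h := splittingErr_mem hF hz
    rw [splittingErr_apply, hdz, map_zero, add_zero] at h
    change C.V.fst (C.V.T.fst z) = 0 at hz0
    rwa [hz0, map_zero, map_zero, sub_zero] at h

end AInfCoalg

end Unit

/-! ### The bar construction preserves quasi-isomorphisms -/

namespace SBimod

variable {V W : SBimod k S}

/-- The map of tensor algebras induced by a map of bimodules. -/
def mapWord (f : Hom V W) : Hom V.T W.T :=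
  recT (W.letter.comp f) 0 (W.cons.comp (tmap f (Hom.id _)))

theorem mapWord_letter (f : Hom V W) (v : V) : mapWord f (V.letter v) = W.letter (f v) :=
  recT_letter _ _ _ v

theorem mapWord_cons (f : Hom V W) (v : V) (x : V.T) : mapWord f (V.cons (tmul _ _ v x)) =
    W.cons (tmul _ _ (f v) (mapWord f x)) := by
  rw [mapWord, recT_cons]
  simp

theorem fst_mapWord (f : Hom V W) (x : V.T) : W.fst (mapWord f x) = f (V.fst x) := by
  induction x using T_induction with
  | h0 => simp
  | ha x y hx hy => simp only [map_add, hx, hy]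
  | h1 v => rw [mapWord_letter, fst_letter', fst_letter']
  | hc v x _ => rw [mapWord_cons, fst_cons, fst_cons, map_zero]

/-- The tensor powers of a map of bimodules. -/
def mapPow (f : Hom V W) : ∀ n, Hom (V.pow n) (W.pow n)
  | 0 => f
  | n + 1 => tmap f (mapPow f n)

theorem mapWord_inc (f : Hom V W) (n : ℕ) (w : V.pow n) :
    mapWord f (V.inc n w) = W.inc n (mapPow f n w) := by
  induction n with
  | zero => exact mapWord_letter f w
  | succ n ih =>
    refine hom_tensor_ext (V := V) (W := V.pow n) (f := (mapWord f).comp (V.inc (n + 1)))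
      (g := (W.inc (n + 1)).comp (mapPow f (n + 1))) (fun v w => ?_) w
    change mapWord f (V.inc (n + 1) (tmul V (V.pow n) v w)) =
      W.inc (n + 1) (tmul W (W.pow n) (f v) (mapPow f n w))
    rw [← cons_inc, mapWord_cons, ih, cons_inc]

theorem prj_mapWord (f : Hom V W) (n : ℕ) (x : V.T) :
    W.prj n (mapWord f x) = mapPow f n (V.prj n x) := by
  induction x using T_inc_induction with
  | h0 => simp
  | ha x y hx hy => simp only [map_add, hx, hy]
  | hi m w =>
    rw [mapWord_inc]
    by_cases h : m = n
    · subst h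
      rw [prj_inc_self, prj_inc_self]
    · rw [prj_inc_ne _ h, prj_inc_ne _ h, map_zero]

/-- The submodule of `T⁺ V` spanned by the words of length at most `i`. -/
def shortWords (V : SBimod k S) (i : ℕ) : Submodule k V.T :=
  ⨅ n, ⨅ (_ : i ≤ n), LinearMap.ker (V.prj n).lin

theorem mem_shortWords {i : ℕ} {x : V.T} : x ∈ shortWords V i ↔ ∀ n, i ≤ n → V.prj n x = 0 := by
  simp only [shortWords, Submodule.mem_iInf, LinearMap.mem_ker]

theorem shortWords_mono : Monotone (shortWords V) := fun _ _ hij _ hx =>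
  mem_shortWords.2 fun n hn => mem_shortWords.1 hx n (hij.trans hn)

theorem inc_mem_shortWords {n i : ℕ} (h : n < i) (w : V.pow n) : V.inc n w ∈ shortWords V i :=
  mem_shortWords.2 fun m hm => prj_inc_ne w (by omega)

theorem shortWords_induction {i : ℕ} (Q : Submodule k V.T)
    (h : ∀ n, n < i → ∀ w, V.inc n w ∈ Q) {x : V.T} (hx : x ∈ shortWords V i) : x ∈ Q := by
  obtain ⟨s, hs⟩ := Grading.eq_sum_inc x
  rw [hs]
  refine sum_mem fun n _ => ?_
  rcases lt_or_ge n i with hn | hn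
  · exact h n hn _
  · rw [mem_shortWords.1 hx n hn, map_zero]
    exact zero_mem _

theorem shortWords_zero : shortWords V 0 = ⊥ :=
  (Submodule.eq_bot_iff _).2 fun _ hx => (Submodule.mem_bot k).1
    (shortWords_induction ⊥ (fun n hn => absurd hn (Nat.not_lt_zero n)) hx)

theorem shortWords_exhaust (x : V.T) : ∃ i, x ∈ shortWords V i := by
  induction x using T_inc_induction with
  | h0 => exact ⟨0, zero_mem _⟩
  | ha x y hx hy =>
    obtain ⟨i, hi⟩ := hx
    obtain ⟨j, hj⟩ := hy
    exact ⟨max i j, add_mem (shortWords_mono (le_max_left _ _) hi)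
      (shortWords_mono (le_max_right _ _) hj)⟩
  | hi n w => exact ⟨n + 1, inc_mem_shortWords (Nat.lt_succ_self n) w⟩

theorem mem_shortWords_of_succ {i : ℕ} {x : V.T} (hx : x ∈ shortWords V (i + 1))
    (h : V.prj i x = 0) : x ∈ shortWords V i := mem_shortWords.2 fun n hn => by
  rcases hn.eq_or_lt with rfl | hn
  · exact h
  · exact mem_shortWords.1 hx n hn

theorem cons_mem_shortWords {i : ℕ} (v : V) {x : V.T} (hx : x ∈ shortWords V i) :
    V.cons (tmul _ _ v x) ∈ shortWords V (i + 1) := by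
  refine shortWords_induction
    ((shortWords V (i + 1)).comap (V.cons.lin ∘ₗ tmul V V.T v)) (fun n hn w => ?_) hx
  rw [Submodule.mem_comap, LinearMap.comp_apply, cons_inc]
  exact inc_mem_shortWords (by omega) _

end SBimod

namespace Cplx

/-- The differential of the tensor powers of a complex. -/
def dPow (X : Cplx k S) : ∀ n, SBimod.Hom (X.V.pow n) (X.V.pow n)
  | 0 => X.d
  | n + 1 => SBimod.tmap X.d (SBimod.Hom.id _) + SBimod.tmap (X.g.sgn 1) (dPow X n)

/-- The tensor powers of a complex. -/
def pow (X : Cplx k S) (n : ℕ) : Cplx k S where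
  V := X.V.pow n
  g := X.g.pow n
  d := X.dPow n
  d_homog := by
    induction n with
    | zero => exact X.d_homog
    | succ n ih =>
      exact (X.d_homog.tmap Grading.id_homog rfl).add (Grading.sgn_homog.tmap ih rfl)
  d_d := by
    have key : ∀ n, Grading.IsHomog (X.g.pow n) (X.g.pow n) (-1) (X.dPow n) ∧
        ∀ x, X.dPow n (X.dPow n x) = 0 := by
      intro n
      induction n with
      | zero => exact ⟨X.d_homog, X.d_d⟩
      | succ n ih =>
        exact ⟨(X.d_homog.tmap Grading.id_homog rfl).add (Grading.sgn_homog.tmap ih.1 rfl),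
          X.tensorD_tensorD (Y := ⟨X.V.pow n, X.g.pow n, X.dPow n, ih.1, ih.2⟩)⟩
    exact (key n).2

theorem mapPow_quasiIso (hS : IsSeparableAlg k S) {X Y : Cplx k S} {f : SBimod.Hom X.V Y.V}
    (hfg : Grading.IsHomog X.g Y.g 0 f) (hf : ∀ x, f (X.d x) = Y.d (f x))
    (hq : IsQuasiIso X.d Y.d f) (n : ℕ) :
    (∀ x, mapPow f n (X.dPow n x) = Y.dPow n (mapPow f n x)) ∧
      IsQuasiIso (X.dPow n) (Y.dPow n) (mapPow f n) := by
  induction n with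
  | zero => exact ⟨hf, hq⟩
  | succ n ih =>
    exact ⟨tmap_tensorD (X := X) (Y := X.pow n) (X' := Y) (Y' := Y.pow n) hfg hf ih.1,
      IsQuasiIso.tmap (X := X) (Y := X.pow n) (X' := Y) (Y' := Y.pow n) hS hfg hf ih.1 hq ih.2⟩

end Cplx

section BarMap

variable (A : DGAlg k S)

/-- The complex `A[-1]`. -/
def desuspension : Cplx k S where
  V := A.V
  g := A.g.shift (-1)
  d := -A.d
  d_homog := (shift_homog A.d_homog).neg
  d_d := fun x => by
    rw [SBimod.Hom.neg_apply, SBimod.Hom.neg_apply, map_neg, A.d_d, neg_zero, neg_zero]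

/-- Up to shorter words, the differential of the bar construction is that of the tensor powers
of `A[-1]`. -/
def barPowD (n : ℕ) : Hom (A.V.pow n) (A.V.pow n) := (desuspension A).dPow n

theorem inc_barPowD_tmul (n : ℕ) (a : A.V) (w : A.V.pow n) :
    A.V.inc (n + 1) (barPowD A (n + 1) (tmul A.V (A.V.pow n) a w)) =
      -A.V.cons (tmul _ _ (A.d a) (A.V.inc n w)) +
        A.V.cons (tmul _ _ (barSgn A a) (A.V.inc n (barPowD A n w))) := by
  rw [cons_inc, cons_inc]
  refine (map_add (A.V.inc (n + 1)).lin (tmul A.V (A.V.pow n) (-A.d a) w)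
    (tmul A.V (A.V.pow n) (barSgn A a) (barPowD A n w))).trans (congrArg (· + _) ?_)
  rw [map_neg, LinearMap.neg_apply]
  exact map_neg (A.V.inc (n + 1)).lin _

/-- The differential of `B A` is, up to words with fewer letters, that of the tensor power
of `A`. -/
theorem barD_inc (n : ℕ) (w : A.V.pow n) :
    barD A (A.V.inc n w) - A.V.inc n (barPowD A n w) ∈ shortWords A.V n := by
  induction n with
  | zero =>
    have : barD A (A.V.inc 0 w) = A.V.inc 0 (barPowD A 0 w) :=
      (barD_letter A w).trans (map_neg A.V.letter.lin (A.d w)).symm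
    rw [this, sub_self]
    exact zero_mem _
  | succ n ih =>
    refine tensor_induction (V := A.V) (W := A.V.pow n) (p := fun w => barD A (A.V.inc (n + 1) w) -
      A.V.inc (n + 1) (barPowD A (n + 1) w) ∈ shortWords A.V (n + 1)) ?_ (fun x y hx hy => ?_)
      (fun a w => ?_) w
    · have h : ∀ x : A.V.pow (n + 1), x = 0 → barD A (A.V.inc (n + 1) x) -
          A.V.inc (n + 1) (barPowD A (n + 1) x) = 0 := fun x hx => by simp [hx]
      have h0 := h 0 rfl
      exact (congrArg (· ∈ shortWords A.V (n + 1)) h0).mpr (zero_mem _)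
    · have h : ∀ x y : A.V.pow (n + 1), barD A (A.V.inc (n + 1) (x + y)) -
          A.V.inc (n + 1) (barPowD A (n + 1) (x + y)) = (barD A (A.V.inc (n + 1) x) -
          A.V.inc (n + 1) (barPowD A (n + 1) x)) + (barD A (A.V.inc (n + 1) y) -
          A.V.inc (n + 1) (barPowD A (n + 1) y)) := fun x y => by
        simp only [map_add]
        abel
      exact (congrArg (· ∈ shortWords A.V (n + 1)) (h x y)).mpr (add_mem hx hy)
    · have h1 : first A.mul (tmul _ _ (barSgn A a) (A.V.inc n w)) ∈ shortWords A.V (n + 1) := by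
        have : first A.mul (tmul _ _ (barSgn A a) (A.V.inc n w)) =
            A.V.inc n (firstPow A.mul n (tmul _ _ (barSgn A a) w)) :=
          dliftRight_ι (fun n => (A.V.inc n).comp (firstPow A.mul n)) _ n w
        rw [this]
        exact inc_mem_shortWords (Nat.lt_succ_self n) _
      have h2 := cons_mem_shortWords (barSgn A a) (ih w)
      rw [inc_barPowD_tmul, ← cons_inc, barD_cons]
      rw [map_sub, map_sub] at h2
      convert sub_mem h2 h1 using 1
      abel

theorem barD_inc_mem {n i : ℕ} (h : n < i) (w : A.V.pow n) :
    barD A (A.V.inc n w) ∈ shortWords A.V i := by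
  have := add_mem (shortWords_mono h.le (barD_inc A n w)) (inc_mem_shortWords h (barPowD A n w))
  rwa [sub_add_cancel] at this

theorem barD_mem_shortWords {i : ℕ} {x : A.V.T} (hx : x ∈ shortWords A.V i) :
    barD A x ∈ shortWords A.V i :=
  shortWords_induction ((shortWords A.V i).comap (barD A).lin)
    (fun _ hn w => barD_inc_mem A hn w) hx

theorem prj_barD {i : ℕ} {x : A.V.T} (hx : x ∈ shortWords A.V (i + 1)) :
    A.V.prj i (barD A x) = barPowD A i (A.V.prj i x) := by
  refine shortWords_induction (LinearMap.eqLocus ((A.V.prj i).lin ∘ₗ (barD A).lin)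
    ((barPowD A i).lin ∘ₗ (A.V.prj i).lin)) (fun n hn w => ?_) hx
  change A.V.prj i (barD A (A.V.inc n w)) = barPowD A i (A.V.prj i (A.V.inc n w))
  rcases (Nat.lt_succ_iff.1 hn).eq_or_lt with rfl | hn
  · have := mem_shortWords.1 (barD_inc A n w) n le_rfl
    rw [map_sub, sub_eq_zero, prj_inc_self] at this
    rw [this, prj_inc_self]
  · rw [mem_shortWords.1 (barD_inc_mem A hn w) i le_rfl, prj_inc_ne _ hn.ne, map_zero]

variable {A} {A' : DGAlg k S}

theorem mapWord_barD (F : DGAlg.Hom A A') (x : A.V.T) :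
    mapWord F.f (barD A x) = barD A' (mapWord F.f x) := by
  have h1 : ∀ a y, mapWord F.f (first A.mul (tmul _ _ a y)) =
      first A'.mul (tmul _ _ (F.f a) (mapWord F.f y)) := by
    intro a y
    induction y using T_induction with
    | h0 => simp
    | ha x y hx hy => simp only [map_add, hx, hy]
    | h1 b => rw [first_letter, mapWord_letter, F.map_mul, mapWord_letter, first_letter]
    | hc b y _ => rw [first_cons, mapWord_cons, F.map_mul, mapWord_cons, first_cons]
  have h2 : ∀ a, barSgn A' (F.f a) = F.f (barSgn A a) :=
    Grading.sgn_comm (shift_homog F.homog)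
  induction x using T_induction with
  | h0 => simp
  | ha x y hx hy => simp only [map_add, hx, hy]
  | h1 a => rw [barD_letter, mapWord_letter, barD_letter, map_neg, mapWord_letter, F.map_d]
  | hc a x hx =>
    rw [barD_cons, mapWord_cons, barD_cons, map_add, map_sub, map_neg, mapWord_cons, mapWord_cons,
      h1, hx, h2, F.map_d]

/-- The bar construction preserves quasi-isomorphisms. -/
theorem mapWord_quasiIso (hS : IsSeparableAlg k S) {F : DGAlg.Hom A A'} (hF : F.QuasiIso) :
    IsQuasiIso (barD A) (barD A') (mapWord F.f) := by
  have hq : IsQuasiIso (desuspension A).d (desuspension A').d F.f := by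
    refine ⟨fun x hx => ?_, fun y hy => ?_⟩
    · rintro ⟨y, hy⟩
      obtain ⟨x', rfl⟩ := hF.1 x (neg_eq_zero.1 hx) ⟨-y, (map_neg A'.d.lin y).trans hy⟩
      exact ⟨-x', show -A.d (-x') = A.d x' by rw [map_neg, neg_neg]⟩
    · obtain ⟨x, y', hx, rfl⟩ := hF.2 y (neg_eq_zero.1 hy)
      exact ⟨x, -y', neg_eq_zero.2 hx,
        congrArg (F.f x + ·) (show -A'.d (-y') = A'.d y' by rw [map_neg, neg_neg])⟩
  have hp := Cplx.mapPow_quasiIso (X := desuspension A) (Y := desuspension A') hS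
    (f := F.f) (shift_homog F.homog)
    (fun x => (map_neg F.f.lin (A.d x)).trans (congrArg _ (F.map_d x))) hq
  refine isQuasiIso_of_filtered (barD_barD A) (barD_barD A') (mapWord_barD F)
    (shortWords A.V) (shortWords A'.V) shortWords_zero shortWords_zero (fun x y => ?_)
    fun i x hx y hy hdx hxy => ?_
  · obtain ⟨i, hi⟩ := shortWords_exhaust x
    obtain ⟨j, hj⟩ := shortWords_exhaust y
    exact ⟨max i j, shortWords_mono (le_max_left _ _) hi, shortWords_mono (le_max_right _ _) hj⟩
  · have h1 : barPowD A i (A.V.prj i x) = 0 := by rw [← prj_barD A hx, hdx, map_zero]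
    have h2 : mapPow F.f i (A.V.prj i x) = barPowD A' i (A'.V.prj i y) := by
      rw [← prj_mapWord, hxy, prj_barD A' hy]
    obtain ⟨x', y', hx', hy'⟩ := (isQuasiIso_iff_cone (d := barPowD A i) (d' := barPowD A' i)
      (hp i).1).1 (hp i).2 _ _ h1 h2
    have hx1 := inc_mem_shortWords (Nat.lt_succ_self i) x'
    have hy1 := inc_mem_shortWords (Nat.lt_succ_self i) y'
    refine ⟨A.V.inc i x', A'.V.inc i y', mem_shortWords_of_succ
      (sub_mem hx (barD_mem_shortWords A hx1)) ?_, mem_shortWords_of_succ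
      (sub_mem (sub_mem hy ?_) (barD_mem_shortWords A' hy1)) ?_⟩
    · rw [map_sub, prj_barD A hx1, prj_inc_self, hx', sub_self]
    · rw [mapWord_inc]
      exact inc_mem_shortWords (Nat.lt_succ_self i) _
    · rw [map_sub, map_sub, prj_mapWord, prj_barD A' hy1, prj_inc_self, prj_inc_self, sub_sub]
      exact sub_eq_zero.2 hy'.symm

end BarMap

/-- A weak equivalence between cocomplete A∞-coalgebras is a quasi-isomorphism. -/
theorem AInfCoalg.Hom.WeakEquiv.quasiIso (hS : IsSeparableAlg k S) {C C' : AInfCoalg k S}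
    (hC : C.Cocomplete) (hC' : C'.Cocomplete) {f : AInfCoalg.Hom C C'} (hf : f.WeakEquiv) :
    f.QuasiIso := by
  have h1 : IsQuasiIso C.barCobarD C'.barCobarD (mapWord f.mapT) := mapWord_quasiIso hS hf
  have hd : ∀ x, mapWord f.mapT (C.barCobarD x) = C'.barCobarD (mapWord f.mapT x) :=
    mapWord_barD f.Ωmap
  have h2 : f.lin.comp C.unitProj = C'.unitProj.comp (mapWord f.mapT) :=
    SBimod.Hom.ext' fun x => by
      change f.lin (C.V.fst (C.V.T.fst x)) = C'.V.fst (C'.V.T.fst (mapWord f.mapT x))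
      rw [fst_mapWord, AInfCoalg.Hom.fst_mapT]
  refine IsQuasiIso.of_comp_left (d := C.barCobarD) ?_ (AInfCoalg.unitProj_quasiIso hC)
    AInfCoalg.unitProj_d f.lin_Δ₁
  rw [h2]
  exact (AInfCoalg.unitProj_quasiIso hC').comp h1 hd AInfCoalg.unitProj_d

/-! ### Direct sums of two bimodules -/

namespace SBimod

/-- The direct sum of two bimodules. -/
def prod (V W : SBimod k S) : SBimod k S where
  carrier := V × W
  l := AlgHom.ofLinearMap
    { toFun := fun s => LinearMap.prodMap (V.l s) (W.l s)
      map_add' := fun a b => LinearMap.ext fun x => by simp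
      map_smul' := fun a b => LinearMap.ext fun x => by simp }
    (LinearMap.ext fun x => by simp) (fun a b => LinearMap.ext fun x => by simp)
  r := AlgHom.ofLinearMap
    { toFun := fun s => LinearMap.prodMap (V.r s) (W.r s)
      map_add' := fun a b => LinearMap.ext fun x => by simp
      map_smul' := fun a b => LinearMap.ext fun x => by simp }
    (LinearMap.ext fun x => by simp) (fun a b => LinearMap.ext fun x => by simp)
  comm := fun s t x => Prod.ext (V.comm s t x.1) (W.comm s t x.2)

variable {V W X : SBimod k S}

/-- The inclusion of the first summand. -/
def inl (V W : SBimod k S) : Hom V (V.prod W) :=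
  ⟨LinearMap.inl k V W, fun s _ => Prod.ext rfl (map_zero (W.l s)).symm,
    fun s _ => Prod.ext rfl (map_zero (W.r s)).symm⟩

/-- The inclusion of the second summand. -/
def inr (V W : SBimod k S) : Hom W (V.prod W) :=
  ⟨LinearMap.inr k V W, fun s _ => Prod.ext (map_zero (V.l s)).symm rfl,
    fun s _ => Prod.ext (map_zero (V.r s)).symm rfl⟩

/-- The projection to the first summand. -/
def projl (V W : SBimod k S) : Hom (V.prod W) V :=
  ⟨LinearMap.fst k V W, fun _ _ => rfl, fun _ _ => rfl⟩

/-- The projection to the second summand. -/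
def projr (V W : SBimod k S) : Hom (V.prod W) W :=
  ⟨LinearMap.snd k V W, fun _ _ => rfl, fun _ _ => rfl⟩

theorem projl_inl (v : V) : projl V W (inl V W v) = v := rfl
theorem projl_inr (w : W) : projl V W (inr V W w) = 0 := rfl
theorem projr_inl (v : V) : projr V W (inl V W v) = 0 := rfl
theorem projr_inr (w : W) : projr V W (inr V W w) = w := rfl

theorem inl_add_inr (x : V.prod W) : inl V W (projl V W x) + inr V W (projr V W x) = x :=
  Prod.ext (add_zero _) (zero_add _)

theorem prod_ext {x y : V.prod W} (h1 : projl V W x = projl V W y)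
    (h2 : projr V W x = projr V W y) : x = y := Prod.ext h1 h2

/-- The grading of a direct sum. -/
def Grading.prod (g : Grading V) (h : Grading W) : Grading (V.prod W) where
  gr := fun n => (g.gr n).comap (projl V W).lin ⊓ (h.gr n).comap (projr V W).lin
  l_mem := fun n s x hx => ⟨g.l_mem n s _ hx.1, h.l_mem n s _ hx.2⟩
  r_mem := fun n s x hx => ⟨g.r_mem n s _ hx.1, h.r_mem n s _ hx.2⟩
  internal := by
    let ρ : V.prod W →ₗ[k] (ℤ →₀ V.prod W) :=
      Finsupp.mapRange.linearMap (inl V W).lin ∘ₗ g.comps ∘ₗ (projl V W).lin +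
        Finsupp.mapRange.linearMap (inr V W).lin ∘ₗ h.comps ∘ₗ (projr V W).lin
    have hρ : ∀ x n, ρ x n = inl V W (g.comps (projl V W x) n) +
      inr V W (h.comps (projr V W x) n) := fun x n => rfl
    refine isInternal_of_components _ ρ ?_ ?_ ?_
    · intro x
      have : ρ x = Finsupp.mapRange.linearMap (inl V W).lin (g.comps (projl V W x)) +
        Finsupp.mapRange.linearMap (inr V W).lin (h.comps (projr V W x)) := rfl
      rw [this, Finsupp.sum_add_index' (fun _ => rfl) (fun _ _ _ => rfl),
        Finsupp.mapRange.linearMap_apply, Finsupp.mapRange.linearMap_apply,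
        Finsupp.sum_mapRange_index (fun _ => rfl), Finsupp.sum_mapRange_index (fun _ => rfl)]
      conv_rhs => rw [← inl_add_inr x, ← g.comps_sum (projl V W x), ← h.comps_sum (projr V W x)]
      simp only [Finsupp.sum, map_sum]
    · intro n x hx
      ext1 m
      rw [hρ, comps_of_mem hx.1, comps_of_mem hx.2]
      by_cases hmn : m = n
      · subst hmn
        rw [Finsupp.single_eq_same, Finsupp.single_eq_same, Finsupp.single_eq_same]
        exact inl_add_inr x
      · rw [Finsupp.single_eq_of_ne hmn, Finsupp.single_eq_of_ne hmn, Finsupp.single_eq_of_ne hmn,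
          map_zero, map_zero, add_zero]
    · intro x n
      rw [hρ]
      refine ⟨?_, ?_⟩
      · change projl V W (inl V W _ + inr V W _) ∈ g.gr n
        rw [map_add, projl_inl, projl_inr, add_zero]
        exact g.comps_mem _ n
      · change projr V W (inl V W _ + inr V W _) ∈ h.gr n
        rw [map_add, projr_inl, projr_inr, zero_add]
        exact h.comps_mem _ n

namespace Grading

variable {g : Grading V} {h : Grading W}

theorem inl_homog : IsHomog g (g.prod h) 0 (inl V W) := fun n x hx =>
  ⟨by rw [add_zero]; exact hx, zero_mem (h.gr (n + 0))⟩

theorem inr_homog : IsHomog h (g.prod h) 0 (inr V W) := fun n x hx =>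
  ⟨zero_mem (g.gr (n + 0)), by rw [add_zero]; exact hx⟩

theorem projl_homog : IsHomog (g.prod h) g 0 (projl V W) := fun n x hx => by
  rw [add_zero]; exact hx.1

theorem projr_homog : IsHomog (g.prod h) h 0 (projr V W) := fun n x hx => by
  rw [add_zero]; exact hx.2

end Grading

/-- The unit element of `S`, as an element of the bimodule `S`. -/
def one (k S : Type u) [Field k] [Ring S] [Algebra k S] : unit k S := (1 : S)

/-- The isomorphism `V → V ⊗ S`. -/
def rightUnit (V : SBimod k S) : Hom V (V.tensor (unit k S)) where
  lin := (tmul V (unit k S)).flip (one k S)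
  map_l := fun s x => rfl
  map_r := fun s x => by
    refine (tmul_balanced x s.unop (one k S)).trans (congrArg (tmul V (unit k S) x) ?_)
    exact (mul_one s.unop).trans (one_mul s.unop).symm

/-- The isomorphism `V → S ⊗ V`. -/
def leftUnit (V : SBimod k S) : Hom V ((unit k S).tensor V) where
  lin := tmul (unit k S) V (one k S)
  map_l := fun s x => by
    refine (tmul_balanced (one k S) s x).symm.trans (congrArg (tmul (unit k S) V · x) ?_)
    exact (one_mul s).trans (mul_one s).symm
  map_r := fun s x => rfl

theorem rightUnit_apply (v : V) : rightUnit V v = tmul _ _ v (one k S) := rfl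
theorem leftUnit_apply (v : V) : leftUnit V v = tmul _ _ (one k S) v := rfl

theorem unitL_one (v : V) : unitL V (tmul _ _ (one k S) v) = v := by
  change V.l 1 v = v
  rw [map_one]
  rfl

/-- The canonical map `V ⊗ S → V`. -/
def unitR (V : SBimod k S) : Hom (V.tensor (unit k S)) V :=
  lift ((V.r.toLinearMap ∘ₗ (MulOpposite.opLinearEquiv k).toLinearMap).flip)
    (fun v (s : S) (t : S) => by
      change V.r (MulOpposite.op t) (V.r (MulOpposite.op s) v) = V.r (MulOpposite.op (s * t)) v
      rw [MulOpposite.op_mul, map_mul]; rfl)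
    (fun s v (t : S) => (V.comm s (MulOpposite.op t) v).symm)
    (fun s v (t : S) => by
      change V.r (MulOpposite.op (t * s.unop)) v = V.r s (V.r (MulOpposite.op t) v)
      rw [MulOpposite.op_mul, map_mul]; rfl)

theorem unitR_one (v : V) : unitR V (tmul _ _ v (one k S)) = v := by
  change V.r (MulOpposite.op 1) v = v
  rw [MulOpposite.op_one, map_one]
  rfl

theorem rightUnit_unitR (t : V.tensor (unit k S)) : rightUnit V (unitR V t) = t := by
  refine hom_tensor_ext (f := (rightUnit V).comp (unitR V)) (g := Hom.id _) (fun v (s : S) => ?_) t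
  exact (tmul_balanced v s (one k S)).trans (congrArg (tmul V (unit k S) v) (mul_one s))

theorem unitR_homog {g : Grading V} :
    Grading.IsHomog (g.tensor (unitG k S)) g 0 (unitR V) :=
  Grading.isHomog_tensor fun i j v s hv hs => by
    change s ∈ (if j = 0 then ⊤ else ⊥ : Submodule k (unit k S)) at hs
    split_ifs at hs with h
    · subst h
      rw [add_zero, add_zero]
      exact g.r_mem i _ v hv
    · rw [Submodule.mem_bot] at hs
      rw [hs, map_zero, map_zero]
      exact zero_mem _

theorem one_mem : one k S ∈ (unitG k S).gr 0 := by
  change one k S ∈ (if (0 : ℤ) = 0 then ⊤ else ⊥ : Submodule k (unit k S))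
  rw [if_pos rfl]
  trivial

theorem rightUnit_homog {g : Grading V} :
    Grading.IsHomog g (g.tensor (unitG k S)) 0 (rightUnit V) := fun _ _ hv =>
  Grading.tmul_mem hv one_mem

theorem leftUnit_homog {g : Grading V} :
    Grading.IsHomog g ((unitG k S).tensor g) 0 (leftUnit V) := fun n v hv => by
  rw [add_comm]
  exact Grading.tmul_mem one_mem hv

theorem unitG_sgn (s : unit k S) : (unitG k S).sgn 1 s = s := by
  have : s ∈ (unitG k S).gr 0 := by
    change s ∈ (if (0 : ℤ) = 0 then ⊤ else ⊥ : Submodule k (unit k S))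
    rw [if_pos rfl]
    trivial
  rw [Grading.sgn_of_mem this]
  simp

end SBimod

/-! ### The bar resolution -/

namespace BarRes

variable (A : DGAlg k S)

/-- The bimodule `S ⊕ B A ⊕ B A` underlying the bar resolution `A⁺ ⊗ (S ⊕ B A)`. The last summand
stands for `A ⊗ (S ⊕ B A)`, whose elements `a ⊗ 1` and `a ⊗ [w]` are written `[a]` and `[a|w]`. -/
def V : SBimod k S := (unit k S).prod (A.V.T.prod A.V.T)

/-- The grading of the bar resolution. -/
def g : Grading (V A) := (unitG k S).prod ((barG A).prod ((barG A).shift 1))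

/-- The inclusion of `S`. -/
def iS : Hom (unit k S) (V A) := inl _ _
/-- The inclusion of `B A`. -/
def iW : Hom A.V.T (V A) := (inr _ _).comp (inl _ _)
/-- The inclusion of `A ⊗ (S ⊕ B A)`. -/
def iU : Hom A.V.T (V A) := (inr _ _).comp (inr _ _)
/-- The projection to `S`. -/
def pS : Hom (V A) (unit k S) := projl _ _
/-- The projection to `B A`. -/
def pW : Hom (V A) A.V.T := (projl _ _).comp (projr _ _)
/-- The projection to `A ⊗ (S ⊕ B A)`. -/
def pU : Hom (V A) A.V.T := (projr _ _).comp (projr _ _)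

@[simp] theorem pS_iS (s) : pS A (iS A s) = s := rfl
@[simp] theorem pS_iW (w) : pS A (iW A w) = 0 := rfl
@[simp] theorem pS_iU (u) : pS A (iU A u) = 0 := rfl
@[simp] theorem pW_iS (s) : pW A (iS A s) = 0 := rfl
@[simp] theorem pW_iW (w) : pW A (iW A w) = w := rfl
@[simp] theorem pW_iU (u) : pW A (iU A u) = 0 := rfl
@[simp] theorem pU_iS (s) : pU A (iS A s) = 0 := rfl
@[simp] theorem pU_iW (w) : pU A (iW A w) = 0 := rfl
@[simp] theorem pU_iU (u) : pU A (iU A u) = u := rfl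

variable {A} in
theorem eq_add (x : V A) : x = iS A (pS A x) + (iW A (pW A x) + iU A (pU A x)) := by
  refine (inl_add_inr x).symm.trans (congrArg (iS A (pS A x) + ·) ?_)
  refine (congrArg (inr _ _) (inl_add_inr (projr _ _ x)).symm).trans ?_
  exact map_add (inr (unit k S) (A.V.T.prod A.V.T)).lin _ _

variable {A} in
theorem induction {p : V A → Prop} (ha : ∀ x y, p x → p y → p (x + y)) (hS : ∀ s, p (iS A s))
    (hW : ∀ w, p (iW A w)) (hU : ∀ u, p (iU A u)) (x : V A) : p x := by
  rw [eq_add x]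
  exact ha _ _ (hS _) (ha _ _ (hW _) (hU _))

/-- The differential of the bar resolution. -/
def d : Hom (V A) (V A) :=
  (iW A).comp ((barD A).comp (pW A)) +
    -((iU A).comp (pW A) + (iU A).comp ((barD A).comp (pU A)))

@[simp] theorem d_iS (s) : d A (iS A s) = 0 := by simp [d]
@[simp] theorem d_iW (w) : d A (iW A w) = iW A (barD A w) - iU A w := by
  simp [d, sub_eq_add_neg]
@[simp] theorem d_iU (u) : d A (iU A u) = -iU A (barD A u) := by simp [d]

theorem pS_d (x) : pS A (d A x) = 0 := by simp [d]

/-- The action of `A` on the bar resolution. -/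
def act : Hom (A.V.tensor (V A)) (V A) :=
  (iU A).comp (A.V.letter.comp ((unitR A.V).comp (tmap (Hom.id _) (pS A))) +
    A.V.cons.comp (tmap (Hom.id _) (pW A)) + (first A.mul).comp (tmap (Hom.id _) (pU A)))

@[simp] theorem act_iS (a s) : act A (tmul _ _ a (iS A s)) =
    iU A (A.V.letter (unitR A.V (tmul _ _ a s))) := by simp [act]
@[simp] theorem act_iW (a w) : act A (tmul _ _ a (iW A w)) = iU A (A.V.cons (tmul _ _ a w)) := by
  simp [act]
@[simp] theorem act_iU (a u) : act A (tmul _ _ a (iU A u)) =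
    iU A (first A.mul (tmul _ _ a u)) := by simp [act]

theorem iS_homog : Grading.IsHomog (unitG k S) (g A) 0 (iS A) := Grading.inl_homog
theorem iW_homog : Grading.IsHomog (barG A) (g A) 0 (iW A) :=
  Grading.inr_homog.comp Grading.inl_homog rfl
theorem iU_homog : Grading.IsHomog ((barG A).shift 1) (g A) 0 (iU A) :=
  Grading.inr_homog.comp Grading.inr_homog rfl
theorem iU_homog' : Grading.IsHomog (barG A) (g A) (-1) (iU A) := fun n x hx => by
  have := iU_homog A (n + -1) x (show x ∈ (barG A).gr (n + -1 + 1) by rwa [neg_add_cancel_right])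
  rwa [add_zero] at this
theorem pS_homog : Grading.IsHomog (g A) (unitG k S) 0 (pS A) := Grading.projl_homog
theorem pW_homog : Grading.IsHomog (g A) (barG A) 0 (pW A) :=
  Grading.projl_homog.comp Grading.projr_homog rfl
theorem pU_homog : Grading.IsHomog (g A) ((barG A).shift 1) 0 (pU A) :=
  Grading.projr_homog.comp Grading.projr_homog rfl
theorem pU_homog' : Grading.IsHomog (g A) (barG A) 1 (pU A) := fun n x hx => by
  have := pU_homog A n x hx
  rw [add_zero] at this
  exact this

theorem d_homog : Grading.IsHomog (g A) (g A) (-1) (d A) :=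
  ((iW_homog A).comp ((barD_homog A).comp (pW_homog A) rfl) rfl).add
    (((iU_homog' A).comp (pW_homog A) rfl).add
      ((iU_homog' A).comp ((barD_homog A).comp (pU_homog' A) rfl) rfl)).neg

/-- The identity map `A → A[-1]` has degree one. -/
theorem shift_id_homog : Grading.IsHomog A.g (A.g.shift (-1)) 1 (Hom.id A.V) := fun n x hx => by
  change x ∈ A.g.gr (n + 1 + -1)
  rwa [add_neg_cancel_right]

theorem act_homog : Grading.IsHomog (A.g.tensor (g A)) (g A) 0 (act A) := by
  refine (iU_homog' A).comp (e := 1) (Grading.IsHomog.add (Grading.IsHomog.add ?_ ?_) ?_) rfl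
  · exact Grading.letter_homog.comp (unitR_homog.comp
      ((shift_id_homog A).tmap (pS_homog A) rfl) rfl) rfl
  · exact Grading.cons_homog.comp ((shift_id_homog A).tmap (pW_homog A) rfl) rfl
  · exact (first_homog' A).comp ((shift_id_homog A).tmap (pU_homog' A) rfl) rfl

/-- The bar resolution of `S`. -/
def P : DGMod A where
  V := V A
  g := g A
  act := act A
  d := d A
  act_act := fun a b x => by
    induction x using induction with
    | ha x y hx hy => simp only [map_add, hx, hy]
    | hS s =>
      rw [act_iS, act_iS, act_iU, first_letter]
      congr 2
      exact A.mul.map_r (MulOpposite.op (s : S)) (tmul _ _ a b) |>.symm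
    | hW w => rw [act_iW, act_iW, act_iU, first_cons]
    | hU u => rw [act_iU, act_iU, act_iU, first_first]
  act_homog := act_homog A
  d_homog := d_homog A
  d_d := fun x => by
    induction x using induction with
    | ha x y hx hy => simp only [map_add, hx, hy, add_zero]
    | hS s => simp
    | hW w => simp [barD_barD]
    | hU u => simp [barD_barD]
  leibniz := fun a x => by
    have ht : A.g.sgn 1 a = -barSgn A a := by rw [barSgn_apply, neg_neg]
    rw [ht]
    induction x using induction with
    | ha x y hx hy =>
      simp only [map_add, hx, hy]
      abel
    | hS s =>
      have : unitR A.V (tmul _ _ (A.d a) s) = A.d (unitR A.V (tmul _ _ a s)) :=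
        (A.d.map_r (MulOpposite.op (s : S)) a).symm
      rw [act_iS, d_iU, barD_letter, act_iS, this]
      simp
    | hW w =>
      rw [act_iW, d_iU, barD_cons, act_iW, d_iW, map_sub, map_sub, act_iW, act_iU]
      simp only [map_add, map_sub, map_neg, LinearMap.neg_apply]
      abel
    | hU u =>
      rw [act_iU, d_iU, barD_first, act_iU, d_iU, map_neg, map_neg, act_iU]
      simp only [map_sub, map_neg, LinearMap.neg_apply]
      abel

/-- The augmentation of the bar resolution. -/
def ε : DGMod.Hom (P A) (DGMod.trivial A) where
  f := pS A
  homog := pS_homog A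
  map_act := fun a x => by
    induction x using induction with
    | ha x y hx hy =>
      change pS A (act A (tmul _ _ a (x + y))) = 0
      change pS A (act A (tmul _ _ a x)) = 0 at hx
      change pS A (act A (tmul _ _ a y)) = 0 at hy
      rw [map_add, map_add, map_add, hx, hy, add_zero]
    | hS s => exact congrArg (pS A) (act_iS A a s)
    | hW w => exact congrArg (pS A) (act_iW A a w)
    | hU u => exact congrArg (pS A) (act_iU A a u)
  map_d := pS_d A

/-- The augmentation is a quasi-isomorphism, with the contracting homotopy `u ↦ -u` from the last
to the second summand. -/
theorem ε_quasiIso : IsQuasiIso (P A).d (DGMod.trivial A).d (ε A).f := by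
  have key : ∀ x, d A (-iW A (pU A x)) + -iW A (pU A (d A x)) = x - iS A (pS A x) := by
    intro x
    induction x using induction with
    | ha x y hx hy =>
      simp only [map_add, neg_add]
      rw [add_add_add_comm, hx, hy]
      abel
    | hS s => simp
    | hW w => simp
    | hU u => simp
  have key2 : ∀ x, d A x = 0 → pS A x = 0 → d A (-iW A (pU A x)) = x := fun x hx hy => by
    have := key x
    rwa [hx, hy, map_zero, map_zero, map_zero, neg_zero, add_zero, sub_zero] at this
  refine ⟨fun x hx => ?_, fun s _ => ⟨iS A s, 0, d_iS A s, add_zero (pS A (iS A s))⟩⟩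
  rintro ⟨y, hy⟩
  exact ⟨_, key2 x hx hy.symm⟩

end BarRes

/-! ### The diagonal of the bar resolution -/

namespace BarRes

variable (A : DGAlg k S)

/-- The quotient `S ⊗_{A⁺} P` of the bar resolution. -/
def Q : SBimod k S := (P A).indec.V

/-- The projection to `S ⊗_{A⁺} P`. -/
def q : Hom (V A) (Q A) := (P A).π

/-- The differential of `S ⊗_{A⁺} P`. -/
def dQ : Hom (Q A) (Q A) := (P A).indec.d

/-- The grading of `S ⊗_{A⁺} P`. -/
def gQ : Grading (Q A) := (P A).indec.g

theorem dQ_q (x : V A) : dQ A (q A x) = q A (d A x) := rfl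

theorem q_act (a : A.V) (x : V A) : q A (act A (tmul _ _ a x)) = 0 := (P A).π_act a x

theorem q_homog : Grading.IsHomog (g A) (gQ A) 0 (q A) := Grading.proj_homog (P A).AP_graded

theorem q_iU (u : A.V.T) : q A (iU A u) = 0 := by
  induction u using T_induction with
  | h0 => simp
  | ha x y hx hy => simp only [map_add, hx, hy, add_zero]
  | h1 a => rw [← unitR_one a, ← act_iS, q_act]
  | hc a w _ => rw [← act_iW, q_act]

/-- The diagonal of the bar resolution on `A ⊗ (S ⊕ B A)`. -/
def φU : Hom A.V.T ((V A).tensor (Q A)) :=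
  (tmap (iU A) ((q A).comp (iS A))).comp (rightUnit _) +
    (tmap (iU A) ((q A).comp (iW A))).comp (deconc A.V)

/-- The diagonal of the bar resolution on `B A`. -/
def φW : Hom A.V.T ((V A).tensor (Q A)) :=
  (tmap (iS A) ((q A).comp (iW A))).comp (leftUnit _) +
    ((tmap (iW A) ((q A).comp (iS A))).comp (rightUnit _) +
      (tmap (iW A) ((q A).comp (iW A))).comp (deconc A.V))

/-- The diagonal `P → P ⊗ Q` of the bar resolution, given by the deconcatenation of words. -/
def φ : Hom (V A) ((V A).tensor (Q A)) :=
  (tmap (iS A) ((q A).comp (iS A))).comp ((rightUnit _).comp (pS A)) +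
    ((φW A).comp (pW A) + (φU A).comp (pU A))

theorem φ_iS (s) : φ A (iS A s) = tmul _ _ (iS A s) (q A (iS A (one k S))) := by
  simp [φ, rightUnit_apply]

theorem φ_iW (w) : φ A (iW A w) = tmul _ _ (iS A (one k S)) (q A (iW A w)) +
    (tmul _ _ (iW A w) (q A (iS A (one k S))) +
      tmap (iW A) ((q A).comp (iW A)) (deconc A.V w)) := by
  simp [φ, φW, rightUnit_apply, leftUnit_apply]

theorem φ_iU (u) : φ A (iU A u) = tmul _ _ (iU A u) (q A (iS A (one k S))) +
    tmap (iU A) ((q A).comp (iW A)) (deconc A.V u) := by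
  simp [φ, φU, rightUnit_apply]

theorem φ_homog : Grading.IsHomog (g A) ((g A).tensor (gQ A)) 0 (φ A) := by
  have hS := (q_homog A).comp (iS_homog A) rfl
  have hW := (q_homog A).comp (iW_homog A) rfl
  refine Grading.IsHomog.add (((iS_homog A).tmap hS rfl).comp
    (rightUnit_homog.comp (pS_homog A) rfl) rfl) (Grading.IsHomog.add ?_ ?_)
  · exact (Grading.IsHomog.add (((iS_homog A).tmap hW rfl).comp leftUnit_homog rfl)
      (Grading.IsHomog.add (((iW_homog A).tmap hS rfl).comp rightUnit_homog rfl)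
        (((iW_homog A).tmap hW rfl).comp deconc_homog rfl))).comp (pW_homog A) rfl
  · refine Grading.IsHomog.comp (h := barG A) (e := 1) (e' := -1) (Grading.IsHomog.add ?_ ?_)
      (pU_homog' A) rfl
    · exact ((iU_homog' A).tmap hS rfl).comp rightUnit_homog rfl
    · exact ((iU_homog' A).tmap hW rfl).comp deconc_homog rfl

theorem φ_act (a : A.V) (x : V A) : φ A (act A (tmul _ _ a x)) =
    tmap (act A) (Hom.id _) (assocInv _ _ _ (tmul _ _ a (φ A x))) := by
  have key : ∀ (j : Hom A.V.T (V A)) (m : Hom (A.V.tensor A.V.T) A.V.T)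
      (_ : ∀ u, act A (tmul _ _ a (j u)) = iU A (m (tmul _ _ a u))) (t : A.V.T.tensor A.V.T),
      tmap (act A) (Hom.id _) (assocInv _ _ _ (tmul _ _ a (tmap j ((q A).comp (iW A)) t))) =
      tmap (iU A) ((q A).comp (iW A)) (tmap m (Hom.id _) (assocInv _ _ _ (tmul _ _ a t))) := by
    intro j m h t
    induction t using tensor_induction with
    | h0 => simp
    | ha x y hx hy => simp only [map_add, hx, hy]
    | ht v w => simp [h]
  induction x using induction with
  | ha x y hx hy => simp only [map_add, hx, hy]
  | hS s =>
    rw [act_iS, φ_iU, deconc_letter, φ_iS, map_zero, add_zero, assocInv_tmul, tmap_tmul, act_iS]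
    rfl
  | hW w =>
    rw [act_iW, φ_iU, deconc_cons, φ_iW]
    simp only [map_add, key (iW A) A.V.cons (act_iW A a), assocInv_tmul, tmap_tmul, act_iS,
      act_iW, unitR_one, Hom.comp_apply, Hom.id_apply]
    abel
  | hU u =>
    rw [act_iU, φ_iU, deconc_first, φ_iU, map_add, map_add, map_add,
      key (iU A) (first A.mul) (act_iU A a), assocInv_tmul, tmap_tmul, act_iU]
    rfl

/-- The differential of `P ⊗ Q`. -/
def D : Hom ((V A).tensor (Q A)) ((V A).tensor (Q A)) :=
  tmap (d A) (Hom.id _) + tmap ((g A).sgn 1) (dQ A)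

theorem D_tmul (x : V A) (y : Q A) : D A (tmul _ _ x y) =
    tmul _ _ (d A x) y + tmul _ _ ((g A).sgn 1 x) (dQ A y) := rfl

theorem sgn_iS (s) : (g A).sgn 1 (iS A s) = iS A s := by
  rw [Grading.sgn_comm (iS_homog A), unitG_sgn]

theorem sgn_iW (w) : (g A).sgn 1 (iW A w) = iW A (barSgnT A w) :=
  Grading.sgn_comm (iW_homog A) w

theorem sgn_iU (u) : (g A).sgn 1 (iU A u) = -iU A (barSgnT A u) := by
  rw [Grading.sgn_comm (iU_homog A), barG_shift_sgn, map_neg]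

theorem φ_d (x : V A) : φ A (d A x) = D A (φ A x) := by
  have hdS : dQ A (q A (iS A (one k S))) = 0 := by rw [dQ_q, d_iS, map_zero]
  have hdW : ∀ w, dQ A (q A (iW A w)) = q A (iW A (barD A w)) := fun w => by
    rw [dQ_q, d_iW, map_sub, q_iU, sub_zero]
  have keyW : ∀ t : A.V.T.tensor A.V.T, D A (tmap (iW A) ((q A).comp (iW A)) t) =
      tmap (iW A) ((q A).comp (iW A)) (tmap (barD A) (Hom.id _) t + tmap (barSgnT A) (barD A) t) -
        tmap (iU A) ((q A).comp (iW A)) t := by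
    intro t
    induction t using tensor_induction with
    | h0 => simp
    | ha x y hx hy =>
      simp only [map_add, hx, hy]
      abel
    | ht v w =>
      simp only [tmap_tmul, D_tmul, Hom.comp_apply, Hom.id_apply, hdW, sgn_iW, d_iW, map_add,
        map_sub, LinearMap.sub_apply]
      abel
  have keyU : ∀ t : A.V.T.tensor A.V.T, D A (tmap (iU A) ((q A).comp (iW A)) t) =
      -tmap (iU A) ((q A).comp (iW A)) (tmap (barD A) (Hom.id _) t + tmap (barSgnT A) (barD A) t) := by
    intro t
    induction t using tensor_induction with
    | h0 => simp
    | ha x y hx hy =>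
      simp only [map_add, hx, hy]
      abel
    | ht v w =>
      simp only [tmap_tmul, D_tmul, Hom.comp_apply, Hom.id_apply, hdW, sgn_iU, d_iU, map_add,
        map_neg, LinearMap.neg_apply]
      abel
  induction x using induction with
  | ha x y hx hy => simp only [map_add, hx, hy]
  | hS s => rw [d_iS, φ_iS, D_tmul, hdS, d_iS]; simp
  | hW w =>
    rw [d_iW, map_sub, φ_iW, φ_iU, deconc_barD, φ_iW, map_add (D A).lin, map_add (D A).lin, keyW,
      D_tmul, D_tmul, hdS, hdW, d_iS, sgn_iS, d_iW]
    simp only [map_add, map_sub, map_zero, LinearMap.zero_apply, LinearMap.sub_apply]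
    abel
  | hU u =>
    rw [d_iU, map_neg, φ_iU, deconc_barD, φ_iU, map_add (D A).lin, keyU, D_tmul, hdS, d_iU]
    simp only [map_add, map_neg, map_zero, LinearMap.neg_apply]
    abel

theorem φ_ε (x : V A) : unitL _ (tmap (pS A) (Hom.id _) (φ A x)) = q A x := by
  have key : ∀ (j : Hom A.V.T (V A)) (_ : ∀ w, pS A (j w) = 0) (t : A.V.T.tensor A.V.T),
      tmap (pS A) (Hom.id _) (tmap j ((q A).comp (iW A)) t) = 0 := by
    intro j h t
    induction t using tensor_induction with
    | h0 => simp
    | ha x y hx hy => simp only [map_add, hx, hy, add_zero]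
    | ht v w => simp [h]
  induction x using induction with
  | ha x y hx hy => simp only [map_add, hx, hy]
  | hS s =>
    have h : ∀ s : S, unitL _ (tmul (unit k S) (Q A) s (q A (iS A (one k S)))) = q A (iS A s) := by
      intro s
      refine (((q A).comp (iS A)).map_l s (one k S)).symm.trans ?_
      exact congrArg ((q A).comp (iS A)) (mul_one s)
    rw [φ_iS, tmap_tmul]
    exact h s
  | hW w =>
    simp only [φ_iW, map_add, key _ (pS_iW A), tmap_tmul, pS_iS, pS_iW, map_zero,
      LinearMap.zero_apply, add_zero, unitL_one, Hom.id_apply]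
  | hU u =>
    rw [φ_iU, map_add, key _ (pS_iU A), tmap_tmul, pS_iU, map_zero, LinearMap.zero_apply, add_zero,
      map_zero, q_iU]

end BarRes

/-! ### Semi-projectivity of the bar resolution -/

namespace BarRes

section Lift

variable {A : DGAlg k S} {M : DGMod A} (fS : Hom (unit k S) M.V) (q : Hom A.V.T M.V)
  (s : Hom M.V M.V)

/-- The map `[a] ↦ a fS(1)`. -/
def liftLetter : Hom A.V M.V := M.act.comp ((tmap (Hom.id _) fS).comp (rightUnit _))

/-- The solution `g` of the equation `g w = q w - s (U w)`, where `U [a] = a fS(1)` and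
`U [a|w] = a g(w)`. -/
def liftW : Hom A.V.T M.V :=
  recT (q.comp A.V.letter + -(s.comp (liftLetter fS))) (q.comp A.V.cons) (-(s.comp M.act))

/-- The map `U` with `U [a] = a fS(1)` and `U [a|w] = a g(w)`, for `g = liftW`. -/
def liftU : Hom A.V.T M.V :=
  recT (liftLetter fS) (M.act.comp (tmap (Hom.id _) (liftW fS q s))) 0

theorem liftU_letter (a : A.V) :
    liftU fS q s (A.V.letter a) = M.act (tmul _ _ a (fS (one k S))) := recT_letter _ _ _ a

theorem liftU_cons (a : A.V) (w : A.V.T) : liftU fS q s (A.V.cons (tmul _ _ a w)) =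
    M.act (tmul _ _ a (liftW fS q s w)) := by
  rw [liftU, recT_cons]
  simp

theorem liftW_eq (w : A.V.T) : liftW fS q s w = q w - s (liftU fS q s w) := by
  induction w using T_induction with
  | h0 => simp
  | ha x y hx hy =>
    simp only [map_add, hx, hy]
    abel
  | h1 a =>
    rw [liftU_letter, liftW, recT_letter, sub_eq_add_neg]
    rfl
  | hc a w _ =>
    rw [liftU_cons, sub_eq_add_neg]
    exact recT_cons _ _ _ a w

theorem liftU_first (a : A.V) (u : A.V.T) : liftU fS q s (first A.mul (tmul _ _ a u)) =
    M.act (tmul _ _ a (liftU fS q s u)) := by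
  induction u using T_induction with
  | h0 => simp
  | ha x y hx hy => simp only [map_add, hx, hy]
  | h1 b => rw [first_letter, liftU_letter, liftU_letter, M.act_act]
  | hc b w _ => rw [first_cons, liftU_cons, liftU_cons, M.act_act]

/-- The action of `A` on a dg module has degree `-1` with respect to the grading of `A[-1]`. -/
theorem act_homog_shift :
    Grading.IsHomog ((A.g.shift (-1)).tensor M.g) M.g (-1) M.act := by
  refine Grading.isHomog_tensor fun i j a x ha hx => ?_
  have := M.act_homog _ _ (Grading.tmul_mem (g := A.g) (i := i + -1) ha hx)
  rwa [show i + -1 + j + 0 = i + j + -1 by omega] at this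

variable {fS q s}

theorem liftLetter_homog (hfS : Grading.IsHomog (unitG k S) M.g 0 fS) :
    Grading.IsHomog (A.g.shift (-1)) M.g (-1) (liftLetter fS) :=
  act_homog_shift.comp ((Grading.id_homog.tmap hfS rfl).comp rightUnit_homog rfl) rfl

theorem liftW_homog (hfS : Grading.IsHomog (unitG k S) M.g 0 fS)
    (hq : Grading.IsHomog (barG A) M.g 0 q) (hs : Grading.IsHomog M.g M.g 1 s) :
    Grading.IsHomog (barG A) M.g 0 (liftW fS q s) :=
  Grading.recT_homog
    ((hq.comp Grading.letter_homog rfl).add (hs.comp (liftLetter_homog hfS) rfl).neg)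
    (hq.comp Grading.cons_homog rfl) (hs.comp act_homog_shift rfl).neg

theorem liftU_homog (hfS : Grading.IsHomog (unitG k S) M.g 0 fS)
    (hq : Grading.IsHomog (barG A) M.g 0 q) (hs : Grading.IsHomog M.g M.g 1 s) :
    Grading.IsHomog (barG A) M.g (-1) (liftU fS q s) := by
  refine Grading.recT_homog (liftLetter_homog hfS) ?_ Grading.zero_homog
  exact act_homog_shift.comp (e := 0) (Grading.id_homog.tmap (liftW_homog hfS hq hs) rfl) rfl

end Lift

/-- The bar resolution is semi-projective over a separable algebra: given a surjective
quasi-isomorphism `p : M → N` with graded section `σ` and contraction `s` of its kernel, a lift of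
`F : P → N` is first chosen on the free generators by `σ`, and then corrected by `s`. -/
theorem semiprojective (hS : IsSeparableAlg k S) (A : DGAlg k S) : (P A).IsSemiprojective := by
  intro M N p hp hq f
  obtain ⟨σ, s, hσ, hs, hpσ, hps, hc⟩ := exists_section_contraction hS hq M.d_homog p.homog M.d_d
    p.map_d hp
  let F : Hom (V A) N.V := f.f
  have hF : Grading.IsHomog (g A) N.g 0 F := f.homog
  have hFa : ∀ a x, F (act A (tmul _ _ a x)) = N.act (tmul _ _ a (F x)) := f.map_act
  have hFd : ∀ x, F (d A x) = N.d (F x) := f.map_d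
  -- the lift on `S`
  let fS : Hom (unit k S) M.V :=
    (Hom.id _ + -(s.comp M.d)).comp (σ.comp (F.comp (iS A)))
  have hfS : Grading.IsHomog (unitG k S) M.g 0 fS :=
    (Grading.id_homog.add (hs.comp M.d_homog rfl).neg).comp
      (hσ.comp (hF.comp (iS_homog A) rfl) rfl) rfl
  have fS_eq : ∀ x, fS x = σ (F (iS A x)) - s (M.d (σ (F (iS A x)))) := fun x =>
    (sub_eq_add_neg _ _).symm
  have pfS : ∀ x, p.f (fS x) = F (iS A x) := fun x => by
    rw [fS_eq, map_sub, hpσ, hps, sub_zero]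
  have dfS : ∀ x, M.d (fS x) = 0 := fun x => by
    have h := hc (M.d (σ (F (iS A x)))) (by rw [p.map_d, hpσ, ← hFd, d_iS, map_zero])
    rw [M.d_d, map_zero, add_zero] at h
    rw [fS_eq, map_sub, h, sub_self]
  -- the lift on the other generators
  let q : Hom A.V.T M.V := σ.comp (F.comp (iW A)) +
    -(s.comp (M.d.comp (σ.comp (F.comp (iW A))) + -(σ.comp (F.comp ((iW A).comp (barD A))))))
  have hq : Grading.IsHomog (barG A) M.g 0 q := by
    have h1 : Grading.IsHomog (barG A) M.g 0 (σ.comp (F.comp (iW A))) :=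
      hσ.comp (hF.comp (iW_homog A) rfl) rfl
    have h2 : Grading.IsHomog (barG A) M.g (-1) (σ.comp (F.comp ((iW A).comp (barD A)))) :=
      hσ.comp (hF.comp ((iW_homog A).comp (barD_homog A) rfl) rfl) rfl
    exact h1.add (hs.comp ((M.d_homog.comp h1 rfl).add h2.neg) rfl).neg
  let G := liftW fS q s
  let U := liftU fS q s
  let c : A.V.T → M.V := fun w => M.d (σ (F (iW A w))) - σ (F (iW A (barD A w))) + U w
  have G_eq : ∀ w, G w = σ (F (iW A w)) - s (c w) := fun w => by
    have h : q w = σ (F (iW A w)) - s (M.d (σ (F (iW A w))) - σ (F (iW A (barD A w)))) := by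
      rw [sub_eq_add_neg, sub_eq_add_neg]
      rfl
    rw [show G w = q w - s (U w) from liftW_eq fS q s w, h,
      show c w = M.d (σ (F (iW A w))) - σ (F (iW A (barD A w))) + U w from rfl, map_add s.lin]
    abel
  have pfG : ∀ w, p.f (G w) = F (iW A w) := fun w => by rw [G_eq, map_sub, hpσ, hps, sub_zero]
  have pfU : ∀ u, p.f (U u) = F (iU A u) := fun u => by
    induction u using T_induction with
    | h0 => simp
    | ha x y hx hy => simp only [map_add, hx, hy]
    | h1 a =>
      rw [show U (A.V.letter a) = _ from liftU_letter fS q s a, p.map_act, pfS, ← hFa, act_iS,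
        unitR_one]
    | hc a w _ =>
      rw [show U (A.V.cons (tmul _ _ a w)) = M.act (tmul _ _ a (G w)) from liftU_cons fS q s a w,
        p.map_act, pfG, ← hFa, act_iW]
  have dG : ∀ w, M.d (U w) = -U (barD A w) → M.d (G w) = G (barD A w) - U w := fun w hw => by
    have h := hc (c w) (by
      change p.f (M.d (σ (F (iW A w))) - σ (F (iW A (barD A w))) + U w) = 0
      rw [map_add, map_sub, p.map_d, hpσ, hpσ, pfU, ← hFd, d_iW, map_sub]
      abel)
    have h1 : M.d (c w) = -c (barD A w) := by
      change M.d (M.d (σ (F (iW A w))) - σ (F (iW A (barD A w))) + U w) =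
        -(M.d (σ (F (iW A (barD A w)))) - σ (F (iW A (barD A (barD A w)))) + U (barD A w))
      rw [map_add, map_sub, M.d_d, hw, barD_barD]
      simp only [map_zero]
      abel
    rw [h1, map_neg, ← sub_eq_add_neg, sub_eq_iff_eq_add] at h
    rw [G_eq, G_eq, map_sub, h]
    change _ - (M.d (σ (F (iW A w))) - σ (F (iW A (barD A w))) + U w + _) = _
    abel
  have dU : ∀ w, M.d (U w) = -U (barD A w) := fun w => by
    induction w using T_induction with
    | h0 => simp
    | ha x y hx hy =>
      simp only [map_add, hx, hy]
      abel
    | h1 a =>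
      rw [show U (A.V.letter a) = _ from liftU_letter fS q s a, M.leibniz, dfS, map_zero, map_zero,
        add_zero, barD_letter, map_neg, neg_neg]
      exact (liftU_letter fS q s _).symm
    | hc a w hw =>
      have h1 : ∀ a w, U (A.V.cons (tmul _ _ a w)) = M.act (tmul _ _ a (G w)) := liftU_cons fS q s
      have h2 : ∀ a w, U (first A.mul (tmul _ _ a w)) = M.act (tmul _ _ a (U w)) :=
        liftU_first fS q s
      rw [barD_cons, barSgn_apply, map_add, map_sub, map_neg, h1, h1, h1, h2, M.leibniz, dG w hw]
      simp only [map_sub, map_neg, LinearMap.neg_apply]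
      abel
  let f' : Hom (V A) M.V := fS.comp (pS A) + (G.comp (pW A) + U.comp (pU A))
  have f'S : ∀ x, f' (iS A x) = fS x := fun x => by simp [f']
  have f'W : ∀ x, f' (iW A x) = G x := fun x => by simp [f']
  have f'U : ∀ x, f' (iU A x) = U x := fun x => by simp [f']
  refine ⟨⟨f', ?_, fun a x => ?_, fun x => ?_⟩, fun x => ?_⟩
  · exact (hfS.comp (pS_homog A) rfl).add (((liftW_homog hfS hq hs).comp (pW_homog A) rfl).add
      ((liftU_homog hfS hq hs).comp (pU_homog' A) rfl))
  · change f' (act A (tmul _ _ a x)) = M.act (tmul _ _ a (f' x))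
    induction x using induction with
    | ha x y hx hy => simp only [map_add, hx, hy]
    | hS x =>
      have h : U (A.V.letter (unitR A.V (tmul _ _ a x))) =
          M.act (tmap (Hom.id _) fS (rightUnit A.V (unitR A.V (tmul _ _ a x)))) :=
        liftU_letter fS q s _
      rw [act_iS, f'U, f'S, h, rightUnit_unitR]
      rfl
    | hW w =>
      rw [act_iW, f'U, f'W]
      exact liftU_cons fS q s a w
    | hU u =>
      rw [act_iU, f'U, f'U]
      exact liftU_first fS q s a u
  · change f' (d A x) = M.d (f' x)
    induction x using induction with
    | ha x y hx hy => simp only [map_add, hx, hy]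
    | hS x => rw [d_iS, f'S, dfS, map_zero]
    | hW w => rw [d_iW, map_sub, f'W, f'W, f'U, dG w (dU w)]
    | hU u => rw [d_iU, map_neg, f'U, f'U, dU]
  · change p.f (f' x) = F x
    induction x using induction with
    | ha x y hx hy => simp only [map_add, hx, hy]
    | hS x => rw [f'S, pfS]
    | hW w => rw [f'W, pfG]
    | hU u => rw [f'U, pfU]

/-- The bar resolution, with its diagonal, computes Tor. -/
def resolution (hS : IsSeparableAlg k S) (A : DGAlg k S) : TorResolution A where
  P := P A
  semiprojective := semiprojective hS A
  ε := ε A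
  quasiIso := ε_quasiIso A
  φ := φ A
  φ_homog := φ_homog A
  φ_act := φ_act A
  φ_d := φ_d A
  φ_ε := φ_ε A

end BarRes

/-! ### Homotopy uniqueness of lifts -/

namespace DGMod

variable {A : DGAlg k S} {M N M' N' : DGMod A}

/-- The identity of a dg module. -/
def Hom.id (M : DGMod A) : DGMod.Hom M M :=
  ⟨SBimod.Hom.id _, Grading.id_homog, fun _ _ => rfl, fun _ => rfl⟩

/-- Composition of morphisms of dg modules. -/
def Hom.comp (g : DGMod.Hom N N') (f : DGMod.Hom M N) : DGMod.Hom M N' where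
  f := g.f.comp f.f
  homog := g.homog.comp f.homog rfl
  map_act := fun a x => (congrArg g.f (f.map_act a x)).trans (g.map_act a _)
  map_d := fun x => (congrArg g.f (f.map_d x)).trans (g.map_d _)

theorem sgn_act (M : DGMod A) (a : A.V) (x : M.V) : M.g.sgn 1 (M.act (tmul _ _ a x)) =
    M.act (tmul _ _ (A.g.sgn 1 a) (M.g.sgn 1 x)) := by
  rw [Grading.sgn_comm M.act_homog, Grading.sgn_tmul]

theorem act_homog_shift (M : DGMod A) {m : ℤ} :
    Grading.IsHomog (A.g.tensor (M.g.shift m)) (M.g.shift m) 0 M.act :=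
  Grading.isHomog_tensor fun i j a x ha hx => by
    have := M.act_homog _ _ (Grading.tmul_mem (g := A.g) (h := M.g) (j := j + m) ha hx)
    rwa [show i + (j + m) + 0 = i + j + 0 + m by omega] at this

section Cocone

variable (p : DGMod.Hom M N)

/-- The action of `A` on the cocone. -/
def coconeAct : SBimod.Hom (A.V.tensor (M.V.prod N.V)) (M.V.prod N.V) :=
  (inl _ _).comp (M.act.comp (tmap (SBimod.Hom.id _) (projl _ _))) +
    (inr _ _).comp (N.act.comp (tmap (A.g.sgn 1) (projr _ _)))

/-- The differential `(m, n) ↦ (d m, p m - d n)` of the cocone. -/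
def coconeD : SBimod.Hom (M.V.prod N.V) (M.V.prod N.V) :=
  (inl _ _).comp (M.d.comp (projl _ _)) +
    (inr _ _).comp (p.f.comp (projl _ _) + -(N.d.comp (projr _ _)))

theorem projl_coconeAct (a : A.V) (x : M.V.prod N.V) : projl _ _ (coconeAct (tmul _ _ a x)) =
    M.act (tmul _ _ a (projl _ _ x)) := add_zero _

theorem projr_coconeAct (a : A.V) (x : M.V.prod N.V) : projr _ _ (coconeAct (tmul _ _ a x)) =
    N.act (tmul _ _ (A.g.sgn 1 a) (projr _ _ x)) := zero_add _

theorem projl_coconeD (x : M.V.prod N.V) : projl _ _ (coconeD p x) = M.d (projl _ _ x) :=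
  add_zero _

theorem projr_coconeD (x : M.V.prod N.V) : projr _ _ (coconeD p x) =
    p.f (projl _ _ x) - N.d (projr _ _ x) :=
  (zero_add _).trans (sub_eq_add_neg _ _).symm

/-- The cocone `M ⊕ N[1]` of a morphism `p : M → N`, with `a (m, n) = (a m, (-1)^{|a|} a n)`. -/
def cocone : DGMod A where
  V := M.V.prod N.V
  g := M.g.prod (N.g.shift 1)
  act := coconeAct
  d := coconeD p
  act_act := fun a b x => by
    refine prod_ext ?_ ?_
    · rw [projl_coconeAct, projl_coconeAct, projl_coconeAct, M.act_act]
    · rw [projr_coconeAct, projr_coconeAct, projr_coconeAct, ← N.act_act,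
        Grading.sgn_comm A.mul_homog, Grading.sgn_tmul]
  act_homog := (Grading.inl_homog.comp (M.act_homog.comp
      (Grading.id_homog.tmap Grading.projl_homog rfl) rfl) rfl).add
    (Grading.inr_homog.comp (N.act_homog_shift.comp
      (Grading.sgn_homog.tmap Grading.projr_homog rfl) rfl) rfl)
  d_homog := by
    have h : Grading.IsHomog M.g (N.g.shift 1) (-1) p.f := fun n x hx => by
      change p.f x ∈ N.g.gr (n + -1 + 1)
      rw [neg_add_cancel_right, ← add_zero n]
      exact p.homog n x hx
    have h1 : Grading.IsHomog (M.g.prod (N.g.shift 1)) (N.g.shift 1) (-1)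
      (p.f.comp (projl M.V N.V)) := h.comp Grading.projl_homog rfl
    exact (Grading.inl_homog.comp (M.d_homog.comp Grading.projl_homog rfl) rfl).add
      (Grading.inr_homog.comp (e := -1) (h1.add
        ((shift_homog N.d_homog).comp Grading.projr_homog rfl).neg) rfl)
  d_d := fun x => by
    refine prod_ext ?_ ?_
    · rw [projl_coconeD, projl_coconeD, M.d_d, map_zero]
    · rw [projr_coconeD, projr_coconeD, projl_coconeD, p.map_d, map_sub, N.d_d, sub_zero, sub_self,
        map_zero]
  leibniz := fun a x => by
    refine prod_ext ?_ ?_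
    · rw [map_add, projl_coconeD, projl_coconeAct, projl_coconeAct, projl_coconeAct, projl_coconeD,
        M.leibniz]
    · rw [map_add, projr_coconeD, projl_coconeAct, projr_coconeAct, projr_coconeAct,
        projr_coconeAct, projr_coconeD, p.map_act, N.leibniz, Grading.sgn_anticomm A.d_homog,
        Grading.sgn_sgn]
      simp only [map_sub, map_neg, LinearMap.neg_apply]
      abel

/-- The cocone of a quasi-isomorphism is acyclic. -/
theorem cocone_acyclic (hp : IsQuasiIso M.d N.d p.f) (x : M.V.prod N.V) (hx : coconeD p x = 0) :
    ∃ y, coconeD p y = x := by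
  have h1 : M.d (projl _ _ x) = 0 := by rw [← projl_coconeD p, hx, map_zero]
  have h2 : p.f (projl _ _ x) = N.d (projr _ _ x) := by
    rw [← sub_eq_zero, ← projr_coconeD, hx, map_zero]
  obtain ⟨m, hm⟩ := hp.1 _ h1 ⟨_, h2.symm⟩
  obtain ⟨z, y, hz, hzy⟩ := hp.2 (projr _ _ x - p.f m) (by
    rw [map_sub, ← p.map_d, hm, h2, sub_self])
  refine ⟨inl _ _ (m + z) + inr _ _ (-y), prod_ext ?_ ?_⟩
  · rw [projl_coconeD, map_add, projl_inl, projl_inr, add_zero, map_add, hm, hz, add_zero]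
  · rw [projr_coconeD, map_add, map_add (projr M.V N.V).lin, projl_inl, projl_inr, projr_inl,
      projr_inr, add_zero, zero_add, map_add, map_neg, sub_neg_eq_add, add_assoc, hzy,
      add_sub_cancel]

/-- The map `(m, m') ↦ (m, p m')` from the cocone of the identity of `M` to the cocone of
`p : M → N`. -/
def coconeFun : SBimod.Hom (M.V.prod M.V) (M.V.prod N.V) :=
  (inl _ _).comp (projl _ _) + (inr _ _).comp (p.f.comp (projr _ _))

theorem projl_coconeFun (x) : projl _ _ (coconeFun p x) = projl _ _ x := add_zero _

theorem projr_coconeFun (x) : projr _ _ (coconeFun p x) = p.f (projr _ _ x) := zero_add _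

/-- The morphism `(m, m') ↦ (m, p m')` from the cocone of the identity of `M` to the cocone of
`p : M → N`. -/
def coconeMap : DGMod.Hom (cocone (Hom.id M)) (cocone p) where
  f := coconeFun p
  homog := (Grading.inl_homog.comp Grading.projl_homog rfl).add
    (Grading.inr_homog.comp ((shift_homog p.homog).comp Grading.projr_homog rfl) rfl)
  map_act := fun a (x : M.V.prod M.V) => by
    change coconeFun p (coconeAct (tmul _ _ a x)) = coconeAct (tmul _ _ a (coconeFun p x))
    refine prod_ext ?_ ?_
    · rw [projl_coconeFun, projl_coconeAct, projl_coconeAct, projl_coconeFun]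
    · rw [projr_coconeFun, projr_coconeAct, projr_coconeAct, projr_coconeFun, p.map_act]
  map_d := fun (x : M.V.prod M.V) => by
    change coconeFun p (coconeD (Hom.id M) x) = coconeD p (coconeFun p x)
    refine prod_ext ?_ ?_
    · rw [projl_coconeFun, projl_coconeD, projl_coconeD, projl_coconeFun]
    · rw [projr_coconeFun, projr_coconeD, projr_coconeD, projr_coconeFun, projl_coconeFun, map_sub,
        p.map_d]
      rfl

/-- A morphism `f` into `M` with `p f = 0`, as a morphism to the cocone of `p`. -/
def toCocone {P : DGMod A} (f : DGMod.Hom P M) (hf : ∀ x, p.f (f.f x) = 0) :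
    DGMod.Hom P (cocone p) where
  f := (inl _ _).comp f.f
  homog := Grading.inl_homog.comp f.homog rfl
  map_act := fun a x => by
    change inl M.V N.V (f.f (P.act (tmul _ _ a x))) = coconeAct (tmul _ _ a (inl M.V N.V (f.f x)))
    refine prod_ext ?_ ?_
    · rw [projl_coconeAct, projl_inl, projl_inl, f.map_act]
    · rw [projr_coconeAct, projr_inl, projr_inl, map_zero, map_zero]
  map_d := fun x => by
    change inl M.V N.V (f.f (P.d x)) = coconeD p (inl M.V N.V (f.f x))
    refine prod_ext ?_ ?_
    · rw [projl_coconeD, projl_inl, projl_inl, f.map_d]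
    · rw [projr_coconeD, projl_inl, projr_inl, projr_inl, hf, map_zero, sub_zero]

end Cocone

/-- The difference of two morphisms of dg modules. -/
def Hom.sub (f g : DGMod.Hom M N) : DGMod.Hom M N where
  f := f.f + -g.f
  homog := f.homog.add g.homog.neg
  map_act := fun a x => by
    simp only [SBimod.Hom.add_apply, SBimod.Hom.neg_apply, f.map_act, g.map_act, map_add, map_neg]
  map_d := fun x => by
    simp only [SBimod.Hom.add_apply, SBimod.Hom.neg_apply, f.map_d, g.map_d, map_add, map_neg]

/-- Two lifts of a morphism out of a semi-projective module along a surjective quasi-isomorphism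
are homotopic, by a homotopy which is linear over `A`, up to a sign. It is obtained by lifting
their difference along the surjective quasi-isomorphism of cocones `coconeMap p`. -/
theorem exists_homotopy {P : DGMod A} (hP : P.IsSemiprojective) (p : DGMod.Hom M N)
    (hs : Function.Surjective p.f) (hq : IsQuasiIso M.d N.d p.f) (f g : DGMod.Hom P M)
    (hfg : ∀ x, p.f (f.f x) = p.f (g.f x)) :
    ∃ h : SBimod.Hom P.V M.V, (∀ a x, h (P.act (tmul _ _ a x)) =
      M.act (tmul _ _ (A.g.sgn 1 a) (h x))) ∧ ∀ x, f.f x = g.f x + (M.d (h x) + h (P.d x)) := by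
  have hid : IsQuasiIso M.d M.d (Hom.id M).f :=
    ⟨fun x _ hx => hx, fun y hy => ⟨y, 0, hy, by rw [map_zero, add_zero]; rfl⟩⟩
  obtain ⟨F, hF⟩ := hP (cocone (Hom.id M)) (cocone p) (coconeMap p)
    (fun x => by
      obtain ⟨y, hy⟩ := hs (projr _ _ x)
      refine ⟨(inl M.V M.V (projl M.V N.V x) + inr M.V M.V y : M.V.prod M.V), ?_⟩
      refine prod_ext (projl_coconeFun p _ |>.trans ?_) (projr_coconeFun p _ |>.trans ?_)
      · rw [map_add, projl_inl, projl_inr, add_zero]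
      · rw [map_add, projr_inl, projr_inr, zero_add, hy])
    ⟨fun x hx _ => cocone_acyclic (Hom.id M) hid x hx, fun y hy => by
      obtain ⟨y', hy'⟩ := cocone_acyclic p hq y hy
      refine ⟨0, y', map_zero _, ?_⟩
      rw [map_zero, zero_add]
      exact hy'⟩
    (toCocone p (f.sub g) (fun x => by
      change p.f (f.f x + -g.f x) = 0
      rw [map_add, map_neg, hfg, add_neg_cancel]))
  let F' : SBimod.Hom P.V (M.V.prod M.V) := F.f
  have hl : ∀ x, projl _ _ (F' x) = f.f x - g.f x := fun x => by
    rw [← projl_coconeFun p (F' x), sub_eq_add_neg]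
    exact congrArg (projl M.V N.V) (hF x)
  refine ⟨(projr M.V M.V).comp F', fun a x => ?_, fun x => ?_⟩
  · exact (congrArg (projr M.V M.V) (F.map_act a x)).trans (projr_coconeAct a (F' x))
  · have h : projr M.V M.V (F' (P.d x)) = (f.f x - g.f x) - M.d (projr M.V M.V (F' x)) :=
      ((congrArg (projr M.V M.V) (F.map_d x)).trans (projr_coconeD (Hom.id M) (F' x))).trans
        (congrArg (· - M.d (projr M.V M.V (F' x))) (hl x))
    rw [SBimod.Hom.comp_apply, SBimod.Hom.comp_apply, h]
    abel

/-- Let `κ : M → W` be a morphism of complexes which vanishes on `A M`. Two lifts to `M` of a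
morphism out of a semi-projective module `P` agree after composition with `κ`, up to a boundary, on
all elements of `P` representing a cycle of `P / A P`. -/
theorem lift_unique {P : DGMod A} (hP : P.IsSemiprojective) (p : DGMod.Hom M N)
    (hs : Function.Surjective p.f) (hq : IsQuasiIso M.d N.d p.f) (f g : DGMod.Hom P M)
    (hfg : ∀ x, p.f (f.f x) = p.f (g.f x)) (W : Cplx k S) (κ : SBimod.Hom M.V W.V)
    (hκa : ∀ a x, κ (M.act (tmul _ _ a x)) = 0) (hκd : ∀ x, κ (M.d x) = W.d (κ x)) {x : P.V}
    (hx : P.π (P.d x) = 0) : ∃ y, κ (f.f x) = κ (g.f x) + W.d y := by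
  obtain ⟨h, hha, hh⟩ := exists_homotopy hP p hs hq f g hfg
  obtain ⟨t, ht⟩ : P.d x ∈ P.AP := (Submodule.Quotient.mk_eq_zero _).1 hx
  have h0 : ∀ t, κ (h (P.act t)) = 0 := fun t => by
    induction t using tensor_induction with
    | h0 => simp
    | ha x y hx hy => simp only [map_add, hx, hy, add_zero]
    | ht a x => rw [hha, hκa]
  refine ⟨κ (h x), ?_⟩
  rw [hh, map_add, map_add, hκd, ← ht, h0, add_zero]

/-! ### Tensor products of dg modules with complexes -/

/-- The differential of `M ⊗ X`, for a dg module `M` and a complex `X`. -/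
def tensorD (M : DGMod A) (X : Cplx k S) : SBimod.Hom (M.V.tensor X.V) (M.V.tensor X.V) :=
  M.cplx.tensorD X

theorem tensorD_tmul (M : DGMod A) (X : Cplx k S) (x : M.V) (y : X.V) :
    tensorD M X (tmul _ _ x y) =
      tmul _ _ (M.d x) y + tmul _ _ (M.g.sgn 1 x) (X.d y) := rfl

/-- The dg module `M ⊗ X`, for a dg module `M` and a complex `X`. -/
def tensor (M : DGMod A) (X : Cplx k S) : DGMod A where
  V := M.V.tensor X.V
  g := M.g.tensor X.g
  act := (tmap M.act (SBimod.Hom.id _)).comp (assocInv _ _ _)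
  d := tensorD M X
  act_act := fun a b x => by
    induction x using tensor_induction with
    | h0 => simp
    | ha x y hx hy => simp only [map_add, hx, hy]
    | ht x y => simp [M.act_act]
  act_homog := (M.act_homog.tmap Grading.id_homog rfl).comp assocInv_homog rfl
  d_homog := (M.cplx.tensor X).d_homog
  d_d := (M.cplx.tensor X).d_d
  leibniz := fun a (x : M.V.tensor X.V) => by
    change tensorD M X (tmap M.act (SBimod.Hom.id _) (assocInv _ _ _ (tmul _ _ a x))) =
      tmap M.act (SBimod.Hom.id _) (assocInv _ _ _ (tmul _ _ (A.d a) x)) +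
        tmap M.act (SBimod.Hom.id _) (assocInv _ _ _ (tmul _ _ (A.g.sgn 1 a) (tensorD M X x)))
    induction x using tensor_induction with
    | h0 => simp
    | ha x y hx hy =>
      simp only [map_add, hx, hy]
      abel
    | ht x y =>
      rw [assocInv_tmul, assocInv_tmul, tmap_tmul, tmap_tmul, tensorD_tmul, tensorD_tmul,
        M.leibniz, M.sgn_act]
      simp only [map_add, assocInv_tmul, tmap_tmul, LinearMap.add_apply, SBimod.Hom.id_apply]
      abel

/-- The tensor product of a morphism of dg modules and a morphism of complexes. -/
def Hom.tensor (f : DGMod.Hom M N) {X Y : Cplx k S} (g : SBimod.Hom X.V Y.V)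
    (hg : Grading.IsHomog X.g Y.g 0 g) (hgd : ∀ x, g (X.d x) = Y.d (g x)) :
    DGMod.Hom (M.tensor X) (N.tensor Y) where
  f := tmap f.f g
  homog := f.homog.tmap hg rfl
  map_act := fun a x => by
    change tmap f.f g (tmap M.act (SBimod.Hom.id _) (assocInv _ _ _ (tmul _ _ a x))) =
      tmap N.act (SBimod.Hom.id _) (assocInv _ _ _ (tmul _ _ a (tmap f.f g x)))
    induction x using tensor_induction with
    | h0 => simp
    | ha x y hx hy => simp only [map_add, hx, hy]
    | ht x y => simp [f.map_act]
  map_d := Cplx.tmap_tensorD (X := M.cplx) (X' := N.cplx) f.homog f.map_d hgd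

end DGMod

/-! ### Comparison of Tor with the bar construction -/

namespace SBimod

variable {V W : SBimod k S}

theorem leftUnit_unitL (t : (unit k S).tensor V) : leftUnit V (unitL V t) = t := by
  refine hom_tensor_ext (f := (leftUnit V).comp (unitL V)) (g := Hom.id _) (fun (s : S) v => ?_) t
  exact (tmul_balanced (one k S) s v).symm.trans (congrArg (tmul (unit k S) V · v) (one_mul s))

theorem unitL_injective : Function.Injective (unitL V) := fun x y h => by
  rw [← leftUnit_unitL x, h, leftUnit_unitL]

theorem unitL_tmap (f : Hom V W) (t : (unit k S).tensor V) :
    unitL W (tmap (Hom.id _) f t) = f (unitL V t) :=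
  hom_tensor_ext (f := (unitL W).comp (tmap (Hom.id _) f)) (g := f.comp (unitL V))
    (fun (s : S) v => (f.map_l s v).symm) t

end SBimod

namespace BarRes

variable (A : DGAlg k S)

theorem pW_act (a : A.V) (x : V A) : pW A (act A (tmul _ _ a x)) = 0 := by simp [act]

theorem pW_d (x : V A) : pW A (d A x) = barD A (pW A x) := by simp [d]

theorem pU_d (x : V A) : pU A (d A x) = -(pW A x + barD A (pU A x)) := by simp [d]

/-- The projection from `S ⊗_{A⁺} P = S ⊕ B A` to `B A`. -/
def qW : Hom (Q A) A.V.T := (P A).AP.desc (pW A) (by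
  rintro _ ⟨t, rfl⟩
  refine hom_tensor_ext (f := (pW A).comp (act A)) (g := 0) (fun a x => ?_) t
  exact pW_act A a x)

theorem qW_q (x : V A) : qW A (q A x) = pW A x := rfl

/-- The map `P → P ⊗ B A` given by the diagonal of the bar resolution. -/
def diag : DGMod.Hom (P A) ((P A).tensor (barCplx A)) where
  f := (tmap (Hom.id _) (qW A)).comp (φ A)
  homog := by
    have h : Grading.IsHomog (gQ A) (barG A) 0 (qW A) := by
      rintro n _ ⟨x, hx, rfl⟩
      exact pW_homog A n x hx
    exact (Grading.id_homog.tmap h rfl).comp (φ_homog A) rfl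
  map_act := fun a x => by
    have h : ∀ t : (V A).tensor (Q A),
        tmap (Hom.id (V A)) (qW A) (tmap (act A) (Hom.id _) (assocInv _ _ _ (tmul _ _ a t))) =
        tmap (act A) (Hom.id _) (assocInv _ _ _ (tmul _ _ a (tmap (Hom.id _) (qW A) t))) := by
      intro t
      induction t using tensor_induction with
      | h0 => simp
      | ha x y hx hy => simp only [map_add, hx, hy]
      | ht x y => simp
    exact (congrArg (tmap (Hom.id _) (qW A)) (φ_act A a x)).trans (h _)
  map_d := fun x => by
    have hd : ∀ y : Q A, qW A (dQ A y) = barD A (qW A y) := fun y => by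
      obtain ⟨y, rfl⟩ := (P A).proj_surjective y
      exact pW_d A y
    exact (congrArg (tmap (Hom.id _) (qW A)) (φ_d A x)).trans
      (Cplx.tmap_tensorD (X := (P A).cplx) (X' := (P A).cplx) (Y := (P A).indec) (Y' := barCplx A)
        (f := Hom.id _) (g := qW A) Grading.id_homog (fun _ => rfl) hd (φ A x))

theorem unitL_diag (x : V A) :
    unitL A.V.T (tmap (pS A) (Hom.id _) ((diag A).f x)) = pW A x := by
  have h : ∀ t : (V A).tensor (Q A), tmap (pS A) (Hom.id _) (tmap (Hom.id _) (qW A) t) =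
      tmap (Hom.id _) (qW A) (tmap (pS A) (Hom.id _) t) := fun t => by
    induction t using tensor_induction with
    | h0 => simp
    | ha x y hx hy => simp only [map_add, hx, hy]
    | ht x y => rfl
  refine (congrArg (unitL A.V.T) (h (φ A x))).trans ?_
  rw [unitL_tmap, φ_ε, qW_q]

theorem pW_diag (x : V A) :
    tmap (pW A) (Hom.id A.V.T) ((diag A).f x) = deconc A.V (pW A x) := by
  refine (tmap_tmap (Hom.id (V A)) (pW A) (qW A) (Hom.id _) (φ A x)).trans ?_
  change tmap (pW A) (qW A) (φ A x) = _
  have key : ∀ (m : Hom A.V.T A.V.T) (i : Hom A.V.T (V A)) (_ : ∀ w, pW A (i w) = m w)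
      (t : A.V.T.tensor A.V.T), tmap (pW A) (qW A) (tmap i ((q A).comp (iW A)) t) =
      tmap m (Hom.id _) t := fun m i h t => by
    rw [tmap_tmap]
    exact tmap_congr (f' := m) (g' := Hom.id _) h (fun w => pW_iW A w) t
  induction x using induction with
  | ha x y hx hy => simp only [map_add, hx, hy]
  | hS s =>
    rw [φ_iS, tmap_tmul, pW_iS, map_zero, map_zero, LinearMap.zero_apply]
  | hW w =>
    simp only [φ_iW, map_add, tmap_tmul, pW_iS, pW_iW, qW_q, map_zero, LinearMap.zero_apply,
      zero_add]
    rw [key (Hom.id _) (iW A) (pW_iW A), tmap_id_id]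
  | hU u =>
    rw [φ_iU, map_add, key 0 (iU A) (pW_iU A), tmap_tmul, pW_iU, map_zero, map_zero,
      LinearMap.zero_apply, zero_add]
    induction deconc A.V u using tensor_induction with
    | h0 => simp
    | ha x y hx hy => rw [map_add, hx, hy, add_zero]
    | ht x y => simp

/-- The augmentation of the bar resolution, tensored with the bar construction. -/
def εBar : DGMod.Hom ((P A).tensor (barCplx A)) ((DGMod.trivial A).tensor (barCplx A)) :=
  (ε A).tensor (X := barCplx A) (Y := barCplx A) (Hom.id _) Grading.id_homog fun _ => rfl

theorem εBar_surjective : Function.Surjective (εBar A).f := by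
  have h : ∀ t : (unit k S).tensor A.V.T, ∃ x, tmap (pS A) (Hom.id A.V.T) x = t := fun t => by
    induction t using tensor_induction with
    | h0 => exact ⟨0, map_zero _⟩
    | ha x y hx hy =>
      obtain ⟨x, rfl⟩ := hx
      obtain ⟨y, rfl⟩ := hy
      exact ⟨x + y, map_add _ _ _⟩
    | ht s w => exact ⟨tmul _ _ (iS A s) w, rfl⟩
  exact h

theorem εBar_quasiIso (hS : IsSeparableAlg k S) :
    IsQuasiIso ((P A).tensor (barCplx A)).d ((DGMod.trivial A).tensor (barCplx A)).d (εBar A).f :=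
  IsQuasiIso.tmap (X := (P A).cplx) (Y := barCplx A) (X' := (DGMod.trivial A).cplx)
    (Y' := barCplx A) hS (pS_homog A) (ε A).map_d (fun _ => rfl) (ε_quasiIso A)
    ⟨fun x _ hx => hx, fun y hy => ⟨y, 0, hy, by rw [map_zero, add_zero]; rfl⟩⟩

end BarRes

namespace TorResolution

variable {A : DGAlg k S} (R : TorResolution A)

theorem ε_surjective : Function.Surjective R.ε.f := fun s => by
  obtain ⟨x, y, -, hxy⟩ := R.quasiIso.2 s rfl
  exact ⟨x, (add_zero _).symm.trans hxy⟩

/-- The diagonal of a resolution, as a morphism of dg modules. -/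
def diag : DGMod.Hom R.P (R.P.tensor R.Q) := ⟨R.φ, R.φ_homog, R.φ_act, R.φ_d⟩

theorem ΔQ_π (x : R.P.V) : R.ΔQ (R.P.π x) = tmap R.P.π (Hom.id _) (R.φ x) := rfl

theorem ΔQ_d (x : R.Q.V) : R.ΔQ (R.Q.d x) = R.Q.tensorD R.Q (R.ΔQ x) := by
  obtain ⟨x, rfl⟩ := R.P.proj_surjective x
  refine (congrArg (tmap R.P.π (Hom.id _)) (R.φ_d x)).trans ?_
  exact Cplx.tmap_tensorD (X := R.P.cplx) (X' := R.Q) (f := R.P.π) (g := Hom.id _)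
    (Grading.proj_homog R.P.AP_graded) (fun _ => rfl) (fun _ => rfl) (R.φ x)

end TorResolution

namespace BarRes

/-- For every resolution, the coproduct of Tor exists, is unique, and is that of the homology of the
bar construction. -/
theorem torCoalg {A : DGAlg k S} (R : TorResolution A) (hS : IsSeparableAlg k S)
    {δ₀ : CoalgStr ((barCplx A).quotZg (barCplx A).B (barCplx A).B_graded)}
    (hδ₀ : (barCplx A).IsInduced (deconc A.V) (barCplx A).B (barCplx A).B_graded δ₀) :
    (∃! δ, R.IsTorCoalg δ) ∧ ∀ δ : CoalgStr R.Torg, R.IsTorCoalg δ → Nonempty (δ.Iso δ₀) := by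
  -- comparison maps between the given resolution and the bar resolution
  obtain ⟨α, hα⟩ := R.semiprojective (P A) _ (ε A) (fun s => ⟨iS A s, rfl⟩) (ε_quasiIso A) R.ε
  obtain ⟨β, hβ⟩ := semiprojective hS A R.P _ R.ε R.ε_surjective R.quasiIso (ε A)
  let a : Hom R.P.V (V A) := α.f
  let b : Hom (V A) R.Q.V := R.P.π.comp β.f
  have ha : ∀ x, a (R.P.d x) = d A (a x) := α.map_d
  have hb : ∀ x, b (d A x) = R.Q.d (b x) := fun x => congrArg R.P.π (β.map_d x)
  have hbU : ∀ u, b (iU A u) = 0 := fun u => by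
    have h : ∀ (c : A.V) (x : V A), b (act A (tmul _ _ c x)) = 0 := fun c x =>
      (congrArg R.P.π (β.map_act c x)).trans (R.P.π_act c _)
    induction u using T_induction with
    | h0 => simp
    | ha x y hx hy => simp only [map_add, hx, hy, add_zero]
    | h1 c => rw [← unitR_one c, ← act_iS, h]
    | hc c w _ => rw [← act_iW, h]
  have hθ₀ : ∀ (c : A.V) (x : R.P.V), pW A (a (R.P.act (tmul _ _ c x))) = 0 := fun c x =>
    (congrArg (pW A) (α.map_act c x)).trans (pW_act A c _)
  let θ : Hom R.Q.V A.V.T := R.P.AP.desc ((pW A).comp a) (by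
    rintro _ ⟨t, rfl⟩
    exact hom_tensor_ext (f := ((pW A).comp a).comp R.P.act) (g := 0) hθ₀ t)
  have hθπ : ∀ x, θ (R.P.π x) = pW A (a x) := fun _ => rfl
  have hθg : Grading.IsHomog R.Q.g (barG A) 0 θ := by
    rintro n _ ⟨x, hx, rfl⟩
    exact ((pW_homog A).comp α.homog rfl : Grading.IsHomog _ _ 0 _) n x hx
  have hθd : ∀ x, θ (R.Q.d x) = barD A (θ x) := fun x => by
    obtain ⟨x, rfl⟩ := R.P.proj_surjective x
    exact (congrArg (pW A) (ha x)).trans (pW_d A _)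
  refine Cplx.transfer (X := R.Q) (Y := barCplx A) (ΔX := R.ΔQ) hS R.N_graded hδ₀ θ hθg hθd
    ?_ ?_ ?_ ?_ ?_
  -- boundaries, and cycles coming from `H(P) = S`, go to boundaries
  · intro x _ hx
    obtain ⟨_, ⟨y, rfl⟩, _, ⟨z, rfl⟩, rfl⟩ := Submodule.mem_sup.1 hx
    have hz : ∃ z' : R.P.V, R.P.d z' = 0 ∧ z' = R.P.cplx.incZ z := ⟨_, R.P.cplx.d_incZ z, rfl⟩
    obtain ⟨z', hz', hzz⟩ := hz
    have h := pU_d A (a z')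
    rw [← ha, hz', map_zero, map_zero, zero_eq_neg, add_eq_zero_iff_eq_neg] at h
    refine ⟨θ y - pU A (a z'), ?_⟩
    change barD A (θ y - pU A (a z')) = θ (R.Q.d y + R.P.π (R.P.cplx.incZ z))
    refine Eq.trans ?_ (congrArg (fun t => θ (R.Q.d y + R.P.π t)) hzz)
    rw [map_sub, map_add, hθd, hθπ, h, sub_eq_add_neg]
  -- injectivity: `β α` is homotopic to the identity after passing to indecomposables
  · intro x hx hx'
    obtain ⟨x, rfl⟩ := R.P.proj_surjective x
    obtain ⟨y, hy⟩ : ∃ y : A.V.T, barD A y = pW A (a x) := hx'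
    obtain ⟨t, ht⟩ := DGMod.lift_unique R.semiprojective R.ε R.ε_surjective R.quasiIso
      (DGMod.Hom.id R.P) (β.comp α) (fun x => ((hβ _).trans (hα x)).symm) R.Q R.P.π R.P.π_act
      (fun _ => rfl) hx
    have hbW : b (iW A (barD A y)) = R.Q.d (b (iW A y)) := by
      rw [← hb, d_iW, map_sub, hbU, sub_zero]
    have hbS : R.P.d (β.f (iS A (pS A (a x)))) = 0 :=
      (β.map_d _).symm.trans ((congrArg β.f (d_iS A _)).trans (map_zero β.f.lin))
    refine Submodule.mem_sup.2 ⟨_, ⟨b (iW A y) + t, rfl⟩, _,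
      ⟨⟨β.f (iS A (pS A (a x))), hbS⟩, rfl⟩, ?_⟩
    change R.Q.d (b (iW A y) + t) + b (iS A (pS A (a x))) = R.P.π x
    replace ht : R.P.π x = b (a x) + R.Q.d t := ht
    rw [ht, map_add, ← hbW, hy]
    conv_rhs => rw [eq_add (a x)]
    rw [map_add b.lin, map_add b.lin, hbU]
    abel
  -- surjectivity: likewise for `α β`
  · intro (y : A.V.T) hy
    refine ⟨b (iW A y), ?_, ?_⟩
    · rw [← hb, d_iW, show barD A y = 0 from hy, map_zero, zero_sub, map_neg, hbU, neg_zero]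
    · have hx : (P A).π (d A (iW A y)) = 0 := by
        rw [d_iW, show barD A y = 0 from hy, map_zero, zero_sub]
        exact (map_neg (q A).lin _).trans ((congrArg _ (q_iU A y)).trans neg_zero)
      obtain ⟨t, ht⟩ := DGMod.lift_unique (semiprojective hS A) (ε A) (fun s => ⟨iS A s, rfl⟩)
        (ε_quasiIso A) (DGMod.Hom.id (P A)) (α.comp β) (fun x => ((hα _).trans (hβ x)).symm)
        (barCplx A) (pW A) (pW_act A) (pW_d A) (x := iW A y) hx
      exact ⟨t, eq_sub_of_add_eq' ht.symm⟩
  · intro x hx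
    rw [← R.ΔQ_d, hx, map_zero]
  · intro x hx
    obtain ⟨x, rfl⟩ := R.P.proj_surjective x
    let e : Hom R.P.V (unit k S) := R.ε.f
    -- the two diagonals, as lifts of the same map along the augmentation
    let Θ := α.tensor (X := R.Q) (Y := barCplx A) θ hθg hθd
    have hΘ : ∀ x, (εBar A).f ((Θ.comp R.diag).f x) = (εBar A).f (((diag A).comp α).f x) := by
      intro x
      refine unitL_injective (V := A.V.T) ?_
      have h : ∀ t : R.P.V.tensor R.Q.V, tmap (pS A) (Hom.id _) (tmap a θ t) =
          tmap (Hom.id _) θ (tmap e (Hom.id _) t) := fun t => by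
        induction t using tensor_induction with
        | h0 => simp
        | ha x y hx hy => simp only [map_add, hx, hy]
        | ht x y => exact congrArg (tmul (unit k S) A.V.T · (θ y)) (hα x)
      refine ((congrArg (unitL A.V.T) (h (R.φ x))).trans ?_).trans (unitL_diag A (a x)).symm
      exact (unitL_tmap θ _).trans (congrArg θ (R.φ_ε x))
    have hκ : ∀ (c : A.V) (x : (V A).tensor A.V.T), tmap (pW A) (Hom.id A.V.T)
        (tmap (act A) (Hom.id _) (assocInv _ _ _ (tmul _ _ c x))) = 0 := fun c x => by
      induction x using tensor_induction with
      | h0 => simp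
      | ha x y hx hy => simp only [map_add, hx, hy, add_zero]
      | ht x y => rw [assocInv_tmul, tmap_tmul, tmap_tmul, pW_act, map_zero, LinearMap.zero_apply]
    obtain ⟨t, ht⟩ := DGMod.lift_unique R.semiprojective (εBar A) (εBar_surjective A)
      (εBar_quasiIso A hS) (Θ.comp R.diag) ((diag A).comp α) hΘ
      ((barCplx A).tensor (barCplx A)) (tmap (pW A) (Hom.id A.V.T)) hκ
      (Cplx.tmap_tensorD (X := (P A).cplx) (X' := barCplx A) (Y := barCplx A)
        (Y' := barCplx A) (f := pW A) (g := Hom.id _) (pW_homog A) (pW_d A) (fun _ => rfl)) hx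
    refine ⟨t, ?_⟩
    have h : tmap θ θ (R.ΔQ (R.P.π x)) = tmap (pW A) (Hom.id A.V.T) (tmap a θ (R.φ x)) := by
      rw [R.ΔQ_π, tmap_tmap, tmap_tmap]
      rfl
    exact h.trans (ht.trans (congrArg (· + (barCplx A).tensorD (barCplx A) t) (pW_diag A (a x))))

end BarRes

end AInf

end

/-- `C` is weakly equivalent and quasi-isomorphic to `B A`; moreover `H(C)` and `Tor^A(S, S)`
have unique induced coproducts (for every choice of a resolution computing Tor, and there is one),
and they are isomorphic as graded coalgebras. -/
theorem proposition6p4 {k S : Type u} [Field k] [Ring S] [Algebra k S]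
    (hS : AInf.IsSeparableAlg k S) (C : AInf.AInfCoalg k S) (hC : C.Cocomplete)
    (A : AInf.DGAlg k S) (F : AInf.DGAlg.Hom C.cobar A) (hF : F.QuasiIso) :
    C.WeaklyEquivalent (AInf.bar A) ∧ C.QuasiIsomorphic (AInf.bar A) ∧
    (∃! δ, C.IsHomologyCoalg δ) ∧
    Nonempty (AInf.TorResolution A) ∧
    ∀ R : AInf.TorResolution A, (∃! δ, R.IsTorCoalg δ) ∧
      ∀ δ δ', C.IsHomologyCoalg δ → R.IsTorCoalg δ' → Nonempty (δ.Iso δ') := by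
  obtain ⟨f, hf⟩ := AInf.exists_weakEquiv_bar hS hC F hF
  have hA := AInf.bar_cocomplete A
  have hfq := AInf.AInfCoalg.Hom.WeakEquiv.quasiIso hS hC hA hf
  obtain ⟨δ₀, hδ₀⟩ := AInf.exists_isInduced_bar A hS
  obtain ⟨hC1, hC2⟩ := AInf.homologyCoalg_of_quasiIso hS f hfq hδ₀
  refine ⟨Relation.EqvGen.rel _ _ ⟨hC, hA, f, hf⟩, Relation.EqvGen.rel _ _ ⟨hC, hA, f, hfq⟩, hC1,
    ⟨AInf.BarRes.resolution hS A⟩, fun R => ?_⟩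
  obtain ⟨hR1, hR2⟩ := AInf.BarRes.torCoalg R hS hδ₀
  refine ⟨hR1, fun δ δ' hδ hδ' => ?_⟩
  obtain ⟨i⟩ := hC2 δ hδ
  obtain ⟨j⟩ := hR2 δ' hδ'
  exact AInf.CoalgStr.Iso.of_common i j
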